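/- **Setting.** Let $d\ge 1$ and let $\Omega\subset\mathbb R^d$ be a polygonal domain (a nonempty connected open set that is the interior of a finite union of closed nondegenerate simplices). Let $A:\Omega\to\mathbb R^{d\times d}$ be symmetric, uniformly positive definite, and Lipschitz continuous on each of finitely many open pieces that cover $\Omega$ up to a null set, and let $0\le c\in L^\infty(\Omega)$. Put $a(u,v)=(A\nabla u,\nabla v)+(cu,v)$ and $b(u,v)=(u,v)_{L^2(\Omega)}$ on $H^1_0(\Omega)$, $\|u\|_a=\sqrt{a(u,u)}$, and $\operatorname{dist}_a(X,Y)=\sup_{u\in X,\|u\|_a=1}\inf_{v\in Y}\|u-v\|_a$. Let $\lambda_1<\dots<\lambda_q$ be the $q\ge1$ smallest distinct eigenvalues of $a(u,v)=\lambda b(u,v)$ $(v\in H^1_0(\Omega))$, with multiplicities $d_1,\dots,d_q$ and eigenspaces $M(\lambda_i)$. For $i\le q$ let $\Gamma_i\subset\mathbb C$ be a circle centred at $\lambda_i^{-1}$ such that for every eigenvalue $\mu\neq\lambda_i$ the point $\mu^{-1}$ lies strictly outside $\Gamma_i$. Fix a polynomial degree $k\ge1$ and a shape regularity constant $\gamma^*$.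 Indices $(i,j)$ run over $1\le i\le q$, $1\le j\le d_i$. Let $\mathscr T$ be a conforming simplicial mesh over $\Omega$ with $h_T/\rho_T\le\gamma^*$ for all $T$ ($h_T$ is the diameter of $T$, $\rho_T$ that of the biggest ball in $T$), such that the interior of each element lies in one of the pieces on which $A$ is Lipschitz; let $h=\max_T h_T$, and let $V^h$ be the space of functions in $H_0^1(\Omega)$ that are continuous on $\bar\Omega$ and polynomials of degree at most $k$ on each element. * *FE approximations.* $(\lambda^h_{ij},u^h_{ij})$ are the smallest eigenpairs of $a(u^h,v)=\lambda^hb(u^h,v)$ $(v\in V^h)$, counted with multiplicity and ordered increasingly in the lexicographic order of $(i,j)$, with $b(u^h_{ij},u^h_{kl})=\delta_{ik}\delta_{jl}$; $M_h(\lambda_i)=\operatorname{span}_j\{u^h_{ij}\}$. * *ParO approximations.* $(\tilde\lambda_{ij},\tilde u_{ij})$ are obtained from some updated orbitals $g_{ij}\in V^h$ by solving the projected eigenvalue problem: $\tilde u_{ij}\in\tilde X:=\operatorname{span}\{g_{kl}\}$, $b(\tilde u_{ij},\tilde u_{kl})=\delta_{ik}\delta_{jl}$, $a(\tilde u_{ij},v)=\tilde\lambda_{ij}b(\tilde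 u_{ij},v)$ for $v\in\tilde X$; $\tilde M(\lambda_i)=\operatorname{span}_j\{\tilde u_{ij}\}$. * *Projections.* $K_h:L^2(\Omega)\to V^h$ is given by $a(K_hw,v)=b(w,v)$ $(v\in V^h)$, $E_h^{(i)}=\frac1{2\pi\mathrm i}\int_{\Gamma_i}(z-K_h)^{-1}dz$, and $\mathcal P^{(i)}$ is the $a$-orthogonal projection onto $\tilde M(\lambda_i)$. For $U=(u_{ij})$, where $b(u_{ij},u_{kl})=\delta_{ik}\delta_{jl}$ and $\{u_{ij}\}_j$ is an orthonormal basis of $M(\lambda_i)$ for each $i$, put $\mathcal E_hU=(E_h^{(i)}u_{ij})$ and $\tilde{\mathcal E}U=(\mathcal P^{(i)}E_h^{(i)}u_{ij})$. * *Estimators.* For $w\in V^h$ let $\mathscr R_T(w)=\sum_{i,j}b(w,u^h_{ij})\lambda^h_{ij}u^h_{ij}+\nabla\cdot(A\nabla w)-cw$ on $T$, let $\mathscr J_e(w)=-A\nabla w^+\cdot\nu^+-A\nabla w^-\cdot\nu^-$ on each interior face $e=T^+\cap T^-$, with $\nu^\pm$ the outward unit normals, and $$\eta^2(w,T)=h_T^2\|\mathscr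 R_T(w)\|_{0,T}^2+\sum_{e\subset\partial T}h_e\|\mathscr J_e(w)\|_{0,e}^2,\qquad \eta^2(W,T)=\sum_{i,j}\eta^2(w_{ij},T),\qquad \eta^2(W,\Omega)=\sum_{T\in\mathscr T}\eta^2(W,T),$$ the sum over $e$ running over the interior faces in $\partial T$, where $h_e$ is the diameter of $e$ (if $d=1$, $h_e$ is the smaller of the lengths of the two elements that meet at $e$). $\tilde\eta$ is defined in the same way with $(\tilde\lambda_{ij},\tilde u_{ij})$ in place of $(\lambda^h_{ij},u^h_{ij})$. Put $D=\sum_{i=1}^q\big(\operatorname{dist}_a^2(M_h(\lambda_i),\tilde M(\lambda_i))+\sum_{j=1}^{d_i}|\lambda^h_{ij}-\tilde\lambda_{ij}|^2\big)$. **Proposition.** There are constants $C>0$ and $\bar h>0$, depending only on $\Omega,A,c$, the pieces, $k,\gamma^*,q$ and the circles $\Gamma_i$, such that for every mesh $\mathscr T$ as above with $h\le\bar h$, all FE approximations and ParO approximations in $V^h$, and all $U$ as above: 1. $\big|\eta(\mathcal E_hU,\Omega)-\tilde\eta(\tilde{\mathcal E}U,\Omega)\big|^2\le C\,D$. 2.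 Let $\theta\in(0,1)$ and $\rho>0$ satisfy $\sqrt{2(C\rho+2\sqrt{C\rho}+2)C\rho}<\theta$, and suppose $D\le\rho\,\tilde\eta^2(\tilde{\mathcal E}U,\Omega)$. If a set $\hat{\mathscr T}\subset\mathscr T$ satisfies $$\sum_{T\in\hat{\mathscr T}}\tilde\eta^2(\tilde{\mathcal E}U,T)\ge\theta\,\tilde\eta^2(\tilde{\mathcal E}U,\Omega),$$ then $$\sum_{T\in\hat{\mathscr T}}\eta^2(\mathcal E_hU,T)\ge\tilde\theta\,\eta^2(\mathcal E_hU,\Omega)\qquad\text{for every }\ \tilde\theta\in\Big(0,\frac{\theta-\sqrt{2(C\rho+2\sqrt{C\rho}+2)C\rho}}{(1+\sqrt{C\rho})^2}\Big].$$ -/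

import Mathlib

open MeasureTheory Set Filter Topology
open scoped ENNReal NNReal ContDiff Real

noncomputable section

namespace ParO

/-! ### The model problem -/

/-- Euclidean space `ℝ^d`. -/
abbrev E (d : ℕ) : Type := EuclideanSpace ℝ (Fin d)

/-- A finite set of points of `ℝ^d` is (the vertex set of) a nondegenerate `d`-simplex. -/
def IsSimplex {d : ℕ} (T : Finset (E d)) : Prop :=
  T.card = d + 1 ∧ AffineIndependent ℝ ((↑) : T → E d)

/-- The closed simplex with vertex set `T` (also used for the faces of simplices). -/
def hull {d : ℕ} (T : Finset (E d)) : Set (E d) := convexHull ℝ (T : Set (E d))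

/-- A polygonal (polyhedral) domain: a nonempty connected open set which is the interior of a
finite union of closed nondegenerate `d`-simplices. -/
def IsPolygonalDomain {d : ℕ} (Ω : Set (E d)) : Prop :=
  IsOpen Ω ∧ IsConnected Ω ∧
    ∃ S : Finset (Finset (E d)), (∀ T ∈ S, IsSimplex T) ∧ Ω = interior (⋃ T ∈ S, hull T)

/-- The data of the eigenvalue problem `-∇·(A∇u) + c u = λ u` on `Ω` with homogeneous Dirichlet
boundary values. `A` is Lipschitz on each of the finitely many pieces `piece s`. -/
structure ModelProblem (d : ℕ) where
  Ω : Set (E d)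
  A : E d → Matrix (Fin d) (Fin d) ℝ
  c : E d → ℝ
  numPieces : ℕ
  piece : Fin numPieces → Set (E d)
  polygonal : IsPolygonalDomain Ω
  symm : ∀ x ∈ Ω, (A x).IsSymm
  elliptic : ∃ α : ℝ, 0 < α ∧ ∀ x ∈ Ω, ∀ ξ : Fin d → ℝ, α * (ξ ⬝ᵥ ξ) ≤ ξ ⬝ᵥ (A x).mulVec ξ
  piece_open : ∀ s, IsOpen (piece s)
  piece_subset : ∀ s, piece s ⊆ Ω
  piece_cover : volume (Ω \ ⋃ s, piece s) = 0
  lipschitz : ∀ s, ∃ L : ℝ≥0, ∀ i j, LipschitzOnWith L (fun x => A x i j) (piece s)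
  c_bounded : MemLp c ∞ (volume.restrict Ω)
  c_nonneg : ∀ᵐ x ∂(volume.restrict Ω), 0 ≤ c x

/-- The real space `L²(Ω)`; the form `b` is its inner product. -/
abbrev L2 {d : ℕ} (Ω : Set (E d)) : Type := Lp ℝ 2 (volume.restrict Ω)

/-- The complex space `L²(Ω; ℂ)`. -/
abbrev L2C {d : ℕ} (Ω : Set (E d)) : Type := Lp ℂ 2 (volume.restrict Ω)

/-- The space `L²(Ω; ℝ^d)` of vector fields. -/
abbrev L2Vec {d : ℕ} (Ω : Set (E d)) : Type := Lp (E d) 2 (volume.restrict Ω)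

/-- Test functions: `C_c^∞(Ω)`. -/
def IsTestFun {d : ℕ} (Ω : Set (E d)) (φ : E d → ℝ) : Prop :=
  ContDiff ℝ ∞ φ ∧ HasCompactSupport φ ∧ tsupport φ ⊆ Ω

/-- `G` is the weak gradient of `u` in `Ω`. -/
def IsWeakGrad {d : ℕ} {Ω : Set (E d)} (u : L2 Ω) (G : L2Vec Ω) : Prop :=
  ∀ φ : E d → ℝ, IsTestFun Ω φ →
    ∫ x in Ω, u x • gradient φ x = - ∫ x in Ω, φ x • G x

open Classical in
/-- The weak gradient of `u` (`0` if `u` has no square integrable weak gradient). -/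
def wgrad {d : ℕ} {Ω : Set (E d)} (u : L2 Ω) : L2Vec Ω :=
  if h : ∃ G : L2Vec Ω, IsWeakGrad u G then h.choose else 0

/-- `H^1_0(Ω)`: the functions that are limits of test functions in the `H^1` norm, that is,
the first components of the closure of `{(φ, ∇φ) : φ ∈ C_c^∞(Ω)}` in `L² × L²`. -/
def H10 {d : ℕ} (Ω : Set (E d)) : Submodule ℝ (L2 Ω) :=
  (Submodule.span ℝ {p : L2 Ω × L2Vec Ω | ∃ φ : E d → ℝ, IsTestFun Ω φ ∧
      (p.1 : E d → ℝ) =ᵐ[volume.restrict Ω] φ ∧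
      (p.2 : E d → E d) =ᵐ[volume.restrict Ω] gradient φ}).topologicalClosure.map
    (LinearMap.fst ℝ (L2 Ω) (L2Vec Ω))

/-- The form `a(u,v) = (A∇u,∇v) + (cu,v)`. -/
def aForm {d : ℕ} (P : ModelProblem d) (u v : L2 P.Ω) : ℝ :=
  (∫ x in P.Ω, (P.A x).mulVec (wgrad u x).ofLp ⬝ᵥ (wgrad v x).ofLp) +
    ∫ x in P.Ω, P.c x * u x * v x

/-- The energy norm `‖u‖_a`. -/
def aNorm {d : ℕ} (P : ModelProblem d) (u : L2 P.Ω) : ℝ := √(aForm P u u)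

/-- `dist_a(X,Y) = sup_{u ∈ X, ‖u‖_a = 1} inf_{v ∈ Y} ‖u - v‖_a`. -/
def distA {d : ℕ} (P : ModelProblem d) (X Y : Submodule ℝ (L2 P.Ω)) : ℝ :=
  sSup {t : ℝ | ∃ u ∈ X, aNorm P u = 1 ∧ t = ⨅ v : Y, aNorm P (u - v)}

/-- `(μ,u)` is an eigenpair of `a(u,v) = μ b(u,v)` for all `v ∈ W`, with `0 ≠ u ∈ W`. -/
def IsEigenpair {d : ℕ} (P : ModelProblem d) (W : Submodule ℝ (L2 P.Ω)) (μ : ℝ)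
    (u : L2 P.Ω) : Prop :=
  u ∈ W ∧ u ≠ 0 ∧ ∀ v ∈ W, aForm P u v = μ * inner ℝ u v

/-- `μ` is an eigenvalue of the continuous problem, posed in `H^1_0(Ω)`. -/
def IsEigenvalue {d : ℕ} (P : ModelProblem d) (μ : ℝ) : Prop :=
  ∃ u, IsEigenpair P (H10 P.Ω) μ u

/-- The eigenspace `M(μ)` of the continuous problem. -/
def eigSpace {d : ℕ} (P : ModelProblem d) (μ : ℝ) : Submodule ℝ (L2 P.Ω) :=
  Submodule.span ℝ {u | IsEigenpair P (H10 P.Ω) μ u}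

/-- `lam` lists the `q` smallest distinct eigenvalues of the continuous problem in increasing
order, and `m i` is the multiplicity of `lam i`. -/
structure IsLowestEigenvalues {d : ℕ} (P : ModelProblem d) {q : ℕ} (lam : Fin q → ℝ)
    (m : Fin q → ℕ) : Prop where
  strictMono : StrictMono lam
  eigenvalue : ∀ i, IsEigenvalue P (lam i)
  lowest : ∀ μ, IsEigenvalue P μ → (∃ i, μ = lam i) ∨ ∀ i, lam i < μ
  mult : ∀ i, Module.finrank ℝ (eigSpace P (lam i)) = m i

/-- A family indexed by the pairs `(i,j)`, `1 ≤ i ≤ q`, `1 ≤ j ≤ d_i` (here `m i` is `d_i`). -/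
abbrev Family {q : ℕ} (m : Fin q → ℕ) (X : Type) : Type := (i : Fin q) → Fin (m i) → X

/-- `b(u_ij, u_kl) = δ_ik δ_jl`. -/
def OrthonormalFamily {d q : ℕ} {Ω : Set (E d)} {m : Fin q → ℕ} (u : Family m (L2 Ω)) : Prop :=
  Orthonormal ℝ (fun p : (i : Fin q) × Fin (m i) => u p.1 p.2)

/-- The span of the whole family. -/
def spanAll {d q : ℕ} {Ω : Set (E d)} {m : Fin q → ℕ} (u : Family m (L2 Ω)) :
    Submodule ℝ (L2 Ω) :=
  Submodule.span ℝ (range fun p : (i : Fin q) × Fin (m i) => u p.1 p.2)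

/-- The span of the `i`-th cluster `u_i1, …, u_id_i`. -/
def cluster {d q : ℕ} {Ω : Set (E d)} {m : Fin q → ℕ} (u : Family m (L2 Ω)) (i : Fin q) :
    Submodule ℝ (L2 Ω) :=
  Submodule.span ℝ (range (u i))

/-- `{u_ij}_j` is an orthonormal basis of `M(λ_i)` for every `i`. -/
def IsEigenbasis {d q : ℕ} (P : ModelProblem d) (lam : Fin q → ℝ) {m : Fin q → ℕ}
    (U : Family m (L2 P.Ω)) : Prop :=
  OrthonormalFamily U ∧ ∀ i, cluster U i = eigSpace P (lam i)

/-! ### Meshes and finite element spaces -/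

/-- A conforming simplicial mesh over `Ω`. Elements are given by their vertex sets. -/
structure Mesh {d : ℕ} (Ω : Set (E d)) where
  elems : Finset (Finset (E d))
  simplex : ∀ T ∈ elems, IsSimplex T
  cover : ⋃ T ∈ elems, hull T = closure Ω
  conforming : ∀ S ∈ elems, ∀ T ∈ elems,
    hull S ∩ hull T = convexHull ℝ ((S : Set (E d)) ∩ (T : Set (E d)))

/-- `h_T`. -/
def elemDiam {d : ℕ} (T : Finset (E d)) : ℝ := Metric.diam (hull T)

/-- `ρ_T`, the diameter of the biggest ball contained in `T`. -/
def inDiam {d : ℕ} (T : Finset (E d)) : ℝ :=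
  sSup {δ : ℝ | ∃ (x : E d) (r : ℝ), 0 < r ∧ Metric.closedBall x r ⊆ hull T ∧ δ = 2 * r}

/-- The mesh size `h = max h_T`. -/
def Mesh.size {d : ℕ} {Ω : Set (E d)} (𝒯 : Mesh Ω) : ℝ := ⨆ T : 𝒯.elems, elemDiam T.1

/-- Shape regularity with constant `γ`. -/
def Mesh.ShapeRegular {d : ℕ} {Ω : Set (E d)} (𝒯 : Mesh Ω) (γ : ℝ) : Prop :=
  ∀ T ∈ 𝒯.elems, elemDiam T / inDiam T ≤ γ

/-- The mesh resolves the pieces on which `A` is Lipschitz: no element is cut by the interfaces. -/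
def Mesh.Resolves {d : ℕ} (P : ModelProblem d) (𝒯 : Mesh P.Ω) : Prop :=
  ∀ T ∈ 𝒯.elems, ∃ s, interior (hull T) ⊆ P.piece s

/-- The value at `x` of a polynomial in the coordinates. -/
def polyEval {d : ℕ} (p : MvPolynomial (Fin d) ℝ) (x : E d) : ℝ :=
  MvPolynomial.eval (fun i => x i) p

/-- `w` is a function of `S^h(Ω)`: continuous on `Ω̄` and on every element a polynomial of degree
at most `k`. -/
def IsPiecewisePoly {d : ℕ} {Ω : Set (E d)} (𝒯 : Mesh Ω) (k : ℕ) (w : E d → ℝ) : Prop :=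
  ContinuousOn w (closure Ω) ∧ ∀ T ∈ 𝒯.elems, ∃ p : MvPolynomial (Fin d) ℝ,
    p.totalDegree ≤ k ∧ ∀ x ∈ hull T, w x = polyEval p x

/-- The finite element space `V^h = S^h(Ω) ∩ H^1_0(Ω)`. -/
def feSpace {d : ℕ} {Ω : Set (E d)} (𝒯 : Mesh Ω) (k : ℕ) : Submodule ℝ (L2 Ω) where
  carrier := {u | u ∈ H10 Ω ∧ ∃ w : E d → ℝ, IsPiecewisePoly 𝒯 k w ∧
    (u : E d → ℝ) =ᵐ[volume.restrict Ω] w}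
  zero_mem' := by
    refine ⟨Submodule.zero_mem _, 0, ⟨continuousOn_const, fun T _ => ⟨0, by simp, ?_⟩⟩,
      Lp.coeFn_zero _ _ _⟩
    intro x _
    simp [polyEval]
  add_mem' := by
    rintro u v ⟨hu, f, ⟨hf, hf'⟩, huf⟩ ⟨hv, g, ⟨hg, hg'⟩, hvg⟩
    refine ⟨Submodule.add_mem _ hu hv, f + g, ⟨hf.add hg, fun T hT => ?_⟩, ?_⟩
    · obtain ⟨p, hp, hfp⟩ := hf' T hT
      obtain ⟨r, hr, hgr⟩ := hg' T hT
      refine ⟨p + r, (MvPolynomial.totalDegree_add p r).trans (max_le hp hr), fun x hx => ?_⟩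
      have h1 := hfp x hx
      have h2 := hgr x hx
      simp only [polyEval] at h1 h2 ⊢
      simp [h1, h2]
    · filter_upwards [Lp.coeFn_add u v, huf, hvg] with x h1 h2 h3
      rw [h1, Pi.add_apply, Pi.add_apply, h2, h3]
  smul_mem' := by
    rintro a u ⟨hu, f, ⟨hf, hf'⟩, huf⟩
    refine ⟨Submodule.smul_mem _ a hu, a • f, ⟨hf.const_smul a, fun T hT => ?_⟩, ?_⟩
    · obtain ⟨p, hp, hfp⟩ := hf' T hT
      refine ⟨a • p, (MvPolynomial.totalDegree_smul_le a p).trans hp, fun x hx => ?_⟩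
      have h1 := hfp x hx
      simp only [polyEval] at h1 ⊢
      simp [h1, MvPolynomial.smul_eval]
    · filter_upwards [Lp.coeFn_smul a u, huf] with x h1 h2
      rw [h1, Pi.smul_apply, Pi.smul_apply, h2]

/-- `{(λ^h_ij, u^h_ij)}` are the smallest eigenpairs (counted with multiplicity, in increasing order
with respect to the lexicographic order of the indices) of the discrete problem in `V`, with
orthonormal eigenfunctions. -/
structure IsLowestDiscrete {d q : ℕ} (P : ModelProblem d) (V : Submodule ℝ (L2 P.Ω))
    {m : Fin q → ℕ} (lamh : Family m ℝ) (uh : Family m (L2 P.Ω)) : Prop where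
  eigenpair : ∀ i j, IsEigenpair P V (lamh i j) (uh i j)
  orthonormal : OrthonormalFamily uh
  mono_within : ∀ i j j', j ≤ j' → lamh i j ≤ lamh i j'
  mono_across : ∀ i i' j j', i < i' → lamh i j ≤ lamh i' j'
  lowest : ∀ μ w, IsEigenpair P V μ w → (∀ i j, inner ℝ (uh i j) w = 0) → ∀ i j, lamh i j ≤ μ

/-- `{(λ̃_ij, ũ_ij)}` are ParO approximations in `V`: from some updated orbitals `g_ij ∈ V`,
they are obtained as orthonormal eigenpairs of the eigenvalue problem projected
to the span of the `g_ij`. -/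
def IsParOApprox {d q : ℕ} (P : ModelProblem d) (V : Submodule ℝ (L2 P.Ω))
    {m : Fin q → ℕ} (lamt : Family m ℝ) (ut : Family m (L2 P.Ω)) : Prop :=
  ∃ g : Family m (L2 P.Ω), (∀ i j, g i j ∈ V) ∧
    OrthonormalFamily ut ∧ ∀ i j, IsEigenpair P (spanAll g) (lamt i j) (ut i j)

/-! ### Spectral projections -/

/-- The embedding `L²(Ω) → L²(Ω; ℂ)`. -/
def toC {d : ℕ} (Ω : Set (E d)) : L2 Ω →L[ℝ] L2C Ω :=
  Complex.ofRealCLM.compLpL 2 (volume.restrict Ω)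

/-- The real part `L²(Ω; ℂ) → L²(Ω)`. -/
def reL {d : ℕ} (Ω : Set (E d)) : L2C Ω →L[ℝ] L2 Ω :=
  Complex.reCLM.compLpL 2 (volume.restrict Ω)

/-- The imaginary part `L²(Ω; ℂ) → L²(Ω)`. -/
def imL {d : ℕ} (Ω : Set (E d)) : L2C Ω →L[ℝ] L2 Ω :=
  Complex.imCLM.compLpL 2 (volume.restrict Ω)

theorem reL_smul {d : ℕ} {Ω : Set (E d)} (z : ℂ) (f : L2C Ω) :
    reL Ω (z • f) = z.re • reL Ω f - z.im • imL Ω f := by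
  apply Lp.ext
  filter_upwards [ContinuousLinearMap.coeFn_compLpL Complex.reCLM (z • f),
    ContinuousLinearMap.coeFn_compLpL Complex.reCLM f,
    ContinuousLinearMap.coeFn_compLpL Complex.imCLM f, Lp.coeFn_smul z f,
    Lp.coeFn_sub (z.re • reL Ω f) (z.im • imL Ω f), Lp.coeFn_smul z.re (reL Ω f),
    Lp.coeFn_smul z.im (imL Ω f)] with x h1 h2 h3 h4 h5 h6 h7
  rw [h5, Pi.sub_apply, h6, h7, Pi.smul_apply, Pi.smul_apply]
  simp only [reL, imL]
  rw [h1, h2, h3, h4]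
  simp

theorem imL_smul {d : ℕ} {Ω : Set (E d)} (z : ℂ) (f : L2C Ω) :
    imL Ω (z • f) = z.re • imL Ω f + z.im • reL Ω f := by
  apply Lp.ext
  filter_upwards [ContinuousLinearMap.coeFn_compLpL Complex.imCLM (z • f),
    ContinuousLinearMap.coeFn_compLpL Complex.reCLM f,
    ContinuousLinearMap.coeFn_compLpL Complex.imCLM f, Lp.coeFn_smul z f,
    Lp.coeFn_add (z.re • imL Ω f) (z.im • reL Ω f), Lp.coeFn_smul z.im (reL Ω f),
    Lp.coeFn_smul z.re (imL Ω f)] with x h1 h2 h3 h4 h5 h6 h7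
  rw [h5, Pi.add_apply, h7, h6, Pi.smul_apply, Pi.smul_apply]
  simp only [reL, imL]
  rw [h1, h2, h3, h4]
  simp

/-- The complexification `f ↦ K (Re f) + i K (Im f)` of a real bounded operator. -/
def complexify {d : ℕ} {Ω : Set (E d)} (K : L2 Ω →L[ℝ] L2 Ω) : L2C Ω →L[ℂ] L2C Ω where
  toFun f := toC Ω (K (reL Ω f)) + Complex.I • toC Ω (K (imL Ω f))
  map_add' f g := by
    simp only [map_add, smul_add]
    abel
  map_smul' z f := by
    have hr : ∀ (t : ℝ) (g : L2C Ω), t • g = (t : ℂ) • g := fun t g => by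
      apply Lp.ext
      filter_upwards [Lp.coeFn_smul t g, Lp.coeFn_smul (t : ℂ) g] with x h1 h2
      rw [h1, h2]
      simp
    simp only [reL_smul, imL_smul, map_sub, map_add, map_smul, hr, RingHom.id_apply]
    simp only [smul_add, smul_smul]
    conv_rhs => rw [← Complex.re_add_im z]
    simp only [add_smul, add_mul, mul_assoc, Complex.I_mul_I]
    simp only [mul_comm Complex.I, mul_neg, mul_one, neg_smul]
    abel
  cont := by fun_prop

open Classical in
/-- The discrete solution operator `K_h : L²(Ω) → V`, `a(K_h w, v) = b(w, v)` for all `v ∈ V`. -/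
def solOp {d : ℕ} (P : ModelProblem d) (V : Submodule ℝ (L2 P.Ω)) : L2 P.Ω →L[ℝ] L2 P.Ω :=
  if h : ∃ K : L2 P.Ω →L[ℝ] L2 P.Ω,
      ∀ w, K w ∈ V ∧ ∀ v ∈ V, aForm P (K w) v = inner ℝ w v
  then h.choose else 0

/-- The spectral projection `(2πi)⁻¹ ∮_Γ (z - K_h)⁻¹ dz`, with `Γ` the circle of radius `r` centred
at `μ⁻¹`. -/
def specProjC {d : ℕ} (P : ModelProblem d) (V : Submodule ℝ (L2 P.Ω)) (μ r : ℝ) :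
    L2C P.Ω →L[ℂ] L2C P.Ω :=
  (2 * π * Complex.I : ℂ)⁻¹ •
    ∮ z in C(((μ⁻¹ : ℝ) : ℂ), r), resolvent (complexify (solOp P V)) z

/-- The spectral projection applied to a real function; its value is a real function. -/
def specProj {d : ℕ} (P : ModelProblem d) (V : Submodule ℝ (L2 P.Ω)) (μ r : ℝ)
    (u : L2 P.Ω) : L2 P.Ω :=
  reL P.Ω (specProjC P V μ r (toC P.Ω u))

open Classical in
/-- The orthogonal projection of `w` onto `Y` with respect to `a(·,·)`. -/
def aProj {d : ℕ} (P : ModelProblem d) (Y : Submodule ℝ (L2 P.Ω)) (w : L2 P.Ω) : L2 P.Ω :=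
  if h : ∃ p ∈ Y, ∀ v ∈ Y, aForm P (w - p) v = 0 then h.choose else 0

/-- `ℰ_h U = (E_h^{(i)} u_ij)_ij`; `r i` is the radius of the circle `Γ_i`. -/
def feProj {d q : ℕ} (P : ModelProblem d) (V : Submodule ℝ (L2 P.Ω)) (lam r : Fin q → ℝ)
    {m : Fin q → ℕ} (U : Family m (L2 P.Ω)) : Family m (L2 P.Ω) :=
  fun i j => specProj P V (lam i) (r i) (U i j)

/-- `ℰ̃_n U = (𝒫^{(i)} E_h^{(i)} u_ij)_ij`, with `𝒫^{(i)}` the `a`-orthogonal projection onto the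
`i`-th ParO space `span {ũ_i1, …, ũ_id_i}`. -/
def paroProj {d q : ℕ} (P : ModelProblem d) (V : Submodule ℝ (L2 P.Ω)) (lam r : Fin q → ℝ)
    {m : Fin q → ℕ} (ut U : Family m (L2 P.Ω)) : Family m (L2 P.Ω) :=
  fun i j => aProj P (cluster ut i) (feProj P V lam r U i j)

/-! ### Residual error estimators -/

open Classical in
/-- The polynomial of degree at most `k` that the finite element function `w` is on `T`. -/
def locPoly {d : ℕ} {Ω : Set (E d)} (k : ℕ) (w : L2 Ω) (T : Finset (E d)) :
    MvPolynomial (Fin d) ℝ :=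
  if h : ∃ p : MvPolynomial (Fin d) ℝ, p.totalDegree ≤ k ∧
      ∀ᵐ x ∂(volume.restrict Ω), x ∈ hull T → w x = polyEval p x
  then h.choose else 0

/-- The flux `A∇w` on the element `T`. -/
def flux {d : ℕ} (P : ModelProblem d) (k : ℕ) (w : L2 P.Ω) (T : Finset (E d)) (x : E d) : E d :=
  WithLp.toLp 2 ((P.A x).mulVec fun i => polyEval (MvPolynomial.pderiv i (locPoly k w T)) x)

/-- The divergence of a vector field. -/
def divergence {d : ℕ} (F : E d → E d) (x : E d) : ℝ :=
  ∑ i, fderiv ℝ (fun y => F y i) x (EuclideanSpace.single i 1)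

/-- The element residual `∑_ij b(w,u_ij) λ_ij u_ij + ∇·(A∇w) - c w` on `T`, for the family of pairs
`(λ_ij, u_ij)`. -/
def elemResidual {d q : ℕ} (P : ModelProblem d) (k : ℕ) {m : Fin q → ℕ} (lam : Family m ℝ)
    (u : Family m (L2 P.Ω)) (w : L2 P.Ω) (T : Finset (E d)) (x : E d) : ℝ :=
  (∑ i, ∑ j, inner ℝ w (u i j) * lam i j * u i j x) + divergence (flux P k w T) x - P.c x * w x

/-- The trace at `x` of a field that is given on the interior of `T`. -/
def traceFrom {d : ℕ} (T : Finset (E d)) (F : E d → E d) (x : E d) : E d :=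
  limUnder (𝓝[interior (hull T)] x) F

/-- The unit normal of the face `e` of `T` that points out of `T`. -/
def outNormal {d : ℕ} (T e : Finset (E d)) : E d :=
  Classical.epsilon fun ν : E d => ‖ν‖ = 1 ∧ (∀ x ∈ e, ∀ y ∈ e, inner ℝ (y - x) ν = 0) ∧
    ∀ x ∈ e, ∀ z ∈ T, z ∉ e → inner ℝ (z - x) ν < 0

/-- The jump residual `-A∇w⁺·ν⁺ - A∇w⁻·ν⁻` on the common side `e` of `T⁺` and `T⁻`. -/
def jump {d : ℕ} (P : ModelProblem d) (k : ℕ) (w : L2 P.Ω) (Tp Tm e : Finset (E d))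
    (x : E d) : ℝ :=
  - inner ℝ (traceFrom Tp (flux P k w Tp) x) (outNormal Tp e)
    - inner ℝ (traceFrom Tm (flux P k w Tm) x) (outNormal Tm e)

/-- `h_e`, the diameter of the common side `e` of `T⁺` and `T⁻`; in dimension one, where `e` is a
point, the smaller of the lengths of `T⁺` and `T⁻`. -/
def faceSize {d : ℕ} (Tp Tm e : Finset (E d)) : ℝ :=
  if d = 1 then min (elemDiam Tp) (elemDiam Tm) else Metric.diam (hull e)

open Classical in
/-- The elements that share a `(d-1)`-dimensional face with `T`. By conformity `S ↦ S ∩ T` is a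
bijection from these elements onto the interior faces contained in `∂T`. -/
def Mesh.neighbors {d : ℕ} {Ω : Set (E d)} (𝒯 : Mesh Ω) (T : Finset (E d)) :
    Finset (Finset (E d)) :=
  𝒯.elems.filter fun S => S ≠ T ∧ (S ∩ T).card = d

open Classical in
/-- The squared local error indicator `η²(w,T) = h_T² ‖R_T(w)‖²_{0,T} + ∑_{e ⊂ ∂T} h_e ‖J_e(w)‖²_{0,e}`
built from the pairs `(λ_ij, u_ij)`. With the ParO pairs this is `η̃²`, with the finite
element eigenpairs it is `η²`. -/
def indicatorSq {d q : ℕ} (P : ModelProblem d) (𝒯 : Mesh P.Ω) (k : ℕ) {m : Fin q → ℕ}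
    (lam : Family m ℝ) (u : Family m (L2 P.Ω)) (w : L2 P.Ω) (T : Finset (E d)) : ℝ :=
  elemDiam T ^ 2 * (∫ x in hull T, elemResidual P k lam u w T x ^ 2) +
    ∑ S ∈ 𝒯.neighbors T, faceSize T S (S ∩ T) *
      ∫ x in hull (S ∩ T), jump P k w T S (S ∩ T) x ^ 2 ∂(μHE[d - 1])

/-- `η²(W,T) = ∑_ij η²(w_ij,T)`. -/
def indicatorSqVec {d q : ℕ} (P : ModelProblem d) (𝒯 : Mesh P.Ω) (k : ℕ) {m : Fin q → ℕ}
    (lam : Family m ℝ) (u : Family m (L2 P.Ω)) (W : Family m (L2 P.Ω)) (T : Finset (E d)) : ℝ :=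
  ∑ i, ∑ j, indicatorSq P 𝒯 k lam u (W i j) T

/-- `η²(W,Ω) = ∑_T η²(W,T)`. -/
def estimatorSq {d q : ℕ} (P : ModelProblem d) (𝒯 : Mesh P.Ω) (k : ℕ) {m : Fin q → ℕ}
    (lam : Family m ℝ) (u : Family m (L2 P.Ω)) (W : Family m (L2 P.Ω)) : ℝ :=
  ∑ T ∈ 𝒯.elems, indicatorSqVec P 𝒯 k lam u W T

/-- The discrepancy `∑_i (dist_a²(M_h(λ_i), M̃(λ_i)) + ∑_j |λ^h_ij - λ̃_ij|²)` between the
finite element and the ParO approximations. -/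
def discrepancy {d q : ℕ} (P : ModelProblem d) {m : Fin q → ℕ} (lamh : Family m ℝ)
    (uh : Family m (L2 P.Ω)) (lamt : Family m ℝ) (ut : Family m (L2 P.Ω)) : ℝ :=
  ∑ i, (distA P (cluster uh i) (cluster ut i) ^ 2 + ∑ j, |lamh i j - lamt i j| ^ 2)

end ParO

end

/-!
The two estimators are Euclidean norms of local contributions, so the difference of their values is
at most the norm of the differences of the contributions. This holds on every set of elements. With
all elements it is the first assertion; the second one follows from the comparison on all elements
and on the marked ones by an elementary computation (`ParO.dorfler_transfer`).

Fix `(i, j)` and let `w = E_h^{(i)} u_ij`, `p = 𝒫^{(i)} w`. The contributions of `w` and `p` differ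
by the residual and the jumps of `w - p`, and by the difference of the sums `∑ b(w,u_kl) λ_kl u_kl`
formed with the two families. Inverse estimates for polynomials and the bounded number of neighbours
of an element bound the former by the `H^1` norm of `w - p` (`ParO.exists_indicator_close`). On an
element the coefficient is extended to a Lipschitz function on the whole space, so that the
divergence exists almost everywhere by Rademacher's theorem and the one-sided traces are values of a
continuous function.

On fine meshes `E_h^{(i)}` is the `L²` projection onto the discrete cluster
(`ParO.IsEigenbasis.exists_specProj_eq`). The operator `K_h` is diagonal in a basis of discrete
eigenfunctions, so the contour integral of its resolvent picks the eigenfunctions whose inverse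
eigenvalues lie inside the circle (`ParO.specProj_eq_sum`). By dimension counts the discrete
eigenvalues of the `k`-th cluster are not below `λ_k` and converge to it, while all further discrete
eigenvalues stay above the next eigenvalue, the minimum of the Rayleigh quotient on the complement
of the exact eigenspaces. Existence of this minimum rests on Rellich's theorem, which is derived
from a translation estimate; the convergence rests on the density of the finite element spaces in
`H^1_0`, for which test functions are interpolated at the vertices.

Hence `w` lies in the discrete cluster with bounded energy, and `‖w - p‖_a` is bounded by the
distance of the clusters. The first of the two eigenvalue sums equals `g = ∑ l, b(w,u_il) λ_il u_il`, because
`w` is orthogonal to the other clusters; it represents the functional `a(w, ·)` on `V^h`. As `p` is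
the `a`-projection of `w`, the second sum is the `L²` projection `Q g` of `g` onto the ParO cluster. Now
`g` belongs to the discrete cluster again, so `g - Q g` is bounded by the distance of the clusters
(`ParO.norm_sum_eigen_sub_le`, `ParO.exists_paro_bound`). The eigenvalue differences in the
discrepancy only enlarge the right-hand side.
-/

open MeasureTheory Set Filter Topology
open scoped ENNReal NNReal ContDiff Real Pointwise

noncomputable section

namespace ParO
section

variable {d : ℕ} {Ω : Set (E d)}

/-! ### Test functions and weak gradients -/

theorem contDiff_gradient {φ : E d → ℝ} (h : ContDiff ℝ ∞ φ) : ContDiff ℝ ∞ (gradient φ) :=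
  (InnerProductSpace.toDual ℝ (E d)).symm.contDiff.comp (h.fderiv_right (by simp))

theorem hasCompactSupport_gradient {φ : E d → ℝ} (h : HasCompactSupport φ) :
    HasCompactSupport (gradient φ) :=
  (h.fderiv (𝕜 := ℝ)).comp_left (g := (InnerProductSpace.toDual ℝ (E d)).symm) (by simp)

theorem gradient_eq_zero_of_notMem_tsupport {φ : E d → ℝ} {x : E d} (hx : x ∉ tsupport φ) :
    gradient φ x = 0 := by
  have : fderiv ℝ φ x = 0 := by
    by_contra h
    exact hx (support_fderiv_subset ℝ h)
  simp [gradient, this]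

theorem IsTestFun.memLp {φ : E d → ℝ} (h : IsTestFun Ω φ) : MemLp φ 2 (volume.restrict Ω) :=
  (h.1.continuous.memLp_of_hasCompactSupport h.2.1).restrict _

theorem IsTestFun.memLp_gradient {φ : E d → ℝ} (h : IsTestFun Ω φ) :
    MemLp (gradient φ) 2 (volume.restrict Ω) :=
  ((contDiff_gradient h.1).continuous.memLp_of_hasCompactSupport
    (hasCompactSupport_gradient h.2.1)).restrict _

/-- The class of a test function in `L²(Ω)`. -/
def IsTestFun.toL2 {φ : E d → ℝ} (h : IsTestFun Ω φ) : L2 Ω := h.memLp.toLp φ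

/-- The class of the gradient of a test function in `L²(Ω; ℝ^d)`. -/
def IsTestFun.gradL2 {φ : E d → ℝ} (h : IsTestFun Ω φ) : L2Vec Ω :=
  h.memLp_gradient.toLp (gradient φ)

theorem IsTestFun.add {φ ψ : E d → ℝ} (h : IsTestFun Ω φ) (h' : IsTestFun Ω ψ) :
    IsTestFun Ω (φ + ψ) :=
  ⟨h.1.add h'.1, h.2.1.add h'.2.1, (tsupport_add φ ψ).trans (union_subset h.2.2 h'.2.2)⟩

theorem IsTestFun.const_smul {φ : E d → ℝ} (h : IsTestFun Ω φ) (t : ℝ) : IsTestFun Ω (t • φ) :=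
  ⟨h.1.const_smul t, h.2.1.smul_left (f := fun _ => t),
    (closure_mono (Function.support_const_smul_subset t φ)).trans h.2.2⟩

theorem IsTestFun.zero : IsTestFun Ω (0 : E d → ℝ) :=
  ⟨contDiff_const, HasCompactSupport.zero, by simp⟩

theorem IsTestFun.mono {Ω' : Set (E d)} (hΩ : Ω' ⊆ Ω) {φ : E d → ℝ} (h : IsTestFun Ω' φ) :
    IsTestFun Ω φ := ⟨h.1, h.2.1, h.2.2.trans hΩ⟩

theorem gradient_add_of_differentiable {φ ψ : E d → ℝ} (h : Differentiable ℝ φ)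
    (h' : Differentiable ℝ ψ) : gradient (φ + ψ) = gradient φ + gradient ψ := by
  ext1 x
  simp [gradient, fderiv_add (h x) (h' x)]

theorem gradient_smul_of_differentiable {φ : E d → ℝ} (h : Differentiable ℝ φ) (t : ℝ) :
    gradient (t • φ) = t • gradient φ := by
  ext1 x
  simp [gradient, fderiv_const_smul (h x)]

/-- The pairs `(φ, ∇φ)` with a test function `φ` in `L² × L²`. -/
def testPairs (Ω : Set (E d)) : Submodule ℝ (L2 Ω × L2Vec Ω) :=
  Submodule.span ℝ {p : L2 Ω × L2Vec Ω | ∃ φ : E d → ℝ, IsTestFun Ω φ ∧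
      (p.1 : E d → ℝ) =ᵐ[volume.restrict Ω] φ ∧
      (p.2 : E d → E d) =ᵐ[volume.restrict Ω] gradient φ}

theorem mem_testPairs {p : L2 Ω × L2Vec Ω} :
    p ∈ testPairs Ω ↔ ∃ φ : E d → ℝ, ∃ h : IsTestFun Ω φ, p = (h.toL2, h.gradL2) := by
  constructor
  · intro hp
    have key : ∃ φ : E d → ℝ, IsTestFun Ω φ ∧ (p.1 : E d → ℝ) =ᵐ[volume.restrict Ω] φ ∧
        (p.2 : E d → E d) =ᵐ[volume.restrict Ω] gradient φ := by
      induction hp using Submodule.span_induction with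
      | mem p hp => exact hp
      | zero =>
        refine ⟨0, IsTestFun.zero, Lp.coeFn_zero _ _ _, ?_⟩
        have : gradient (0 : E d → ℝ) = 0 := by ext1 x; simp [gradient]
        rw [this]
        exact Lp.coeFn_zero _ _ _
      | add x y _ _ hx hy =>
        obtain ⟨φ, h, h1, h2⟩ := hx
        obtain ⟨ψ, h', h1', h2'⟩ := hy
        refine ⟨φ + ψ, h.add h', (Lp.coeFn_add x.1 y.1).trans (h1.add h1'), ?_⟩
        rw [gradient_add_of_differentiable (h.1.differentiable (by simp))
          (h'.1.differentiable (by simp))]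
        exact (Lp.coeFn_add x.2 y.2).trans (h2.add h2')
      | smul t x _ hx =>
        obtain ⟨φ, h, h1, h2⟩ := hx
        refine ⟨t • φ, h.const_smul t, (Lp.coeFn_smul t x.1).trans (h1.const_smul t), ?_⟩
        rw [gradient_smul_of_differentiable (h.1.differentiable (by simp))]
        exact (Lp.coeFn_smul t x.2).trans (h2.const_smul t)
    obtain ⟨φ, h, h1, h2⟩ := key
    exact ⟨φ, h, Prod.ext (Lp.ext (h1.trans h.memLp.coeFn_toLp.symm))
      (Lp.ext (h2.trans h.memLp_gradient.coeFn_toLp.symm))⟩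
  · rintro ⟨φ, h, rfl⟩
    exact Submodule.subset_span ⟨φ, h, h.memLp.coeFn_toLp, h.memLp_gradient.coeFn_toLp⟩

theorem mem_H10 {u : L2 Ω} :
    u ∈ H10 Ω ↔ ∃ G : L2Vec Ω, (u, G) ∈ (testPairs Ω).topologicalClosure := by
  constructor
  · rintro ⟨⟨v, G⟩, h, rfl⟩
    exact ⟨G, h⟩
  · rintro ⟨G, h⟩
    exact ⟨(u, G), h, rfl⟩

theorem IsTestFun.memLp_fderiv {φ : E d → ℝ} (h : IsTestFun Ω φ) (y : E d) :
    MemLp (fun x => fderiv ℝ φ x y) 2 (volume.restrict Ω) := by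
  have : Continuous (fun x => fderiv ℝ φ x y) :=
    ((h.1.fderiv_right (m := ∞) (by simp)).continuous).clm_apply continuous_const
  exact (this.memLp_of_hasCompactSupport (h.2.1.fderiv_apply (𝕜 := ℝ) y)).restrict _

theorem inner_gradient_eq {φ : E d → ℝ} (x y : E d) :
    inner ℝ y (gradient φ x) = fderiv ℝ φ x y := by
  rw [real_inner_comm, inner_gradient_left]

theorem IsTestFun.memLp_smul {φ : E d → ℝ} (h : IsTestFun Ω φ) (y : E d) :
    MemLp (fun x => φ x • y) 2 (volume.restrict Ω) :=
  (ContinuousLinearMap.toSpanSingleton ℝ y).comp_memLp' h.memLp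

theorem IsTestFun.integrable_smul {φ : E d → ℝ} (h : IsTestFun Ω φ) (G : L2Vec Ω) :
    Integrable (fun x => φ x • G x) (volume.restrict Ω) :=
  memLp_one_iff_integrable.1 ((Lp.memLp G).smul (p := 2) (q := 2) (r := 1) h.memLp)

theorem IsTestFun.integrable_smul_gradient {φ : E d → ℝ} (h : IsTestFun Ω φ) (u : L2 Ω) :
    Integrable (fun x => u x • gradient φ x) (volume.restrict Ω) :=
  memLp_one_iff_integrable.1 (h.memLp_gradient.smul (p := 2) (q := 2) (r := 1) (Lp.memLp u))

/-- The weak gradient tested against constant directions, as an identity of `L²` inner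
products; this form is stable under `L²` limits. -/
theorem isWeakGrad_iff {u : L2 Ω} {G : L2Vec Ω} :
    IsWeakGrad u G ↔ ∀ (φ : E d → ℝ) (h : IsTestFun Ω φ) (y : E d),
      inner ℝ ((h.memLp_fderiv y).toLp _ : L2 Ω) u = - inner ℝ ((h.memLp_smul y).toLp _ : L2Vec Ω) G := by
  have e1 : ∀ (φ : E d → ℝ) (h : IsTestFun Ω φ) (y : E d),
      inner ℝ ((h.memLp_fderiv y).toLp _ : L2 Ω) u
        = inner ℝ y (∫ x in Ω, u x • gradient φ x) := by
    intro φ h y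
    rw [← integral_inner (h.integrable_smul_gradient u), L2.inner_def]
    refine integral_congr_ae ?_
    filter_upwards [(h.memLp_fderiv y).coeFn_toLp] with x hx
    rw [hx, inner_smul_right, inner_gradient_eq]
    simp
  have e2 : ∀ (φ : E d → ℝ) (h : IsTestFun Ω φ) (y : E d),
      inner ℝ ((h.memLp_smul y).toLp _ : L2Vec Ω) G
        = inner ℝ y (∫ x in Ω, φ x • G x) := by
    intro φ h y
    rw [← integral_inner (h.integrable_smul G), L2.inner_def]
    refine integral_congr_ae ?_
    filter_upwards [(h.memLp_smul y).coeFn_toLp] with x hx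
    rw [hx, inner_smul_right, inner_smul_left]
    simp
  constructor
  · intro hw φ h y
    rw [e1 φ h, e2 φ h, hw φ h, inner_neg_right]
  · intro H φ h
    refine ext_inner_left ℝ fun y => ?_
    rw [← e1 φ h, inner_neg_right, ← e2 φ h, H φ h y]

theorem IsWeakGrad.add {u v : L2 Ω} {F G : L2Vec Ω} (hu : IsWeakGrad u F) (hv : IsWeakGrad v G) :
    IsWeakGrad (u + v) (F + G) := by
  rw [isWeakGrad_iff] at *
  intro φ h y
  rw [inner_add_right, inner_add_right, hu φ h, hv φ h]
  ring

theorem IsWeakGrad.smul {u : L2 Ω} {G : L2Vec Ω} (hu : IsWeakGrad u G) (t : ℝ) :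
    IsWeakGrad (t • u) (t • G) := by
  rw [isWeakGrad_iff] at *
  intro φ h y
  rw [inner_smul_right, inner_smul_right, hu φ h]
  ring

theorem isClosed_isWeakGrad : IsClosed {p : L2 Ω × L2Vec Ω | IsWeakGrad p.1 p.2} := by
  simp only [isWeakGrad_iff, ofPred_forall]
  refine isClosed_iInter fun φ => isClosed_iInter fun h => isClosed_iInter fun y => ?_
  exact isClosed_eq (by fun_prop) (by fun_prop)

/-- Integration by parts for a function that is continuously differentiable near the support of
the test function. -/
theorem integral_smul_gradient_eq {f φ : E d → ℝ} (hf : ContDiff ℝ 1 f)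
    (h : IsTestFun Ω φ) :
    ∫ x in Ω, f x • gradient φ x = - ∫ x in Ω, φ x • gradient f x := by
  have hgf : Continuous (gradient f) :=
    (InnerProductSpace.toDual ℝ (E d)).symm.continuous.comp (hf.continuous_fderiv (by simp))
  have hφ' : Continuous (gradient φ) := (contDiff_gradient h.1).continuous
  have i1 : Integrable (fun x => f x • gradient φ x) volume :=
    (hf.continuous.smul hφ').integrable_of_hasCompactSupport
      (hasCompactSupport_gradient h.2.1).smul_left
  have i2 : Integrable (fun x => φ x • gradient f x) volume :=
    (h.1.continuous.smul hgf).integrable_of_hasCompactSupport h.2.1.smul_right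
  rw [setIntegral_eq_integral_of_forall_compl_eq_zero, setIntegral_eq_integral_of_forall_compl_eq_zero]
  · refine ext_inner_left ℝ fun y => ?_
    rw [inner_neg_right, ← integral_inner i1, ← integral_inner i2]
    simp only [inner_smul_right, inner_gradient_eq]
    have c1 : Continuous (fun x => fderiv ℝ f x y) :=
      (hf.continuous_fderiv (by simp)).clm_apply continuous_const
    have c2 : Continuous (fun x => fderiv ℝ φ x y) :=
      (h.1.continuous_fderiv (by simp)).clm_apply continuous_const
    rw [integral_mul_fderiv_eq_neg_fderiv_mul_of_integrable]
    · simp only [mul_comm]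
    · exact (c1.mul h.1.continuous).integrable_of_hasCompactSupport h.2.1.mul_left
    · exact (hf.continuous.mul c2).integrable_of_hasCompactSupport
        (h.2.1.fderiv_apply (𝕜 := ℝ) y).mul_left
    · exact (hf.continuous.mul h.1.continuous).integrable_of_hasCompactSupport h.2.1.mul_left
    · exact fun x _ => hf.differentiable (by simp) x
    · exact fun x _ => h.1.differentiable (by simp) x
  · intro x hx
    rw [image_eq_zero_of_notMem_tsupport (fun hx' => hx (h.2.2 hx')), zero_smul]
  · intro x hx
    rw [gradient_eq_zero_of_notMem_tsupport (fun hx' => hx (h.2.2 hx')), smul_zero]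

theorem IsTestFun.isWeakGrad {φ : E d → ℝ} (h : IsTestFun Ω φ) : IsWeakGrad h.toL2 h.gradL2 := by
  intro ψ hψ
  have e1 : ∫ x in Ω, (h.toL2 : E d → ℝ) x • gradient ψ x = ∫ x in Ω, φ x • gradient ψ x := by
    refine integral_congr_ae ?_
    filter_upwards [h.memLp.coeFn_toLp] with x hx
    rw [IsTestFun.toL2, hx]
  have e2 : ∫ x in Ω, ψ x • (h.gradL2 : E d → E d) x = ∫ x in Ω, ψ x • gradient φ x := by
    refine integral_congr_ae ?_
    filter_upwards [h.memLp_gradient.coeFn_toLp] with x hx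
    rw [IsTestFun.gradL2, hx]
  rw [e1, e2, integral_smul_gradient_eq (h.1.of_le (by exact_mod_cast le_top)) hψ]

theorem isWeakGrad_of_mem_closure {u : L2 Ω} {G : L2Vec Ω}
    (h : (u, G) ∈ (testPairs Ω).topologicalClosure) : IsWeakGrad u G := by
  have : ((testPairs Ω : Submodule ℝ _) : Set (L2 Ω × L2Vec Ω)) ⊆ {p | IsWeakGrad p.1 p.2} := by
    intro p hp
    obtain ⟨φ, h, rfl⟩ := mem_testPairs.1 hp
    exact h.isWeakGrad
  exact closure_minimal this isClosed_isWeakGrad h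

theorem locallyIntegrableOn_of_L2Vec (G : L2Vec Ω) (hΩ : IsOpen Ω) :
    LocallyIntegrableOn G Ω volume := by
  rw [locallyIntegrableOn_iff hΩ.isLocallyClosed]
  intro K hK hKc
  have : IsFiniteMeasure ((volume : Measure (E d)).restrict K) := ⟨by simpa using hKc.measure_lt_top⟩
  have h1 : MemLp G 2 (volume.restrict K) := (Lp.memLp G).mono_measure (Measure.restrict_mono hK le_rfl)
  exact h1.integrable (by norm_num)

/-- The fundamental lemma of the calculus of variations, for a square integrable field on `Ω` and a
locally integrable one on an open subset. -/
theorem IsWeakGrad.ae_eq_of_test (hΩ : IsOpen Ω) {O : Set (E d)} (hO : IsOpen O) (hOΩ : O ⊆ Ω)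
    {F : E d → E d} {G : L2Vec Ω} (hF : LocallyIntegrableOn F O volume)
    (h : ∀ φ : E d → ℝ, IsTestFun O φ → ∫ x in Ω, φ x • G x = ∫ x in O, φ x • F x) :
    ∀ᵐ x ∂(volume : Measure (E d)), x ∈ O → G x = F x := by
  have hG : LocallyIntegrableOn G O volume := (locallyIntegrableOn_of_L2Vec G hΩ).mono_set hOΩ
  have := hO.ae_eq_zero_of_integral_contDiff_smul_eq_zero (hG.sub hF) (μ := volume) ?_
  · filter_upwards [this] with x hx hxO
    have := hx hxO
    rwa [Pi.sub_apply, sub_eq_zero] at this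
  intro φ h1 h2 h3
  have hφ : IsTestFun O φ := ⟨h1, h2, h3⟩
  have i1 : Integrable (fun x => φ x • G x) volume := by
    rw [← integrableOn_iff_integrable_of_support_subset (s := Ω)]
    · exact (hφ.mono hOΩ).integrable_smul G
    · intro x hx
      refine hOΩ (h3 (subset_tsupport _ fun h0 => hx ?_))
      simp [h0]
  have i2 : Integrable (fun x => φ x • F x) volume := by
    have hs : Function.support (fun x => φ x • F x) ⊆ tsupport φ := by
      intro x hx
      exact subset_tsupport _ fun h0 => hx (by simp [h0])
    rw [← integrableOn_iff_integrable_of_support_subset hs]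
    have := (hF.integrableOn_compact_subset h3 h2)
    exact this.continuousOn_smul h1.continuous.continuousOn h2
  have z : ∀ (H : E d → E d) {S : Set (E d)}, O ⊆ S → ∫ x in S, φ x • H x = ∫ x, φ x • H x := by
    intro H S hS
    refine setIntegral_eq_integral_of_forall_compl_eq_zero fun x hx => ?_
    rw [image_eq_zero_of_notMem_tsupport (fun hx' => hx (hS (h3 hx'))), zero_smul]
  simp only [Pi.sub_apply, smul_sub]
  rw [integral_sub i1 i2, sub_eq_zero, ← z _ hOΩ, ← z _ le_rfl]
  exact h φ hφ

theorem IsWeakGrad.unique (hΩ : IsOpen Ω) {u : L2 Ω} {F G : L2Vec Ω} (hF : IsWeakGrad u F)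
    (hG : IsWeakGrad u G) : F = G := by
  refine Lp.ext ?_
  have := IsWeakGrad.ae_eq_of_test hΩ hΩ le_rfl (F := G) (G := F)
    (locallyIntegrableOn_of_L2Vec G hΩ) (fun φ hφ => by
      rw [← neg_inj, ← hF φ hφ, ← hG φ hφ])
  rw [Filter.EventuallyEq, ae_restrict_iff' hΩ.measurableSet]
  exact this

theorem IsWeakGrad.wgrad_eq (hΩ : IsOpen Ω) {u : L2 Ω} {G : L2Vec Ω} (h : IsWeakGrad u G) :
    wgrad u = G := by
  have hex : ∃ G : L2Vec Ω, IsWeakGrad u G := ⟨G, h⟩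
  rw [wgrad, dif_pos hex]
  exact hex.choose_spec.unique hΩ h

theorem mem_closure_wgrad (hΩ : IsOpen Ω) {u : L2 Ω} (hu : u ∈ H10 Ω) :
    (u, wgrad u) ∈ (testPairs Ω).topologicalClosure := by
  obtain ⟨G, hG⟩ := mem_H10.1 hu
  rwa [(isWeakGrad_of_mem_closure hG).wgrad_eq hΩ]

theorem isWeakGrad_wgrad (hΩ : IsOpen Ω) {u : L2 Ω} (hu : u ∈ H10 Ω) : IsWeakGrad u (wgrad u) :=
  isWeakGrad_of_mem_closure (mem_closure_wgrad hΩ hu)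

theorem wgrad_add (hΩ : IsOpen Ω) {u v : L2 Ω} (hu : u ∈ H10 Ω) (hv : v ∈ H10 Ω) :
    wgrad (u + v) = wgrad u + wgrad v :=
  ((isWeakGrad_wgrad hΩ hu).add (isWeakGrad_wgrad hΩ hv)).wgrad_eq hΩ

theorem wgrad_smul (hΩ : IsOpen Ω) {u : L2 Ω} (hu : u ∈ H10 Ω) (t : ℝ) :
    wgrad (t • u) = t • wgrad u :=
  ((isWeakGrad_wgrad hΩ hu).smul t).wgrad_eq hΩ

theorem wgrad_sub (hΩ : IsOpen Ω) {u v : L2 Ω} (hu : u ∈ H10 Ω) (hv : v ∈ H10 Ω) :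
    wgrad (u - v) = wgrad u - wgrad v := by
  have := wgrad_add hΩ hu (Submodule.smul_mem _ (-1 : ℝ) hv)
  rw [wgrad_smul hΩ hv] at this
  simpa [sub_eq_add_neg] using this

/-- `H^1_0` is complete: limits in `L²` of functions whose weak gradients converge. -/
theorem mem_H10_of_tendsto (hΩ : IsOpen Ω) {u : ℕ → L2 Ω} {v : L2 Ω} {G : L2Vec Ω}
    (hu : ∀ n, u n ∈ H10 Ω) (h : Tendsto u atTop (𝓝 v))
    (h' : Tendsto (fun n => wgrad (u n)) atTop (𝓝 G)) : v ∈ H10 Ω ∧ wgrad v = G := by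
  have : (v, G) ∈ (testPairs Ω).topologicalClosure :=
    (Submodule.isClosed_topologicalClosure _).mem_of_tendsto (h.prodMk_nhds h')
      (Eventually.of_forall fun n => mem_closure_wgrad hΩ (hu n))
  exact ⟨mem_H10.2 ⟨G, this⟩, (isWeakGrad_of_mem_closure this).wgrad_eq hΩ⟩

theorem IsTestFun.mem_H10 {φ : E d → ℝ} (h : IsTestFun Ω φ) : h.toL2 ∈ H10 Ω :=
  ParO.mem_H10.2 ⟨h.gradL2, Submodule.le_topologicalClosure _ (mem_testPairs.2 ⟨φ, h, rfl⟩)⟩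

theorem IsTestFun.wgrad_toL2 (hΩ : IsOpen Ω) {φ : E d → ℝ} (h : IsTestFun Ω φ) :
    wgrad h.toL2 = h.gradL2 := h.isWeakGrad.wgrad_eq hΩ

/-- Test functions are dense in `H^1_0`. -/
theorem exists_seq_testFun (hΩ : IsOpen Ω) {u : L2 Ω} (hu : u ∈ H10 Ω) :
    ∃ (φ : ℕ → E d → ℝ) (h : ∀ n, IsTestFun Ω (φ n)),
      Tendsto (fun n => (h n).toL2) atTop (𝓝 u) ∧
      Tendsto (fun n => (h n).gradL2) atTop (𝓝 (wgrad u)) := by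
  obtain ⟨p, hp, hp'⟩ := mem_closure_iff_seq_limit.1 (mem_closure_wgrad hΩ hu)
  choose φ h e using fun n => mem_testPairs.1 (hp n)
  refine ⟨φ, h, ?_, ?_⟩
  · have := (continuous_fst.tendsto _).comp hp'
    refine this.congr fun n => by simp [e]
  · have := (continuous_snd.tendsto _).comp hp'
    refine this.congr fun n => by simp [e]

end

section

variable {d : ℕ} {Ω : Set (E d)}

/-! ### The Poincaré inequality and Rellich's theorem -/

theorem eLpNorm_two_sq {α F : Type*} [MeasurableSpace α] [NormedAddCommGroup F] (f : α → F)
    (μ : Measure α) : eLpNorm f 2 μ ^ 2 = ∫⁻ x, ‖f x‖ₑ ^ 2 ∂μ := by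
  have h := eLpNorm_nnreal_pow_eq_lintegral (μ := μ) (f := f) (p := 2) two_ne_zero
  have e : ((2 : ℝ≥0) : ℝ) = ((2 : ℕ) : ℝ) := by norm_num
  simp only [e, ENNReal.rpow_natCast] at h
  exact_mod_cast h

/-- A translation changes a smooth function in `L²` by at most the length of the translation times
the norm of the gradient. -/
theorem lintegral_translate_sub_le {φ : E d → ℝ} (hφ : ContDiff ℝ ∞ φ) (h : E d) :
    ∫⁻ x, ‖φ (x + h) - φ x‖ₑ ^ 2 ≤ ‖h‖ₑ ^ 2 * ∫⁻ x, ‖gradient φ x‖ₑ ^ 2 := by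
  have hg : Continuous (gradient φ) := (contDiff_gradient hφ).continuous
  have hpt : ∀ x, ‖φ (x + h) - φ x‖ₑ ^ 2
      ≤ ∫⁻ t in Icc (0 : ℝ) 1, ‖h‖ₑ ^ 2 * ‖gradient φ (x + t • h)‖ₑ ^ 2 := by
    intro x
    set μ : Measure ℝ := volume.restrict (Icc (0 : ℝ) 1) with hμ
    have : IsProbabilityMeasure μ := ⟨by simp [hμ]⟩
    set g : ℝ → ℝ := fun t => inner ℝ h (gradient φ (x + t • h)) with hgdef
    have hgc : Continuous g := by fun_prop
    have e : φ (x + h) - φ x = ∫ t, g t ∂μ := by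
      have hd : ∀ t ∈ uIcc (0 : ℝ) 1, HasDerivAt (fun t : ℝ => φ (x + t • h)) (g t) t := by
        intro t _
        have h1 : HasDerivAt (fun t : ℝ => x + t • h) h t := by
          simpa using ((hasDerivAt_id t).smul_const h).const_add x
        have := ((hφ.differentiable (by simp) (x + t • h)).hasFDerivAt).comp_hasDerivAt t h1
        rwa [← inner_gradient_eq] at this
      have := intervalIntegral.integral_eq_sub_of_hasDerivAt hd (hgc.intervalIntegrable _ _)
      rw [hμ, integral_Icc_eq_integral_Ioc, ← intervalIntegral.integral_of_le zero_le_one, this]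
      simp
    have h1 : ‖φ (x + h) - φ x‖ₑ ≤ eLpNorm g 2 μ := by
      calc ‖φ (x + h) - φ x‖ₑ ≤ ∫⁻ t, ‖g t‖ₑ ∂μ := e ▸ enorm_integral_le_lintegral_enorm _
        _ = eLpNorm g 1 μ := eLpNorm_one_eq_lintegral_enorm.symm
        _ ≤ eLpNorm g 2 μ := eLpNorm_le_eLpNorm_of_exponent_le (by norm_num)
            hgc.aestronglyMeasurable
    calc ‖φ (x + h) - φ x‖ₑ ^ 2 ≤ eLpNorm g 2 μ ^ 2 := by gcongr
      _ = ∫⁻ t, ‖g t‖ₑ ^ 2 ∂μ := eLpNorm_two_sq g μ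
      _ ≤ _ := by
        refine lintegral_mono fun t => ?_
        rw [← mul_pow]
        gcongr
        rw [← ofReal_norm, ← ofReal_norm, ← ofReal_norm, ← ENNReal.ofReal_mul (norm_nonneg _)]
        exact ENNReal.ofReal_le_ofReal (norm_inner_le_norm _ _)
  calc ∫⁻ x, ‖φ (x + h) - φ x‖ₑ ^ 2
      ≤ ∫⁻ x, ∫⁻ t in Icc (0 : ℝ) 1, ‖h‖ₑ ^ 2 * ‖gradient φ (x + t • h)‖ₑ ^ 2 :=
        lintegral_mono hpt
    _ = ∫⁻ t in Icc (0 : ℝ) 1, ∫⁻ x, ‖h‖ₑ ^ 2 * ‖gradient φ (x + t • h)‖ₑ ^ 2 := by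
        refine lintegral_lintegral_swap ?_
        refine Measurable.aemeasurable ?_
        have : Continuous (fun p : E d × ℝ => gradient φ (p.1 + p.2 • h)) := by fun_prop
        exact (this.measurable.enorm.pow_const 2).const_mul _
    _ = ∫⁻ t in Icc (0 : ℝ) 1, ‖h‖ₑ ^ 2 * ∫⁻ x, ‖gradient φ x‖ₑ ^ 2 := by
        refine lintegral_congr fun t => ?_
        have hgt : Continuous (fun x => gradient φ (x + t • h)) := by fun_prop
        rw [lintegral_const_mul _ (hgt.measurable.enorm.pow_const 2)]
        rw [lintegral_add_right_eq_self (fun x => ‖gradient φ x‖ₑ ^ 2)]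
    _ = _ := by simp

theorem enorm_toLp_sq {F : Type*} [NormedAddCommGroup F] {f : E d → F}
    (hf : MemLp f 2 (volume.restrict Ω)) : ‖hf.toLp f‖ₑ ^ 2 = ∫⁻ x in Ω, ‖f x‖ₑ ^ 2 := by
  rw [Lp.enorm_toLp, eLpNorm_two_sq]

theorem IsTestFun.enorm_toL2_sq {φ : E d → ℝ} (h : IsTestFun Ω φ) :
    ‖h.toL2‖ₑ ^ 2 = ∫⁻ x, ‖φ x‖ₑ ^ 2 := by
  rw [IsTestFun.toL2, enorm_toLp_sq, setLIntegral_eq_of_support_subset]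
  exact fun x hx => h.2.2 (subset_tsupport _ fun h0 => hx (by simp [h0]))

theorem IsTestFun.enorm_gradL2_sq {φ : E d → ℝ} (h : IsTestFun Ω φ) :
    ‖h.gradL2‖ₑ ^ 2 = ∫⁻ x, ‖gradient φ x‖ₑ ^ 2 := by
  rw [IsTestFun.gradL2, enorm_toLp_sq, setLIntegral_eq_of_support_subset]
  exact fun x hx => h.2.2 (by_contra fun h0 => hx (by
    simp [gradient_eq_zero_of_notMem_tsupport h0]))

/-- Poincaré–Friedrichs inequality for test functions. -/
theorem IsTestFun.norm_toL2_le (hd : 1 ≤ d) {R : ℝ} (hR : 0 ≤ R) (hΩ : Ω ⊆ Metric.closedBall 0 R)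
    {φ : E d → ℝ} (h : IsTestFun Ω φ) : ‖h.toL2‖ ≤ (2 * R + 1) * ‖h.gradL2‖ := by
  -- translation by more than the diameter makes the supports of `φ` and its translate disjoint
  set e : E d := (2 * R + 1) • EuclideanSpace.single ⟨0, hd⟩ (1 : ℝ) with he
  have hne : ‖e‖ = 2 * R + 1 := by
    rw [he, norm_smul, Real.norm_of_nonneg (by linarith)]
    simp
  have hz : ∀ x, φ x = 0 ∨ φ (x + e) = 0 := by
    intro x
    by_contra hcon
    push Not at hcon
    have h1 := hΩ (h.2.2 (subset_tsupport φ hcon.1))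
    have h2 := hΩ (h.2.2 (subset_tsupport φ hcon.2))
    rw [mem_closedBall_zero_iff] at h1 h2
    have := norm_sub_le (x + e) x
    rw [add_sub_cancel_left, hne] at this
    linarith
  have key : ‖h.toL2‖ₑ ^ 2 ≤ (‖e‖ₑ * ‖h.gradL2‖ₑ) ^ 2 := by
    rw [mul_pow, h.enorm_toL2_sq, h.enorm_gradL2_sq]
    refine le_trans (lintegral_mono fun x => ?_) (lintegral_translate_sub_le h.1 e)
    rcases hz x with h0 | h0
    · simp [h0]
    · simp [h0]
  have key2 := (ENNReal.pow_le_pow_left_iff (two_ne_zero)).1 key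
  rw [← ofReal_norm, ← ofReal_norm, ← ofReal_norm, ← ENNReal.ofReal_mul (norm_nonneg _),
    ENNReal.ofReal_le_ofReal_iff (by positivity), hne] at key2
  exact key2

/-- Poincaré–Friedrichs inequality. -/
theorem norm_le_norm_wgrad (hd : 1 ≤ d) (hΩo : IsOpen Ω) {R : ℝ} (hR : 0 ≤ R)
    (hΩ : Ω ⊆ Metric.closedBall 0 R) {u : L2 Ω} (hu : u ∈ H10 Ω) :
    ‖u‖ ≤ (2 * R + 1) * ‖wgrad u‖ := by
  obtain ⟨φ, h, h1, h2⟩ := exists_seq_testFun hΩo hu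
  exact le_of_tendsto_of_tendsto' h1.norm (h2.norm.const_mul _)
    fun n => (h n).norm_toL2_le hd hR hΩ

/-- The square integral of a function is controlled by its mean and by its oscillation. -/
theorem lintegral_sq_le_mean_add_oscillation {α : Type*} [MeasurableSpace α] {μ : Measure α}
    [IsFiniteMeasure μ] (h0 : μ univ ≠ 0) {w : α → ℝ} (i1 : Integrable w μ)
    (i2 : Integrable (fun x => w x ^ 2) μ) :
    ∫⁻ x, ‖w x‖ₑ ^ 2 ∂μ ≤ (μ univ)⁻¹ * (‖∫ x, w x ∂μ‖ₑ ^ 2 +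
      ∫⁻ x, ∫⁻ y, ‖w y - w x‖ₑ ^ 2 ∂μ ∂μ) := by
  have hVpos : 0 < μ.real univ := ENNReal.toReal_pos h0 (measure_ne_top _ _)
  -- expand the square: the double integral of `(w y - w x)²` is `2 (V J - I²)`
  obtain ⟨V, hV⟩ : ∃ V, V = μ.real univ := ⟨_, rfl⟩
  rw [← hV] at hVpos
  obtain ⟨I, hI⟩ : ∃ I, I = ∫ x, w x ∂μ := ⟨_, rfl⟩
  obtain ⟨J, hJ⟩ : ∃ J, J = ∫ x, w x ^ 2 ∂μ := ⟨_, rfl⟩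
  have inner_int : ∀ x, ∫ y, (w y - w x) ^ 2 ∂μ = J - 2 * w x * I + V * w x ^ 2 := by
    intro x
    have : ∀ y, (w y - w x) ^ 2 = w y ^ 2 - 2 * w x * w y + w x ^ 2 := fun y => by ring
    have i3 : Integrable (fun y => w y ^ 2 - 2 * w x * w y) μ := i2.sub (i1.const_mul _)
    simp only [this]
    rw [integral_add i3 (integrable_const _),
      integral_sub i2 (i1.const_mul _), integral_const_mul, integral_const, ← hV, ← hI, ← hJ, smul_eq_mul]
  have inner_i : ∀ x, Integrable (fun y => (w y - w x) ^ 2) μ := by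
    intro x
    have : ∀ y, (w y - w x) ^ 2 = w y ^ 2 - 2 * w x * w y + w x ^ 2 := fun y => by ring
    simp only [this]
    exact (i2.sub (i1.const_mul _)).add (integrable_const _)
  have outer_i : Integrable (fun x => J - 2 * w x * I + V * w x ^ 2) μ :=
    ((integrable_const _).sub ((i1.const_mul 2).mul_const I)).add (i2.const_mul _)
  have outer : ∫ x, (J - 2 * w x * I + V * w x ^ 2) ∂μ
      = 2 * (V * J - I ^ 2) := by
    have i3 : Integrable (fun x => J - 2 * w x * I) μ :=
      (integrable_const _).sub ((i1.const_mul 2).mul_const I)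
    rw [integral_add i3 (i2.const_mul _),
      integral_sub (integrable_const _) ((i1.const_mul 2).mul_const I), integral_const,
      integral_mul_const, integral_const_mul, integral_const_mul, ← hV, ← hI, ← hJ, smul_eq_mul]
    ring
  have e1 : ∫⁻ x, ‖w x‖ₑ ^ 2 ∂μ = ENNReal.ofReal J := by
    rw [hJ, ofReal_integral_eq_lintegral_ofReal i2 (ae_of_all _ fun x => sq_nonneg _)]
    refine lintegral_congr fun x => ?_
    rw [← ofReal_norm, ← ENNReal.ofReal_pow (norm_nonneg _), Real.norm_eq_abs, sq_abs]
  have e2 : ∫⁻ x, ∫⁻ y, ‖w y - w x‖ₑ ^ 2 ∂μ ∂μ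
      = ENNReal.ofReal (2 * (V * J - I ^ 2)) := by
    rw [← outer, ofReal_integral_eq_lintegral_ofReal outer_i]
    · refine lintegral_congr fun x => ?_
      rw [← inner_int, ofReal_integral_eq_lintegral_ofReal (inner_i x)
        (ae_of_all _ fun x => sq_nonneg _)]
      refine lintegral_congr fun y => ?_
      rw [← ofReal_norm, ← ENNReal.ofReal_pow (norm_nonneg _), Real.norm_eq_abs, sq_abs]
    · refine ae_of_all _ fun x => ?_
      dsimp only
      rw [← inner_int]
      exact integral_nonneg fun y => sq_nonneg _
  have hnn : 0 ≤ 2 * (V * J - I ^ 2) := by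
    rw [← outer]
    refine integral_nonneg fun x => ?_
    dsimp only
    rw [← inner_int]
    exact integral_nonneg fun y => sq_nonneg _
  have e3 : (μ univ)⁻¹ = ENNReal.ofReal V⁻¹ := by
    rw [ENNReal.ofReal_inv_of_pos hVpos, hV, measureReal_def,
      ENNReal.ofReal_toReal (measure_ne_top _ _)]
  rw [e1, e2, e3, ← hI, ← ofReal_norm, ← ENNReal.ofReal_pow (norm_nonneg _), Real.norm_eq_abs, sq_abs,
    ← ENNReal.ofReal_add (sq_nonneg _) hnn, ← ENNReal.ofReal_mul (by positivity)]
  refine ENNReal.ofReal_le_ofReal ?_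
  rw [le_inv_mul_iff₀ hVpos]
  linarith

/-- The half open unit cube, translated by the integer vector `n` and scaled by `s`. -/
def cell (s : ℝ) (n : Fin d → ℤ) : Set (E d) := {x | ∀ i, ⌊x i / s⌋ = n i}

theorem measurableSet_cell (s : ℝ) (n : Fin d → ℤ) : MeasurableSet (cell s n : Set (E d)) := by
  have : (cell s n : Set (E d)) = ⋂ i, (fun x : E d => ⌊x i / s⌋) ⁻¹' {n i} := by
    ext x; simp [cell]
  rw [this]
  refine MeasurableSet.iInter fun i => ?_
  have hm : Measurable (fun x : E d => ⌊x i / s⌋) :=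
    Int.measurable_floor.comp (by fun_prop)
  exact hm (measurableSet_singleton _)

theorem disjoint_cell (s : ℝ) {n n' : Fin d → ℤ} (h : n ≠ n') :
    Disjoint (cell s n : Set (E d)) (cell s n') := by
  refine disjoint_left.2 fun x hx hx' => h ?_
  ext i
  rw [← hx i, ← hx' i]

theorem dist_le_of_mem_cell {s : ℝ} (hs : 0 < s) {n : Fin d → ℤ} {x y : E d}
    (hx : x ∈ cell s n) (hy : y ∈ cell s n) : ‖y - x‖ ≤ s * √d := by
  have hc : ∀ i, |y i - x i| ≤ s := by
    intro i
    have := Int.abs_sub_lt_one_of_floor_eq_floor ((hy i).trans (hx i).symm)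
    rw [← sub_div, abs_div, abs_of_pos hs, div_lt_one hs] at this
    exact this.le
  rw [EuclideanSpace.norm_eq]
  calc √(∑ i, ‖(y - x) i‖ ^ 2) ≤ √(∑ _i : Fin d, s ^ 2) := by
        refine Real.sqrt_le_sqrt (Finset.sum_le_sum fun i _ => ?_)
        have := hc i
        simpa using sq_le_sq' (by linarith [abs_nonneg (y i - x i)]) this
    _ = s * √d := by
        rw [Finset.sum_const, Finset.card_univ, Fintype.card_fin, nsmul_eq_mul, mul_comm,
          Real.sqrt_mul (sq_nonneg s), Real.sqrt_sq hs.le]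

theorem volume_cell {s : ℝ} (hs : 0 < s) (n : Fin d → ℤ) :
    volume (cell s n : Set (E d)) = ENNReal.ofReal (s ^ d) * volume (cell 1 0 : Set (E d)) := by
  have : (cell s n : Set (E d)) = (WithLp.toLp 2 (fun i => s * (n i : ℝ)) : E d) +ᵥ (s • (cell 1 0 : Set (E d))) := by
    ext x
    rw [Set.mem_vadd_set_iff_neg_vadd_mem, Set.mem_smul_set_iff_inv_smul_mem₀ hs.ne']
    simp only [cell, mem_ofPred_eq, vadd_eq_add]
    refine forall_congr' fun i => ?_
    have : (s⁻¹ • (-(WithLp.toLp 2 (fun i => s * (n i : ℝ)) : E d) + x)) i / 1 = x i / s - n i := by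
      simp
      field_simp
      ring
    rw [this, Int.floor_sub_intCast]
    simp [sub_eq_zero]
  rw [this, measure_vadd, Measure.addHaar_smul]
  simp [abs_of_pos hs]

theorem volume_cell_one_ne_zero : volume (cell 1 0 : Set (E d)) ≠ 0 := by
  have ho : IsOpen {x : E d | ∀ i, x i ∈ Ioo (0 : ℝ) 1} := by
    simp only [ofPred_forall]
    exact isOpen_iInter_of_finite fun i => isOpen_Ioo.preimage (by fun_prop)
  have hne : ({x : E d | ∀ i, x i ∈ Ioo (0 : ℝ) 1}).Nonempty :=
    ⟨WithLp.toLp 2 (fun _ => 1 / 2), fun i => by norm_num⟩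
  refine ne_of_gt ((ho.measure_pos volume hne).trans_le (measure_mono ?_))
  intro x hx i
  have := hx i
  simp [Int.floor_eq_zero_iff, this.1.le, this.2]

theorem volume_cell_one_ne_top : volume (cell 1 0 : Set (E d)) ≠ ⊤ := by
  refine ((Metric.isBounded_iff_subset_closedBall 0).2 ⟨1 * √d, fun x hx => ?_⟩).measure_lt_top.ne
  have h0 : (0 : E d) ∈ (cell 1 0 : Set (E d)) := by simp [cell]
  simpa using dist_le_of_mem_cell one_pos h0 hx

/-- Summed over the cells of a grid, the oscillation of a function on the cells is controlled by its
gradient. -/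
theorem sum_oscillation_le {φ : E d → ℝ} (hφ : ContDiff ℝ ∞ φ) {s : ℝ} (hs : 0 < s)
    (N : Finset (Fin d → ℤ)) :
    ∑ n ∈ N, ∫⁻ x in cell s n, ∫⁻ y in cell s n, ‖φ y - φ x‖ₑ ^ 2
      ≤ volume (Metric.closedBall (0 : E d) (s * √d)) * (ENNReal.ofReal (s * √d) ^ 2 *
        ∫⁻ x, ‖gradient φ x‖ₑ ^ 2) := by
  -- two points of a cell differ by a vector of the ball `B`: enlarge the inner domain of integration
  -- to `x + B`, and integrate over `x` first
  set B := Metric.closedBall (0 : E d) (s * √d)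
  set G : E d → ℝ≥0∞ := fun x => ∫⁻ h in B, ‖φ (x + h) - φ x‖ₑ ^ 2
  have h1 : ∀ n ∈ N, ∫⁻ x in cell s n, ∫⁻ y in cell s n, ‖φ y - φ x‖ₑ ^ 2
      ≤ ∫⁻ x in cell s n, G x := by
    intro n _
    refine setLIntegral_mono' (measurableSet_cell s n) fun x hx => ?_
    rw [← lintegral_indicator (measurableSet_cell s n)]
    rw [← lintegral_add_left_eq_self _ x]
    simp only [G]
    rw [← lintegral_indicator (show MeasurableSet B from Metric.isClosed_closedBall.measurableSet)]
    refine lintegral_mono fun h => ?_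
    by_cases hh : x + h ∈ cell s n
    · have : h ∈ B := by
        have := dist_le_of_mem_cell hs hx hh
        rw [add_sub_cancel_left] at this
        simpa [B] using this
      simp only [indicator_of_mem hh, indicator_of_mem this, le_refl]
    · simp [hh]
  calc _ ≤ ∑ n ∈ N, ∫⁻ x in cell s n, G x := Finset.sum_le_sum h1
    _ = ∫⁻ x in ⋃ n ∈ N, cell s n, G x := by
        rw [lintegral_biUnion_finset]
        · exact fun n _ n' _ hnn => disjoint_cell s hnn
        · exact fun n _ => measurableSet_cell s n
    _ ≤ ∫⁻ x, G x := setLIntegral_le_lintegral _ _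
    _ = ∫⁻ h in B, ∫⁻ x, ‖φ (x + h) - φ x‖ₑ ^ 2 := by
        refine lintegral_lintegral_swap ?_
        have hc := hφ.continuous
        have : Continuous (fun p : E d × E d => φ (p.1 + p.2) - φ p.1) := by fun_prop
        exact (this.measurable.enorm.pow_const 2).aemeasurable
    _ ≤ ∫⁻ h in B, ENNReal.ofReal (s * √d) ^ 2 * ∫⁻ x, ‖gradient φ x‖ₑ ^ 2 := by
        refine setLIntegral_mono' Metric.isClosed_closedBall.measurableSet fun h hh => ?_
        refine (lintegral_translate_sub_le hφ h).trans ?_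
        gcongr
        rw [← ofReal_norm]
        exact ENNReal.ofReal_le_ofReal (by simpa [B] using hh)
    _ = _ := by rw [setLIntegral_const, mul_comm]

/-- A bounded set of functions is totally bounded when, up to small errors, it is controlled by
finitely many bounded linear functionals. -/
theorem totallyBounded_of_finite_functionals {H : Type*} [NormedAddCommGroup H] [NormedSpace ℝ H]
    {S : Set H} (hS : Bornology.IsBounded S)
    (h : ∀ ε > 0, ∃ (n : ℕ) (T : H →L[ℝ] (Fin n → ℝ)) (c : ℝ), 0 < c ∧
      ∀ u ∈ S, ∀ v ∈ S, ‖u - v‖ ≤ c * ‖T u - T v‖ + ε) : TotallyBounded S := by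
  rw [Metric.totallyBounded_iff]
  intro ε hε
  obtain ⟨n, T, c, hc, hT⟩ := h (ε / 2) (half_pos hε)
  have hb : TotallyBounded (T '' S) := by
    have : Bornology.IsBounded (T '' S) := T.lipschitz.isBounded_image hS
    exact this.isCompact_closure.totallyBounded.subset subset_closure
  obtain ⟨t, htS, htf, ht⟩ := Metric.finite_approx_of_totallyBounded hb (ε / (2 * c)) (by positivity)
  choose! g hgS hg using fun y (hy : y ∈ t) => htS hy
  refine ⟨g '' t, htf.image g, fun u hu => ?_⟩
  obtain ⟨y, hy, hyu⟩ := mem_iUnion₂.1 (ht (mem_image_of_mem T hu))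
  refine mem_iUnion₂.2 ⟨g y, mem_image_of_mem g hy, ?_⟩
  rw [Metric.mem_ball, dist_eq_norm] at hyu ⊢
  have := hT u hu (g y) (hgS y hy)
  rw [hg y hy] at this
  calc ‖u - g y‖ ≤ c * ‖T u - y‖ + ε / 2 := this
    _ < c * (ε / (2 * c)) + ε / 2 := by gcongr
    _ = ε := by field_simp; ring

/-- The integrals over the cells, as bounded linear functionals on `L²(Ω)`. -/
def cellIntegral [IsFiniteMeasure ((volume : Measure (E d)).restrict Ω)] (s : ℝ)
    (n : Fin d → ℤ) : L2 Ω →L[ℝ] ℝ :=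
  innerSL ℝ (indicatorConstLp 2 (measurableSet_cell s n) (measure_ne_top (volume.restrict Ω) _) (1 : ℝ))

theorem IsTestFun.cellIntegral_toL2 [IsFiniteMeasure ((volume : Measure (E d)).restrict Ω)]
    (s : ℝ) (n : Fin d → ℤ) {φ : E d → ℝ} (h : IsTestFun Ω φ) :
    cellIntegral s n h.toL2 = ∫ x in cell s n, φ x := by
  rw [cellIntegral, innerSL_apply_apply, L2.inner_indicatorConstLp_one]
  have e : ∫ x in cell s n, (h.toL2 : E d → ℝ) x ∂(volume.restrict Ω)
      = ∫ x in cell s n, φ x ∂(volume.restrict Ω) := by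
    refine setIntegral_congr_ae (measurableSet_cell s n) ?_
    filter_upwards [h.memLp.coeFn_toLp] with x hx _
    exact hx
  rw [e, Measure.restrict_restrict (measurableSet_cell s n), Set.inter_comm,
    ← Measure.restrict_restrict' (measurableSet_cell s n)]
  refine setIntegral_eq_integral_of_forall_compl_eq_zero fun x hx => ?_
  exact image_eq_zero_of_notMem_tsupport fun hx' => hx (h.2.2 hx')

theorem IsTestFun.lintegral_cell_le [IsFiniteMeasure ((volume : Measure (E d)).restrict Ω)]
    (s : ℝ) (n : Fin d → ℤ) {φ : E d → ℝ} (h : IsTestFun Ω φ)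
    (h0 : volume (cell s n : Set (E d)) ≠ 0) (ht : volume (cell s n : Set (E d)) ≠ ⊤) :
    ∫⁻ x in cell s n, ‖φ x‖ₑ ^ 2 ≤ (volume (cell s n : Set (E d)))⁻¹ *
      (‖cellIntegral s n h.toL2‖ₑ ^ 2 +
        ∫⁻ x in cell s n, ∫⁻ y in cell s n, ‖φ y - φ x‖ₑ ^ 2) := by
  have hfin : IsFiniteMeasure ((volume : Measure (E d)).restrict (cell s n)) :=
    ⟨by rw [Measure.restrict_apply_univ]; exact ht.lt_top⟩
  have i1 : Integrable φ := h.1.continuous.integrable_of_hasCompactSupport h.2.1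
  have i2 : Integrable (fun x => φ x ^ 2) :=
    (h.1.continuous.memLp_of_hasCompactSupport h.2.1).integrable_sq
  have := lintegral_sq_le_mean_add_oscillation (μ := (volume : Measure (E d)).restrict (cell s n))
    (by rwa [Measure.restrict_apply_univ]) (i1.mono_measure Measure.restrict_le_self)
    (i2.mono_measure Measure.restrict_le_self)
  rw [h.cellIntegral_toL2]
  rwa [Measure.restrict_apply_univ] at this

theorem enorm_sq_eq_ofReal {F : Type*} [NormedAddCommGroup F] (x : F) :
    ‖x‖ₑ ^ 2 = ENNReal.ofReal (‖x‖ ^ 2) := by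
  rw [← ofReal_norm, ENNReal.ofReal_pow (norm_nonneg _)]

theorem exists_finset_cell_cover {R : ℝ} (hΩ : Ω ⊆ Metric.closedBall 0 R) {s : ℝ} (hs : 0 < s) :
    ∃ N : Finset (Fin d → ℤ), ∀ x ∈ Ω, ∃ n ∈ N, x ∈ cell s n := by
  refine ⟨Fintype.piFinset fun _ => Finset.Icc (-(⌈R / s⌉ + 1)) (⌈R / s⌉ + 1), fun x hx =>
    ⟨fun i => ⌊x i / s⌋, ?_, fun i => rfl⟩⟩
  rw [Fintype.mem_piFinset]
  intro i
  have h1 : |x i| ≤ R := (PiLp.norm_apply_le x i).trans (by simpa using hΩ hx)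
  have h2 : |x i / s| ≤ R / s := by
    rw [abs_div, abs_of_pos hs]
    gcongr
  have h3 : R / s ≤ ⌈R / s⌉ := Int.le_ceil _
  rw [abs_le] at h2
  rw [Finset.mem_Icc]
  constructor
  · rw [Int.le_floor]
    push_cast
    linarith
  · have : ((⌊x i / s⌋ : ℤ) : ℝ) ≤ ((⌈R / s⌉ : ℤ) : ℝ) := (Int.floor_le _).trans (by linarith)
    have := Int.cast_le.1 this
    omega

/-- Poincaré's inequality on a fine grid of cells. -/
theorem exists_cell_bound [IsFiniteMeasure ((volume : Measure (E d)).restrict Ω)]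
    {R : ℝ} (hΩ : Ω ⊆ Metric.closedBall 0 R) {ε : ℝ} (hε : 0 < ε) :
    ∃ (s : ℝ) (N : Finset (Fin d → ℤ)) (c : ℝ), 0 ≤ c ∧ ∀ (φ : E d → ℝ) (h : IsTestFun Ω φ),
      ‖h.toL2‖ ^ 2 ≤ c * ∑ n ∈ N, (cellIntegral s n h.toL2) ^ 2 + ε * ‖h.gradL2‖ ^ 2 := by
  obtain ⟨V, hVe⟩ : ∃ V, V = (volume (cell 1 0 : Set (E d))).toReal := ⟨_, rfl⟩
  have hV : 0 < V := hVe ▸ ENNReal.toReal_pos volume_cell_one_ne_zero volume_cell_one_ne_top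
  obtain ⟨W, hWe⟩ : ∃ W, W = (volume (Metric.closedBall (0 : E d) (√d))).toReal := ⟨_, rfl⟩
  -- the mesh size of the grid: the constant in front of the gradient becomes at most `ε`
  obtain ⟨s, hs, hsε⟩ : ∃ s : ℝ, 0 < s ∧ V⁻¹ * W * (s * √d) ^ 2 ≤ ε := by
    have : Tendsto (fun s : ℝ => V⁻¹ * W * (s * √d) ^ 2) (𝓝[>] 0) (𝓝 (V⁻¹ * W * (0 * √d) ^ 2)) :=
      tendsto_nhdsWithin_of_tendsto_nhds (Continuous.tendsto (by fun_prop) 0)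
    have h2 := (this.eventually_le_const (u := ε) (by simpa using hε)).and self_mem_nhdsWithin
    obtain ⟨s, h1, h2⟩ := h2.exists
    exact ⟨s, h2, h1⟩
  obtain ⟨N, hcov⟩ := exists_finset_cell_cover hΩ hs
  refine ⟨s, N, (s ^ d * V)⁻¹, by positivity, fun φ h => ?_⟩
  have hvc : ∀ n : Fin d → ℤ, volume (cell s n : Set (E d)) = ENNReal.ofReal (s ^ d * V) := by
    intro n
    rw [hVe, volume_cell hs, ENNReal.ofReal_mul (by positivity),
      ENNReal.ofReal_toReal volume_cell_one_ne_top]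
  have hvb : volume (Metric.closedBall (0 : E d) (s * √d)) = ENNReal.ofReal (s ^ d * W) := by
    rw [hWe, Measure.addHaar_closedBall_mul _ _ hs.le (by positivity), ENNReal.ofReal_mul (by positivity),
      ENNReal.ofReal_toReal Metric.isBounded_closedBall.measure_lt_top.ne]
    simp
  have key : ‖h.toL2‖ₑ ^ 2 ≤ (ENNReal.ofReal (s ^ d * V))⁻¹ *
      (∑ n ∈ N, ‖cellIntegral s n h.toL2‖ₑ ^ 2 +
        ENNReal.ofReal (s ^ d * W) * (ENNReal.ofReal (s * √d) ^ 2 * ‖h.gradL2‖ₑ ^ 2)) := by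
    have h1 : ‖h.toL2‖ₑ ^ 2 ≤ ∑ n ∈ N, ∫⁻ x in cell s n, ‖φ x‖ₑ ^ 2 := by
      rw [h.enorm_toL2_sq]
      calc ∫⁻ x, ‖φ x‖ₑ ^ 2 = ∫⁻ x in ⋃ n ∈ N, cell s n, ‖φ x‖ₑ ^ 2 := by
            rw [setLIntegral_eq_of_support_subset]
            intro x hx
            have : x ∈ Ω := h.2.2 (subset_tsupport _ fun h0 => hx (by simp [h0]))
            obtain ⟨n, hn, hx⟩ := hcov x this
            exact mem_iUnion₂.2 ⟨n, hn, hx⟩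
        _ ≤ _ := by
            rw [lintegral_biUnion_finset (fun n _ n' _ hnn => disjoint_cell s hnn)
              (fun n _ => measurableSet_cell s n)]
    refine h1.trans ?_
    calc ∑ n ∈ N, ∫⁻ x in cell s n, ‖φ x‖ₑ ^ 2
        ≤ ∑ n ∈ N, (ENNReal.ofReal (s ^ d * V))⁻¹ * (‖cellIntegral s n h.toL2‖ₑ ^ 2 +
            ∫⁻ x in cell s n, ∫⁻ y in cell s n, ‖φ y - φ x‖ₑ ^ 2) := by
          refine Finset.sum_le_sum fun n _ => ?_
          rw [← hvc n]
          exact h.lintegral_cell_le s n (by rw [hvc]; exact (ENNReal.ofReal_pos.2 (by positivity)).ne')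
            (by rw [hvc]; exact ENNReal.ofReal_ne_top)
      _ ≤ _ := by
          rw [← Finset.mul_sum, Finset.sum_add_distrib]
          gcongr
          have := sum_oscillation_le h.1 hs N
          rwa [hvb, ← h.enorm_gradL2_sq] at this
  have hsV : 0 < s ^ d * V := by positivity
  have hW : 0 ≤ W := hWe ▸ ENNReal.toReal_nonneg
  simp only [enorm_sq_eq_ofReal] at key
  rw [← ENNReal.ofReal_sum_of_nonneg (fun _ _ => sq_nonneg _), ← ENNReal.ofReal_inv_of_pos hsV,
    ← ENNReal.ofReal_pow (by positivity), ← ENNReal.ofReal_mul (by positivity),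
    ← ENNReal.ofReal_mul (by positivity), ← ENNReal.ofReal_add (by positivity) (by positivity),
    ← ENNReal.ofReal_mul (by positivity), ENNReal.ofReal_le_ofReal_iff (by positivity)] at key
  simp only [Real.norm_eq_abs, sq_abs] at key
  refine key.trans ?_
  rw [mul_add]
  refine add_le_add le_rfl ?_
  calc (s ^ d * V)⁻¹ * (s ^ d * W * ((s * √d) ^ 2 * ‖h.gradL2‖ ^ 2))
      = V⁻¹ * W * (s * √d) ^ 2 * ‖h.gradL2‖ ^ 2 := by field_simp
    _ ≤ _ := by gcongr

/-- Rellich's theorem: sets that are bounded in `H^1_0` are totally bounded in `L²`. -/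
theorem totallyBounded_H10 (hd : 1 ≤ d) (hΩo : IsOpen Ω) {R : ℝ} (hR : 0 ≤ R)
    (hΩ : Ω ⊆ Metric.closedBall 0 R) (K : ℝ) :
    TotallyBounded {u : L2 Ω | u ∈ H10 Ω ∧ ‖wgrad u‖ ≤ K} := by
  have hfin : IsFiniteMeasure ((volume : Measure (E d)).restrict Ω) :=
    ⟨by simpa using (Metric.isBounded_closedBall.subset hΩ).measure_lt_top⟩
  -- by density it is enough to treat test functions
  set S : Set (L2 Ω) := {u | ∃ (φ : E d → ℝ) (h : IsTestFun Ω φ), u = h.toL2 ∧ ‖h.gradL2‖ ≤ K + 1}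
  have hsub : {u : L2 Ω | u ∈ H10 Ω ∧ ‖wgrad u‖ ≤ K} ⊆ closure S := by
    rintro u ⟨hu, huK⟩
    obtain ⟨φ, h, h1, h2⟩ := exists_seq_testFun hΩo hu
    refine mem_closure_of_tendsto h1 ?_
    filter_upwards [h2.norm.eventually_lt_const (show ‖wgrad u‖ < K + 1 by linarith)] with n hn
    exact ⟨φ n, h n, rfl, hn.le⟩
  refine TotallyBounded.subset hsub (TotallyBounded.closure ?_)
  refine totallyBounded_of_finite_functionals ?_ ?_
  · refine (Metric.isBounded_iff_subset_closedBall 0).2 ⟨(2 * R + 1) * (K + 1), ?_⟩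
    rintro u ⟨φ, h, rfl, hK⟩
    rw [mem_closedBall_zero_iff]
    refine (h.norm_toL2_le hd hR hΩ).trans ?_
    gcongr
  · intro ε hε
    rcases lt_or_ge (K + 1) 0 with hK | hK
    · refine ⟨0, 0, 1, one_pos, ?_⟩
      rintro u ⟨φ, h, rfl, h'⟩
      exact absurd (h'.trans_lt hK) (not_lt.2 (norm_nonneg _))
    -- with this `δ` the gradient of a difference of two elements contributes at most `ε²`
    set δ := ε ^ 2 / (4 * (K + 1) ^ 2 + 1)
    obtain ⟨s, N, c, hc, hN⟩ := exists_cell_bound (ε := δ) hΩ (by positivity)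
    set T : L2 Ω →L[ℝ] (Fin N.card → ℝ) := ContinuousLinearMap.pi fun i =>
      cellIntegral s ((N.equivFin.symm i : N) : Fin d → ℤ)
    refine ⟨N.card, T, √(c * N.card) + 1, by positivity, ?_⟩
    rintro u ⟨φ, hφ, rfl, hφK⟩ v ⟨ψ, hψ, rfl, hψK⟩
    have hχ : IsTestFun Ω (φ + (-1 : ℝ) • ψ) := hφ.add (hψ.const_smul _)
    have e1 : hχ.toL2 = hφ.toL2 - hψ.toL2 := by
      simp only [IsTestFun.toL2]
      rw [MemLp.toLp_add hφ.memLp (hψ.const_smul _).memLp, MemLp.toLp_const_smul _ hψ.memLp]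
      simp [sub_eq_add_neg]
    have e2 : hχ.gradL2 = hφ.gradL2 - hψ.gradL2 := by
      rw [← hχ.wgrad_toL2 hΩo, e1, wgrad_sub hΩo hφ.mem_H10 hψ.mem_H10, hφ.wgrad_toL2 hΩo,
        hψ.wgrad_toL2 hΩo]
    have hg : ‖hχ.gradL2‖ ≤ 2 * (K + 1) := by
      rw [e2]
      exact (norm_sub_le _ _).trans (by linarith)
    have hb := hN _ hχ
    have hsum : ∑ n ∈ N, (cellIntegral s n hχ.toL2) ^ 2 ≤ N.card * ‖T hφ.toL2 - T hψ.toL2‖ ^ 2 := by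
      rw [← map_sub, ← e1, ← nsmul_eq_mul]
      refine Finset.sum_le_card_nsmul _ _ _ fun n hn => ?_
      have := norm_le_pi_norm (T hχ.toL2) (N.equivFin ⟨n, hn⟩)
      simp only [T, ContinuousLinearMap.coe_pi', Equiv.symm_apply_apply, Real.norm_eq_abs] at this
      rw [← sq_abs]
      gcongr
      exact this
    have hfinal : ‖hφ.toL2 - hψ.toL2‖ ^ 2 ≤ (√(c * N.card) * ‖T hφ.toL2 - T hψ.toL2‖ + ε) ^ 2 := by
      rw [← e1]
      have h1 : δ * ‖hχ.gradL2‖ ^ 2 ≤ ε ^ 2 := by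
        calc δ * ‖hχ.gradL2‖ ^ 2 ≤ δ * (2 * (K + 1)) ^ 2 := by gcongr
          _ ≤ ε ^ 2 := by
            rw [div_mul_eq_mul_div, div_le_iff₀ (by positivity)]
            nlinarith [sq_nonneg ε]
      have h2 : c * ∑ n ∈ N, (cellIntegral s n hχ.toL2) ^ 2
          ≤ (√(c * N.card) * ‖T hφ.toL2 - T hψ.toL2‖) ^ 2 := by
        rw [mul_pow, Real.sq_sqrt (by positivity), mul_assoc]
        gcongr
      have h3 : 0 ≤ √(c * N.card) * ‖T hφ.toL2 - T hψ.toL2‖ * ε := by positivity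
      nlinarith
    have := le_of_sq_le_sq hfinal (by positivity)
    linarith [norm_nonneg (T hφ.toL2 - T hψ.toL2)]

end

section

/-! ### Eigenvalue problems for symmetric forms -/

section Form
variable {H : Type*} [NormedAddCommGroup H] [InnerProductSpace ℝ H]

/-- `a` is a symmetric positive definite bilinear form on the subspace `W`. -/
structure FormOn (W : Submodule ℝ H) (a : H → H → ℝ) : Prop where
  add_left : ∀ u ∈ W, ∀ v ∈ W, ∀ w ∈ W, a (u + v) w = a u w + a v w
  smul_left : ∀ (t : ℝ), ∀ u ∈ W, ∀ w ∈ W, a (t • u) w = t * a u w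
  symm : ∀ u ∈ W, ∀ v ∈ W, a u v = a v u
  pos : ∀ u ∈ W, u ≠ 0 → 0 < a u u

namespace FormOn
variable {W V : Submodule ℝ H} {a : H → H → ℝ}

theorem mono (h : FormOn W a) (hV : V ≤ W) : FormOn V a :=
  ⟨fun u hu v hv w hw => h.add_left u (hV hu) v (hV hv) w (hV hw),
    fun t u hu w hw => h.smul_left t u (hV hu) w (hV hw),
    fun u hu v hv => h.symm u (hV hu) v (hV hv), fun u hu => h.pos u (hV hu)⟩

theorem add_right (h : FormOn W a) {u v w : H} (hu : u ∈ W) (hv : v ∈ W) (hw : w ∈ W) :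
    a w (u + v) = a w u + a w v := by
  rw [h.symm w hw _ (W.add_mem hu hv), h.add_left u hu v hv w hw, h.symm u hu w hw,
    h.symm v hv w hw]

theorem smul_right (h : FormOn W a) (t : ℝ) {u w : H} (hu : u ∈ W) (hw : w ∈ W) :
    a w (t • u) = t * a w u := by
  rw [h.symm w hw _ (W.smul_mem t hu), h.smul_left t u hu w hw, h.symm u hu w hw]

theorem zero_left (h : FormOn W a) {w : H} (hw : w ∈ W) : a 0 w = 0 := by
  simpa using h.smul_left 0 0 W.zero_mem w hw

theorem sub_left (h : FormOn W a) {u v w : H} (hu : u ∈ W) (hv : v ∈ W) (hw : w ∈ W) :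
    a (u - v) w = a u w - a v w := by
  have := h.add_left u hu ((-1 : ℝ) • v) (W.smul_mem _ hv) w hw
  rw [h.smul_left _ v hv w hw] at this
  rw [sub_eq_add_neg, ← neg_one_smul ℝ v, this]
  ring

theorem sub_right (h : FormOn W a) {u v w : H} (hu : u ∈ W) (hv : v ∈ W) (hw : w ∈ W) :
    a w (u - v) = a w u - a w v := by
  rw [h.symm w hw _ (W.sub_mem hu hv), h.sub_left hu hv hw, h.symm u hu w hw, h.symm v hv w hw]

theorem sum_left (h : FormOn W a) {ι : Type*} (s : Finset ι) (c : ι → ℝ) {u : ι → H}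
    (hu : ∀ i, u i ∈ W) {w : H} (hw : w ∈ W) :
    a (∑ i ∈ s, c i • u i) w = ∑ i ∈ s, c i * a (u i) w := by
  classical
  induction s using Finset.induction_on with
  | empty => simpa using h.zero_left hw
  | insert i s hi ih =>
    rw [Finset.sum_insert hi, Finset.sum_insert hi, h.add_left _ (W.smul_mem _ (hu i)) _
      (W.sum_mem fun j _ => W.smul_mem _ (hu j)) w hw, h.smul_left _ _ (hu i) _ hw, ih]

theorem self_nonneg (h : FormOn W a) {u : H} (hu : u ∈ W) : 0 ≤ a u u := by
  by_cases h0 : u = 0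
  · rw [h0, h.zero_left W.zero_mem]
  · exact (h.pos u hu h0).le

theorem eq_zero_of_self_le (h : FormOn W a) {u : H} (hu : u ∈ W) (h0 : a u u ≤ 0) : u = 0 := by
  by_contra hne
  exact (h.pos u hu hne).not_ge h0

/-- The form as a bilinear map on the subspace. -/
def toBilin (h : FormOn W a) : LinearMap.BilinForm ℝ W :=
  LinearMap.mk₂ ℝ (fun u v : W => a u v)
    (fun u v w => h.add_left u u.2 v v.2 w w.2) (fun t u w => h.smul_left t u u.2 w w.2)
    (fun w u v => h.add_right u.2 v.2 w.2) (fun t w u => h.smul_right t u.2 w.2)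

@[simp] theorem toBilin_apply (h : FormOn W a) (u v : W) : h.toBilin u v = a u v := rfl

theorem cauchy_schwarz (h : FormOn W a) {u v : H} (hu : u ∈ W) (hv : v ∈ W) :
    a u v ≤ √(a u u) * √(a v v) := by
  have := LinearMap.BilinForm.apply_mul_apply_le_of_forall_zero_le h.toBilin
    (fun x => h.self_nonneg x.2) ⟨u, hu⟩ ⟨v, hv⟩
  simp only [toBilin_apply] at this
  rw [← Real.sqrt_mul (h.self_nonneg hu)]
  refine Real.le_sqrt_of_sq_le ?_
  rw [h.symm v hv u hu] at this
  nlinarith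

theorem sqrt_add_le (h : FormOn W a) {u v : H} (hu : u ∈ W) (hv : v ∈ W) :
    √(a (u + v) (u + v)) ≤ √(a u u) + √(a v v) := by
  refine Real.sqrt_le_left (by positivity) |>.2 ?_
  rw [h.add_left u hu v hv _ (W.add_mem hu hv), h.add_right hu hv hu, h.add_right hu hv hv,
    h.symm v hv u hu]
  have := h.cauchy_schwarz hu hv
  have h1 := Real.sq_sqrt (h.self_nonneg hu)
  have h2 := Real.sq_sqrt (h.self_nonneg hv)
  nlinarith

theorem self_smul (h : FormOn W a) (t : ℝ) {u : H} (hu : u ∈ W) :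
    a (t • u) (t • u) = t ^ 2 * a u u := by
  rw [h.smul_left t u hu _ (W.smul_mem t hu), h.smul_right t hu hu]
  ring

theorem sqrt_sum_le (h : FormOn W a) {ι : Type*} (s : Finset ι) (c : ι → ℝ) {u : ι → H}
    (hu : ∀ i, u i ∈ W) :
    √(a (∑ i ∈ s, c i • u i) (∑ i ∈ s, c i • u i)) ≤ ∑ i ∈ s, |c i| * √(a (u i) (u i)) := by
  classical
  induction s using Finset.induction_on with
  | empty => simp [h.zero_left W.zero_mem]
  | insert i s hi ih =>
    rw [Finset.sum_insert hi, Finset.sum_insert hi]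
    refine (h.sqrt_add_le (W.smul_mem _ (hu i)) (W.sum_mem fun j _ => W.smul_mem _ (hu j))).trans ?_
    refine add_le_add (le_of_eq ?_) ih
    rw [h.self_smul _ (hu i), Real.sqrt_mul (sq_nonneg _), Real.sqrt_sq_eq_abs]

end FormOn

/-- A finite orthonormal basis of `V` which consists of eigenvectors of the form `a` on `V`. -/
structure IsEigBasis (a : H → H → ℝ) (V : Submodule ℝ H) {ι : Type*} [Fintype ι] (e : ι → H)
    (μ : ι → ℝ) : Prop where
  orthonormal : Orthonormal ℝ e
  mem : ∀ i, e i ∈ V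
  complete : ∀ v ∈ V, v = ∑ i, inner ℝ (e i) v • e i
  eig : ∀ i, ∀ v ∈ V, a (e i) v = μ i * inner ℝ (e i) v

/-- The spectral theorem for a symmetric form on a finite-dimensional subspace. -/
theorem FormOn.exists_isEigBasis {V : Submodule ℝ H} [FiniteDimensional ℝ V] {a : H → H → ℝ}
    (h : FormOn V a) : ∃ (n : ℕ) (e : Fin n → H) (μ : Fin n → ℝ), IsEigBasis a V e μ := by
  have : CompleteSpace V := FiniteDimensional.complete ℝ V
  let T : V →ₗ[ℝ] V :=
    ((InnerProductSpace.toDual ℝ V).symm.toLinearEquiv.toLinearMap ∘ₗ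
      (LinearMap.toContinuousLinearMap (𝕜 := ℝ) (E := V) (F' := ℝ)).toLinearMap) ∘ₗ h.toBilin
  have hT : ∀ u v : V, inner ℝ (T u) v = a u v := fun u v => by
    simp [T]
  have hs : T.IsSymmetric := fun u v => by
    rw [hT, real_inner_comm, hT, h.symm u u.2 v v.2]
  let b := hs.eigenvectorBasis rfl
  refine ⟨Module.finrank ℝ V, fun i => (b i : H), fun i => hs.eigenvalues rfl i, ?_, ?_, ?_, ?_⟩
  · exact b.orthonormal.comp_linearIsometry V.subtypeₗᵢ
  · exact fun i => (b i).2
  · intro v hv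
    have := congrArg (Submodule.subtype V) (b.sum_repr' ⟨v, hv⟩)
    rw [map_sum] at this
    simpa using this.symm
  · intro i v hv
    rw [← hT (b i) ⟨v, hv⟩, hs.apply_eigenvectorBasis rfl i]
    simp [b, inner_smul_left]

namespace IsEigBasis
variable {a : H → H → ℝ} {V : Submodule ℝ H} {ι : Type*} [Fintype ι] {e : ι → H} {μ : ι → ℝ}

theorem form_eq (he : IsEigBasis a V e μ) (h : FormOn V a) {v w : H} (hv : v ∈ V) (hw : w ∈ V) :
    a v w = ∑ i, μ i * inner ℝ (e i) v * inner ℝ (e i) w := by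
  conv_lhs => rw [he.complete v hv]
  rw [h.sum_left _ _ he.mem hw]
  refine Finset.sum_congr rfl fun i _ => ?_
  rw [he.eig i w hw]
  ring

theorem norm_sq_eq (he : IsEigBasis a V e μ) {v : H} (hv : v ∈ V) :
    ‖v‖ ^ 2 = ∑ i, inner ℝ (e i) v ^ 2 := by
  rw [← real_inner_self_eq_norm_sq]
  conv_lhs => rw [he.complete v hv]
  rw [sum_inner]
  refine Finset.sum_congr rfl fun i _ => ?_
  rw [real_inner_smul_left, ← he.complete v hv]
  ring

theorem eigenvalue_pos (he : IsEigBasis a V e μ) (h : FormOn V a) (i : ι) : 0 < μ i := by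
  have h1 := h.pos (e i) (he.mem i) (he.orthonormal.ne_zero i)
  rw [he.eig i _ (he.mem i), real_inner_self_eq_norm_sq, he.orthonormal.1 i] at h1
  simpa using h1

end IsEigBasis

/-- An orthonormal family of eigenvectors extends to an orthonormal eigenbasis. -/
theorem FormOn.exists_isEigBasis_extending {V : Submodule ℝ H} [FiniteDimensional ℝ V]
    {a : H → H → ℝ} (h : FormOn V a) {κ : Type*} [Fintype κ] {u : κ → H} {ν : κ → ℝ}
    (ho : Orthonormal ℝ u) (hu : ∀ k, u k ∈ V)
    (he : ∀ k, ∀ v ∈ V, a (u k) v = ν k * inner ℝ (u k) v) :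
    ∃ (n : ℕ) (f : Fin n → H) (μ : Fin n → ℝ),
      IsEigBasis a V (Sum.elim u f) (Sum.elim ν μ) := by
  classical
  -- the orthogonal complement of the `u k` in `V` is invariant: diagonalize the form on it
  set Z : Submodule ℝ H := V ⊓ (Submodule.span ℝ (range u))ᗮ
  have hZV : Z ≤ V := inf_le_left
  have hZu : ∀ z ∈ Z, ∀ k, inner ℝ (u k) z = 0 := fun z hz k =>
    (Submodule.mem_orthogonal _ _).1 hz.2 _ (Submodule.subset_span ⟨k, rfl⟩)
  have : FiniteDimensional ℝ Z := Submodule.finiteDimensional_of_le hZV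
  obtain ⟨n, f, μ, hf⟩ := (h.mono hZV).exists_isEigBasis
  have hdec : ∀ v ∈ V, v - ∑ k, inner ℝ (u k) v • u k ∈ Z := by
    intro v hv
    refine ⟨V.sub_mem hv (V.sum_mem fun k _ => V.smul_mem _ (hu k)), ?_⟩
    rw [SetLike.mem_coe, Submodule.mem_orthogonal]
    intro x hx
    induction hx using Submodule.span_induction with
    | mem x hx =>
      obtain ⟨k, rfl⟩ := hx
      rw [inner_sub_right, ho.inner_right_fintype, sub_self]
    | zero => simp
    | add x y _ _ hx hy => rw [inner_add_left, hx, hy, add_zero]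
    | smul t x _ hx => rw [inner_smul_left, hx, mul_zero]
  have hfu : ∀ k i, inner ℝ (u k) (f i) = 0 := fun k i => hZu _ (hf.mem i) k
  have hfu' : ∀ k i, inner ℝ (f i) (u k) = 0 := fun k i => by rw [real_inner_comm, hfu]
  refine ⟨n, f, μ, ?_, ?_, ?_, ?_⟩
  · rw [orthonormal_iff_ite]
    rintro (k | i) (l | j)
    · simpa using orthonormal_iff_ite.1 ho k l
    · simpa using hfu k j
    · simpa [real_inner_comm] using hfu l i
    · simpa using orthonormal_iff_ite.1 hf.orthonormal i j
  · rintro (k | i)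
    · exact hu k
    · exact hZV (hf.mem i)
  · intro v hv
    rw [Fintype.sum_sum_type]
    simp only [Sum.elim_inl, Sum.elim_inr]
    have h1 := hf.complete _ (hdec v hv)
    have h2 : ∀ i, inner ℝ (f i) (v - ∑ k, inner ℝ (u k) v • u k) = inner ℝ (f i) v := by
      intro i
      rw [inner_sub_right, inner_sum, Finset.sum_eq_zero, sub_zero]
      intro k _
      rw [inner_smul_right, hfu', mul_zero]
    simp only [h2] at h1
    rw [← h1]
    abel
  · rintro (k | i) v hv
    · exact he k v hv
    · have hsplit : v = (v - ∑ k, inner ℝ (u k) v • u k) + ∑ k, inner ℝ (u k) v • u k := by abel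
      have hsum : ∑ k, inner ℝ (u k) v • u k ∈ V := V.sum_mem fun k _ => V.smul_mem _ (hu k)
      have hz0 : a (f i) (∑ k, inner ℝ (u k) v • u k) = 0 := by
        rw [h.symm _ (hZV (hf.mem i)) _ hsum, h.sum_left _ _ hu (hZV (hf.mem i))]
        refine Finset.sum_eq_zero fun k _ => ?_
        rw [he k _ (hZV (hf.mem i)), hfu, mul_zero, mul_zero]
      have hi0 : inner ℝ (f i) (∑ k, inner ℝ (u k) v • u k) = 0 := by
        rw [inner_sum]
        refine Finset.sum_eq_zero fun k _ => ?_
        rw [inner_smul_right, hfu', mul_zero]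
      simp only [Sum.elim_inr]
      rw [hsplit, h.add_right (hZV (hdec v hv)) hsum (hZV (hf.mem i)), hz0, inner_add_right, hi0,
        add_zero, add_zero, hf.eig i _ (hdec v hv)]

/-- Fewer linear conditions than vectors: a nontrivial combination satisfies all of them. -/
theorem exists_combination_orthogonal {J K : Type*} [Fintype J] [Fintype K]
    (hJK : Fintype.card J < Fintype.card K) (x : J → H) (y : K → H) :
    ∃ c : K → ℝ, c ≠ 0 ∧ ∀ j, inner ℝ (x j) (∑ k, c k • y k) = 0 := by
  let L : (K → ℝ) →ₗ[ℝ] (J → ℝ) := LinearMap.pi fun j =>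
    (innerₛₗ ℝ (x j)) ∘ₗ (Fintype.linearCombination ℝ y)
  have hk : LinearMap.ker L ≠ ⊥ := LinearMap.ker_ne_bot_of_finrank_lt (by simpa using hJK)
  obtain ⟨c, hc, hc0⟩ := Submodule.exists_mem_ne_zero_of_ne_bot hk
  refine ⟨c, hc0, fun j => ?_⟩
  have := congrFun (LinearMap.mem_ker.1 hc) j
  simpa [L, Fintype.linearCombination_apply] using this

theorem Orthonormal.norm_sq_sum {K : Type*} [Fintype K] {y : K → H} (hy : Orthonormal ℝ y)
    (c : K → ℝ) : ‖∑ k, c k • y k‖ ^ 2 = ∑ k, c k ^ 2 := by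
  rw [← real_inner_self_eq_norm_sq, hy.inner_sum]
  simp [sq]

/-- The form on the span of an orthonormal family of eigenvectors. -/
theorem FormOn.self_sum_eig {V : Submodule ℝ H} {a : H → H → ℝ} (h : FormOn V a)
    {K : Type*} [Fintype K] {y : K → H} (hy : Orthonormal ℝ y) (hyV : ∀ k, y k ∈ V) {ν : K → ℝ}
    (he : ∀ k, ∀ v ∈ V, a (y k) v = ν k * inner ℝ (y k) v) (c : K → ℝ) :
    a (∑ k, c k • y k) (∑ k, c k • y k) = ∑ k, ν k * c k ^ 2 := by
  have hs : ∑ k, c k • y k ∈ V := V.sum_mem fun k _ => V.smul_mem _ (hyV k)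
  rw [h.sum_left _ _ hyV hs]
  refine Finset.sum_congr rfl fun k _ => ?_
  rw [he k _ hs, hy.inner_right_fintype]
  ring

theorem sum_sq_pos_of_ne_zero {K : Type*} [Fintype K] {c : K → ℝ} (hc : c ≠ 0) :
    0 < ∑ k, c k ^ 2 := by
  obtain ⟨k, hk⟩ := Function.ne_iff.1 hc
  exact Finset.sum_pos' (fun _ _ => sq_nonneg _) ⟨k, Finset.mem_univ k, by
    have : c k ≠ 0 := hk
    positivity⟩

/-- Lower bound for discrete eigenvalues: if `a ≥ β b` on the functions orthogonal to `x`, then a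
family of more discrete eigenvectors than there are conditions cannot have all eigenvalues below
`β`. -/
theorem FormOn.le_of_eigenvalues_le {V W : Submodule ℝ H} {a : H → H → ℝ} (h : FormOn W a)
    (hVW : V ≤ W) {J K : Type*} [Fintype J] [Fintype K] (hJK : Fintype.card J < Fintype.card K)
    {x : J → H} {β : ℝ} (hβ : ∀ v ∈ W, (∀ j, inner ℝ (x j) v = 0) → β * ‖v‖ ^ 2 ≤ a v v)
    {y : K → H} (hy : Orthonormal ℝ y) (hyV : ∀ k, y k ∈ V) {ν : K → ℝ}
    (he : ∀ k, ∀ v ∈ V, a (y k) v = ν k * inner ℝ (y k) v) {μ : ℝ} (hν : ∀ k, ν k ≤ μ) :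
    β ≤ μ := by
  obtain ⟨c, hc, hx⟩ := exists_combination_orthogonal hJK x y
  have h1 := hβ _ (W.sum_mem fun k _ => W.smul_mem _ (hVW (hyV k))) hx
  rw [Orthonormal.norm_sq_sum hy, (h.mono hVW).self_sum_eig hy hyV he] at h1
  have h2 : ∑ k, ν k * c k ^ 2 ≤ μ * ∑ k, c k ^ 2 := by
    rw [Finset.mul_sum]
    exact Finset.sum_le_sum fun k _ => mul_le_mul_of_nonneg_right (hν k) (sq_nonneg _)
  exact le_of_mul_le_mul_right (h1.trans h2) (sum_sq_pos_of_ne_zero hc)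

/-- Upper bound for discrete eigenvalues by means of approximations `v k ∈ V` of exact
eigenvectors `u k`. All eigenvectors `e i` of the discrete problem with eigenvalue below `Λ` are
among the `x j`, of which there are fewer than approximations. -/
theorem FormOn.sqrt_eigenvalue_le {V W : Submodule ℝ H} {a : H → H → ℝ} (h : FormOn W a)
    (hVW : V ≤ W) {J K ι : Type*} [Fintype J] [Fintype K] [Fintype ι]
    (hJK : Fintype.card J < Fintype.card K) {e : ι → H} {μ : ι → ℝ} (he : IsEigBasis a V e μ)
    {x : J → H} {Λ : ℝ} (hΛ : 0 ≤ Λ) (hx : ∀ i, (∃ j, x j = e i) ∨ Λ ≤ μ i)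
    {u : K → H} (hu : Orthonormal ℝ u) (huW : ∀ k, u k ∈ W) {ν : K → ℝ}
    (hue : ∀ k, ∀ v ∈ W, a (u k) v = ν k * inner ℝ (u k) v) {ν₀ : ℝ} (hν₀ : 0 ≤ ν₀)
    (hν : ∀ k, ν k ≤ ν₀)
    {v : K → H} (hvV : ∀ k, v k ∈ V) {ε : ℝ} (hv : ∀ k, ‖v k - u k‖ ≤ ε)
    (hva : ∀ k, √(a (v k - u k) (v k - u k)) ≤ ε) (hε : 0 ≤ ε) :
    √Λ * (1 - Fintype.card K * ε) ≤ √ν₀ + Fintype.card K * ε := by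
  -- a combination `z` of the approximations without components along the `x j`: its Rayleigh
  -- quotient is at least `Λ`, and up to the approximation error at most `ν₀`
  obtain ⟨c, hc, hxc⟩ := exists_combination_orthogonal hJK x v
  set z := ∑ k, c k • v k with hz
  have hzV : z ∈ V := V.sum_mem fun k _ => V.smul_mem _ (hvV k)
  set S := √(∑ k, c k ^ 2) with hS
  have hSpos : 0 < S := Real.sqrt_pos.2 (sum_sq_pos_of_ne_zero hc)
  have hcS : ∀ k, |c k| ≤ S := fun k =>
    Real.abs_le_sqrt (Finset.single_le_sum (f := fun k => c k ^ 2) (fun _ _ => sq_nonneg _)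
      (Finset.mem_univ k))
  have hcsum : ∑ k, |c k| * ε ≤ Fintype.card K * ε * S := by
    calc ∑ k, |c k| * ε ≤ ∑ _k : K, S * ε :=
          Finset.sum_le_sum fun k _ => mul_le_mul_of_nonneg_right (hcS k) hε
      _ = _ := by simp; ring
  have hsplit : z = ∑ k, c k • u k + ∑ k, c k • (v k - u k) := by
    rw [← Finset.sum_add_distrib]
    refine Finset.sum_congr rfl fun k _ => ?_
    rw [← smul_add, add_sub_cancel]
  have hn1 : ‖∑ k, c k • u k‖ = S := by
    rw [hS, ← Orthonormal.norm_sq_sum hu, Real.sqrt_sq (norm_nonneg _)]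
  have hn2 : ‖∑ k, c k • (v k - u k)‖ ≤ Fintype.card K * ε * S := by
    refine (norm_sum_le _ _).trans (le_trans (Finset.sum_le_sum fun k _ => ?_) hcsum)
    rw [norm_smul, Real.norm_eq_abs]
    gcongr
    exact hv k
  have hd : ∀ k, v k - u k ∈ W := fun k => W.sub_mem (hVW (hvV k)) (huW k)
  have ha1 : √(a (∑ k, c k • u k) (∑ k, c k • u k)) ≤ √ν₀ * S := by
    rw [h.self_sum_eig hu huW hue, hS, ← Real.sqrt_mul hν₀, Finset.mul_sum]
    exact Real.sqrt_le_sqrt (Finset.sum_le_sum fun k _ =>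
      mul_le_mul_of_nonneg_right (hν k) (sq_nonneg _))
  have ha2 : √(a (∑ k, c k • (v k - u k)) (∑ k, c k • (v k - u k))) ≤ Fintype.card K * ε * S := by
    refine (h.sqrt_sum_le _ c hd).trans (le_trans (Finset.sum_le_sum fun k _ => ?_) hcsum)
    gcongr
    exact hva k
  have hza : √(a z z) ≤ (√ν₀ + Fintype.card K * ε) * S := by
    rw [hsplit, add_mul]
    exact (h.sqrt_add_le (W.sum_mem fun k _ => W.smul_mem _ (huW k))
      (W.sum_mem fun k _ => W.smul_mem _ (hd k))).trans (add_le_add ha1 ha2)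
  have hzn : (1 - Fintype.card K * ε) * S ≤ ‖z‖ := by
    have := norm_sub_le z (∑ k, c k • (v k - u k))
    rw [hsplit, add_sub_cancel_right, hn1, ← hsplit] at this
    linarith
  have hzΛ : √Λ * ‖z‖ ≤ √(a z z) := by
    rw [← Real.sqrt_sq (norm_nonneg z), ← Real.sqrt_mul hΛ]
    refine Real.sqrt_le_sqrt ?_
    rw [he.norm_sq_eq hzV, he.form_eq (h.mono hVW) hzV hzV, Finset.mul_sum]
    refine Finset.sum_le_sum fun i _ => ?_
    rcases hx i with ⟨j, hj⟩ | hi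
    · have : inner ℝ (e i) z = 0 := by rw [← hj]; exact hxc j
      simp [this]
    · rw [mul_assoc, ← sq]
      exact mul_le_mul_of_nonneg_right hi (sq_nonneg _)
  have : √Λ * (1 - Fintype.card K * ε) * S ≤ (√ν₀ + Fintype.card K * ε) * S := by
    calc √Λ * (1 - Fintype.card K * ε) * S = √Λ * ((1 - Fintype.card K * ε) * S) := by ring
      _ ≤ √Λ * ‖z‖ := by gcongr
      _ ≤ _ := hzΛ.trans hza
  exact le_of_mul_le_mul_right this hSpos

/-- The `a`-orthogonal projection is the best approximation in the energy norm. -/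
theorem FormOn.self_sub_projection_le {W : Submodule ℝ H} {a : H → H → ℝ} (h : FormOn W a)
    {Y : Submodule ℝ H} (hYW : Y ≤ W) {w p v : H} (hw : w ∈ W) (hp : p ∈ Y) (hv : v ∈ Y)
    (h1 : ∀ v ∈ Y, a (w - p) v = 0) : a (w - p) (w - p) ≤ a (w - v) (w - v) := by
  have hd : p - v ∈ Y := Y.sub_mem hp hv
  have hwp : w - p ∈ W := W.sub_mem hw (hYW hp)
  have e : w - v = (w - p) + (p - v) := by abel
  rw [e, h.add_left _ hwp _ (hYW hd) _ (W.add_mem hwp (hYW hd)), h.add_right hwp (hYW hd) hwp,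
    h.add_right hwp (hYW hd) (hYW hd), h1 _ hd, h.symm _ (hYW hd) _ hwp, h1 _ hd]
  linarith [h.self_nonneg (hYW hd)]

end Form

end

section

/-! ### Existence of eigenvectors by minimization -/

section Minimization
variable {H : Type*} [NormedAddCommGroup H] [InnerProductSpace ℝ H]

/-- The energy space is compactly embedded and complete: this is all that is used of `H^1_0` to
solve eigenvalue problems. -/
structure FormOn.IsCompactEnergy (W : Submodule ℝ H) (a : H → H → ℝ) : Prop where
  compact : ∀ K : ℝ, TotallyBounded {u : H | u ∈ W ∧ a u u ≤ K}
  complete : ∀ (u : ℕ → H) (v : H), (∀ n, u n ∈ W) → Tendsto u atTop (𝓝 v) →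
    (∀ ε > 0, ∃ N, ∀ n ≥ N, ∀ m ≥ N, a (u n - u m) (u n - u m) < ε) →
    v ∈ W ∧ Tendsto (fun n => a (u n - v) (u n - v)) atTop (𝓝 0)

variable {W : Submodule ℝ H} {a : H → H → ℝ}

theorem FormOn.parallelogram (h : FormOn W a) {u v : H} (hu : u ∈ W) (hv : v ∈ W) :
    a (u - v) (u - v) = 2 * a u u + 2 * a v v - a (u + v) (u + v) := by
  rw [h.sub_left hu hv (W.sub_mem hu hv), h.sub_right hu hv hu, h.sub_right hu hv hv,
    h.add_left u hu v hv _ (W.add_mem hu hv), h.add_right hu hv hu, h.add_right hu hv hv]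
  ring

/-- The Rayleigh quotient attains its minimum on closed subspaces. A minimizing sequence
converges in `H` by compactness, and then in energy by the parallelogram identity. -/
theorem FormOn.exists_minimizer [CompleteSpace H] (h : FormOn W a) (hc : FormOn.IsCompactEnergy W a)
    {Z : Submodule ℝ H} (hZ : IsClosed (Z : Set H)) (hne : ∃ v ∈ W, v ∈ Z ∧ v ≠ 0) :
    ∃ w ∈ W, w ∈ Z ∧ ‖w‖ = 1 ∧ ∀ v ∈ W, v ∈ Z → a w w * ‖v‖ ^ 2 ≤ a v v := by
  set S : Set ℝ := {t | ∃ v ∈ W, v ∈ Z ∧ ‖v‖ = 1 ∧ t = a v v} with hS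
  have hnorm : ∀ v ∈ W, v ∈ Z → v ≠ 0 → a (‖v‖⁻¹ • v) (‖v‖⁻¹ • v) ∈ S := fun v hv hvZ h0 =>
    ⟨‖v‖⁻¹ • v, W.smul_mem _ hv, Z.smul_mem _ hvZ, by
      rw [norm_smul, norm_inv, norm_norm, inv_mul_cancel₀ (norm_ne_zero_iff.2 h0)], rfl⟩
  have hSne : S.Nonempty := by
    obtain ⟨v, hv, hvZ, h0⟩ := hne
    exact ⟨_, hnorm v hv hvZ h0⟩
  have hSb : BddBelow S := ⟨0, by rintro t ⟨v, hv, -, -, rfl⟩; exact h.self_nonneg hv⟩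
  set μ := sInf S with hμ
  have hμ0 : 0 ≤ μ := le_csInf hSne (by rintro t ⟨v, hv, -, -, rfl⟩; exact h.self_nonneg hv)
  have hmin : ∀ v ∈ W, v ∈ Z → μ * ‖v‖ ^ 2 ≤ a v v := by
    intro v hv hvZ
    by_cases h0 : v = 0
    · simp [h0, h.zero_left W.zero_mem]
    · have := csInf_le hSb (hnorm v hv hvZ h0)
      rw [h.self_smul _ hv, inv_pow, inv_mul_eq_div, le_div_iff₀ (by positivity)] at this
      exact this
  have hex : ∀ n : ℕ, ∃ v ∈ W, v ∈ Z ∧ ‖v‖ = 1 ∧ a v v < μ + 1 / ((n : ℝ) + 1) := by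
    intro n
    obtain ⟨t, ⟨v, hv, hvZ, h1, rfl⟩, ht⟩ := exists_lt_of_csInf_lt hSne
      (show sInf S < μ + 1 / ((n : ℝ) + 1) from lt_add_of_pos_right _ (by positivity))
    exact ⟨v, hv, hvZ, h1, ht⟩
  choose v hvW hvZ hv1 hva using hex
  have hcpt : IsCompact (closure {u : H | u ∈ W ∧ a u u ≤ μ + 1}) :=
    (hc.compact (μ + 1)).closure.isCompact_of_isClosed isClosed_closure
  have hmem : ∀ n, v n ∈ closure {u : H | u ∈ W ∧ a u u ≤ μ + 1} := fun n =>
    subset_closure ⟨hvW n, (hva n).le.trans (by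
      have : 1 / ((n : ℝ) + 1) ≤ 1 := by
        rw [div_le_one (by positivity)]
        linarith [(Nat.cast_nonneg n : (0 : ℝ) ≤ n)]
      linarith)⟩
  -- compactness gives convergence in `H`; the parallelogram identity then makes the subsequence a
  -- Cauchy sequence in energy
  obtain ⟨w, -, φ, hφ, hlim⟩ := hcpt.tendsto_subseq hmem
  have hε : Tendsto (fun n : ℕ => 1 / ((φ n : ℝ) + 1)) atTop (𝓝 0) :=
    tendsto_one_div_add_atTop_nhds_zero_nat.comp hφ.tendsto_atTop
  have hcauchy : ∀ ε > 0, ∃ N, ∀ n ≥ N, ∀ m ≥ N,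
      a (v (φ n) - v (φ m)) (v (φ n) - v (φ m)) < ε := by
    intro ε hεpos
    obtain ⟨N₁, hN₁⟩ := eventually_atTop.1 (hε.eventually_lt_const (show (0 : ℝ) < ε / 8 by positivity))
    obtain ⟨N₂, hN₂⟩ := Metric.cauchySeq_iff.1 hlim.cauchySeq (√(ε / (2 * (μ + 1)))) (by positivity)
    refine ⟨max N₁ N₂, fun n hn m hm => ?_⟩
    have h1 := hN₁ n (le_of_max_le_left hn)
    have h2 := hN₁ m (le_of_max_le_left hm)
    have h3 := hN₂ n (le_of_max_le_right hn) m (le_of_max_le_right hm)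
    rw [dist_eq_norm, Real.lt_sqrt (norm_nonneg _), lt_div_iff₀ (by positivity)] at h3
    have h4 := hmin _ (W.add_mem (hvW (φ n)) (hvW (φ m))) (Z.add_mem (hvZ (φ n)) (hvZ (φ m)))
    have h5 := parallelogram_law_with_norm ℝ (v (φ n)) (v (φ m))
    rw [hv1, hv1] at h5
    rw [h.parallelogram (hvW _) (hvW _)]
    simp only [Function.comp_apply] at h3
    have h6 := hva (φ n)
    have h7 := hva (φ m)
    nlinarith [norm_nonneg (v (φ n) - v (φ m))]
  obtain ⟨hwW, hwa⟩ := hc.complete (fun n => v (φ n)) w (fun n => hvW _) hlim hcauchy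
  have hwZ : w ∈ Z := hZ.mem_of_tendsto hlim (Eventually.of_forall fun n => hvZ _)
  have hw1 : ‖w‖ = 1 := by
    refine tendsto_nhds_unique hlim.norm ?_
    simp [hv1]
  have hwμ : a w w ≤ μ := by
    have h1 : √(a w w) ≤ √μ := by
      have hlim2 : Tendsto (fun n => √(μ + 1 / ((φ n : ℝ) + 1)) +
          √(a (v (φ n) - w) (v (φ n) - w))) atTop (𝓝 (√(μ + 0) + √0)) :=
        ((hε.const_add μ).sqrt).add hwa.sqrt
      rw [add_zero, Real.sqrt_zero, add_zero] at hlim2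
      refine ge_of_tendsto' hlim2 fun n => ?_
      have := h.sqrt_add_le (hvW (φ n)) (W.sub_mem hwW (hvW (φ n)))
      rw [add_sub_cancel] at this
      have e : a (w - v (φ n)) (w - v (φ n)) = a (v (φ n) - w) (v (φ n) - w) := by
        rw [← neg_sub, ← neg_one_smul ℝ, h.self_smul _ (W.sub_mem (hvW _) hwW)]
        ring
      rw [e] at this
      exact this.trans (add_le_add_left (Real.sqrt_le_sqrt (hva _).le) _)
    exact (Real.sqrt_le_sqrt_iff hμ0).1 h1
  refine ⟨w, hwW, hwZ, hw1, fun u hu huZ => le_trans ?_ (hmin u hu huZ)⟩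
  exact mul_le_mul_of_nonneg_right hwμ (sq_nonneg _)

/-- The next eigenvector: on the orthogonal complement of finitely many eigenvectors the
Rayleigh quotient is minimized by an eigenvector. -/
theorem FormOn.exists_next_eigenvector [CompleteSpace H] (h : FormOn W a)
    (hc : FormOn.IsCompactEnergy W a)
    {J : Type*} [Fintype J] {x : J → H} {ν : J → ℝ} (hx : Orthonormal ℝ x) (hxW : ∀ j, x j ∈ W)
    (he : ∀ j, ∀ v ∈ W, a (x j) v = ν j * inner ℝ (x j) v)
    (hne : ∃ v ∈ W, v ≠ 0 ∧ ∀ j, inner ℝ (x j) v = 0) :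
    ∃ w ∈ W, ∃ μ : ℝ, ‖w‖ = 1 ∧ (∀ j, inner ℝ (x j) w = 0) ∧
      (∀ v ∈ W, a w v = μ * inner ℝ w v) ∧
      ∀ v ∈ W, (∀ j, inner ℝ (x j) v = 0) → μ * ‖v‖ ^ 2 ≤ a v v := by
  set Z : Submodule ℝ H := (Submodule.span ℝ (range x))ᗮ
  have hZ : ∀ v, v ∈ Z ↔ ∀ j, inner ℝ (x j) v = 0 := by
    intro v
    rw [Submodule.mem_orthogonal]
    constructor
    · exact fun hv j => hv _ (Submodule.subset_span ⟨j, rfl⟩)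
    · intro hv y hy
      induction hy using Submodule.span_induction with
      | mem y hy => obtain ⟨j, rfl⟩ := hy; exact hv j
      | zero => simp
      | add y z _ _ hy hz => rw [inner_add_left, hy, hz, add_zero]
      | smul t y _ hy => rw [inner_smul_left, hy, mul_zero]
  obtain ⟨w, hwW, hwZ, hw1, hmin⟩ := h.exists_minimizer hc (Submodule.isClosed_orthogonal _)
    (by
      obtain ⟨v, hv, h0, hv'⟩ := hne
      exact ⟨v, hv, (hZ v).2 hv', h0⟩ : ∃ v ∈ W, v ∈ Z ∧ v ≠ 0)
  have hwx := (hZ w).1 hwZ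
  refine ⟨w, hwW, a w w, hw1, hwx, ?_, fun v hv hvx => hmin v hv ((hZ v).2 hvx)⟩
  -- first order condition on `W ∩ Z`: the form `a - a(w,w) b` is nonnegative there and vanishes at
  -- `w`, so by the Cauchy–Schwarz inequality `w` is in its kernel
  have hfirst : ∀ v ∈ W, v ∈ Z → a w v = a w w * inner ℝ w v := by
    intro v hv hvZ
    let B : LinearMap.BilinForm ℝ (W ⊓ Z : Submodule ℝ H) :=
      (h.mono (inf_le_left : W ⊓ Z ≤ W)).toBilin - a w w • innerₗ _
    have hB : ∀ y z : (W ⊓ Z : Submodule ℝ H), B y z = a y z - a w w * inner ℝ (y : H) (z : H) :=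
      fun y z => by simp [B]
    have := LinearMap.BilinForm.apply_mul_apply_le_of_forall_zero_le B (fun y => by
      rw [hB, real_inner_self_eq_norm_sq, sub_nonneg]
      exact hmin _ y.2.1 y.2.2) ⟨w, hwW, hwZ⟩ ⟨v, hv, hvZ⟩
    rw [hB, hB, hB, hB] at this
    simp only [real_inner_self_eq_norm_sq, hw1] at this
    rw [h.symm v hv w hwW, real_inner_comm w v] at this
    have h0 : (a w v - a w w * inner ℝ w v) ^ 2 ≤ 0 := by
      nlinarith
    have := pow_eq_zero_iff (two_ne_zero) |>.1 (le_antisymm h0 (sq_nonneg _))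
    linarith
  intro v hv
  have hsum : ∑ j, inner ℝ (x j) v • x j ∈ W := W.sum_mem fun j _ => W.smul_mem _ (hxW j)
  have hvd : v - ∑ j, inner ℝ (x j) v • x j ∈ W := W.sub_mem hv hsum
  have hvZ : v - ∑ j, inner ℝ (x j) v • x j ∈ Z := by
    rw [hZ]
    intro j
    rw [inner_sub_right, hx.inner_right_fintype, sub_self]
  have h1 := hfirst _ hvd hvZ
  have h2 : a w (∑ j, inner ℝ (x j) v • x j) = 0 := by
    rw [h.symm _ hwW _ hsum, h.sum_left _ _ hxW hwW]
    refine Finset.sum_eq_zero fun j _ => ?_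
    rw [he j _ hwW, hwx, mul_zero, mul_zero]
  have h3 : inner ℝ w (∑ j, inner ℝ (x j) v • x j) = 0 := by
    rw [inner_sum]
    refine Finset.sum_eq_zero fun j _ => ?_
    rw [inner_smul_right, (real_inner_comm (x j) w).trans (hwx j), mul_zero]
  rw [h.sub_right hv hsum hwW, h2, inner_sub_right, h3, sub_zero, sub_zero] at h1
  exact h1

end Minimization

/-! ### The energy form -/

variable {d : ℕ}

theorem IsPolygonalDomain.exists_subset_closedBall {Ω : Set (E d)} (h : IsPolygonalDomain Ω) :
    ∃ R : ℝ, 0 ≤ R ∧ Ω ⊆ Metric.closedBall 0 R := by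
  obtain ⟨-, -, S, -, rfl⟩ := h
  have hb : Bornology.IsBounded (⋃ T ∈ S, hull T : Set (E d)) := by
    rw [Bornology.isBounded_biUnion_finset]
    exact fun T _ => (T.finite_toSet.isCompact_convexHull (𝕜 := ℝ)).isBounded
  obtain ⟨R, hR⟩ := (hb.subset interior_subset).subset_closedBall (0 : E d)
  exact ⟨max R 0, le_max_right _ _, hR.trans (Metric.closedBall_subset_closedBall (le_max_left _ _))⟩

namespace ModelProblem
variable (P : ModelProblem d)

theorem isOpen : IsOpen P.Ω := P.polygonal.1

theorem isFiniteMeasure : IsFiniteMeasure ((volume : Measure (E d)).restrict P.Ω) := by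
  obtain ⟨R, -, hR⟩ := P.polygonal.exists_subset_closedBall
  exact ⟨by simpa using (Metric.isBounded_closedBall.subset hR).measure_lt_top⟩

theorem exists_bound_coeff : ∃ C : ℝ, 0 ≤ C ∧ ∀ s, ∀ x ∈ P.piece s, ∀ i j, |P.A x i j| ≤ C := by
  obtain ⟨R, hR, hΩ⟩ := P.polygonal.exists_subset_closedBall
  have : ∀ s, ∃ C : ℝ, 0 ≤ C ∧ ∀ x ∈ P.piece s, ∀ i j, |P.A x i j| ≤ C := by
    intro s
    obtain ⟨L, hL⟩ := P.lipschitz s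
    rcases (P.piece s).eq_empty_or_nonempty with he | ⟨y, hy⟩
    · exact ⟨0, le_rfl, by simp [he]⟩
    refine ⟨∑ i, ∑ j, |P.A y i j| + L * (2 * R), by positivity, fun x hx i j => ?_⟩
    have h1 := (hL i j).dist_le_mul x hx y hy
    have h2 : dist x y ≤ 2 * R := by
      have a1 := hΩ (P.piece_subset s hx)
      have a2 := hΩ (P.piece_subset s hy)
      rw [Metric.mem_closedBall] at a1 a2
      linarith [dist_triangle_right x y 0]
    have h3 : |P.A y i j| ≤ ∑ i, ∑ j, |P.A y i j| :=
      (Finset.single_le_sum (f := fun j => |P.A y i j|) (fun _ _ => abs_nonneg _)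
        (Finset.mem_univ j)).trans
        (Finset.single_le_sum (f := fun i => ∑ j, |P.A y i j|)
          (fun _ _ => Finset.sum_nonneg fun _ _ => abs_nonneg _) (Finset.mem_univ i))
    rw [Real.dist_eq] at h1
    have h4 : (L : ℝ) * dist x y ≤ L * (2 * R) := by gcongr
    have h5 := abs_sub_abs_le_abs_sub (P.A x i j) (P.A y i j)
    linarith
  choose C hC0 hC using this
  refine ⟨∑ s, C s, Finset.sum_nonneg fun s _ => hC0 s, fun s x hx i j => ?_⟩
  exact (hC s x hx i j).trans (Finset.single_le_sum (f := C) (fun s _ => hC0 s) (Finset.mem_univ s))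

theorem ae_mem_piece : ∀ᵐ x ∂(volume.restrict P.Ω), ∃ s, x ∈ P.piece s := by
  rw [ae_restrict_iff' P.isOpen.measurableSet, ae_iff]
  refine measure_mono_null (fun x hx => ?_) P.piece_cover
  simpa using hx

theorem aestronglyMeasurable_coeff (i j : Fin d) :
    AEStronglyMeasurable (fun x => P.A x i j) (volume.restrict P.Ω) := by
  have h1 : ∀ s, AEStronglyMeasurable (fun x => P.A x i j) (volume.restrict (P.piece s)) := by
    intro s
    obtain ⟨L, hL⟩ := P.lipschitz s
    exact (hL i j).continuousOn.aestronglyMeasurable (P.piece_open s).measurableSet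
  have h2 := aestronglyMeasurable_iUnion_iff.2 h1
  refine h2.mono_ac ?_
  have : P.Ω ≤ᵐ[volume] (⋃ s, P.piece s : Set (E d)) := by
    have := P.piece_cover
    rwa [← ae_le_set] at this
  exact (Measure.restrict_mono_ae this).absolutelyContinuous

theorem integrable_mul_component (F G : L2Vec P.Ω) (i j : Fin d) :
    Integrable (fun x => G x j * F x i) (volume.restrict P.Ω) := by
  have h : ∀ (F : L2Vec P.Ω) i, MemLp (fun x => F x i) 2 (volume.restrict P.Ω) := fun F i =>
    (EuclideanSpace.proj i : E d →L[ℝ] ℝ).comp_memLp' (Lp.memLp F)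
  exact (h G j).integrable_mul (h F i)

theorem integrable_energy (F G : L2Vec P.Ω) :
    Integrable (fun x => (P.A x).mulVec (F x).ofLp ⬝ᵥ (G x).ofLp) (volume.restrict P.Ω) := by
  obtain ⟨C, hC0, hC⟩ := P.exists_bound_coeff
  simp only [dotProduct, Matrix.mulVec, Finset.sum_mul]
  refine integrable_finsetSum _ fun i _ => integrable_finsetSum _ fun j _ => ?_
  simp only [mul_assoc]
  refine (P.integrable_mul_component G F i j).bdd_mul (P.aestronglyMeasurable_coeff i j) (c := C) ?_
  filter_upwards [P.ae_mem_piece] with x ⟨s, hs⟩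
  exact hC s x hs i j

theorem exists_essBound_c : ∃ C : ℝ, 0 ≤ C ∧ ∀ᵐ x ∂(volume.restrict P.Ω), |P.c x| ≤ C := by
  refine ⟨(eLpNormEssSup P.c (volume.restrict P.Ω)).toReal, ENNReal.toReal_nonneg, ?_⟩
  filter_upwards [ae_le_eLpNormEssSup (f := P.c) (μ := volume.restrict P.Ω)] with x hx
  have htop : eLpNormEssSup P.c (volume.restrict P.Ω) ≠ ⊤ := by
    have := P.c_bounded.2
    rw [eLpNorm_exponent_top] at this
    exact this.ne
  exact (toReal_enorm (P.c x)).symm.le.trans (ENNReal.toReal_mono htop hx)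

theorem integrable_potential (u v : L2 P.Ω) :
    Integrable (fun x => P.c x * u x * v x) (volume.restrict P.Ω) := by
  have h1 : Integrable (fun x => u x * v x) (volume.restrict P.Ω) :=
    (Lp.memLp u).integrable_mul (Lp.memLp v)
  obtain ⟨K, -, hK⟩ := P.exists_essBound_c
  have h2 := h1.bdd_mul P.c_bounded.1 hK
  simpa only [mul_assoc] using h2

theorem aForm_add_left {u v w : L2 P.Ω} (hu : u ∈ H10 P.Ω) (hv : v ∈ H10 P.Ω) :
    aForm P (u + v) w = aForm P u w + aForm P v w := by
  have e1 : (∫ x in P.Ω, (P.A x).mulVec (wgrad (u + v) x).ofLp ⬝ᵥ (wgrad w x).ofLp)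
      = (∫ x in P.Ω, (P.A x).mulVec (wgrad u x).ofLp ⬝ᵥ (wgrad w x).ofLp)
        + ∫ x in P.Ω, (P.A x).mulVec (wgrad v x).ofLp ⬝ᵥ (wgrad w x).ofLp := by
    rw [← integral_add (P.integrable_energy _ _) (P.integrable_energy _ _), wgrad_add P.isOpen hu hv]
    refine integral_congr_ae ?_
    filter_upwards [Lp.coeFn_add (wgrad u) (wgrad v)] with x hx
    rw [hx, Pi.add_apply, WithLp.ofLp_add, Matrix.mulVec_add, add_dotProduct]
  have e2 : (∫ x in P.Ω, P.c x * (u + v : L2 P.Ω) x * w x)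
      = (∫ x in P.Ω, P.c x * u x * w x) + ∫ x in P.Ω, P.c x * v x * w x := by
    rw [← integral_add (P.integrable_potential _ _) (P.integrable_potential _ _)]
    refine integral_congr_ae ?_
    filter_upwards [Lp.coeFn_add u v] with x hx
    rw [hx, Pi.add_apply]
    ring
  rw [aForm, aForm, aForm, e1, e2]
  ring

theorem aForm_smul_left (t : ℝ) {u w : L2 P.Ω} (hu : u ∈ H10 P.Ω) :
    aForm P (t • u) w = t * aForm P u w := by
  have e1 : (∫ x in P.Ω, (P.A x).mulVec (wgrad (t • u) x).ofLp ⬝ᵥ (wgrad w x).ofLp)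
      = t * (∫ x in P.Ω, (P.A x).mulVec (wgrad u x).ofLp ⬝ᵥ (wgrad w x).ofLp) := by
    rw [← integral_const_mul, wgrad_smul P.isOpen hu]
    refine integral_congr_ae ?_
    filter_upwards [Lp.coeFn_smul t (wgrad u)] with x hx
    rw [hx, Pi.smul_apply, WithLp.ofLp_smul, Matrix.mulVec_smul, smul_dotProduct, smul_eq_mul]
  have e2 : (∫ x in P.Ω, P.c x * (t • u : L2 P.Ω) x * w x) = t * ∫ x in P.Ω, P.c x * u x * w x := by
    rw [← integral_const_mul]
    refine integral_congr_ae ?_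
    filter_upwards [Lp.coeFn_smul t u] with x hx
    rw [hx, Pi.smul_apply, smul_eq_mul]
    ring
  rw [aForm, aForm, e1, e2]
  ring

theorem aForm_symm (u v : L2 P.Ω) : aForm P u v = aForm P v u := by
  rw [aForm, aForm]
  congr 1
  · refine setIntegral_congr_fun P.isOpen.measurableSet fun x hx => ?_
    beta_reduce
    rw [dotProduct_comm, Matrix.dotProduct_mulVec, ← Matrix.mulVec_transpose, (P.symm x hx).eq]
  · congr 1
    ext x
    ring

theorem dotProduct_ofLp_self (y : E d) : y.ofLp ⬝ᵥ y.ofLp = ‖y‖ ^ 2 := by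
  rw [EuclideanSpace.norm_sq_eq]
  simp [dotProduct, sq]

theorem norm_sq_L2Vec (G : L2Vec P.Ω) : ‖G‖ ^ 2 = ∫ x in P.Ω, ‖G x‖ ^ 2 := by
  rw [← real_inner_self_eq_norm_sq, L2.inner_def]
  simp

theorem norm_sq_L2 {Ω : Set (E d)} (u : L2 Ω) : ‖u‖ ^ 2 = ∫ x in Ω, u x ^ 2 := by
  rw [← real_inner_self_eq_norm_sq, L2.inner_def]
  simp

theorem integrable_norm_sq (G : L2Vec P.Ω) :
    Integrable (fun x => ‖G x‖ ^ 2) (volume.restrict P.Ω) :=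
  (Lp.memLp G).norm.integrable_sq

theorem exists_coercive : ∃ α : ℝ, 0 < α ∧ ∀ u : L2 P.Ω, α * ‖wgrad u‖ ^ 2 ≤ aForm P u u := by
  obtain ⟨α, hα, hell⟩ := P.elliptic
  refine ⟨α, hα, fun u => ?_⟩
  have h1 : α * ‖wgrad u‖ ^ 2
      ≤ ∫ x in P.Ω, (P.A x).mulVec (wgrad u x).ofLp ⬝ᵥ (wgrad u x).ofLp := by
    rw [P.norm_sq_L2Vec, ← integral_const_mul]
    refine setIntegral_mono_on ((P.integrable_norm_sq _).const_mul _) (P.integrable_energy _ _)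
      P.isOpen.measurableSet fun x hx => ?_
    have := hell x hx (wgrad u x).ofLp
    rwa [dotProduct_ofLp_self, dotProduct_comm] at this
  have h2 : 0 ≤ ∫ x in P.Ω, P.c x * u x * u x := by
    refine integral_nonneg_of_ae ?_
    filter_upwards [P.c_nonneg] with x hx
    rw [mul_assoc]
    exact mul_nonneg hx (mul_self_nonneg _)
  rw [aForm]
  linarith

theorem abs_mulVec_dotProduct_le {M : Matrix (Fin d) (Fin d) ℝ} {C : ℝ}
    (hM : ∀ i j, |M i j| ≤ C) (y : E d) : M.mulVec y.ofLp ⬝ᵥ y.ofLp ≤ C * d * ‖y‖ ^ 2 := by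
  have hterm : ∀ i j, M i j * y j * y i ≤ C / 2 * (y j ^ 2 + y i ^ 2) := by
    intro i j
    have h1 := hM i j
    have h2 : M i j * y j * y i ≤ |M i j| * (|y j| * |y i|) := by
      rw [← abs_mul, ← abs_mul, ← mul_assoc]
      exact le_abs_self _
    have h3 : |y j| * |y i| ≤ (y j ^ 2 + y i ^ 2) / 2 := by
      nlinarith [sq_abs (y j), sq_abs (y i), sq_nonneg (|y j| - |y i|)]
    have h4 : 0 ≤ |y j| * |y i| := by positivity
    have h5 : |M i j| * (|y j| * |y i|) ≤ C * ((y j ^ 2 + y i ^ 2) / 2) :=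
      mul_le_mul h1 h3 h4 ((abs_nonneg _).trans h1)
    linarith
  calc M.mulVec y.ofLp ⬝ᵥ y.ofLp = ∑ i, ∑ j, M i j * y j * y i := by
        simp only [dotProduct, Matrix.mulVec, Finset.sum_mul]
    _ ≤ ∑ i, ∑ j, C / 2 * (y j ^ 2 + y i ^ 2) :=
        Finset.sum_le_sum fun i _ => Finset.sum_le_sum fun j _ => hterm i j
    _ = C * d * ‖y‖ ^ 2 := by
        simp only [← Finset.mul_sum, Finset.sum_add_distrib, Finset.sum_const, Finset.card_univ,
          Fintype.card_fin, nsmul_eq_mul]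
        rw [EuclideanSpace.norm_sq_eq]
        simp only [Real.norm_eq_abs, sq_abs]
        ring

/-- The energy norm is bounded by the `H^1` norm. -/
theorem exists_aForm_le : ∃ C : ℝ, 0 ≤ C ∧
    ∀ u : L2 P.Ω, aForm P u u ≤ C * (‖wgrad u‖ ^ 2 + ‖u‖ ^ 2) := by
  obtain ⟨C, hC0, hC⟩ := P.exists_bound_coeff
  obtain ⟨K, hK0, hK⟩ := P.exists_essBound_c
  refine ⟨C * d + K, by positivity, fun u => ?_⟩
  have h1 : (∫ x in P.Ω, (P.A x).mulVec (wgrad u x).ofLp ⬝ᵥ (wgrad u x).ofLp)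
      ≤ C * d * ‖wgrad u‖ ^ 2 := by
    rw [P.norm_sq_L2Vec, ← integral_const_mul]
    refine integral_mono_ae (P.integrable_energy _ _) ((P.integrable_norm_sq _).const_mul _) ?_
    filter_upwards [P.ae_mem_piece] with x ⟨s, hs⟩
    exact abs_mulVec_dotProduct_le (hC s x hs) _
  have h2 : (∫ x in P.Ω, P.c x * u x * u x) ≤ K * ‖u‖ ^ 2 := by
    rw [norm_sq_L2, ← integral_const_mul]
    refine integral_mono_ae (P.integrable_potential _ _) ((Lp.memLp u).integrable_sq.const_mul _) ?_
    filter_upwards [hK] with x hx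
    rw [mul_assoc, ← sq]
    exact mul_le_mul_of_nonneg_right ((le_abs_self _).trans hx) (sq_nonneg _)
  rw [aForm]
  have h3 : 0 ≤ K * ‖wgrad u‖ ^ 2 := by positivity
  have h4 : 0 ≤ C * d * ‖u‖ ^ 2 := by positivity
  nlinarith

theorem exists_poincare (hd : 1 ≤ d) : ∃ C : ℝ, 0 < C ∧
    ∀ u ∈ H10 P.Ω, ‖u‖ ≤ C * ‖wgrad u‖ := by
  obtain ⟨R, hR, hΩ⟩ := P.polygonal.exists_subset_closedBall
  exact ⟨2 * R + 1, by positivity, fun u hu => norm_le_norm_wgrad hd P.isOpen hR hΩ hu⟩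

theorem formOn (hd : 1 ≤ d) : FormOn (H10 P.Ω) (aForm P) where
  add_left _ hu _ hv _ _ := P.aForm_add_left hu hv
  smul_left t _ hu _ _ := P.aForm_smul_left t hu
  symm u _ v _ := P.aForm_symm u v
  pos u hu h0 := by
    obtain ⟨α, hα, h⟩ := P.exists_coercive
    obtain ⟨C, hC, hp⟩ := P.exists_poincare hd
    have h1 : 0 < ‖wgrad u‖ := by
      by_contra hcon
      have := le_antisymm (not_lt.1 hcon) (norm_nonneg _)
      have := hp u hu
      simp_all
    exact lt_of_lt_of_le (by positivity) (h u)

theorem isCompactEnergy (hd : 1 ≤ d) : FormOn.IsCompactEnergy (H10 P.Ω) (aForm P) := by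
  obtain ⟨α, hα, hco⟩ := P.exists_coercive
  obtain ⟨R, hR, hΩ⟩ := P.polygonal.exists_subset_closedBall
  obtain ⟨C, hC0, hC⟩ := P.exists_aForm_le
  constructor
  · intro K
    refine (totallyBounded_H10 hd P.isOpen hR hΩ (√(K / α))).subset ?_
    rintro u ⟨hu, hK⟩
    refine ⟨hu, Real.le_sqrt_of_sq_le ?_⟩
    rw [le_div_iff₀ hα, mul_comm]
    exact (hco u).trans hK
  · intro u v hu huv hcau
    have hG : CauchySeq fun n => wgrad (u n) := by
      rw [Metric.cauchySeq_iff]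
      intro ε hε
      obtain ⟨N, hN⟩ := hcau (α * ε ^ 2) (by positivity)
      refine ⟨N, fun n hn m hm => ?_⟩
      have := (hco _).trans_lt (hN n hn m hm)
      rw [wgrad_sub P.isOpen (hu n) (hu m)] at this
      rw [dist_eq_norm]
      exact lt_of_pow_lt_pow_left₀ 2 hε.le (lt_of_mul_lt_mul_left this hα.le)
    obtain ⟨G, hG⟩ := cauchySeq_tendsto_of_complete hG
    obtain ⟨hv, hvG⟩ := mem_H10_of_tendsto P.isOpen hu huv hG
    refine ⟨hv, ?_⟩
    have hlim : Tendsto (fun n => C * (‖wgrad (u n) - G‖ ^ 2 + ‖u n - v‖ ^ 2)) atTop (𝓝 0) := by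
      have h1 := (tendsto_iff_norm_sub_tendsto_zero.1 hG).pow 2
      have h2 := (tendsto_iff_norm_sub_tendsto_zero.1 huv).pow 2
      simpa using (h1.add h2).const_mul C
    refine squeeze_zero (fun n => (P.formOn hd).self_nonneg (Submodule.sub_mem _ (hu n) hv))
      (fun n => ?_) hlim
    have := hC (u n - v)
    rwa [wgrad_sub P.isOpen (hu n) hv, hvG] at this

/-- `H^1_0` is infinite-dimensional: some nonzero function satisfies any finite number of
orthogonality conditions. -/
theorem exists_ne_zero_orthogonal (hd : 1 ≤ d) {J : Type*} [Fintype J] (x : J → L2 P.Ω) :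
    ∃ v ∈ H10 P.Ω, v ≠ 0 ∧ ∀ j, inner ℝ (x j) v = 0 := by
  have : Nonempty (Fin d) := ⟨⟨0, hd⟩⟩
  obtain ⟨x₀, hx₀⟩ := P.polygonal.2.1.nonempty
  have hinf : P.Ω.Infinite := infinite_of_mem_nhds x₀ (P.isOpen.mem_nhds hx₀)
  -- bump functions which are one at one of the points and vanish at the others
  obtain ⟨t, htΩ, htcard⟩ := hinf.exists_subset_card_eq (Fintype.card J + 1)
  have hφ : ∀ y : t, ∃ φ : E d → ℝ, IsTestFun P.Ω φ ∧ φ y = 1 ∧ ∀ z : t, z ≠ y → φ z = 0 := by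
    intro y
    have hs : P.Ω ∩ ((t.erase y : Finset (E d)) : Set (E d))ᶜ ∈ 𝓝 (y : E d) := by
      refine inter_mem (P.isOpen.mem_nhds (htΩ y.2)) ?_
      exact (t.erase y).finite_toSet.isClosed.isOpen_compl.mem_nhds (by simp)
    obtain ⟨f, hf, hfc, hfs, -, hf1⟩ := exists_contDiff_tsupport_subset (n := ⊤) hs
    refine ⟨f, ⟨hfs, hfc, hf.trans inter_subset_left⟩, hf1, fun z hz => ?_⟩
    refine image_eq_zero_of_notMem_tsupport fun hz' => (hf hz').2 ?_
    simp only [Finset.mem_coe, Finset.mem_erase]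
    exact ⟨fun h => hz (Subtype.ext h), z.2⟩
  choose φ hφt hφ1 hφ0 using hφ
  obtain ⟨c, hc, hcx⟩ := exists_combination_orthogonal (J := J) (K := t) (by simp [htcard]) x
    (fun y => (hφt y).toL2)
  refine ⟨_, Submodule.sum_mem _ fun y _ => Submodule.smul_mem _ _ (hφt y).mem_H10, ?_, hcx⟩
  intro h0
  apply hc
  have hcont : Continuous (fun x => ∑ y, c y * φ y x) :=
    continuous_finsetSum _ fun y _ => continuous_const.mul (hφt y).1.continuous
  have hae : (fun x => ∑ y, c y * φ y x) =ᵐ[volume.restrict P.Ω] 0 := by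
    have h1 : ((∑ y, c y • (hφt y).toL2 : L2 P.Ω) : E d → ℝ)
        =ᵐ[volume.restrict P.Ω] fun x => ∑ y, c y * φ y x := by
      refine (Lp.coeFn_finsetSum _ _).trans ?_
      have : ∀ y ∈ (Finset.univ : Finset t), ((c y • (hφt y).toL2 : L2 P.Ω) : E d → ℝ)
          =ᵐ[volume.restrict P.Ω] fun x => c y * φ y x := by
        intro y _
        filter_upwards [Lp.coeFn_smul (c y) (hφt y).toL2, (hφt y).memLp.coeFn_toLp] with x h1 h2
        rw [h1, Pi.smul_apply, IsTestFun.toL2, h2, smul_eq_mul]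
      have h2 := (Finset.eventually_all Finset.univ).2 this
      filter_upwards [h2] with x hx
      rw [Finset.sum_apply]
      exact Finset.sum_congr rfl hx
    rw [h0] at h1
    exact h1.symm.trans (Lp.coeFn_zero _ _ _)
  have hz := Measure.eqOn_open_of_ae_eq hae P.isOpen hcont.continuousOn continuousOn_const
  ext y
  have := hz (htΩ y.2)
  simp only [Pi.zero_apply] at this
  rw [Finset.sum_eq_single y] at this
  · simpa [hφ1] using this
  · intro z _ hzy
    rw [hφ0 z y hzy.symm, mul_zero]
  · simp

end ModelProblem

end

section

/-! ### The contour integral of the resolvent -/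

section Resolvent
variable {A : Type*} [NormedRing A] [NormedAlgebra ℂ A] {ι : Type*} [Fintype ι]

/-- The resolvent of an operator that is diagonal with respect to a complete system of orthogonal
idempotents is diagonal too. -/
theorem resolvent_eq_sum {p : ι → A} (hp : CompleteOrthogonalIdempotents p) (κ : ι → ℂ) {z : ℂ}
    (hz : ∀ i, z ≠ κ i) :
    resolvent (∑ i, κ i • p i) z = ∑ i, (z - κ i)⁻¹ • p i := by
  classical
  have hmul : ∀ f g : ι → ℂ, (∑ i, f i • p i) * (∑ i, g i • p i) = ∑ i, (f i * g i) • p i := by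
    intro f g
    rw [Finset.sum_mul]
    refine Finset.sum_congr rfl fun i _ => ?_
    rw [Finset.mul_sum, Finset.sum_eq_single i]
    · rw [smul_mul_smul_comm, (hp.idem i).eq]
    · intro j _ hj
      rw [smul_mul_smul_comm, hp.ortho hj.symm, smul_zero]
    · simp
  have hsub : algebraMap ℂ A z - ∑ i, κ i • p i = ∑ i, (z - κ i) • p i := by
    simp only [sub_smul, Finset.sum_sub_distrib, ← Finset.smul_sum, hp.complete,
      Algebra.algebraMap_eq_smul_one]
  have hne : ∀ i, z - κ i ≠ 0 := fun i => sub_ne_zero.2 (hz i)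
  let u : Aˣ := ⟨∑ i, (z - κ i) • p i, ∑ i, (z - κ i)⁻¹ • p i,
    by rw [hmul]; simp [hne, hp.complete], by rw [hmul]; simp [hne, hp.complete]⟩
  rw [resolvent, hsub]
  exact Ring.inverse_unit u

/-- The contour integral of the resolvent is the sum of the spectral projections that belong to
the eigenvalues inside the circle. -/
theorem circleIntegral_resolvent_eq [CompleteSpace A] {p : ι → A}
    (hp : CompleteOrthogonalIdempotents p) (κ : ι → ℂ) {c : ℂ} {r : ℝ} (hr : 0 ≤ r)
    (s : Finset ι) (hin : ∀ i ∈ s, κ i ∈ Metric.ball c r)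
    (hout : ∀ i ∉ s, κ i ∉ Metric.closedBall c r) :
    (2 * π * Complex.I : ℂ)⁻¹ • (∮ z in C(c, r), resolvent (∑ i, κ i • p i) z) = ∑ i ∈ s, p i := by
  classical
  have hsph : ∀ i, κ i ∉ Metric.sphere c r := by
    intro i hi
    by_cases h : i ∈ s
    · exact (Metric.sphere_disjoint_ball).le_bot ⟨hi, hin i h⟩
    · exact hout i h (Metric.sphere_subset_closedBall hi)
  have hint : ∀ i, (∮ z in C(c, r), (z - κ i)⁻¹) = if i ∈ s then 2 * π * Complex.I else 0 := by
    intro i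
    split_ifs with h
    · exact circleIntegral.integral_sub_inv_of_mem_ball (hin i h)
    · refine DiffContOnCl.circleIntegral_eq_zero hr ?_
      refine DifferentiableOn.diffContOnCl fun z hz => ?_
      have : z - κ i ≠ 0 := by
        rw [sub_ne_zero]
        rintro rfl
        exact hout i h (Metric.closure_ball_subset_closedBall hz)
      have hd : DifferentiableAt ℂ (fun y : ℂ => y - κ i) z := differentiableAt_id.sub_const _
      exact (hd.inv this).differentiableWithinAt
  rw [circleIntegral.integral_congr hr (g := fun z => ∑ i, (z - κ i)⁻¹ • p i)]
  · rw [circleIntegral.integral_fun_sum]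
    · simp only [circleIntegral.integral_smul_const, hint]
      rw [Finset.smul_sum, ← Finset.sum_subset (Finset.subset_univ s)]
      · refine Finset.sum_congr rfl fun i hi => ?_
        rw [if_pos hi, smul_smul, inv_mul_cancel₀, one_smul]
        simp [Real.pi_ne_zero, Complex.I_ne_zero]
      · intro i _ hi
        simp [hi]
    · intro i _
      have h1 : CircleIntegrable (fun z => (z - κ i)⁻¹) c r :=
        circleIntegrable_sub_inv_iff.2 (Or.inr (by rw [abs_of_nonneg hr]; exact hsph i))
      exact h1.smul_continuousOn continuousOn_const
  · intro z hz
    exact resolvent_eq_sum hp κ fun i h => hsph i (h ▸ hz)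

end Resolvent

variable {d : ℕ} {Ω : Set (E d)}

theorem reL_toC (u : L2 Ω) : reL Ω (toC Ω u) = u := by
  apply Lp.ext
  filter_upwards [ContinuousLinearMap.coeFn_compLpL Complex.reCLM (toC Ω u),
    ContinuousLinearMap.coeFn_compLpL (p := 2) Complex.ofRealCLM u] with x h1 h2
  rw [reL, h1, toC, h2]
  simp

theorem imL_toC (u : L2 Ω) : imL Ω (toC Ω u) = 0 := by
  apply Lp.ext
  filter_upwards [ContinuousLinearMap.coeFn_compLpL Complex.imCLM (toC Ω u),
    ContinuousLinearMap.coeFn_compLpL (p := 2) Complex.ofRealCLM u,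
    Lp.coeFn_zero ℝ 2 (volume.restrict Ω)] with x h1 h2 h3
  rw [imL, h1, toC, h2, h3]
  simp

theorem toC_re_add_im (f : L2C Ω) : toC Ω (reL Ω f) + Complex.I • toC Ω (imL Ω f) = f := by
  apply Lp.ext
  filter_upwards [ContinuousLinearMap.coeFn_compLpL Complex.reCLM f,
    ContinuousLinearMap.coeFn_compLpL Complex.imCLM f,
    ContinuousLinearMap.coeFn_compLpL (p := 2) Complex.ofRealCLM (reL Ω f),
    ContinuousLinearMap.coeFn_compLpL (p := 2) Complex.ofRealCLM (imL Ω f),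
    Lp.coeFn_add (toC Ω (reL Ω f)) (Complex.I • toC Ω (imL Ω f)),
    Lp.coeFn_smul Complex.I (toC Ω (imL Ω f))] with x h1 h2 h3 h4 h5 h6
  rw [h5, Pi.add_apply, h6, Pi.smul_apply, toC, h3, h4, reL, imL, h1, h2]
  simp only [Complex.ofRealCLM_apply, Complex.reCLM_apply, Complex.imCLM_apply, smul_eq_mul]
  rw [mul_comm]
  exact Complex.re_add_im _

theorem complexify_apply (K : L2 Ω →L[ℝ] L2 Ω) (f : L2C Ω) :
    complexify K f = toC Ω (K (reL Ω f)) + Complex.I • toC Ω (K (imL Ω f)) := rfl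

theorem reL_toC_add (u v : L2 Ω) : reL Ω (toC Ω u + Complex.I • toC Ω v) = u := by
  rw [map_add, reL_toC, reL_smul, imL_toC]
  simp

theorem imL_toC_add (u v : L2 Ω) : imL Ω (toC Ω u + Complex.I • toC Ω v) = v := by
  rw [map_add, imL_toC, imL_smul, imL_toC, reL_toC]
  simp

/-- Complexification is a homomorphism of operator rings. -/
def complexifyHom (Ω : Set (E d)) : (L2 Ω →L[ℝ] L2 Ω) →+* (L2C Ω →L[ℂ] L2C Ω) where
  toFun := complexify
  map_one' := by
    ext1 f
    rw [complexify_apply]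
    exact toC_re_add_im f
  map_mul' K L := by
    ext1 f
    rw [mul_apply_eq_comp, complexify_apply, complexify_apply L, complexify_apply K,
      reL_toC_add, imL_toC_add]
    rfl
  map_zero' := by
    ext1 f
    simp [complexify_apply]
  map_add' K L := by
    ext1 f
    simp only [complexify_apply, add_apply, map_add, smul_add]
    abel

theorem real_smul_L2C (t : ℝ) (g : L2C Ω) : t • g = (t : ℂ) • g := by
  apply Lp.ext
  filter_upwards [Lp.coeFn_smul t g, Lp.coeFn_smul (t : ℂ) g] with x h1 h2
  rw [h1, h2]
  simp

theorem complexifyHom_smul (t : ℝ) (K : L2 Ω →L[ℝ] L2 Ω) :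
    complexifyHom Ω (t • K) = (t : ℂ) • complexifyHom Ω K := by
  ext1 f
  change complexify (t • K) f = (t : ℂ) • complexify K f
  simp only [complexify_apply, smul_apply, map_smul, smul_add, real_smul_L2C]
  rw [smul_comm]

/-- The orthogonal projection onto the line through a unit vector. -/
def rankOneProj {H : Type*} [NormedAddCommGroup H] [InnerProductSpace ℝ H] (e : H) : H →L[ℝ] H :=
  (innerSL ℝ e).smulRight e

theorem rankOneProj_apply {H : Type*} [NormedAddCommGroup H] [InnerProductSpace ℝ H] (e u : H) :
    rankOneProj e u = inner ℝ e u • e := rfl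

theorem orthogonalIdempotents_rankOneProj {H : Type*} [NormedAddCommGroup H]
    [InnerProductSpace ℝ H] {ι : Type*} {e : ι → H} (he : Orthonormal ℝ e) :
    OrthogonalIdempotents (fun i => rankOneProj (e i)) where
  idem i := by
    ext1 u
    simp only [mul_apply_eq_comp, rankOneProj_apply, inner_smul_right,
      real_inner_self_eq_norm_sq, he.1 i]
    simp
  ortho i j hij := by
    ext1 u
    simp only [mul_apply_eq_comp, rankOneProj_apply, inner_smul_right, he.2 hij]
    simp

/-- The discrete solution operator in terms of an eigenbasis. -/
theorem solOp_eq_sum {P : ModelProblem d} {V : Submodule ℝ (L2 P.Ω)} (h : FormOn V (aForm P))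
    {ι : Type*} [Fintype ι] {e : ι → L2 P.Ω} {μ : ι → ℝ} (he : IsEigBasis (aForm P) V e μ) :
    solOp P V = ∑ i, (μ i)⁻¹ • rankOneProj (e i) := by
  set K : L2 P.Ω →L[ℝ] L2 P.Ω := ∑ i, (μ i)⁻¹ • rankOneProj (e i) with hK
  have hKa : ∀ w, K w = ∑ i, ((μ i)⁻¹ * inner ℝ (e i) w) • e i := by
    intro w
    simp [hK, rankOneProj_apply, smul_smul]
  have hKV : ∀ w, K w ∈ V := fun w => by
    rw [hKa]
    exact V.sum_mem fun i _ => V.smul_mem _ (he.mem i)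
  have hKs : ∀ w, K w ∈ V ∧ ∀ v ∈ V, aForm P (K w) v = inner ℝ w v := by
    refine fun w => ⟨hKV w, fun v hv => ?_⟩
    rw [hKa, h.sum_left _ _ he.mem hv]
    conv_rhs => rw [he.complete v hv, inner_sum]
    refine Finset.sum_congr rfl fun i _ => ?_
    rw [he.eig i v hv, inner_smul_right, real_inner_comm w]
    have := (he.eigenvalue_pos h i).ne'
    field_simp
  have hex : ∃ K : L2 P.Ω →L[ℝ] L2 P.Ω,
      ∀ w, K w ∈ V ∧ ∀ v ∈ V, aForm P (K w) v = inner ℝ w v := ⟨K, hKs⟩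
  rw [solOp, dif_pos hex]
  ext1 w
  have h1 := hex.choose_spec w
  have h2 := hKs w
  have hd : hex.choose w - K w ∈ V := V.sub_mem h1.1 h2.1
  refine sub_eq_zero.1 (h.eq_zero_of_self_le hd (le_of_eq ?_))
  rw [h.sub_left h1.1 h2.1 hd, h1.2 _ hd, h2.2 _ hd, sub_self]

/-- The spectral projection is the orthogonal projection onto the span of the discrete
eigenfunctions whose inverse eigenvalues lie inside the circle. -/
theorem specProj_eq_sum {P : ModelProblem d} {V : Submodule ℝ (L2 P.Ω)} (h : FormOn V (aForm P))
    {ι : Type*} [Fintype ι] {e : ι → L2 P.Ω} {μ : ι → ℝ} (he : IsEigBasis (aForm P) V e μ)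
    {lam r : ℝ} (hr : 0 ≤ r) (h0 : r < lam⁻¹) (s : Finset ι)
    (hin : ∀ i ∈ s, |(μ i)⁻¹ - lam⁻¹| < r) (hout : ∀ i ∉ s, r < |(μ i)⁻¹ - lam⁻¹|)
    (u : L2 P.Ω) : specProj P V lam r u = ∑ i ∈ s, inner ℝ (e i) u • e i := by
  classical
  -- `none` stands for the complementary idempotent; it belongs to the eigenvalue `0` of the
  -- solution operator, which `r < lam⁻¹` keeps outside the circle
  have hp := CompleteOrthogonalIdempotents.option (orthogonalIdempotents_rankOneProj he.orthonormal)
  have hpC := hp.map (complexifyHom P.Ω)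
  have hsol : complexify (solOp P V) = ∑ o : Option ι,
      ((o.elim 0 (fun i => (μ i)⁻¹) : ℝ) : ℂ) •
        (complexifyHom P.Ω ∘ (Option.elim · (1 - ∑ i, rankOneProj (e i))
          (fun i => rankOneProj (e i)))) o := by
    rw [solOp_eq_sum h he]
    change complexifyHom P.Ω _ = _
    rw [map_sum, Fintype.sum_option]
    simp [complexifyHom_smul]
  have hdist : ∀ t : ℝ, dist ((t : ℝ) : ℂ) ((lam⁻¹ : ℝ) : ℂ) = |t - lam⁻¹| := fun t => by
    rw [Complex.dist_eq, ← Complex.ofReal_sub, Complex.norm_real, Real.norm_eq_abs]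
  have key := circleIntegral_resolvent_eq hpC
    (fun o => ((o.elim 0 (fun i => (μ i)⁻¹) : ℝ) : ℂ)) (c := ((lam⁻¹ : ℝ) : ℂ)) hr
    (s.map Function.Embedding.some) (by
      intro o ho
      obtain ⟨i, hi, rfl⟩ := Finset.mem_map.1 ho
      rw [Metric.mem_ball, hdist]
      exact hin i hi) (by
      rintro (_ | i) ho
      · rw [Metric.mem_closedBall, hdist, not_le]
        simp only [Option.elim_none, zero_sub, abs_neg]
        exact h0.trans_le (le_abs_self _)
      · rw [Metric.mem_closedBall, hdist, not_le]
        exact hout i fun hi => ho (Finset.mem_map.2 ⟨i, hi, rfl⟩))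
  rw [specProj, specProjC, hsol, key, Finset.sum_map]
  have : ∑ x ∈ s, (complexifyHom P.Ω ∘ (Option.elim · (1 - ∑ i, rankOneProj (e i))
          (fun i => rankOneProj (e i)))) (Function.Embedding.some x)
        = complexify (∑ x ∈ s, rankOneProj (e x)) := by
    change _ = complexifyHom P.Ω _
    rw [map_sum]
    rfl
  rw [this, complexify_apply, reL_toC_add, reL_toC]
  simp [rankOneProj_apply]

end

section

variable {d : ℕ} {P : ModelProblem d}

/-! ### Separation of the discrete eigenvalues -/

/-- `eigSpace` is a span, but every element of it already solves the eigenvalue equation. -/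
theorem mem_of_mem_eigSpace (hd : 1 ≤ d) {μ : ℝ} {u : L2 P.Ω} (hu : u ∈ eigSpace P μ) :
    u ∈ H10 P.Ω ∧ ∀ v ∈ H10 P.Ω, aForm P u v = μ * inner ℝ u v := by
  have h := P.formOn hd
  induction hu using Submodule.span_induction with
  | mem x hx => exact ⟨hx.1, hx.2.2⟩
  | zero => exact ⟨zero_mem _, fun v hv => by rw [h.zero_left hv]; simp⟩
  | add x y _ _ hx hy =>
    refine ⟨add_mem hx.1 hy.1, fun v hv => ?_⟩
    rw [h.add_left _ hx.1 _ hy.1 _ hv, hx.2 v hv, hy.2 v hv, inner_add_left]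
    ring
  | smul t x _ hx =>
    refine ⟨Submodule.smul_mem _ _ hx.1, fun v hv => ?_⟩
    rw [h.smul_left _ _ hx.1 _ hv, hx.2 v hv, real_inner_smul_left]
    ring

theorem IsEigenvalue.pos (hd : 1 ≤ d) {μ : ℝ} (hμ : IsEigenvalue P μ) : 0 < μ := by
  obtain ⟨u, hu, h0, he⟩ := hμ
  have h1 := (P.formOn hd).pos u hu h0
  rw [he u hu, real_inner_self_eq_norm_sq] at h1
  exact pos_of_mul_pos_left h1 (sq_nonneg _)

theorem mem_cluster {q : ℕ} {Ω : Set (E d)} {m : Fin q → ℕ} (u : Family m (L2 Ω)) (i : Fin q)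
    (j : Fin (m i)) : u i j ∈ cluster u i := Submodule.subset_span ⟨j, rfl⟩

section
variable {q : ℕ} {lam : Fin q → ℝ} {m : Fin q → ℕ} {U : Family m (L2 P.Ω)}

theorem IsEigenbasis.mem (hd : 1 ≤ d) (hU : IsEigenbasis P lam U) (i : Fin q) (j : Fin (m i)) :
    U i j ∈ H10 P.Ω ∧ ∀ v ∈ H10 P.Ω, aForm P (U i j) v = lam i * inner ℝ (U i j) v :=
  mem_of_mem_eigSpace hd (by rw [← hU.2 i]; exact mem_cluster U i j)

/-- On the orthogonal complement of the first `n` eigenspaces the Rayleigh quotient is bounded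
below by an eigenvalue that is different from the first `n` ones. -/
theorem IsEigenbasis.exists_eigenvalue_le (hd : 1 ≤ d) (hU : IsEigenbasis P lam U) (n : ℕ) :
    ∃ μ, IsEigenvalue P μ ∧ (∀ k : Fin q, k.val < n → μ ≠ lam k) ∧
      ∀ v ∈ H10 P.Ω, (∀ p : (i : Fin q) × Fin (m i), p.1.val < n → inner ℝ (U p.1 p.2) v = 0) →
        μ * ‖v‖ ^ 2 ≤ aForm P v v := by
  let x : {p : (i : Fin q) × Fin (m i) // p.1.val < n} → L2 P.Ω := fun p => U p.1.1 p.1.2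
  have hx : Orthonormal ℝ x := hU.1.comp _ Subtype.val_injective
  obtain ⟨w, hw, μ, hw1, hwx, hwe, hmin⟩ := (P.formOn hd).exists_next_eigenvector
    (P.isCompactEnergy hd) (ν := fun p => lam p.1.1) hx (fun p => (hU.mem hd _ _).1)
    (fun p => (hU.mem hd _ _).2) (P.exists_ne_zero_orthogonal hd x)
  have hw0 : w ≠ 0 := by
    rintro rfl
    simp at hw1
  refine ⟨μ, ⟨w, hw, hw0, hwe⟩, ?_, fun v hv hvx => hmin v hv fun p => hvx p.1 p.2⟩
  rintro k hk rfl
  have hwk : w ∈ cluster U k := by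
    rw [hU.2 k]
    exact Submodule.subset_span ⟨hw, hw0, hwe⟩
  have horth : ∀ y ∈ cluster U k, inner ℝ y w = 0 := by
    intro y hy
    induction hy using Submodule.span_induction with
    | mem y hy =>
      obtain ⟨j, rfl⟩ := hy
      exact hwx ⟨⟨k, j⟩, hk⟩
    | zero => simp
    | add y z _ _ hy hz => rw [inner_add_left, hy, hz, add_zero]
    | smul t y _ hy => rw [real_inner_smul_left, hy, mul_zero]
  exact hw0 (inner_self_eq_zero.1 (horth w hwk))

/-- On the orthogonal complement of the preceding eigenspaces the Rayleigh quotient is at least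
`lam i`. -/
theorem IsEigenbasis.le_form (hd : 1 ≤ d) (hlam : IsLowestEigenvalues P lam m)
    (hU : IsEigenbasis P lam U) (i : Fin q) {v : L2 P.Ω} (hv : v ∈ H10 P.Ω)
    (hvU : ∀ p : (i : Fin q) × Fin (m i), p.1.val < i.val → inner ℝ (U p.1 p.2) v = 0) :
    lam i * ‖v‖ ^ 2 ≤ aForm P v v := by
  obtain ⟨μ, hμ, hne, hmin⟩ := hU.exists_eigenvalue_le hd i.val
  refine le_trans (mul_le_mul_of_nonneg_right ?_ (sq_nonneg _)) (hmin v hv hvU)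
  rcases hlam.lowest μ hμ with ⟨k, rfl⟩ | h
  · exact hlam.strictMono.monotone (not_lt.1 fun hk => hne k hk rfl)
  · exact (h i).le

/-- Beyond the `i`-th eigenspace the Rayleigh quotient is so large that its inverse lies to the
left of the `i`-th circle. In particular the circle does not surround the origin. -/
theorem IsEigenbasis.exists_gap (hd : 1 ≤ d) (hlam : IsLowestEigenvalues P lam m)
    (hU : IsEigenbasis P lam U) {r : Fin q → ℝ}
    (hΓ : ∀ i μ, IsEigenvalue P μ → μ ≠ lam i → r i < |μ⁻¹ - (lam i)⁻¹|) (i : Fin q) :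
    ∃ β : ℝ, 0 < β ∧ r i < (lam i)⁻¹ - β⁻¹ ∧ ∀ v ∈ H10 P.Ω,
      (∀ p : (i : Fin q) × Fin (m i), p.1.val < i.val + 1 → inner ℝ (U p.1 p.2) v = 0) →
        β * ‖v‖ ^ 2 ≤ aForm P v v := by
  obtain ⟨μ, hμ, hne, hmin⟩ := hU.exists_eigenvalue_le hd (i.val + 1)
  have hlt : lam i < μ := by
    rcases hlam.lowest μ hμ with ⟨k, rfl⟩ | h
    · exact hlam.strictMono (not_le.1 fun hk => hne k (Nat.lt_succ_of_le hk) rfl)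
    · exact h i
  have h0 := (hlam.eigenvalue i).pos hd
  have hinv : μ⁻¹ < (lam i)⁻¹ := inv_strictAnti₀ h0 hlt
  refine ⟨μ, hμ.pos hd, ?_, hmin⟩
  have := hΓ i μ hμ hlt.ne'
  rwa [abs_of_neg (by linarith), neg_sub] at this

/-- Lower bound for the eigenvalue of a discrete eigenvector that is orthogonal to the first
clusters. -/
theorem IsLowestDiscrete.le_eigenvalue (hd : 1 ≤ d) {V : Submodule ℝ (L2 P.Ω)}
    (hV : V ≤ H10 P.Ω) {lamh : Family m ℝ} {uh : Family m (L2 P.Ω)}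
    (hh : IsLowestDiscrete P V lamh uh) {n : ℕ} {β : ℝ}
    (hβ : ∀ v ∈ H10 P.Ω,
      (∀ p : (i : Fin q) × Fin (m i), p.1.val < n → inner ℝ (U p.1 p.2) v = 0) →
        β * ‖v‖ ^ 2 ≤ aForm P v v) {w : L2 P.Ω} {μ : ℝ} (hw : w ∈ V) (hw1 : ‖w‖ = 1)
    (hwe : ∀ v ∈ V, aForm P w v = μ * inner ℝ w v)
    (hwu : ∀ p : (i : Fin q) × Fin (m i), p.1.val < n →
      inner ℝ (uh p.1 p.2) w = 0 ∧ lamh p.1 p.2 ≤ μ) : β ≤ μ := by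
  let J := {p : (i : Fin q) × Fin (m i) // p.1.val < n}
  let y : Option J → L2 P.Ω := fun o => o.elim w fun p => uh p.1.1 p.1.2
  refine (P.formOn hd).le_of_eigenvalues_le hV (J := J) (K := Option J) (by simp)
    (x := fun p => U p.1.1 p.1.2) (fun v hv hx => hβ v hv fun p hp => hx ⟨p, hp⟩)
    (y := y) (ν := fun o => o.elim μ fun p => lamh p.1.1 p.1.2) ?_ ?_ ?_ ?_
  · have ho : Orthonormal ℝ fun p : J => uh p.1.1 p.1.2 :=
      hh.orthonormal.comp _ Subtype.val_injective
    rw [orthonormal_iff_ite] at ho ⊢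
    rintro (_ | p) (_ | p')
    · simp [y, hw1]
    · simpa [y, real_inner_comm] using (hwu p'.1 p'.2).1
    · simpa [y] using (hwu p.1 p.2).1
    · simpa [y] using ho p p'
  · rintro (_ | p)
    exacts [hw, (hh.eigenpair _ _).1]
  · rintro (_ | p) v hv
    exacts [hwe v hv, (hh.eigenpair _ _).2.2 v hv]
  · rintro (_ | p)
    exacts [le_rfl, (hwu p.1 p.2).2]

/-- The perturbation bound for the discrete eigenvalues forces them below `lam₀ + δ` once the
approximation error is small. -/
theorem exists_small_of_sqrt_le {lam₀ δ N : ℝ} (h0 : 0 ≤ lam₀) (hδ : 0 < δ) :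
    ∀ᶠ ε in 𝓝[>] (0 : ℝ), ∀ Λ : ℝ, 0 ≤ Λ → √Λ * (1 - N * ε) ≤ √lam₀ + N * ε → Λ < lam₀ + δ := by
  have hc : ContinuousAt (fun ε : ℝ => ((√lam₀ + N * ε) / (1 - N * ε)) ^ 2) 0 := by
    refine ContinuousAt.pow (ContinuousAt.div (by fun_prop) (by fun_prop) (by simp)) 2
  have h1 : ∀ᶠ ε in 𝓝 (0 : ℝ), ((√lam₀ + N * ε) / (1 - N * ε)) ^ 2 < lam₀ + δ := by
    refine hc.eventually_lt continuousAt_const ?_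
    simp [Real.sq_sqrt h0, hδ]
  have h2 : ∀ᶠ ε in 𝓝 (0 : ℝ), 0 < 1 - N * ε :=
    ContinuousAt.eventually_lt continuousAt_const (by fun_prop) (by simp)
  filter_upwards [nhdsWithin_le_nhds h1, nhdsWithin_le_nhds h2] with ε h3 h4 Λ hΛ hle
  refine lt_of_le_of_lt ?_ h3
  rw [← le_div_iff₀ h4] at hle
  exact (Real.sqrt_le_left ((Real.sqrt_nonneg _).trans hle)).1 hle

/-- The discrete spectral projections. If `V` contains good approximations of the eigenfunctions,
then every circle surrounds exactly the inverses of the discrete eigenvalues of its own cluster,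
so that the contour integral is the orthogonal projection onto the discrete cluster. -/
theorem IsEigenbasis.exists_specProj_eq (hd : 1 ≤ d) (hlam : IsLowestEigenvalues P lam m)
    (hU : IsEigenbasis P lam U) {r : Fin q → ℝ} (hr : ∀ i, 0 < r i)
    (hΓ : ∀ i μ, IsEigenvalue P μ → μ ≠ lam i → r i < |μ⁻¹ - (lam i)⁻¹|) :
    ∃ ε > 0, ∃ Λ : ℝ, 0 < Λ ∧ ∀ V : Submodule ℝ (L2 P.Ω), FiniteDimensional ℝ V → V ≤ H10 P.Ω →
      (∀ i j, ∃ v ∈ V, ‖v - U i j‖ ≤ ε ∧ √(aForm P (v - U i j) (v - U i j)) ≤ ε) →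
      ∀ (lamh : Family m ℝ) (uh : Family m (L2 P.Ω)), IsLowestDiscrete P V lamh uh →
        (∀ i u, specProj P V (lam i) (r i) u = ∑ j, inner ℝ (uh i j) u • uh i j) ∧
        ∀ i j, 0 < lamh i j ∧ lamh i j ≤ Λ := by
  classical
  have hpos : ∀ i, 0 < lam i := fun i => (hlam.eigenvalue i).pos hd
  -- inverses of numbers close to `lam k` lie inside the `k`-th circle and outside the others
  have hδ : ∀ k, ∃ δ > 0, ∀ t, dist t (lam k) < δ → |t⁻¹ - (lam k)⁻¹| < r k ∧
      ∀ i, i ≠ k → r i < |t⁻¹ - (lam i)⁻¹| := by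
    intro k
    have hev : ∀ᶠ t in 𝓝 (lam k), |t⁻¹ - (lam k)⁻¹| < r k ∧
        ∀ i, i ≠ k → r i < |t⁻¹ - (lam i)⁻¹| := by
      have hcont : ∀ s : ℝ, ContinuousAt (fun t : ℝ => |t⁻¹ - s|) (lam k) := fun s =>
        ((continuousAt_inv₀ (hpos k).ne').sub continuousAt_const).abs
      refine ((hcont _).eventually_lt continuousAt_const (by simpa using hr k)).and ?_
      rw [eventually_all]
      intro i
      by_cases hik : i = k
      · simp [hik]
      · have := continuousAt_const.eventually_lt (hcont (lam i)⁻¹)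
          (hΓ i (lam k) (hlam.eigenvalue k) fun h => hik (hlam.strictMono.injective h).symm)
        filter_upwards [this] with t ht _
        exact ht
    exact Metric.eventually_nhds_iff.1 hev
  choose δ hδ0 hδ using hδ
  choose β hβ0 hβr hβ using hU.exists_gap hd hlam hΓ
  obtain ⟨N, hN⟩ : ∃ N : ℝ, N = (Fintype.card ((i : Fin q) × Fin (m i)) : ℝ) := ⟨_, rfl⟩
  have hev := (eventually_all.2 fun k =>
    exists_small_of_sqrt_le (N := N) (hpos k).le (hδ0 k)).and self_mem_nhdsWithin
  obtain ⟨ε, hεk, hε⟩ := hev.exists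
  have hε : 0 < ε := hε
  refine ⟨ε, hε, ∑ k, (lam k + δ k) + 1, ?_, ?_⟩
  · exact add_pos_of_nonneg_of_pos
      (Finset.sum_nonneg fun k _ => (add_pos (hpos k) (hδ0 k)).le) one_pos
  intro V hfin hV happ lamh uh hh
  have hF := (P.formOn hd).mono hV
  obtain ⟨n, f, μ, hb⟩ := hF.exists_isEigBasis_extending
    (u := fun p : (i : Fin q) × Fin (m i) => uh p.1 p.2) (ν := fun p => lamh p.1 p.2)
    hh.orthonormal (fun p => (hh.eigenpair _ _).1) (fun p => (hh.eigenpair _ _).2.2)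
  have hfu : ∀ t i j, inner ℝ (uh i j) (f t) = 0 := fun t i j => by
    have := hb.orthonormal.2 (i := Sum.inl ⟨i, j⟩) (j := Sum.inr t) (by simp)
    simpa using this
  have hfe : ∀ t, ∀ v ∈ V, aForm P (f t) v = μ t * inner ℝ (f t) v := fun t => hb.eig (Sum.inr t)
  have hf0 : ∀ t, f t ≠ 0 := fun t => hb.orthonormal.ne_zero (Sum.inr t)
  have hle : ∀ t i j, lamh i j ≤ μ t := fun t i j =>
    hh.lowest (μ t) (f t) ⟨hb.mem (Sum.inr t), hf0 t, hfe t⟩ (hfu t) i j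
  -- the rest of the spectrum lies to the left of all circles
  have hrest : ∀ t i, r i < |(μ t)⁻¹ - (lam i)⁻¹| := by
    intro t i
    have h1 : β i ≤ μ t := hh.le_eigenvalue hd hV (hβ i) (hb.mem (Sum.inr t))
      (hb.orthonormal.1 (Sum.inr t)) (hfe t) fun p _ => ⟨hfu t _ _, hle t _ _⟩
    have h2 : (μ t)⁻¹ ≤ (β i)⁻¹ := inv_anti₀ (hβ0 i) h1
    rw [abs_sub_comm]
    exact lt_of_lt_of_le (by linarith [hβr i]) (le_abs_self _)
  -- discrete eigenvalues are not smaller than the exact ones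
  have hlow : ∀ i j, lam i ≤ lamh i j := by
    intro i j
    refine hh.le_eigenvalue hd hV (fun v hv => hU.le_form hd hlam i hv) (hh.eigenpair i j).1
      (hh.orthonormal.1 ⟨i, j⟩) (hh.eigenpair i j).2.2 fun p hp => ⟨?_, hh.mono_across _ _ _ _ hp⟩
    exact hh.orthonormal.2 (i := p) (j := ⟨i, j⟩) (by rintro rfl; exact lt_irrefl _ hp)
  choose w hwV hw1 hw2 using happ
  -- and not much larger: the approximants of the eigenfunctions up to the `k`-th cluster outnumber
  -- the discrete eigenvectors that may have eigenvalues below `lamh k l`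
  have hup : ∀ k l, lamh k l < lam k + δ k := by
    intro k l
    have h0 : 0 ≤ lamh k l := (hpos k).le.trans (hlow k l)
    refine hεk k _ h0 ?_
    let K := {p : (i : Fin q) × Fin (m i) // p.1 ≤ k}
    let z : K := ⟨⟨k, l⟩, le_rfl⟩
    have hJK : Fintype.card {p : K // p ≠ z} < Fintype.card K :=
      Fintype.card_subtype_lt (x := z) (by simp)
    have key := (P.formOn hd).sqrt_eigenvalue_le hV hJK hb
      (x := fun p : {p : K // p ≠ z} => uh p.1.1.1 p.1.1.2) h0 ?_
      (u := fun p : K => U p.1.1 p.1.2) (hU.1.comp _ Subtype.val_injective)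
      (fun p => (hU.mem hd _ _).1) (ν := fun p => lam p.1.1) (fun p => (hU.mem hd _ _).2)
      (hpos k).le (fun p => hlam.strictMono.monotone p.2)
      (v := fun p : K => w p.1.1 p.1.2) (fun p => hwV _ _) (fun p => hw1 _ _)
      (fun p => hw2 _ _) hε.le
    · have hcard : (Fintype.card K : ℝ) ≤ N := by
        rw [hN]
        exact_mod_cast Fintype.card_subtype_le _
      have h3 : (Fintype.card K : ℝ) * ε ≤ N * ε := by gcongr
      have h4 := mul_le_mul_of_nonneg_left h3 (Real.sqrt_nonneg (lamh k l))
      linarith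
    · rintro (p | t)
      · by_cases hp : p.1 ≤ k
        · by_cases hpz : (⟨p, hp⟩ : K) = z
          · right
            have : p = ⟨k, l⟩ := congrArg Subtype.val hpz
            subst this
            exact le_rfl
          · exact Or.inl ⟨⟨⟨p, hp⟩, hpz⟩, rfl⟩
        · exact Or.inr (hh.mono_across _ _ _ _ (not_le.1 hp))
      · exact Or.inr (hle t k l)
  have hnear : ∀ k l, dist (lamh k l) (lam k) < δ k := fun k l => by
    rw [Real.dist_eq, abs_of_nonneg (by linarith [hlow k l])]
    linarith [hup k l]
  refine ⟨fun i u => ?_, fun i j => ⟨(hpos i).trans_le (hlow i j), ?_⟩⟩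
  · let s : Finset (((i : Fin q) × Fin (m i)) ⊕ Fin n) :=
      Finset.univ.map ⟨fun j : Fin (m i) => Sum.inl ⟨i, j⟩, fun j j' h => by simpa using h⟩
    rw [specProj_eq_sum hF hb (hr i).le
      (by linarith [hβr i, inv_pos.2 (hβ0 i)]) s ?_ ?_ u, Finset.sum_map]
    · rfl
    · intro p hp
      obtain ⟨j, -, rfl⟩ := Finset.mem_map.1 hp
      exact (hδ i _ (hnear i j)).1
    · rintro (p | t) hp
      · have hpi : i ≠ p.1 := by
          rintro rfl
          exact hp (Finset.mem_map.2 ⟨p.2, Finset.mem_univ _, rfl⟩)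
        exact (hδ p.1 _ (hnear p.1 p.2)).2 i hpi
      · exact hrest t i
  · have := Finset.single_le_sum (f := fun k => lam k + δ k)
      (fun k _ => (add_pos (hpos k) (hδ0 k)).le) (Finset.mem_univ i)
    linarith [hup i j]

end

end

section

variable {d : ℕ} {P : ModelProblem d}

/-! ### Comparison of the finite element and the ParO clusters -/

/-- Coercivity: the energy norm controls the norms of the function and of its gradient. -/
theorem exists_norm_le_aNorm (hd : 1 ≤ d) (P : ModelProblem d) : ∃ C : ℝ, 0 < C ∧
    ∀ u ∈ H10 P.Ω, ‖u‖ ≤ C * aNorm P u ∧ ‖wgrad u‖ ≤ C * aNorm P u := by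
  obtain ⟨α, hα, hco⟩ := P.exists_coercive
  obtain ⟨C, hC, hp⟩ := P.exists_poincare hd
  have hs : 0 < √α := Real.sqrt_pos.2 hα
  have hg : ∀ u : L2 P.Ω, ‖wgrad u‖ ≤ (√α)⁻¹ * aNorm P u := by
    intro u
    rw [inv_mul_eq_div, le_div_iff₀ hs, aNorm]
    refine Real.le_sqrt_of_sq_le ?_
    rw [mul_pow, Real.sq_sqrt hα.le, mul_comm]
    exact hco u
  refine ⟨(C + 1) * (√α)⁻¹, by positivity, fun u hu => ⟨?_, ?_⟩⟩
  · have h1 := mul_le_mul_of_nonneg_left (hg u) hC.le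
    have h2 : 0 ≤ (√α)⁻¹ * aNorm P u := mul_nonneg (inv_nonneg.2 hs.le) (Real.sqrt_nonneg _)
    linarith [hp u hu]
  · have h2 : 0 ≤ C * ((√α)⁻¹ * aNorm P u) :=
      mul_nonneg hC.le (mul_nonneg (inv_nonneg.2 hs.le) (Real.sqrt_nonneg _))
    linarith [hg u]

theorem distA_nonneg (X Y : Submodule ℝ (L2 P.Ω)) : 0 ≤ distA P X Y := by
  refine Real.sSup_nonneg ?_
  rintro t ⟨u, -, -, rfl⟩
  exact Real.iInf_nonneg fun v => Real.sqrt_nonneg _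

/-- The `a`-orthogonal projection error of a function in `X` is bounded by the distance of `X`
and `Y`. -/
theorem aNorm_sub_le_distA (hd : 1 ≤ d) {X Y : Submodule ℝ (L2 P.Ω)} (hX : X ≤ H10 P.Ω)
    (hY : Y ≤ H10 P.Ω) {w p : L2 P.Ω} (hw : w ∈ X) (hp : p ∈ Y)
    (horth : ∀ v ∈ Y, aForm P (w - p) v = 0) : aNorm P (w - p) ≤ aNorm P w * distA P X Y := by
  have h := P.formOn hd
  have hbelow : ∀ u : L2 P.Ω, BddBelow (range fun v : Y => aNorm P (u - v)) := fun u =>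
    ⟨0, by rintro _ ⟨v, rfl⟩; exact Real.sqrt_nonneg _⟩
  rcases eq_or_ne w 0 with rfl | hw0
  · have : aForm P (0 - p) (0 - p) ≤ 0 := by
      have h1 := horth (0 - p) (Y.sub_mem Y.zero_mem hp)
      exact h1.le
    rw [aNorm, Real.sqrt_eq_zero_of_nonpos this]
    exact mul_nonneg (Real.sqrt_nonneg _) (distA_nonneg _ _)
  -- the distance is a supremum over normalised functions
  set s := aNorm P w with hs
  have hspos : 0 < s := Real.sqrt_pos.2 (h.pos w (hX hw) hw0)
  have hscale : ∀ v ∈ H10 P.Ω, aNorm P (s⁻¹ • v) = s⁻¹ * aNorm P v := by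
    intro v hv
    rw [aNorm, h.self_smul _ hv, Real.sqrt_mul (sq_nonneg _), Real.sqrt_sq (inv_nonneg.2 hspos.le)]
    rfl
  have hbdd : BddAbove {t : ℝ | ∃ u ∈ X, aNorm P u = 1 ∧ t = ⨅ v : Y, aNorm P (u - v)} := by
    refine ⟨1, ?_⟩
    rintro t ⟨u, -, hu1, rfl⟩
    refine (ciInf_le (hbelow u) ⟨0, Y.zero_mem⟩).trans ?_
    rw [sub_zero, hu1]
  have h1 : ⨅ v : Y, aNorm P (s⁻¹ • w - v) ≤ distA P X Y := by
    refine le_csSup hbdd ⟨s⁻¹ • w, X.smul_mem _ hw, ?_, rfl⟩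
    rw [hscale _ (hX hw), ← hs, inv_mul_cancel₀ hspos.ne']
  have h2 : s⁻¹ * aNorm P (w - p) ≤ ⨅ v : Y, aNorm P (s⁻¹ • w - v) := by
    have : Nonempty Y := ⟨0⟩
    refine le_ciInf fun v => ?_
    have hv : s • (v : L2 P.Ω) ∈ Y := Y.smul_mem _ v.2
    have e : s⁻¹ • w - v = s⁻¹ • (w - s • (v : L2 P.Ω)) := by
      rw [smul_sub, smul_smul, inv_mul_cancel₀ hspos.ne', one_smul]
    rw [e, hscale _ (sub_mem (hX hw) (hY hv))]
    refine mul_le_mul_of_nonneg_left ?_ (inv_nonneg.2 hspos.le)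
    exact Real.sqrt_le_sqrt (h.self_sub_projection_le hY (hX hw) hp hv horth)
  have h3 := h2.trans h1
  rwa [inv_mul_le_iff₀ hspos] at h3

section
variable {q : ℕ} {m : Fin q → ℕ} {V : Submodule ℝ (L2 P.Ω)}

theorem IsParOApprox.mem {lamt : Family m ℝ} {ut : Family m (L2 P.Ω)}
    (ht : IsParOApprox P V lamt ut) (i : Fin q) (j : Fin (m i)) : ut i j ∈ V := by
  obtain ⟨g, hg, -, he⟩ := ht
  have : spanAll g ≤ V := by
    rw [spanAll, Submodule.span_le]
    rintro _ ⟨p, rfl⟩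
    exact hg _ _
  exact this (he i j).1

theorem cluster_le {u : Family m (L2 P.Ω)} (hu : ∀ i j, u i j ∈ V) (i : Fin q) :
    cluster u i ≤ V := by
  rw [cluster, Submodule.span_le]
  rintro _ ⟨j, rfl⟩
  exact hu i j

theorem IsParOApprox.orthonormal {lamt : Family m ℝ} {ut : Family m (L2 P.Ω)}
    (ht : IsParOApprox P V lamt ut) : OrthonormalFamily ut := ht.choose_spec.2.1

theorem IsParOApprox.form_eq {lamt : Family m ℝ} {ut : Family m (L2 P.Ω)}
    (ht : IsParOApprox P V lamt ut) (i i' : Fin q) (j : Fin (m i)) {v : L2 P.Ω}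
    (hv : v ∈ cluster ut i') : aForm P (ut i j) v = lamt i j * inner ℝ (ut i j) v := by
  obtain ⟨g, hg, -, he⟩ := ht
  have : cluster ut i' ≤ spanAll g := by
    rw [cluster, Submodule.span_le]
    rintro _ ⟨l, rfl⟩
    exact (he i' l).1
  exact (he i j).2.2 v (this hv)

theorem OrthonormalFamily.orthonormal_cluster {Ω : Set (E d)} {u : Family m (L2 Ω)}
    (hu : OrthonormalFamily u) (i : Fin q) : Orthonormal ℝ (u i) :=
  hu.comp (fun j => (⟨i, j⟩ : (i : Fin q) × Fin (m i))) fun j j' h => by simpa using h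

theorem OrthonormalFamily.inner_eq_zero {Ω : Set (E d)} {u : Family m (L2 Ω)}
    (hu : OrthonormalFamily u) {i k : Fin q} (hik : i ≠ k) (l : Fin (m k)) {w : L2 Ω}
    (hw : w ∈ cluster u i) : inner ℝ w (u k l) = 0 := by
  induction hw using Submodule.span_induction with
  | mem x hx =>
    obtain ⟨j, rfl⟩ := hx
    exact hu.2 (i := ⟨i, j⟩) (j := ⟨k, l⟩) (by simp [hik])
  | zero => simp
  | add x y _ _ hx hy => rw [inner_add_left, hx, hy, add_zero]
  | smul t x _ hx => rw [real_inner_smul_left, hx, mul_zero]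

/-- The `a`-orthogonal projection onto a ParO cluster exists. -/
theorem IsParOApprox.aProj_spec (hd : 1 ≤ d) (hV : V ≤ H10 P.Ω) {lamt : Family m ℝ}
    {ut : Family m (L2 P.Ω)} (ht : IsParOApprox P V lamt ut) (i : Fin q) {w : L2 P.Ω}
    (hw : w ∈ H10 P.Ω) : aProj P (cluster ut i) w ∈ cluster ut i ∧
      ∀ v ∈ cluster ut i, aForm P (w - aProj P (cluster ut i) w) v = 0 := by
  have h := P.formOn hd
  have hex : ∃ p ∈ cluster ut i, ∀ v ∈ cluster ut i, aForm P (w - p) v = 0 := by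
    have hmem : ∀ j, ut i j ∈ H10 P.Ω := fun j => hV (ht.mem i j)
    have hY : cluster ut i ≤ H10 P.Ω := (cluster_le ht.mem i).trans hV
    have ho := ht.orthonormal.orthonormal_cluster i
    have hp : ∑ j, (aForm P w (ut i j) / lamt i j) • ut i j ∈ cluster ut i :=
      Submodule.sum_mem _ fun j _ => Submodule.smul_mem _ _ (mem_cluster ut i j)
    refine ⟨_, hp, fun v hv => ?_⟩
    have hwp := sub_mem hw (hY hp)
    rw [h.symm _ hwp _ (hY hv)]
    induction hv using Submodule.span_induction with
    | mem x hx =>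
      obtain ⟨l, rfl⟩ := hx
      have hl : lamt i l ≠ 0 := by
        have h1 := h.pos _ (hmem l) (ho.ne_zero l)
        rw [ht.form_eq i i l (mem_cluster ut i l)] at h1
        exact fun h0 => by simp [h0] at h1
      rw [h.sub_right hw (hY hp) (hmem l), h.symm _ (hmem l) _ hw, ht.form_eq i i l hp,
        ho.inner_right_fintype]
      field_simp
      ring
    | zero => exact h.zero_left hwp
    | add x y hx hy hx' hy' => rw [h.add_left _ (hY hx) _ (hY hy) _ hwp, hx', hy', add_zero]
    | smul t x hx hx' => rw [h.smul_left _ _ (hY hx) _ hwp, hx', mul_zero]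
  rw [aProj, dif_pos hex]
  exact hex.choose_spec

/-- For a finite element function `w` in the `i`-th discrete cluster, the difference between the
volume terms `∑ b(w,u_kl) λ_kl u_kl` of the two estimators is `g - Q g`, where `g` is the first of
these sums, which lies in the same discrete cluster, and `Q` is the `L²` projection onto the ParO
cluster. Hence it is bounded by the distance of the clusters alone. -/
theorem norm_sum_eigen_sub_le (hd : 1 ≤ d) (hV : V ≤ H10 P.Ω) {C : ℝ} (hC0 : 0 ≤ C)
    (hC : ∀ u ∈ H10 P.Ω, ‖u‖ ≤ C * aNorm P u) {lamh lamt : Family m ℝ}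
    {uh ut : Family m (L2 P.Ω)} (hh : IsLowestDiscrete P V lamh uh)
    (ht : IsParOApprox P V lamt ut) (i : Fin q) {w : L2 P.Ω} (hw : w ∈ cluster uh i) :
    ‖∑ k, ∑ l, (inner ℝ w (uh k l) * lamh k l) • uh k l -
        ∑ k, ∑ l, (inner ℝ (aProj P (cluster ut i) w) (ut k l) * lamt k l) • ut k l‖ ≤
      C * (aNorm P (∑ l, (inner ℝ w (uh i l) * lamh i l) • uh i l) *
        distA P (cluster uh i) (cluster ut i)) := by
  have h := P.formOn hd
  have huV : ∀ i j, uh i j ∈ V := fun i j => (hh.eigenpair i j).1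
  have hX : cluster uh i ≤ H10 P.Ω := (cluster_le huV i).trans hV
  have hY : cluster ut i ≤ H10 P.Ω := (cluster_le ht.mem i).trans hV
  set g := ∑ l, (inner ℝ w (uh i l) * lamh i l) • uh i l with hg
  have hgX : g ∈ cluster uh i :=
    Submodule.sum_mem _ fun j _ => Submodule.smul_mem _ _ (mem_cluster uh i j)
  have hou := hh.orthonormal.orthonormal_cluster i
  have hot := ht.orthonormal.orthonormal_cluster i
  obtain ⟨hp, hporth⟩ := ht.aProj_spec hd hV i (hX hw)
  have hsum1 : ∑ k, ∑ l, (inner ℝ w (uh k l) * lamh k l) • uh k l = g := by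
    rw [Finset.sum_eq_single i]
    · intro k _ hk
      refine Finset.sum_eq_zero fun l _ => ?_
      rw [hh.orthonormal.inner_eq_zero hk.symm l hw, zero_mul, zero_smul]
    · simp
  -- `g` represents the functional `a(w, ·)` on `V`
  have hag : ∀ v ∈ V, aForm P w v = inner ℝ g v := by
    intro v hv
    have hwsum : w = ∑ l, inner ℝ (uh i l) w • uh i l := by
      have h1 := Submodule.mem_span_range_iff_exists_fun ℝ |>.1 hw
      obtain ⟨c, rfl⟩ := h1
      exact Finset.sum_congr rfl fun l _ => by rw [hou.inner_right_fintype]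
    conv_lhs => rw [hwsum]
    rw [h.sum_left _ _ (fun l => hV (huV i l)) (hV hv), hg, sum_inner]
    refine Finset.sum_congr rfl fun l _ => ?_
    rw [(hh.eigenpair i l).2.2 v hv, real_inner_smul_left, real_inner_comm w]
    ring
  -- as `w` and its `a`-projection have the same `a`-products with the ParO cluster, the second
  -- sum is the `L²` projection of `g`
  have hsum2 : ∑ k, ∑ l, (inner ℝ (aProj P (cluster ut i) w) (ut k l) * lamt k l) • ut k l =
      ∑ l, inner ℝ (ut i l) g • ut i l := by
    rw [Finset.sum_eq_single i]
    · refine Finset.sum_congr rfl fun l _ => ?_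
      congr 1
      rw [real_inner_comm, mul_comm, ← ht.form_eq i i l hp, h.symm _ (hV (ht.mem i l)) _ (hY hp),
        real_inner_comm, ← hag _ (ht.mem i l)]
      have := hporth _ (mem_cluster ut i l)
      rw [h.sub_left (hX hw) (hY hp) (hV (ht.mem i l))] at this
      linarith
    · intro k _ hk
      refine Finset.sum_eq_zero fun l _ => ?_
      rw [ht.orthonormal.inner_eq_zero hk.symm l hp, zero_mul, zero_smul]
    · simp
  rw [hsum1, hsum2]
  set Q := ∑ l, inner ℝ (ut i l) g • ut i l with hQ
  have hQY : Q ∈ cluster ut i :=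
    Submodule.sum_mem _ fun j _ => Submodule.smul_mem _ _ (mem_cluster ut i j)
  have horthQ : ∀ v ∈ cluster ut i, inner ℝ (g - Q) v = 0 := by
    intro v hv
    induction hv using Submodule.span_induction with
    | mem x hx =>
      obtain ⟨l, rfl⟩ := hx
      rw [real_inner_comm, inner_sub_right, hQ, hot.inner_right_fintype, sub_self]
    | zero => simp
    | add x y _ _ hx hy => rw [inner_add_right, hx, hy, add_zero]
    | smul t x _ hx => rw [real_inner_smul_right, hx, mul_zero]
  obtain ⟨hp', hporth'⟩ := ht.aProj_spec hd hV i (hX hgX)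
  -- the `L²` projection is at least as good as the `a`-projection
  have hbest : ‖g - Q‖ ≤ ‖g - aProj P (cluster ut i) g‖ := by
    have e : g - aProj P (cluster ut i) g = (g - Q) + (Q - aProj P (cluster ut i) g) := by abel
    have h1 := norm_add_sq_eq_norm_sq_add_norm_sq_of_inner_eq_zero (g - Q)
      (Q - aProj P (cluster ut i) g) (horthQ _ (sub_mem hQY hp'))
    rw [e]
    nlinarith [norm_nonneg (g - Q), norm_nonneg ((g - Q) + (Q - aProj P (cluster ut i) g)),
      mul_self_nonneg ‖Q - aProj P (cluster ut i) g‖]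
  refine hbest.trans ((hC _ (sub_mem (hX hgX) (hY hp'))).trans ?_)
  exact mul_le_mul_of_nonneg_left (aNorm_sub_le_distA hd hX hY hgX hp' hporth') hC0

/-- All three quantities on which the difference of the estimators depends are bounded by the
distance of the clusters. -/
theorem exists_paro_bound (hd : 1 ≤ d) (P : ModelProblem d) {Λ : ℝ} (hΛ : 0 < Λ) :
    ∃ C : ℝ, 0 < C ∧ ∀ V : Submodule ℝ (L2 P.Ω), V ≤ H10 P.Ω →
      ∀ (lamh lamt : Family m ℝ) (uh ut : Family m (L2 P.Ω)),
        IsLowestDiscrete P V lamh uh → IsParOApprox P V lamt ut →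
        (∀ i j, 0 < lamh i j ∧ lamh i j ≤ Λ) → ∀ (i : Fin q) (u w : L2 P.Ω), ‖u‖ = 1 →
          w = ∑ j, inner ℝ (uh i j) u • uh i j →
            w ∈ V ∧ aProj P (cluster ut i) w ∈ V ∧
            ‖w - aProj P (cluster ut i) w‖ ≤ C * distA P (cluster uh i) (cluster ut i) ∧
            ‖wgrad (w - aProj P (cluster ut i) w)‖ ≤
              C * distA P (cluster uh i) (cluster ut i) ∧
            ‖∑ k, ∑ l, (inner ℝ w (uh k l) * lamh k l) • uh k l -
                ∑ k, ∑ l, (inner ℝ (aProj P (cluster ut i) w) (ut k l) * lamt k l) • ut k l‖ ≤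
              C * distA P (cluster uh i) (cluster ut i) := by
  obtain ⟨C, hC, hCn⟩ := exists_norm_le_aNorm hd P
  refine ⟨C * √Λ + C * √(Λ ^ 3), by positivity, ?_⟩
  intro V hV lamh lamt uh ut hh ht hl i u w hu hw
  have h := P.formOn hd
  have huV : ∀ i j, uh i j ∈ V := fun i j => (hh.eigenpair i j).1
  have hX : cluster uh i ≤ H10 P.Ω := (cluster_le huV i).trans hV
  have hY : cluster ut i ≤ H10 P.Ω := (cluster_le ht.mem i).trans hV
  have hwX : w ∈ cluster uh i := by
    rw [hw]
    exact Submodule.sum_mem _ fun j _ => Submodule.smul_mem _ _ (mem_cluster uh i j)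
  obtain ⟨hp, hporth⟩ := ht.aProj_spec hd hV i (hX hwX)
  have hou := hh.orthonormal.orthonormal_cluster i
  have hbessel : ∑ j, inner ℝ (uh i j) u ^ 2 ≤ 1 := by
    have := hou.sum_inner_products_le (x := u) (s := Finset.univ)
    simpa [hu] using this
  -- the coefficients of `w` are those of `u`, and the eigenvalues are at most `Λ`
  have hwa : aNorm P w ≤ √Λ := by
    refine Real.sqrt_le_sqrt ?_
    rw [hw, (h.mono hV).self_sum_eig hou (huV i) fun l => (hh.eigenpair i l).2.2]
    calc _ ≤ ∑ j, Λ * inner ℝ (uh i j) u ^ 2 :=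
          Finset.sum_le_sum fun j _ => mul_le_mul_of_nonneg_right (hl i j).2 (sq_nonneg _)
      _ ≤ Λ := by
        rw [← Finset.mul_sum]
        nlinarith
  have hga : aNorm P (∑ l, (inner ℝ w (uh i l) * lamh i l) • uh i l) ≤ √(Λ ^ 3) := by
    refine Real.sqrt_le_sqrt ?_
    rw [(h.mono hV).self_sum_eig hou (huV i) fun l => (hh.eigenpair i l).2.2]
    calc _ ≤ ∑ j, Λ ^ 3 * inner ℝ (uh i j) u ^ 2 := by
          refine Finset.sum_le_sum fun j _ => ?_
          rw [hw, real_inner_comm, hou.inner_right_fintype]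
          have h3 : lamh i j ^ 3 ≤ Λ ^ 3 := pow_le_pow_left₀ (hl i j).1.le (hl i j).2 3
          calc _ = lamh i j ^ 3 * inner ℝ (uh i j) u ^ 2 := by ring
            _ ≤ _ := mul_le_mul_of_nonneg_right h3 (sq_nonneg _)
      _ ≤ Λ ^ 3 := by
        rw [← Finset.mul_sum]
        have : 0 < Λ ^ 3 := by positivity
        nlinarith
  have hD := distA_nonneg (P := P) (cluster uh i) (cluster ut i)
  have h1 : aNorm P (w - aProj P (cluster ut i) w) ≤
      √Λ * distA P (cluster uh i) (cluster ut i) :=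
    (aNorm_sub_le_distA hd hX hY hwX hp hporth).trans (mul_le_mul_of_nonneg_right hwa hD)
  have h2 : C * aNorm P (w - aProj P (cluster ut i) w) ≤
      (C * √Λ + C * √(Λ ^ 3)) * distA P (cluster uh i) (cluster ut i) := by
    have := mul_le_mul_of_nonneg_left h1 hC.le
    have h0 : 0 ≤ C * √(Λ ^ 3) * distA P (cluster uh i) (cluster ut i) := by positivity
    linarith
  have hsub := sub_mem (hX hwX) (hY hp)
  refine ⟨cluster_le huV i hwX, cluster_le ht.mem i hp, (hCn _ hsub).1.trans h2,
    (hCn _ hsub).2.trans h2, ?_⟩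
  refine (norm_sum_eigen_sub_le hd hV hC.le (fun u hu => (hCn u hu).1) hh ht i hwX).trans ?_
  have h3 := mul_le_mul_of_nonneg_left (mul_le_mul_of_nonneg_right hga hD) hC.le
  have h0 : 0 ≤ C * √Λ * distA P (cluster uh i) (cluster ut i) := by positivity
  linarith

end

end

section

variable {d : ℕ}

/-! ### Polynomials and inverse estimates -/

@[simp] theorem polyEval_add (p q : MvPolynomial (Fin d) ℝ) (x : E d) :
    polyEval (p + q) x = polyEval p x + polyEval q x := by simp [polyEval]

@[simp] theorem polyEval_sub (p q : MvPolynomial (Fin d) ℝ) (x : E d) :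
    polyEval (p - q) x = polyEval p x - polyEval q x := by simp [polyEval]

@[simp] theorem polyEval_smul (t : ℝ) (p : MvPolynomial (Fin d) ℝ) (x : E d) :
    polyEval (t • p) x = t * polyEval p x := by simp [polyEval, MvPolynomial.smul_eval]

@[simp] theorem polyEval_zero (x : E d) : polyEval 0 x = 0 := by simp [polyEval]

/-- The gradient of a polynomial. -/
def polyGrad (p : MvPolynomial (Fin d) ℝ) (x : E d) : E d :=
  WithLp.toLp 2 fun i => polyEval (MvPolynomial.pderiv i p) x

theorem norm_sq_polyGrad (p : MvPolynomial (Fin d) ℝ) (x : E d) :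
    ‖polyGrad p x‖ ^ 2 = ∑ i, polyEval (MvPolynomial.pderiv i p) x ^ 2 := by
  rw [EuclideanSpace.norm_sq_eq]
  simp [polyGrad]

theorem hasFDerivAt_polyEval (p : MvPolynomial (Fin d) ℝ) (x : E d) :
    HasFDerivAt (polyEval p) (innerSL ℝ (polyGrad p x)) x := by
  induction p using MvPolynomial.induction_on with
  | C a =>
    have h1 : polyEval (d := d) (MvPolynomial.C a) = fun _ => a := by
      ext y
      simp [polyEval]
    have h2 : innerSL ℝ (polyGrad (MvPolynomial.C a) x) = 0 := by
      have : polyGrad (MvPolynomial.C a) x = 0 := by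
        ext i
        simp [polyGrad]
      rw [this, map_zero]
    rw [h1, h2]
    exact hasFDerivAt_const _ _
  | add p q hp hq =>
    have h1 : polyEval (p + q) = fun y => polyEval p y + polyEval q y := by
      ext y
      simp
    have h2 : polyGrad (p + q) x = polyGrad p x + polyGrad q x := by
      ext i
      simp [polyGrad]
    rw [h1, h2, map_add]
    exact hp.add hq
  | mul_X p n hp =>
    have h1 : polyEval (p * MvPolynomial.X n) = fun y => polyEval p y * y n := by
      ext y
      simp [polyEval]
    rw [h1]
    have h3 : HasFDerivAt (fun y : E d => y n) (EuclideanSpace.proj n : E d →L[ℝ] ℝ) x :=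
      (EuclideanSpace.proj n : E d →L[ℝ] ℝ).hasFDerivAt
    refine (hp.mul h3).congr_fderiv ?_
    ext v
    simp only [add_apply, smul_apply, innerSL_apply_apply, PiLp.inner_apply, polyGrad,
      polyEval, Derivation.leibniz, MvPolynomial.pderiv_X, map_add]
    have h4 : ∀ i, v i * MvPolynomial.eval (fun i => x i) (if n = i then p else 0) =
        if n = i then v i * MvPolynomial.eval (fun i => x i) p else 0 := fun i => by
      split_ifs <;> simp
    simp [Pi.single_apply, Finset.sum_add_distrib, mul_add, Finset.mul_sum, h4, mul_left_comm,
      mul_comm]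

theorem gradient_polyEval (p : MvPolynomial (Fin d) ℝ) : gradient (polyEval p) = polyGrad p := by
  ext1 x
  refine HasGradientAt.gradient ?_
  rw [hasGradientAt_iff_hasFDerivAt]
  exact hasFDerivAt_polyEval p x

theorem continuous_polyEval (p : MvPolynomial (Fin d) ℝ) : Continuous (polyEval p) :=
  (MvPolynomial.continuous_eval p).comp (PiLp.continuous_ofLp 2 _)

theorem continuous_polyGrad (p : MvPolynomial (Fin d) ℝ) : Continuous (polyGrad p) :=
  (PiLp.continuous_toLp 2 _).comp (continuous_pi fun _ => continuous_polyEval _)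

theorem contDiff_polyEval (p : MvPolynomial (Fin d) ℝ) : ContDiff ℝ 1 (polyEval p) := by
  rw [contDiff_one_iff_hasFDerivAt]
  exact ⟨_, (innerSL ℝ).continuous.comp (continuous_polyGrad p), hasFDerivAt_polyEval p⟩

theorem totalDegree_pderiv_le (i : Fin d) (p : MvPolynomial (Fin d) ℝ) :
    (MvPolynomial.pderiv i p).totalDegree ≤ p.totalDegree := by
  conv_lhs => rw [p.as_sum, map_sum]
  refine MvPolynomial.totalDegree_finsetSum_le fun s hs => ?_
  rw [MvPolynomial.pderiv_monomial]
  refine (MvPolynomial.totalDegree_monomial_le _ _).trans ?_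
  refine le_trans ?_ (MvPolynomial.le_totalDegree hs)
  have h : s - Finsupp.single i 1 ≤ s := tsub_le_self
  exact Finsupp.degree_mono h

/-- Polynomials of degree at most `k` are invariant under scaling and translation. -/
theorem exists_scaled_poly (p : MvPolynomial (Fin d) ℝ) (x : E d) (r : ℝ) :
    ∃ p' : MvPolynomial (Fin d) ℝ, p'.totalDegree ≤ p.totalDegree ∧
      ∀ y, polyEval p' y = polyEval p (x + r • y) := by
  let f : Fin d → MvPolynomial (Fin d) ℝ := fun i =>
    MvPolynomial.C (x i) + MvPolynomial.C r * MvPolynomial.X i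
  have hf : ∀ i, (f i).totalDegree ≤ 1 := by
    intro i
    refine (MvPolynomial.totalDegree_add _ _).trans (max_le (by simp) ?_)
    refine (MvPolynomial.totalDegree_mul _ _).trans ?_
    simp
  refine ⟨MvPolynomial.aeval f p, ?_, fun y => ?_⟩
  · conv_lhs => rw [p.as_sum, map_sum]
    refine MvPolynomial.totalDegree_finsetSum_le fun s hs => ?_
    rw [MvPolynomial.aeval_monomial]
    refine (MvPolynomial.totalDegree_mul _ _).trans ?_
    rw [MvPolynomial.algebraMap_eq, MvPolynomial.totalDegree_C, zero_add]
    refine le_trans ?_ (MvPolynomial.le_totalDegree hs)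
    rw [Finsupp.prod, Finsupp.sum]
    refine (MvPolynomial.totalDegree_finsetProd _ _).trans (Finset.sum_le_sum fun i _ => ?_)
    refine (MvPolynomial.totalDegree_pow _ _).trans ?_
    exact (Nat.mul_le_mul_left _ (hf i)).trans (by simp)
  · rw [polyEval, polyEval, MvPolynomial.aeval_def, ← MvPolynomial.eval₂_id,
      MvPolynomial.algebraMap_eq]
    induction p using MvPolynomial.induction_on with
    | C a => simp
    | add p q hp hq => simp [hp, hq]
    | mul_X p n hp => simp [hp, f]

/-- A polynomial that vanishes on an open set is zero as a formal polynomial. -/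
theorem poly_eq_zero_of_eqOn_nhds {p : MvPolynomial (Fin d) ℝ} {x : E d}
    (h : ∀ᶠ y in 𝓝 x, polyEval p y = 0) : p = 0 := by
  have h1 : ∀ᶠ z in 𝓝 x.ofLp, polyEval p (WithLp.toLp 2 z) = 0 :=
    (PiLp.continuous_toLp 2 (fun _ : Fin d => ℝ)).continuousAt.eventually h
  obtain ⟨ε, hε, hb⟩ := Metric.eventually_nhds_iff_ball.1 h1
  refine MvPolynomial.funext_set (fun i => Metric.ball (x i) ε) (fun i => ?_) fun z hz => ?_
  · rw [Real.ball_eq_Ioo]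
    exact Ioo_infinite (by linarith)
  · rw [map_zero]
    exact hb z (by rw [ball_pi _ hε]; exact hz)

/-- On a finite-dimensional space every seminorm is bounded by every norm. -/
theorem exists_norm_le_of_injective {F G G' : Type*} [AddCommGroup F] [Module ℝ F]
    [FiniteDimensional ℝ F] [NormedAddCommGroup G] [NormedSpace ℝ G] [NormedAddCommGroup G']
    [NormedSpace ℝ G'] (ι : F →ₗ[ℝ] G) (hι : Function.Injective ι) (J : F →ₗ[ℝ] G') :
    ∃ C : ℝ, 0 < C ∧ ∀ p, ‖J p‖ ≤ C * ‖ι p‖ := by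
  let e := LinearEquiv.ofInjective ι hι
  let L : LinearMap.range ι →L[ℝ] G' := LinearMap.toContinuousLinearMap (J ∘ₗ e.symm.toLinearMap)
  refine ⟨‖L‖ + 1, by positivity, fun p => ?_⟩
  have h1 : J p = L (e p) := by simp [L]
  have h2 : ‖(e p : LinearMap.range ι)‖ = ‖ι p‖ := rfl
  rw [h1, ← h2]
  exact (L.le_opNorm _).trans (by gcongr; linarith)

/-- The restriction of polynomials to a compact set. -/
def polyRestrict (K : Set (E d)) : MvPolynomial (Fin d) ℝ →ₗ[ℝ] C(K, ℝ) where
  toFun p := ⟨fun x => polyEval p x, (continuous_polyEval p).comp continuous_subtype_val⟩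
  map_add' p q := by ext; simp
  map_smul' t p := by ext; simp

theorem memLp_polyEval {K : Set (E d)} (hK : IsCompact K) (p : MvPolynomial (Fin d) ℝ) :
    MemLp (polyEval p) 2 (volume.restrict K) := by
  have : IsFiniteMeasure ((volume : Measure (E d)).restrict K) :=
    ⟨by rw [Measure.restrict_apply_univ]; exact hK.measure_lt_top⟩
  obtain ⟨C, hC⟩ := hK.exists_bound_of_continuousOn (continuous_polyEval p).continuousOn
  refine MemLp.of_bound (continuous_polyEval p).aestronglyMeasurable C ?_
  exact (ae_restrict_iff' hK.measurableSet).2 (ae_of_all _ hC)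

/-- Polynomials as square integrable functions on a compact set. -/
def polyToLp {K : Set (E d)} (hK : IsCompact K) :
    MvPolynomial (Fin d) ℝ →ₗ[ℝ] Lp ℝ 2 (volume.restrict K) where
  toFun p := (memLp_polyEval hK p).toLp
  map_add' p q := by
    rw [← MemLp.toLp_add]
    congr 1
    ext
    simp
  map_smul' t p := by
    rw [RingHom.id_apply, ← MemLp.toLp_const_smul]
    congr 1
    ext
    simp

theorem norm_sq_polyToLp {K : Set (E d)} (hK : IsCompact K) (p : MvPolynomial (Fin d) ℝ) :
    ‖polyToLp hK p‖ ^ 2 = ∫ x in K, polyEval p x ^ 2 := by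
  rw [ModelProblem.norm_sq_L2]
  refine integral_congr_ae ?_
  filter_upwards [(memLp_polyEval hK p).coeFn_toLp] with x hx
  rw [← hx]
  rfl

/-- On the finite-dimensional space of polynomials of degree at most `k` the `L²` norm on the unit
ball bounds the values and the derivatives on any ball. -/
theorem exists_inverse_estimate_unit (d k : ℕ) (R : ℝ) : ∃ C : ℝ, 0 < C ∧
    ∀ p : MvPolynomial (Fin d) ℝ, p.totalDegree ≤ k → ∀ x ∈ Metric.closedBall (0 : E d) R,
      polyEval p x ^ 2 ≤ C * ∫ y in Metric.closedBall (0 : E d) 1, polyEval p y ^ 2 ∧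
      ∀ i, polyEval (MvPolynomial.pderiv i p) x ^ 2 ≤
        C * ∫ y in Metric.closedBall (0 : E d) 1, polyEval p y ^ 2 := by
  have hK : IsCompact (Metric.closedBall (0 : E d) R) := isCompact_closedBall _ _
  have hB : IsCompact (Metric.closedBall (0 : E d) 1) := isCompact_closedBall _ _
  have : CompactSpace (Metric.closedBall (0 : E d) R) := isCompact_iff_compactSpace.1 hK
  let F := MvPolynomial.restrictTotalDegree (Fin d) ℝ k
  let ι : F →ₗ[ℝ] Lp ℝ 2 (volume.restrict (Metric.closedBall (0 : E d) 1)) :=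
    polyToLp hB ∘ₗ F.subtype
  have hι : Function.Injective ι := by
    rw [← LinearMap.ker_eq_bot, LinearMap.ker_eq_bot']
    rintro ⟨p, hp⟩ h0
    have h1 : polyEval p =ᵐ[volume.restrict (Metric.closedBall (0 : E d) 1)] 0 := by
      have h2 : polyToLp hB p = 0 := h0
      refine (memLp_polyEval hB p).coeFn_toLp.symm.trans ?_
      have h3 : (memLp_polyEval hB p).toLp = 0 := h2
      rw [h3]
      exact Lp.coeFn_zero _ _ _
    have h2 : polyEval p =ᵐ[volume.restrict (Metric.ball (0 : E d) 1)] 0 :=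
      ae_restrict_of_ae_restrict_of_subset Metric.ball_subset_closedBall h1
    have h3 := Measure.eqOn_open_of_ae_eq h2 Metric.isOpen_ball
      (continuous_polyEval p).continuousOn continuousOn_const
    have h4 : p = 0 := poly_eq_zero_of_eqOn_nhds (x := 0)
      (Filter.eventually_of_mem (Metric.ball_mem_nhds 0 one_pos) fun y hy => h3 hy)
    exact Subtype.ext h4
  obtain ⟨C₀, hC₀, h₀⟩ := exists_norm_le_of_injective ι hι (polyRestrict _ ∘ₗ F.subtype :
    F →ₗ[ℝ] C(Metric.closedBall (0 : E d) R, ℝ))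
  have hder := fun i => exists_norm_le_of_injective ι hι
    (polyRestrict _ ∘ₗ (MvPolynomial.pderiv i).toLinearMap ∘ₗ F.subtype :
      F →ₗ[ℝ] C(Metric.closedBall (0 : E d) R, ℝ))
  choose C₁ hC₁ h₁ using hder
  set C := C₀ + ∑ i, C₁ i with hC
  have hC0 : 0 < C := add_pos_of_pos_of_nonneg hC₀ (Finset.sum_nonneg fun i _ => (hC₁ i).le)
  have hle₀ : C₀ ≤ C := le_add_of_nonneg_right (Finset.sum_nonneg fun i _ => (hC₁ i).le)
  have hle₁ : ∀ i, C₁ i ≤ C := fun i =>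
    (Finset.single_le_sum (fun i _ => (hC₁ i).le) (Finset.mem_univ i)).trans
      (le_add_of_nonneg_left hC₀.le)
  have hsq : ∀ (t : ℝ) (p : F), |t| ≤ C * ‖ι p‖ →
      t ^ 2 ≤ C ^ 2 * ∫ y in Metric.closedBall (0 : E d) 1, polyEval p.1 y ^ 2 := by
    intro t p ht
    rw [← norm_sq_polyToLp hB, ← sq_abs, ← mul_pow]
    exact pow_le_pow_left₀ (abs_nonneg _) ht 2
  refine ⟨C ^ 2, by positivity, fun p hp x hx => ?_⟩
  let p' : F := ⟨p, (MvPolynomial.mem_restrictTotalDegree _ _ _).2 hp⟩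
  refine ⟨hsq _ p' ?_, fun i => hsq _ p' ?_⟩
  · refine le_trans ?_ ((h₀ p').trans (mul_le_mul_of_nonneg_right hle₀ (norm_nonneg _)))
    exact ContinuousMap.norm_coe_le_norm (polyRestrict (Metric.closedBall (0 : E d) R) p) ⟨x, hx⟩
  · refine le_trans ?_ ((h₁ i p').trans (mul_le_mul_of_nonneg_right (hle₁ i) (norm_nonneg _)))
    exact ContinuousMap.norm_coe_le_norm (polyRestrict (Metric.closedBall (0 : E d) R)
      (MvPolynomial.pderiv i p)) ⟨x, hx⟩

/-- The inverse estimates for polynomials on balls, with their scaling behaviour. -/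
theorem exists_inverse_estimate (d k : ℕ) (R : ℝ) : ∃ C : ℝ, 0 < C ∧
    ∀ p : MvPolynomial (Fin d) ℝ, p.totalDegree ≤ k → ∀ (x₀ : E d) (r : ℝ), 0 < r →
      ∀ x ∈ Metric.closedBall x₀ (R * r),
      r ^ d * polyEval p x ^ 2 ≤ C * ∫ y in Metric.closedBall x₀ r, polyEval p y ^ 2 ∧
      ∀ i, r ^ (d + 2) * polyEval (MvPolynomial.pderiv i p) x ^ 2 ≤
        C * ∫ y in Metric.closedBall x₀ r, polyEval p y ^ 2 := by
  obtain ⟨C, hC, h⟩ := exists_inverse_estimate_unit d k R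
  refine ⟨C, hC, fun p hp x₀ r hr x hx => ?_⟩
  obtain ⟨p', hp', he⟩ := exists_scaled_poly p x₀ r
  -- the integral over the unit ball scales like `r ^ (-d)`
  have hint : r ^ d * ∫ y in Metric.closedBall (0 : E d) 1, polyEval p' y ^ 2 =
      ∫ y in Metric.closedBall x₀ r, polyEval p y ^ 2 := by
    simp only [he]
    rw [Measure.setIntegral_comp_smul_of_pos volume (fun z => polyEval p (x₀ + z) ^ 2) _ hr,
      smul_unitClosedBall_of_nonneg hr.le, finrank_euclideanSpace_fin, smul_eq_mul,
      mul_inv_cancel_left₀ (by positivity)]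
    have hmp := measurePreserving_add_left (volume : Measure (E d)) x₀
    have hpre : (x₀ + ·) ⁻¹' Metric.closedBall x₀ r = Metric.closedBall 0 r := by
      ext z
      simp
    rw [← hpre]
    exact hmp.setIntegral_preimage_emb (measurableEmbedding_addLeft x₀)
      (fun z => polyEval p z ^ 2) _
  have hxy : x₀ + r • (r⁻¹ • (x - x₀)) = x := by
    rw [smul_smul, mul_inv_cancel₀ hr.ne', one_smul, add_sub_cancel]
  have hy : r⁻¹ • (x - x₀) ∈ Metric.closedBall (0 : E d) R := by
    rw [mem_closedBall_zero_iff, norm_smul, norm_inv, Real.norm_of_nonneg hr.le,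
      inv_mul_le_iff₀ hr, mul_comm, ← dist_eq_norm]
    exact hx
  obtain ⟨h0, h1⟩ := h p' (hp'.trans hp) _ hy
  rw [he, hxy] at h0
  -- a derivative scales like `r`
  have hder : ∀ i, polyEval (MvPolynomial.pderiv i p') (r⁻¹ • (x - x₀)) =
      r * polyEval (MvPolynomial.pderiv i p) x := by
    have h2 := hasFDerivAt_polyEval p' (r⁻¹ • (x - x₀))
    have h3 : HasFDerivAt (polyEval p) (innerSL ℝ (polyGrad p x)) (x₀ + r • (r⁻¹ • (x - x₀))) := by
      rw [hxy]
      exact hasFDerivAt_polyEval p x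
    have h4 : HasFDerivAt (fun y : E d => x₀ + r • y) (r • ContinuousLinearMap.id ℝ (E d))
        (r⁻¹ • (x - x₀)) := ((hasFDerivAt_id _).const_smul r).const_add x₀
    have h5 : HasFDerivAt (polyEval p')
        ((innerSL ℝ (polyGrad p x)).comp (r • ContinuousLinearMap.id ℝ (E d)))
        (r⁻¹ • (x - x₀)) := by
      have : polyEval p' = polyEval p ∘ fun y : E d => x₀ + r • y := funext he
      rw [this]
      exact HasFDerivAt.comp _ h3 h4
    intro i
    have h6 := DFunLike.congr_fun (h2.unique h5) (EuclideanSpace.single i 1)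
    simpa [polyGrad, EuclideanSpace.inner_single_right] using h6
  constructor
  · calc _ ≤ r ^ d * (C * ∫ y in Metric.closedBall (0 : E d) 1, polyEval p' y ^ 2) := by gcongr
      _ = _ := by rw [← hint]; ring
  · intro i
    have h7 := h1 i
    rw [hder] at h7
    calc _ = r ^ d * (r * polyEval (MvPolynomial.pderiv i p) x) ^ 2 := by ring
      _ ≤ r ^ d * (C * ∫ y in Metric.closedBall (0 : E d) 1, polyEval p' y ^ 2) := by gcongr
      _ = _ := by rw [← hint]; ring

end

section

variable {d : ℕ}

/-! ### Simplices and conforming meshes -/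

theorem isCompact_hull (T : Finset (E d)) : IsCompact (hull T) :=
  T.finite_toSet.isCompact_convexHull ℝ

theorem isClosed_hull (T : Finset (E d)) : IsClosed (hull T) := (isCompact_hull T).isClosed

theorem measurableSet_hull (T : Finset (E d)) : MeasurableSet (hull T) :=
  (isClosed_hull T).measurableSet

theorem convex_hull (T : Finset (E d)) : Convex ℝ (hull T) := convex_convexHull ℝ _

theorem hull_mono {S T : Finset (E d)} (h : S ⊆ T) : hull S ⊆ hull T :=
  convexHull_mono (Finset.coe_subset.2 h)

theorem mem_hull {T : Finset (E d)} {x : E d} (h : x ∈ T) : x ∈ hull T :=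
  subset_convexHull ℝ _ h

theorem ae_mem_interior_hull (T : Finset (E d)) :
    ∀ᵐ x ∂(volume : Measure (E d)), x ∈ hull T → x ∈ interior (hull T) := by
  have h0 := (convex_hull T).addHaar_frontier volume
  have : ∀ᵐ x ∂(volume : Measure (E d)), x ∉ frontier (hull T) := measure_eq_zero_iff_ae_notMem.1 h0
  filter_upwards [this] with x hx hxT
  by_contra h
  exact hx ⟨subset_closure hxT, h⟩

theorem restrict_hull_eq_interior (T : Finset (E d)) :
    (volume : Measure (E d)).restrict (hull T) = volume.restrict (interior (hull T)) := by
  refine Measure.restrict_congr_set ?_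
  filter_upwards [ae_mem_interior_hull T] with x hx
  exact propext ⟨hx, fun h => interior_subset h⟩

/-- The hull of at most `d` points is contained in a proper affine subspace. -/
theorem volume_hull_eq_zero {e : Finset (E d)} (he : e.card ≤ d) :
    volume (hull e) = 0 := by
  have hsub : hull e ⊆ affineSpan ℝ (e : Set (E d)) := convexHull_subset_affineSpan _
  refine measure_mono_null hsub (Measure.addHaar_affineSubspace volume _ fun htop => ?_)
  rcases e.eq_empty_or_nonempty with rfl | hne
  · simp at htop
  have h1 : vectorSpan ℝ (e : Set (E d)) = ⊤ := by
    rw [← direction_affineSpan, htop, AffineSubspace.direction_top]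
  have hc : e.card = (e.card - 1) + 1 := by
    have := hne.card_pos
    omega
  classical
  have h2 := finrank_vectorSpan_image_finset_le ℝ (id : E d → E d) e hc
  rw [Finset.image_id] at h2
  rw [h1, finrank_top, finrank_euclideanSpace_fin] at h2
  have := hne.card_pos
  omega

namespace IsSimplex
variable {T : Finset (E d)}

theorem affineSpan_eq_top (h : IsSimplex T) :
    affineSpan ℝ (range ((↑) : T → E d)) = ⊤ := by
  rw [h.2.affineSpan_eq_top_iff_card_eq_finrank_add_one]
  simp [h.1]

/-- The barycentric coordinate system of a simplex. -/
def basis (h : IsSimplex T) : AffineBasis T ℝ (E d) := ⟨(↑), h.2, h.affineSpan_eq_top⟩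

@[simp] theorem basis_apply (h : IsSimplex T) (z : T) : h.basis z = z := rfl

theorem hull_eq (h : IsSimplex T) : hull T = convexHull ℝ (range h.basis) := by
  rw [hull]
  congr 1
  ext x
  simp

theorem mem_interior_iff (h : IsSimplex T) {x : E d} :
    x ∈ interior (hull T) ↔ ∀ z, 0 < h.basis.coord z x := by
  rw [h.hull_eq, h.basis.interior_convexHull]
  rfl

theorem interior_nonempty (h : IsSimplex T) : (interior (hull T)).Nonempty := by
  rw [h.hull_eq]
  exact ⟨_, h.basis.centroid_mem_interior_convexHull⟩

/-- Two affine functions that agree at the vertices are equal. -/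
theorem affineMap_ext (h : IsSimplex T) {f g : E d →ᵃ[ℝ] ℝ} (hfg : ∀ z ∈ T, f z = g z) : f = g := by
  ext x
  have hx : x ∈ affineSpan ℝ (range ((↑) : T → E d)) := by
    rw [h.affineSpan_eq_top]
    trivial
  refine affineSpan_induction (p := fun x => f x = g x) hx ?_ fun c u v w hu hv hw => ?_
  · rintro _ ⟨z, rfl⟩
    exact hfg z z.2
  · have hl : ∀ f : E d →ᵃ[ℝ] ℝ, f (c • (u -ᵥ v) +ᵥ w) = c * (f u - f v) + f w := fun f => by
      rw [f.map_vadd, map_smul, f.linearMap_vsub]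
      rfl
    rw [hl, hl, hu, hv, hw]

end IsSimplex

theorem affineMap_centroid (f : E d →ᵃ[ℝ] ℝ) {s : Finset (E d)} (hs : s.Nonempty) :
    f ((s.card : ℝ)⁻¹ • ∑ y ∈ s, y) = (s.card : ℝ)⁻¹ * ∑ y ∈ s, f y := by
  have hf : ∀ x, f x = f.linear x + f 0 := fun x => by
    have := f.map_vadd 0 x
    simpa using this
  have hc : (s.card : ℝ) ≠ 0 := by exact_mod_cast hs.card_pos.ne'
  rw [hf, map_smul, map_sum, Finset.sum_congr rfl fun y _ => hf y, Finset.sum_add_distrib,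
    Finset.sum_const, nsmul_eq_mul, mul_add, inv_mul_cancel_left₀ hc, smul_eq_mul]

theorem affineMap_lineMap (f : E d →ᵃ[ℝ] ℝ) (x y : E d) (t : ℝ) :
    f (AffineMap.lineMap x y t) = (1 - t) * f x + t * f y := by
  rw [AffineMap.apply_lineMap, AffineMap.lineMap_apply_ring']
  ring

section Overlap
open Classical
variable {A B : Finset (E d)}

/-- Two simplices with a common face overlap if they lie on the same side of it. -/
theorem IsSimplex.interior_inter_nonempty (hd : 1 ≤ d) (hA : IsSimplex A) (hB : IsSimplex B)
    {a b : E d} (ha : a ∈ A) (hb : b ∈ B) (hab : A.erase a = B.erase b)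
    (hpos : 0 < hA.basis.coord ⟨a, ha⟩ b) :
    (interior (hull A) ∩ interior (hull B)).Nonempty := by
  set e := A.erase a with he
  have hecard : e.card = d := by rw [he, Finset.card_erase_of_mem ha, hA.1]; rfl
  have hne : e.Nonempty := Finset.card_pos.1 (by omega)
  set c : E d := (e.card : ℝ)⁻¹ • ∑ y ∈ e, y with hc
  have hcinv : (0 : ℝ) < (e.card : ℝ)⁻¹ := by
    have := hne.card_pos
    positivity
  -- the barycentric coordinates of the centroid of the face
  have hcoord : ∀ {S : Finset (E d)} (hS : IsSimplex S) (z : S), e ⊆ S →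
      hS.basis.coord z c = if (z : E d) ∈ e then (e.card : ℝ)⁻¹ else 0 := by
    intro S hS z heS
    rw [hc, affineMap_centroid _ hne]
    have h1 : ∀ y ∈ e, hS.basis.coord z y = if (z : E d) = y then 1 else 0 := by
      intro y hy
      have := hS.basis.coord_apply z ⟨y, heS hy⟩
      simpa [Subtype.ext_iff] using this
    rw [Finset.sum_congr rfl h1, Finset.sum_ite_eq]
    simp
  -- points on the segment from the centroid `c` of the face to `b`, close to `c`, are interior to
  -- both simplices
  have hA' : ∀ z : A, (z : E d) ∉ e → z = ⟨a, ha⟩ := fun z hz => by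
    by_contra hne
    exact hz (Finset.mem_erase.2 ⟨fun h => hne (Subtype.ext h), z.2⟩)
  have hB' : ∀ z : B, (z : E d) ∉ e → z = ⟨b, hb⟩ := fun z hz => by
    by_contra hne
    rw [hab] at hz
    exact hz (Finset.mem_erase.2 ⟨fun h => hne (Subtype.ext h), z.2⟩)
  have heA : e ⊆ A := Finset.erase_subset _ _
  have heB : e ⊆ B := by rw [hab]; exact Finset.erase_subset _ _
  have hev : ∀ᶠ t in 𝓝[>] (0 : ℝ), ∀ z : A, 0 < hA.basis.coord z (AffineMap.lineMap c b t) := by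
    rw [eventually_all]
    intro z
    by_cases hz : (z : E d) ∈ e
    · have hcont : ContinuousAt (fun t : ℝ => (1 - t) * hA.basis.coord z c +
          t * hA.basis.coord z b) 0 := by fun_prop
      have := (continuousAt_const (y := (0 : ℝ))).eventually_lt hcont
        (by simpa [hcoord hA z heA, hz] using hne)
      filter_upwards [nhdsWithin_le_nhds this] with t ht
      rwa [affineMap_lineMap]
    · filter_upwards [self_mem_nhdsWithin] with t ht
      rw [affineMap_lineMap, hcoord hA z heA, if_neg hz, hA' z hz, mul_zero, zero_add]
      exact mul_pos ht hpos
  have hlt : ∀ᶠ t in 𝓝[>] (0 : ℝ), t < 1 := nhdsWithin_le_nhds (eventually_lt_nhds one_pos)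
  obtain ⟨t, ⟨ht, ht1⟩, ht0⟩ := ((hev.and hlt).and self_mem_nhdsWithin).exists
  have ht0 : 0 < t := ht0
  refine ⟨AffineMap.lineMap c b t, hA.mem_interior_iff.2 ht, hB.mem_interior_iff.2 fun z => ?_⟩
  rw [affineMap_lineMap, hcoord hB z heB]
  by_cases hz : (z : E d) ∈ e
  · have hzb : hB.basis.coord z b = 0 := by
      refine hB.basis.coord_apply_ne (i := z) (j := ⟨b, hb⟩) ?_
      rintro rfl
      rw [hab] at hz
      simp at hz
    rw [if_pos hz, hzb]
    have : 0 < 1 - t := by linarith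
    positivity
  · rw [if_neg hz, hB' z hz]
    have : hB.basis.coord ⟨b, hb⟩ b = 1 := hB.basis.coord_apply_eq ⟨b, hb⟩
    rw [this]
    linarith

end Overlap

namespace Mesh
variable {Ω : Set (E d)} (𝒯 : Mesh Ω)

/-- By conformity different elements meet in the hull of fewer than `d + 1` vertices. -/
theorem volume_inter_eq_zero {S T : Finset (E d)} (hS : S ∈ 𝒯.elems) (hT : T ∈ 𝒯.elems)
    (hne : S ≠ T) : volume (hull S ∩ hull T) = 0 := by
  classical
  rw [𝒯.conforming S hS T hT, ← Finset.coe_inter]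
  refine volume_hull_eq_zero ?_
  have h1 : S ∩ T ⊂ S := by
    refine Finset.inter_subset_left.ssubset_of_ne fun h => hne ?_
    refine Finset.eq_of_subset_of_card_le (Finset.inter_eq_left.1 h) ?_
    rw [(𝒯.simplex S hS).1, (𝒯.simplex T hT).1]
  have h2 := Finset.card_lt_card h1
  rw [(𝒯.simplex S hS).1] at h2
  omega

theorem disjoint_interior {S T : Finset (E d)} (hS : S ∈ 𝒯.elems) (hT : T ∈ 𝒯.elems)
    (hne : S ≠ T) : Disjoint (interior (hull S)) (interior (hull T)) := by
  rw [Set.disjoint_iff_inter_eq_empty, ← interior_inter]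
  by_contra h
  have h1 := isOpen_interior.measure_pos volume (nonempty_iff_ne_empty.2 h)
  have h2 := measure_mono_null interior_subset (𝒯.volume_inter_eq_zero hS hT hne)
  exact h1.ne' h2

open Classical in
/-- An element has at most one neighbour across each of its faces. -/
theorem inter_injOn (hd : 1 ≤ d) {T : Finset (E d)} (hT : T ∈ 𝒯.elems) :
    InjOn (fun S => S ∩ T) (𝒯.neighbors T : Set (Finset (E d))) := by
  intro S hS S' hS' heq
  have heq : S ∩ T = S' ∩ T := heq
  simp only [neighbors, Finset.coe_filter, mem_ofPred_eq] at hS hS'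
  obtain ⟨hSm, hST, hSc⟩ := hS
  obtain ⟨hSm', hST', hSc'⟩ := hS'
  by_contra hne
  -- the vertex of an element opposite to the common face
  have hopp : ∀ {R : Finset (E d)}, R ∈ 𝒯.elems → S ∩ T ⊆ R → ∃ z ∈ R, R.erase z = S ∩ T := by
    intro R hR hsub
    have hc := (𝒯.simplex R hR).1
    obtain ⟨z, hz, hz'⟩ := Finset.exists_mem_notMem_of_card_lt_card
      (s := S ∩ T) (t := R) (by omega)
    refine ⟨z, hz, (Finset.eq_of_subset_of_card_le (fun y hy => ?_) ?_).symm⟩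
    · exact Finset.mem_erase.2 ⟨fun h => hz' (h ▸ hy), hsub hy⟩
    · rw [Finset.card_erase_of_mem hz]
      omega
  obtain ⟨z, hz, hze⟩ := hopp hSm Finset.inter_subset_left
  obtain ⟨z', hz', hze'⟩ := hopp hSm' (heq ▸ Finset.inter_subset_left)
  obtain ⟨t, ht, hte⟩ := hopp hT Finset.inter_subset_right
  have hsT := 𝒯.simplex T hT
  have hsS := 𝒯.simplex S hSm
  have hsS' := 𝒯.simplex S' hSm'
  -- `f` vanishes on the common face and is positive on the side of `T`
  set f := hsT.basis.coord ⟨t, ht⟩ with hf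
  have hfe : ∀ y ∈ S ∩ T, f y = 0 := by
    intro y hy
    have hyT : y ∈ T := (Finset.mem_inter.1 hy).2
    refine hsT.basis.coord_apply_ne (i := ⟨t, ht⟩) (j := ⟨y, hyT⟩) ?_
    rintro h
    have : t = y := congrArg Subtype.val h
    subst this
    rw [← hte] at hy
    simp at hy
  have hft : f t = 1 := hsT.basis.coord_apply_eq ⟨t, ht⟩
  have hov : ∀ {A B : Finset (E d)}, A ∈ 𝒯.elems → B ∈ 𝒯.elems → A ≠ B →
      ¬ (interior (hull A) ∩ interior (hull B)).Nonempty := fun hA hB hAB h =>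
    h.ne_empty (Set.disjoint_iff_inter_eq_empty.1 (𝒯.disjoint_interior hA hB hAB))
  -- hence every neighbour across the face lies on the negative side, and two of them overlap
  have hneg : ∀ {R : Finset (E d)} (hR : R ∈ 𝒯.elems), R ≠ T → ∀ y ∈ R, R.erase y = S ∩ T →
      f y < 0 := by
    intro R hR hRT y hy hye
    rcases lt_trichotomy (f y) 0 with h | h | h
    · exact h
    · exfalso
      have h0 : f = 0 := (𝒯.simplex R hR).affineMap_ext fun x hx => by
        by_cases hxy : x = y
        · rw [hxy, h]; rfl
        · rw [hfe x (hye ▸ Finset.mem_erase.2 ⟨hxy, hx⟩)]; rfl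
      rw [h0] at hft
      simp at hft
    · exact (hov hT hR hRT.symm
        (hsT.interior_inter_nonempty hd (𝒯.simplex R hR) ht hy (hte.trans hye.symm) h)).elim
  have hz0 := hneg hSm hST z hz hze
  have hz0' := hneg hSm' hST' z' hz' hze'
  have hfg : f = f z • hsS.basis.coord ⟨z, hz⟩ := hsS.affineMap_ext fun x hx => by
    by_cases hxz : x = z
    · subst hxz
      have : hsS.basis.coord ⟨x, hz⟩ x = 1 := hsS.basis.coord_apply_eq ⟨x, hz⟩
      simp [this]
    · have h0 : hsS.basis.coord ⟨z, hz⟩ x = 0 :=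
        hsS.basis.coord_apply_ne (i := ⟨z, hz⟩) (j := ⟨x, hx⟩)
          fun h => hxz (congrArg Subtype.val h).symm
      rw [hfe x (hze ▸ Finset.mem_erase.2 ⟨hxz, hx⟩)]
      simp [h0]
  have hpos : 0 < hsS.basis.coord ⟨z, hz⟩ z' := by
    have h1 : f z' = f z * hsS.basis.coord ⟨z, hz⟩ z' := by
      conv_lhs => rw [hfg]
      rfl
    rw [h1] at hz0'
    exact pos_of_mul_neg_right hz0' hz0.le
  exact hov hSm hSm' hne (hsS.interior_inter_nonempty hd hsS' hz hz' (hze.trans hze'.symm) hpos)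

theorem card_neighbors_le (hd : 1 ≤ d) {T : Finset (E d)} (hT : T ∈ 𝒯.elems) :
    (𝒯.neighbors T).card ≤ d + 1 := by
  classical
  have h1 : (𝒯.neighbors T).card ≤ (T.powersetCard d).card := by
    refine Finset.card_le_card_of_injOn (fun S => S ∩ T) (fun S hS => ?_) ?_
    · have := (Finset.mem_filter.1 hS).2.2
      refine Finset.mem_coe.2 (Finset.mem_powersetCard.2 ⟨Finset.inter_subset_right, ?_⟩)
      convert! this
    · convert! 𝒯.inter_injOn hd hT
  rw [Finset.card_powersetCard, (𝒯.simplex T hT).1, Nat.choose_succ_self_right] at h1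
  exact h1

theorem mem_neighbors_comm {S T : Finset (E d)} (hS : S ∈ 𝒯.elems) (hT : T ∈ 𝒯.elems) :
    S ∈ 𝒯.neighbors T ↔ T ∈ 𝒯.neighbors S := by
  simp only [neighbors, Finset.mem_filter, hS, hT, true_and]
  rw [Finset.inter_comm, ne_comm]

/-- Sums over all pairs of neighbours are bounded by sums over the elements. -/
theorem sum_neighbors_le (hd : 1 ≤ d) {X : Finset (E d) → ℝ} (hX : ∀ T ∈ 𝒯.elems, 0 ≤ X T) :
    ∑ T ∈ 𝒯.elems, ∑ S ∈ 𝒯.neighbors T, (X T + X S) ≤ 2 * (d + 1) * ∑ T ∈ 𝒯.elems, X T := by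
  classical
  have h1 : ∑ T ∈ 𝒯.elems, ∑ S ∈ 𝒯.neighbors T, X T ≤ (d + 1) * ∑ T ∈ 𝒯.elems, X T := by
    rw [Finset.mul_sum]
    refine Finset.sum_le_sum fun T hT => ?_
    rw [Finset.sum_const, nsmul_eq_mul]
    refine mul_le_mul_of_nonneg_right ?_ (hX T hT)
    exact_mod_cast 𝒯.card_neighbors_le hd hT
  have h2 : ∑ T ∈ 𝒯.elems, ∑ S ∈ 𝒯.neighbors T, X S =
      ∑ T ∈ 𝒯.elems, ∑ S ∈ 𝒯.neighbors T, X T := by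
    refine Finset.sum_comm' fun T S => ?_
    constructor
    · rintro ⟨hT, hS⟩
      have hS' := (Finset.mem_filter.1 hS).1
      exact ⟨(𝒯.mem_neighbors_comm hS' hT).1 hS, hS'⟩
    · rintro ⟨hT, hS⟩
      have hT' := (Finset.mem_filter.1 hT).1
      exact ⟨hT', (𝒯.mem_neighbors_comm hT' hS).1 hT⟩
  simp only [Finset.sum_add_distrib]
  rw [h2]
  linarith

theorem elemDiam_nonneg (T : Finset (E d)) : 0 ≤ elemDiam T := Metric.diam_nonneg

theorem elemDiam_le_size {T : Finset (E d)} (hT : T ∈ 𝒯.elems) : elemDiam T ≤ 𝒯.size :=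
  le_ciSup (f := fun T : 𝒯.elems => elemDiam T.1) (Set.finite_range _).bddAbove ⟨T, hT⟩

theorem hull_subset_closure {T : Finset (E d)} (hT : T ∈ 𝒯.elems) : hull T ⊆ closure Ω := by
  rw [← 𝒯.cover]
  exact subset_biUnion_of_mem (u := fun T => hull T) hT

theorem subset_iUnion_hull : Ω ⊆ ⋃ T ∈ 𝒯.elems, hull T := by
  rw [𝒯.cover]
  exact subset_closure

/-- Each element of a shape regular mesh contains a ball of comparable size. -/
theorem exists_ball (hd : 1 ≤ d) {γ : ℝ} (h𝒯 : 𝒯.ShapeRegular γ) {T : Finset (E d)}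
    (hT : T ∈ 𝒯.elems) : ∃ (x : E d) (r : ℝ), 0 < r ∧ Metric.closedBall x r ⊆ hull T ∧
      r ≤ elemDiam T ∧ elemDiam T ≤ 4 * γ * r := by
  have : Nonempty (Fin d) := ⟨⟨0, hd⟩⟩
  have hs := 𝒯.simplex T hT
  set s := {δ : ℝ | ∃ (x : E d) (r : ℝ), 0 < r ∧ Metric.closedBall x r ⊆ hull T ∧ δ = 2 * r}
    with hsdef
  have hle : ∀ (x : E d) (r : ℝ), 0 < r → Metric.closedBall x r ⊆ hull T →
      2 * r ≤ elemDiam T := by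
    intro x r hr hsub
    have h1 := Metric.diam_mono hsub (isCompact_hull T).isBounded
    obtain ⟨v, hv⟩ := exists_norm_eq (E d) hr.le
    have h2 : dist (x + v) (x - v) ≤ Metric.diam (Metric.closedBall x r) :=
      Metric.dist_le_diam_of_mem Metric.isBounded_closedBall (by simp [hv]) (by simp [hv])
    have h3 : dist (x + v) (x - v) = 2 * r := by
      rw [dist_eq_norm, show x + v - (x - v) = (2 : ℝ) • v by rw [two_smul]; abel, norm_smul, hv]
      norm_num
    rw [h3] at h2
    exact h2.trans h1
  have hbdd : BddAbove s := by
    refine ⟨elemDiam T, ?_⟩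
    rintro δ ⟨x, r, hr, hsub, rfl⟩
    exact hle x r hr hsub
  obtain ⟨x₀, hx₀⟩ := hs.interior_nonempty
  obtain ⟨ε, hε, hball⟩ := Metric.isOpen_iff.1 isOpen_interior x₀ hx₀
  have hmem : ε ∈ s := ⟨x₀, ε / 2, by positivity,
    ((Metric.closedBall_subset_ball (by linarith)).trans hball).trans interior_subset, by ring⟩
  have hin : 0 < inDiam T := lt_of_lt_of_le hε (le_csSup hbdd hmem)
  -- the supremum of the diameters is attained up to a factor `2`
  obtain ⟨δ, ⟨x, r, hr, hsub, rfl⟩, hδ⟩ := exists_lt_of_lt_csSup (s := s) ⟨ε, hmem⟩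
    (show inDiam T / 2 < sSup s by
      change inDiam T / 2 < inDiam T
      linarith)
  refine ⟨x, r, hr, hsub, by linarith [hle x r hr hsub], ?_⟩
  have h1 := h𝒯 T hT
  have hγ : 0 ≤ γ := le_trans (div_nonneg (elemDiam_nonneg T) hin.le) h1
  rw [div_le_iff₀ hin] at h1
  have h2 : γ * inDiam T ≤ γ * (4 * r) := mul_le_mul_of_nonneg_left (by linarith) hγ
  linarith

theorem hull_subset_closedBall {T : Finset (E d)} {x : E d} {r ρ : ℝ} (hr : 0 ≤ r)
    (hsub : Metric.closedBall x r ⊆ hull T) (hρ : elemDiam T ≤ ρ) :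
    hull T ⊆ Metric.closedBall x ρ := fun _ hy =>
  (Metric.dist_le_diam_of_mem (isCompact_hull T).isBounded hy
    (hsub (Metric.mem_closedBall_self hr))).trans hρ

end Mesh

/-! ### Faces -/

/-- The surface measure of a face is at most of the order of the corresponding power of its
diameter. -/
theorem exists_measure_face_le (d : ℕ) (hd : 1 ≤ d) : ∃ C : ℝ, 0 < C ∧ ∀ e : Finset (E d),
    e.card = d → AffineIndependent ℝ ((↑) : e → E d) →
      (μHE[d - 1] : Measure (E d)) (hull e) ≤
        ENNReal.ofReal (C * Metric.diam (hull e) ^ (d - 1)) := by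
  obtain ⟨C, hC⟩ : ∃ C : ℝ, C = (volume (Metric.ball (0 : E (d - 1)) 1)).toReal := ⟨_, rfl⟩
  have hC0 : 0 ≤ C := by rw [hC]; positivity
  refine ⟨C + 1, by positivity, fun e he hind => ?_⟩
  have hne : e.Nonempty := Finset.card_pos.1 (by omega)
  obtain ⟨p, hp⟩ := hne
  set W := vectorSpan ℝ (e : Set (E d)) with hW
  have hfr : Module.finrank ℝ W = d - 1 := by
    have := hind.finrank_vectorSpan (n := d - 1) (by simp [he]; omega)
    rwa [Subtype.range_coe_subtype, Finset.setOfPred_mem] at this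
  -- an isometric chart of the affine span of the face, with `p` at the origin
  let iso : W ≃ₗᵢ[ℝ] E (d - 1) :=
    (stdOrthonormalBasis ℝ W).repr.trans
      (LinearIsometryEquiv.piLpCongrLeft 2 ℝ ℝ (finCongr hfr))
  let f : E (d - 1) → E d := fun y => (iso.symm y : E d) + p
  have hf : Isometry f := by
    refine Isometry.of_dist_eq fun y z => ?_
    simp only [f, dist_add_right]
    rw [← Subtype.dist_eq, iso.symm.dist_map]
  set D := Metric.diam (hull e) with hD
  have hsub : hull e ⊆ f '' Metric.closedBall 0 D := by
    intro x hx
    have hxp : x - p ∈ W := by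
      have h1 : x ∈ affineSpan ℝ (e : Set (E d)) := convexHull_subset_affineSpan _ hx
      have h2 : p ∈ affineSpan ℝ (e : Set (E d)) := subset_affineSpan _ _ hp
      have := AffineSubspace.vsub_mem_direction h1 h2
      rwa [direction_affineSpan] at this
    refine ⟨iso ⟨x - p, hxp⟩, ?_, by simp [f]⟩
    rw [mem_closedBall_zero_iff, iso.norm_map, Submodule.coe_norm, ← dist_eq_norm]
    exact Metric.dist_le_diam_of_mem (isCompact_hull e).isBounded hx (mem_hull hp)
  calc (μHE[d - 1] : Measure (E d)) (hull e) ≤ μHE[d - 1] (f '' Metric.closedBall 0 D) :=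
        measure_mono hsub
    _ = ENNReal.ofReal (D ^ (d - 1)) * ENNReal.ofReal C := by
      rw [hf.euclideanHausdorffMeasure_image, EuclideanSpace.euclideanHausdorffMeasure_eq_volume,
        Measure.addHaar_closedBall _ _ Metric.diam_nonneg, finrank_euclideanSpace_fin, hC,
        ENNReal.ofReal_toReal measure_ball_lt_top.ne]
    _ ≤ ENNReal.ofReal ((C + 1) * D ^ (d - 1)) := by
      have h0 : 0 ≤ D ^ (d - 1) := pow_nonneg Metric.diam_nonneg _
      rw [← ENNReal.ofReal_mul h0]
      refine ENNReal.ofReal_le_ofReal ?_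
      linarith

theorem faceSize_nonneg (S T e : Finset (E d)) : 0 ≤ faceSize S T e := by
  rw [faceSize]
  split_ifs
  exacts [le_min (Mesh.elemDiam_nonneg _) (Mesh.elemDiam_nonneg _), Metric.diam_nonneg]

theorem faceSize_le {S T e : Finset (E d)} (h1 : e ⊆ S) (h2 : e ⊆ T) :
    faceSize S T e ≤ min (elemDiam S) (elemDiam T) := by
  rw [faceSize]
  split_ifs
  · exact le_rfl
  · exact le_min (Metric.diam_mono (hull_mono h1) (isCompact_hull S).isBounded)
      (Metric.diam_mono (hull_mono h2) (isCompact_hull T).isBounded)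

open Classical in
/-- The outward normal of a face exists, so it is a unit vector: it is the negative normalised
gradient of the barycentric coordinate of the opposite vertex. -/
theorem norm_outNormal (hd : 1 ≤ d) {T e : Finset (E d)} (hT : IsSimplex T) (he : e ⊆ T)
    (hc : e.card = d) : ‖outNormal T e‖ = 1 := by
  obtain ⟨t, ht, hte⟩ : ∃ t ∈ T, t ∉ e :=
    Finset.exists_mem_notMem_of_card_lt_card (by rw [hc, hT.1]; omega)
  have hTe : ∀ z ∈ T, z ∉ e → z = t := by
    intro z hz hze
    by_contra hne
    have : insert z (insert t e) ⊆ T :=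
      Finset.insert_subset hz (Finset.insert_subset ht he)
    have h1 := Finset.card_le_card this
    rw [Finset.card_insert_of_notMem (by simp [hne, hze]), Finset.card_insert_of_notMem hte,
      hc, hT.1] at h1
    omega
  set f := hT.basis.coord ⟨t, ht⟩ with hf
  have hfe : ∀ y ∈ e, f y = 0 := fun _ hy =>
    hT.basis.coord_apply_ne (i := ⟨t, ht⟩) (j := ⟨_, he hy⟩) (by
      intro h
      rw [Subtype.mk.injEq] at h
      exact hte (h ▸ hy))
  have hft : f t = 1 := hT.basis.coord_apply_eq ⟨t, ht⟩
  let ℓ : E d →L[ℝ] ℝ := LinearMap.toContinuousLinearMap f.linear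
  let n : E d := (InnerProductSpace.toDual ℝ (E d)).symm ℓ
  have hn : ∀ x y, inner ℝ (x - y) n = f x - f y := by
    intro x y
    rw [real_inner_comm]
    have : inner ℝ n (x - y) = f.linear (x - y) := InnerProductSpace.toDual_symm_apply
    rw [this]
    have := f.linearMap_vsub x y
    simpa using this
  obtain ⟨x, hx⟩ : e.Nonempty := Finset.card_pos.1 (by omega)
  have hn0 : n ≠ 0 := by
    intro h0
    have := hn t x
    rw [h0, hft, hfe x hx] at this
    simp at this
  have hn0' : 0 < ‖n‖ := norm_pos_iff.2 hn0
  have hex : ∃ ν : E d, ‖ν‖ = 1 ∧ (∀ x ∈ e, ∀ y ∈ e, inner ℝ (y - x) ν = 0) ∧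
      ∀ x ∈ e, ∀ z ∈ T, z ∉ e → inner ℝ (z - x) ν < 0 := by
    refine ⟨-(‖n‖⁻¹ • n), ?_, fun x hx y hy => ?_, fun x hx z hz hze => ?_⟩
    · rw [norm_neg, norm_smul, norm_inv, norm_norm, inv_mul_cancel₀ hn0'.ne']
    · rw [inner_neg_right, inner_smul_right, hn, hfe x hx, hfe y hy]
      simp
    · rw [inner_neg_right, inner_smul_right, hn, hTe z hz hze, hft, hfe x hx]
      simp [hn0]
  exact (Classical.epsilon_spec hex).1

end

section

variable {d : ℕ}

/-! ### Finite element functions -/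

section
variable {P : ModelProblem d} {𝒯 : Mesh P.Ω} {k : ℕ}

theorem Mesh.Resolves.interior_hull_subset (hR : 𝒯.Resolves P) {T : Finset (E d)}
    (hT : T ∈ 𝒯.elems) : interior (hull T) ⊆ P.Ω := by
  obtain ⟨s, hs⟩ := hR T hT
  exact hs.trans (P.piece_subset s)

theorem Mesh.Resolves.restrict_hull_le (hR : 𝒯.Resolves P) {T : Finset (E d)}
    (hT : T ∈ 𝒯.elems) : (volume : Measure (E d)).restrict (hull T) ≤ volume.restrict P.Ω := by
  rw [restrict_hull_eq_interior]
  exact Measure.restrict_mono_set _ (hR.interior_hull_subset hT)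

/-- The polynomial that represents a function on an element is unique. -/
theorem locPoly_eq (hR : 𝒯.Resolves P) {T : Finset (E d)} (hT : T ∈ 𝒯.elems) {w : L2 P.Ω}
    {p : MvPolynomial (Fin d) ℝ} (hp : p.totalDegree ≤ k)
    (h : ∀ᵐ x ∂(volume.restrict P.Ω), x ∈ hull T → w x = polyEval p x) : locPoly k w T = p := by
  have hex : ∃ p : MvPolynomial (Fin d) ℝ, p.totalDegree ≤ k ∧
      ∀ᵐ x ∂(volume.restrict P.Ω), x ∈ hull T → w x = polyEval p x := ⟨p, hp, h⟩
  rw [locPoly, dif_pos hex]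
  have h' := hex.choose_spec.2
  set p' := hex.choose
  have hae : polyEval (p' - p) =ᵐ[volume.restrict (interior (hull T))] 0 := by
    have h1 := ae_restrict_of_ae_restrict_of_subset (hR.interior_hull_subset hT) h
    have h2 := ae_restrict_of_ae_restrict_of_subset (hR.interior_hull_subset hT) h'
    filter_upwards [h1, h2, ae_restrict_mem isOpen_interior.measurableSet] with x h1 h2 h3
    rw [polyEval_sub, ← h1 (interior_subset h3), ← h2 (interior_subset h3), sub_self]
    rfl
  have hz := Measure.eqOn_open_of_ae_eq hae isOpen_interior
    (continuous_polyEval _).continuousOn continuousOn_const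
  obtain ⟨x, hx⟩ := (𝒯.simplex T hT).interior_nonempty
  exact sub_eq_zero.1 (poly_eq_zero_of_eqOn_nhds (x := x)
    (Filter.eventually_of_mem (isOpen_interior.mem_nhds hx) fun y hy => hz hy))

theorem locPoly_spec {T : Finset (E d)} (hT : T ∈ 𝒯.elems) {w : L2 P.Ω} (hw : w ∈ feSpace 𝒯 k) :
    (locPoly k w T).totalDegree ≤ k ∧
      ∀ᵐ x ∂(volume.restrict P.Ω), x ∈ hull T → w x = polyEval (locPoly k w T) x := by
  have hex : ∃ p : MvPolynomial (Fin d) ℝ, p.totalDegree ≤ k ∧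
      ∀ᵐ x ∂(volume.restrict P.Ω), x ∈ hull T → w x = polyEval p x := by
    obtain ⟨-, f, ⟨-, hf⟩, hwf⟩ := hw
    obtain ⟨p, hp, hfp⟩ := hf T hT
    refine ⟨p, hp, ?_⟩
    filter_upwards [hwf] with x hx hxT
    rw [hx, hfp x hxT]
  rw [locPoly, dif_pos hex]
  exact hex.choose_spec

theorem locPoly_add (hR : 𝒯.Resolves P) {T : Finset (E d)} (hT : T ∈ 𝒯.elems) {w v : L2 P.Ω}
    (hw : w ∈ feSpace 𝒯 k) (hv : v ∈ feSpace 𝒯 k) :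
    locPoly k (w + v) T = locPoly k w T + locPoly k v T := by
  obtain ⟨h1, h2⟩ := locPoly_spec hT hw
  obtain ⟨h3, h4⟩ := locPoly_spec hT hv
  refine locPoly_eq hR hT ((MvPolynomial.totalDegree_add _ _).trans (max_le h1 h3)) ?_
  filter_upwards [h2, h4, Lp.coeFn_add w v] with x a b c hx
  rw [c, Pi.add_apply, a hx, b hx, polyEval_add]

theorem locPoly_smul (hR : 𝒯.Resolves P) {T : Finset (E d)} (hT : T ∈ 𝒯.elems) (t : ℝ)
    {w : L2 P.Ω} (hw : w ∈ feSpace 𝒯 k) : locPoly k (t • w) T = t • locPoly k w T := by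
  obtain ⟨h1, h2⟩ := locPoly_spec hT hw
  refine locPoly_eq hR hT ((MvPolynomial.totalDegree_smul_le _ _).trans h1) ?_
  filter_upwards [h2, Lp.coeFn_smul t w] with x a c hx
  rw [c, Pi.smul_apply, a hx, polyEval_smul, smul_eq_mul]

theorem locPoly_sub (hR : 𝒯.Resolves P) {T : Finset (E d)} (hT : T ∈ 𝒯.elems) {w v : L2 P.Ω}
    (hw : w ∈ feSpace 𝒯 k) (hv : v ∈ feSpace 𝒯 k) :
    locPoly k (w - v) T = locPoly k w T - locPoly k v T := by
  have h := locPoly_add hR hT (sub_mem hw hv) hv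
  rw [sub_add_cancel] at h
  rw [h, add_sub_cancel_right]

theorem feSpace_le_H10 {Ω : Set (E d)} (𝒯 : Mesh Ω) (k : ℕ) : feSpace 𝒯 k ≤ H10 Ω :=
  fun _ hu => hu.1

/-- A subspace is finite-dimensional if finitely many maps into a finite-dimensional space, which
are linear on it, separate its points. -/
theorem finiteDimensional_of_injOn {H F κ : Type*} [AddCommGroup H] [Module ℝ H]
    [AddCommGroup F] [Module ℝ F] [Finite κ] (V : Submodule ℝ H) (W : Submodule ℝ F)
    [Module.Finite ℝ W] (Φ : H → κ → F) (hmem : ∀ w ∈ V, ∀ T, Φ w T ∈ W)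
    (hadd : ∀ w ∈ V, ∀ v ∈ V, ∀ T, Φ (w + v) T = Φ w T + Φ v T)
    (hsmul : ∀ (t : ℝ), ∀ w ∈ V, ∀ T, Φ (t • w) T = t • Φ w T)
    (hinj : ∀ w ∈ V, (∀ T, Φ w T = 0) → w = 0) : FiniteDimensional ℝ V := by
  let Ψ : V →ₗ[ℝ] (κ → W) :=
    { toFun := fun w T => ⟨Φ w T, hmem w w.2 T⟩
      map_add' := fun w v => funext fun T => Subtype.ext (hadd w w.2 v v.2 T)
      map_smul' := fun t w => funext fun T => Subtype.ext (hsmul t w w.2 T) }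
  refine FiniteDimensional.of_injective Ψ ?_
  rw [← LinearMap.ker_eq_bot, LinearMap.ker_eq_bot']
  intro w hw
  exact Subtype.ext (hinj w w.2 fun T => congrArg Subtype.val (congrFun hw T))

theorem finiteDimensional_feSpace (hR : 𝒯.Resolves P) (k : ℕ) :
    FiniteDimensional ℝ (feSpace 𝒯 k) := by
  refine finiteDimensional_of_injOn (κ := 𝒯.elems) (feSpace 𝒯 k)
    (MvPolynomial.restrictTotalDegree (Fin d) ℝ k) (fun (w : L2 P.Ω) T => locPoly k w T.1)
    (fun w hw T => (MvPolynomial.mem_restrictTotalDegree _ _ _).2 (locPoly_spec T.2 hw).1)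
    (fun w hw v hv T => locPoly_add hR T.2 hw hv) (fun t w hw T => locPoly_smul hR T.2 t hw) ?_
  intro w hw hw0
  have h0 : ∀ T ∈ 𝒯.elems, locPoly k w T = 0 := fun T hT => hw0 ⟨T, hT⟩
  have h1 : ∀ᵐ x ∂(volume.restrict P.Ω), ∀ T ∈ 𝒯.elems, x ∈ hull T → w x = 0 := by
    rw [eventually_all_finset]
    intro T hT
    filter_upwards [(locPoly_spec hT hw).2] with x hx hxT
    rw [hx hxT, h0 T hT, polyEval_zero]
  refine Lp.ext ?_
  filter_upwards [h1, ae_restrict_mem P.isOpen.measurableSet,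
    Lp.coeFn_zero ℝ 2 (volume.restrict P.Ω)] with x hx hxΩ hz
  obtain ⟨T, hT, hxT⟩ := mem_iUnion₂.1 (𝒯.subset_iUnion_hull hxΩ)
  rw [hx T hT hxT]
  exact hz.symm

/-- On an element the weak gradient is the gradient of the polynomial. -/
theorem wgrad_ae_eq_polyGrad (hR : 𝒯.Resolves P) {T : Finset (E d)} (hT : T ∈ 𝒯.elems)
    {w : L2 P.Ω} (hw : w ∈ feSpace 𝒯 k) :
    ∀ᵐ x ∂(volume.restrict (hull T)), wgrad w x = polyGrad (locPoly k w T) x := by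
  obtain ⟨hp, hae⟩ := locPoly_spec hT hw
  set p := locPoly k w T
  have hO : IsOpen (interior (hull T)) := isOpen_interior
  have hOΩ := hR.interior_hull_subset hT
  have hcont := (continuous_polyGrad p)
  have key := IsWeakGrad.ae_eq_of_test (G := wgrad w) P.isOpen hO hOΩ (F := polyGrad p)
    ((hcont.locallyIntegrable (μ := volume)).locallyIntegrableOn _) fun φ hφ => by
      have h1 := isWeakGrad_wgrad P.isOpen hw.1 φ (hφ.mono hOΩ)
      have h2 : ∫ x in P.Ω, w x • gradient φ x =
          ∫ x in interior (hull T), polyEval p x • gradient φ x := by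
        rw [setIntegral_eq_of_subset_of_forall_sdiff_eq_zero P.isOpen.measurableSet hOΩ]
        · refine integral_congr_ae ?_
          filter_upwards [ae_restrict_of_ae_restrict_of_subset hOΩ hae,
            ae_restrict_mem hO.measurableSet] with x hx hxO
          rw [hx (interior_subset hxO)]
        · intro x hx
          rw [gradient_eq_zero_of_notMem_tsupport fun h => hx.2 (hφ.2.2 h), smul_zero]
      have h3 := integral_smul_gradient_eq (contDiff_polyEval p) hφ
      rw [h2, h3, neg_inj, gradient_polyEval] at h1
      exact h1.symm
  rw [restrict_hull_eq_interior, ae_restrict_iff' hO.measurableSet]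
  exact key

end

/-! ### The coefficient on an element -/

/-- `B` extends the coefficient `A` from the interior of `T` to a Lipschitz function, and `C` bounds
its Lipschitz constant as well as its values on `T`. -/
structure IsCoeffExtension (P : ModelProblem d) (T : Finset (E d)) (C : ℝ≥0)
    (B : E d → Matrix (Fin d) (Fin d) ℝ) : Prop where
  lipschitz : ∀ i j, LipschitzWith C fun x => B x i j
  eqOn : ∀ x ∈ interior (hull T), P.A x = B x
  bound : ∀ x ∈ hull T, ∀ i j, |B x i j| ≤ C

theorem closure_interior_hull {T : Finset (E d)} (hT : IsSimplex T) :
    closure (interior (hull T)) = hull T := by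
  rw [(convex_hull T).closure_interior_eq_closure_of_nonempty_interior hT.interior_nonempty,
    (isClosed_hull T).closure_eq]

/-- The coefficient extends from each element with a bound that depends on neither the element nor
the mesh. -/
theorem exists_coeffExtension (P : ModelProblem d) : ∃ C : ℝ≥0, ∀ 𝒯 : Mesh P.Ω, 𝒯.Resolves P →
    ∀ T ∈ 𝒯.elems, ∃ B, IsCoeffExtension P T C B := by
  obtain ⟨C₀, hC₀, hb⟩ := P.exists_bound_coeff
  choose L hL using P.lipschitz
  refine ⟨⟨C₀, hC₀⟩ + ∑ s, L s, fun 𝒯 hR T hT => ?_⟩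
  obtain ⟨s, hs⟩ := hR T hT
  have hLs : L s ≤ ⟨C₀, hC₀⟩ + ∑ s, L s :=
    (Finset.single_le_sum (fun _ _ => zero_le) (Finset.mem_univ s)).trans le_add_self
  have hext : ∀ i j, ∃ g : E d → ℝ, LipschitzWith (⟨C₀, hC₀⟩ + ∑ s, L s) g ∧
      EqOn (fun x => P.A x i j) g (interior (hull T)) := fun i j =>
    (((hL s i j).mono hs).weaken hLs).extend_real
  choose g hg hge using hext
  refine ⟨fun x => Matrix.of fun i j => g i j x, fun i j => hg i j, fun x hx => ?_, ?_⟩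
  · ext i j
    exact hge i j hx
  · intro x hx i j
    rw [← closure_interior_hull (𝒯.simplex T hT)] at hx
    have hcl : IsClosed {y : E d | |g i j y| ≤ C₀} :=
      isClosed_le (hg i j).continuous.abs continuous_const
    have h1 : closure (interior (hull T)) ⊆ {y : E d | |g i j y| ≤ C₀} := by
      refine closure_minimal (fun y hy => ?_) hcl
      rw [mem_ofPred_eq, ← hge i j hy]
      exact hb s y (hs hy) i j
    refine (h1 hx).trans ?_
    have h2 : (0 : ℝ) ≤ ((∑ s, L s : ℝ≥0) : ℝ) := NNReal.coe_nonneg _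
    change C₀ ≤ C₀ + ((∑ s, L s : ℝ≥0) : ℝ)
    linarith

/-- The flux of a polynomial for the extended coefficient. -/
def polyFlux (B : E d → Matrix (Fin d) (Fin d) ℝ) (p : MvPolynomial (Fin d) ℝ) (x : E d) : E d :=
  WithLp.toLp 2 ((B x).mulVec (polyGrad p x).ofLp)

theorem polyFlux_apply (B : E d → Matrix (Fin d) (Fin d) ℝ) (p : MvPolynomial (Fin d) ℝ) (x : E d)
    (i : Fin d) :
    polyFlux B p x i = ∑ j, B x i j * polyEval (MvPolynomial.pderiv j p) x := rfl

theorem polyFlux_sub (B : E d → Matrix (Fin d) (Fin d) ℝ) (p q : MvPolynomial (Fin d) ℝ) (x : E d) :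
    polyFlux B (p - q) x = polyFlux B p x - polyFlux B q x := by
  ext i
  rw [PiLp.sub_apply, polyFlux_apply, polyFlux_apply, polyFlux_apply, ← Finset.sum_sub_distrib]
  refine Finset.sum_congr rfl fun j _ => ?_
  rw [map_sub, polyEval_sub]
  ring

/-- `∇·(B∇p)`, expanded by the product rule. -/
def polyDiv (B : E d → Matrix (Fin d) (Fin d) ℝ) (p : MvPolynomial (Fin d) ℝ) (x : E d) : ℝ :=
  ∑ i, ∑ j, (fderiv ℝ (fun y => B y i j) x (EuclideanSpace.single i 1) *
      polyEval (MvPolynomial.pderiv j p) x +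
    B x i j * polyEval (MvPolynomial.pderiv i (MvPolynomial.pderiv j p)) x)

theorem polyDiv_sub (B : E d → Matrix (Fin d) (Fin d) ℝ) (p q : MvPolynomial (Fin d) ℝ) (x : E d) :
    polyDiv B (p - q) x = polyDiv B p x - polyDiv B q x := by
  simp only [polyDiv, ← Finset.sum_sub_distrib]
  refine Finset.sum_congr rfl fun i _ => Finset.sum_congr rfl fun j _ => ?_
  simp only [map_sub, polyEval_sub]
  ring

namespace IsCoeffExtension
variable {P : ModelProblem d} {T : Finset (E d)} {C : ℝ≥0} {B : E d → Matrix (Fin d) (Fin d) ℝ}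

theorem continuous_polyFlux (hB : IsCoeffExtension P T C B) (p : MvPolynomial (Fin d) ℝ) :
    Continuous (polyFlux B p) := by
  refine (PiLp.continuous_toLp 2 _).comp (continuous_pi fun i => ?_)
  exact continuous_finsetSum Finset.univ fun j _ =>
    (hB.lipschitz i j).continuous.mul (continuous_polyEval (MvPolynomial.pderiv j p))

theorem flux_eq (hB : IsCoeffExtension P T C B) (k : ℕ) (w : L2 P.Ω) {x : E d}
    (hx : x ∈ interior (hull T)) : flux P k w T x = polyFlux B (locPoly k w T) x := by
  rw [flux, hB.eqOn x hx]
  rfl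

/-- The one-sided limit of the flux at a face is the value of the continuous extension. -/
theorem traceFrom_eq (hB : IsCoeffExtension P T C B) (hT : IsSimplex T) (k : ℕ) (w : L2 P.Ω)
    {x : E d} (hx : x ∈ hull T) :
    traceFrom T (flux P k w T) x = polyFlux B (locPoly k w T) x := by
  rw [← closure_interior_hull hT] at hx
  have : (𝓝[interior (hull T)] x).NeBot := mem_closure_iff_nhdsWithin_neBot.1 hx
  refine Tendsto.limUnder_eq ?_
  refine ((hB.continuous_polyFlux (locPoly k w T)).continuousWithinAt
    (s := interior (hull T)) (x := x)).tendsto.congr' ?_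
  filter_upwards [self_mem_nhdsWithin] with y hy
  rw [hB.flux_eq k w hy]

/-- By Rademacher's theorem the product rule for the divergence of the flux holds almost
everywhere. -/
theorem divergence_flux_ae_eq (hB : IsCoeffExtension P T C B) (k : ℕ) (w : L2 P.Ω) :
    ∀ᵐ x ∂(volume.restrict (hull T)),
      divergence (flux P k w T) x = polyDiv B (locPoly k w T) x := by
  rw [restrict_hull_eq_interior]
  have h1 : ∀ᵐ x ∂(volume : Measure (E d)), ∀ i j, DifferentiableAt ℝ (fun y => B y i j) x := by
    rw [eventually_all]
    intro i
    rw [eventually_all]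
    intro j
    exact (hB.lipschitz i j).ae_differentiableAt
  filter_upwards [ae_restrict_of_ae h1, ae_restrict_mem isOpen_interior.measurableSet] with x hx hxT
  rw [divergence, polyDiv]
  refine Finset.sum_congr rfl fun i _ => ?_
  have he : (fun y => flux P k w T y i) =ᶠ[𝓝 x]
      fun y => ∑ j, B y i j * polyEval (MvPolynomial.pderiv j (locPoly k w T)) y := by
    filter_upwards [isOpen_interior.mem_nhds hxT] with y hy
    rw [hB.flux_eq k w hy, polyFlux_apply]
  have hd := HasFDerivAt.fun_sum (u := Finset.univ) fun j _ =>
    (hx i j).hasFDerivAt.mul (hasFDerivAt_polyEval (MvPolynomial.pderiv j (locPoly k w T)) x)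
  have h2 : HasFDerivAt (fun y => flux P k w T y i) _ x := hd.congr_of_eventuallyEq he
  rw [h2.fderiv, sum_apply]
  refine Finset.sum_congr rfl fun j _ => ?_
  simp [polyGrad, EuclideanSpace.inner_single_right]
  ring

theorem measurable_polyDiv (hB : IsCoeffExtension P T C B) (p : MvPolynomial (Fin d) ℝ) :
    Measurable (polyDiv B p) := by
  refine Finset.measurable_fun_sum _ fun i _ => Finset.measurable_fun_sum _ fun j _ => ?_
  refine Measurable.add (Measurable.mul (measurable_fderiv_apply_const ℝ _ _)
    (continuous_polyEval _).measurable) ?_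
  exact ((hB.lipschitz i j).continuous.mul (continuous_polyEval _)).measurable

theorem abs_polyDiv_le (hB : IsCoeffExtension P T C B) (p : MvPolynomial (Fin d) ℝ) {x : E d}
    (hx : x ∈ hull T) : |polyDiv B p x| ≤ ∑ i, ∑ j, C * (|polyEval (MvPolynomial.pderiv j p) x| +
      |polyEval (MvPolynomial.pderiv i (MvPolynomial.pderiv j p)) x|) := by
  refine (Finset.abs_sum_le_sum_abs _ _).trans (Finset.sum_le_sum fun i _ => ?_)
  refine (Finset.abs_sum_le_sum_abs _ _).trans (Finset.sum_le_sum fun j _ => ?_)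
  refine (abs_add_le _ _).trans ?_
  rw [abs_mul, abs_mul, mul_add]
  refine add_le_add (mul_le_mul_of_nonneg_right ?_ (abs_nonneg _))
    (mul_le_mul_of_nonneg_right (hB.bound x hx i j) (abs_nonneg _))
  have h1 : ‖fderiv ℝ (fun y => B y i j) x‖ ≤ C := norm_fderiv_le_of_lipschitz ℝ (hB.lipschitz i j)
  have h2 := (fderiv ℝ (fun y => B y i j) x).le_opNorm (EuclideanSpace.single i 1)
  rw [show ‖EuclideanSpace.single i (1 : ℝ)‖ = 1 by simp, mul_one] at h2
  exact h2.trans h1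

theorem norm_polyFlux_le (hB : IsCoeffExtension P T C B) (p : MvPolynomial (Fin d) ℝ) {x : E d}
    (hx : x ∈ hull T) : ‖polyFlux B p x‖ ≤ d * C * ‖polyGrad p x‖ := by
  have h0 : ∀ i, |polyFlux B p x i| ≤ C * ∑ j, |polyGrad p x j| := by
    intro i
    rw [polyFlux_apply, Finset.mul_sum]
    refine (Finset.abs_sum_le_sum_abs _ _).trans (Finset.sum_le_sum fun j _ => ?_)
    rw [abs_mul]
    exact mul_le_mul_of_nonneg_right (hB.bound x hx i j) (abs_nonneg _)
  have h1 : (∑ j, |polyGrad p x j|) ^ 2 ≤ d * ‖polyGrad p x‖ ^ 2 := by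
    have := sq_sum_le_card_mul_sum_sq (s := Finset.univ) (f := fun j => |polyGrad p x j|)
    rw [EuclideanSpace.norm_sq_eq]
    simpa using this
  refine (pow_le_pow_iff_left₀ (norm_nonneg _) (by positivity) two_ne_zero).1 ?_
  rw [EuclideanSpace.norm_sq_eq]
  calc ∑ i, ‖polyFlux B p x i‖ ^ 2 ≤ ∑ _i : Fin d, (C * ∑ j, |polyGrad p x j|) ^ 2 := by
        refine Finset.sum_le_sum fun i _ => ?_
        exact pow_le_pow_left₀ (norm_nonneg _) (h0 i) 2
    _ = d * (C ^ 2 * (∑ j, |polyGrad p x j|) ^ 2) := by simp [mul_pow]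
    _ ≤ d * (C ^ 2 * (d * ‖polyGrad p x‖ ^ 2)) := by gcongr
    _ = (d * C * ‖polyGrad p x‖) ^ 2 := by ring

end IsCoeffExtension

end

section

variable {d : ℕ}

/-! ### Comparison of square roots of sums -/

/-- The reverse triangle inequality for Euclidean norms with components `√(X i)` and `√(Y i)`. -/
theorem sq_sqrt_sub_sqrt_sum_le {ι : Type*} (s : Finset ι) {X Y Z : ι → ℝ}
    (hX : ∀ i ∈ s, 0 ≤ X i) (hY : ∀ i ∈ s, 0 ≤ Y i)
    (h : ∀ i ∈ s, (√(X i) - √(Y i)) ^ 2 ≤ Z i) :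
    (√(∑ i ∈ s, X i) - √(∑ i ∈ s, Y i)) ^ 2 ≤ ∑ i ∈ s, Z i := by
  have hcs := Real.sum_mul_le_sqrt_mul_sqrt s (fun i => √(X i)) (fun i => √(Y i))
  rw [Finset.sum_congr rfl fun i hi => Real.sq_sqrt (hX i hi),
    Finset.sum_congr rfl fun i hi => Real.sq_sqrt (hY i hi)] at hcs
  refine le_trans ?_ (Finset.sum_le_sum h)
  have h1 : ∑ i ∈ s, (√(X i) - √(Y i)) ^ 2 =
      ∑ i ∈ s, X i + ∑ i ∈ s, Y i - 2 * ∑ i ∈ s, √(X i) * √(Y i) := by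
    rw [Finset.mul_sum, ← Finset.sum_add_distrib, ← Finset.sum_sub_distrib]
    refine Finset.sum_congr rfl fun i hi => ?_
    rw [sub_sq, Real.sq_sqrt (hX i hi), Real.sq_sqrt (hY i hi)]
    ring
  rw [h1, sub_sq, Real.sq_sqrt (Finset.sum_nonneg hX), Real.sq_sqrt (Finset.sum_nonneg hY)]
  linarith

theorem sq_sqrt_sub_sqrt_add_le {a b c d Z₁ Z₂ : ℝ} (ha : 0 ≤ a) (hb : 0 ≤ b) (hc : 0 ≤ c)
    (hd : 0 ≤ d) (h1 : (√a - √c) ^ 2 ≤ Z₁) (h2 : (√b - √d) ^ 2 ≤ Z₂) :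
    (√(a + b) - √(c + d)) ^ 2 ≤ Z₁ + Z₂ := by
  have := sq_sqrt_sub_sqrt_sum_le Finset.univ (X := ![a, b]) (Y := ![c, d]) (Z := ![Z₁, Z₂])
    (by simp [Fin.forall_fin_two, ha, hb]) (by simp [Fin.forall_fin_two, hc, hd])
    (by simp [Fin.forall_fin_two, h1, h2])
  simpa using this

theorem sq_sqrt_mul_sub_sqrt_mul {c : ℝ} (hc : 0 ≤ c) (X Y : ℝ) :
    (√(c * X) - √(c * Y)) ^ 2 = c * (√X - √Y) ^ 2 := by
  rw [Real.sqrt_mul hc, Real.sqrt_mul hc, ← mul_sub, mul_pow, Real.sq_sqrt hc]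

theorem norm_sq_toLp {α : Type*} [MeasurableSpace α] {μ : Measure α} {f : α → ℝ}
    (hf : MemLp f 2 μ) : ‖hf.toLp f‖ ^ 2 = ∫ x, f x ^ 2 ∂μ := by
  rw [← real_inner_self_eq_norm_sq, L2.inner_def]
  refine integral_congr_ae ?_
  filter_upwards [hf.coeFn_toLp] with x hx
  rw [hx]
  simp [sq]

/-- The reverse triangle inequality in `L²`. -/
theorem sq_sqrt_integral_sub_le {α : Type*} [MeasurableSpace α] {μ : Measure α} {f g : α → ℝ}
    (hf : MemLp f 2 μ) (hg : MemLp g 2 μ) :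
    (√(∫ x, f x ^ 2 ∂μ) - √(∫ x, g x ^ 2 ∂μ)) ^ 2 ≤ ∫ x, (f x - g x) ^ 2 ∂μ := by
  have h1 := norm_sq_toLp (hf.sub hg)
  rw [MemLp.toLp_sub hf hg] at h1
  simp only [Pi.sub_apply] at h1
  rw [← norm_sq_toLp hf, ← norm_sq_toLp hg, ← h1, Real.sqrt_sq (norm_nonneg _),
    Real.sqrt_sq (norm_nonneg _)]
  have h2 := norm_sub_norm_le (hg.toLp g) (hf.toLp f)
  rw [norm_sub_rev] at h2
  exact sq_le_sq' (by linarith) (norm_sub_norm_le _ _)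

theorem faceSize_comm (S T e : Finset (E d)) : faceSize S T e = faceSize T S e := by
  rw [faceSize, faceSize, min_comm]

/-! ### Local estimates of the estimator terms -/

theorem sq_sum_sum_le {n : ℕ} (f : Fin n → Fin n → ℝ) :
    (∑ i, ∑ j, f i j) ^ 2 ≤ n ^ 2 * ∑ i, ∑ j, f i j ^ 2 := by
  have h := sq_sum_le_card_mul_sum_sq (s := Finset.univ) (f := fun p : Fin n × Fin n => f p.1 p.2)
  rw [Fintype.sum_prod_type, Fintype.sum_prod_type] at h
  simpa [sq] using h

theorem integrableOn_norm_sq_polyGrad (p : MvPolynomial (Fin d) ℝ) {K : Set (E d)}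
    (hK : IsCompact K) : IntegrableOn (fun x => ‖polyGrad p x‖ ^ 2) K volume :=
  ((continuous_polyGrad p).norm.pow 2).continuousOn.integrableOn_compact hK

/-- Pointwise bounds of the first and second derivatives by the Dirichlet integral. -/
theorem exists_deriv_estimate (d k : ℕ) (γ : ℝ) : ∃ C : ℝ, 0 < C ∧
    ∀ (T : Finset (E d)) (x₀ : E d) (r : ℝ), 0 < r → Metric.closedBall x₀ r ⊆ hull T →
      elemDiam T ≤ 4 * γ * r → ∀ p : MvPolynomial (Fin d) ℝ, p.totalDegree ≤ k → ∀ x ∈ hull T,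
      r ^ d * ‖polyGrad p x‖ ^ 2 ≤ C * ∫ y in hull T, ‖polyGrad p y‖ ^ 2 ∧
      r ^ (d + 2) * ∑ i, ∑ j, polyEval (MvPolynomial.pderiv i (MvPolynomial.pderiv j p)) x ^ 2 ≤
        C * ∫ y in hull T, ‖polyGrad p y‖ ^ 2 := by
  obtain ⟨C, hC, h⟩ := exists_inverse_estimate d k (4 * γ)
  refine ⟨C * (d + 1), by positivity, fun T x₀ r hr hsub hdiam p hp x hx => ?_⟩
  have hxb := Mesh.hull_subset_closedBall hr.le hsub hdiam hx
  set I := ∫ y in hull T, ‖polyGrad p y‖ ^ 2 with hI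
  have hI0 : 0 ≤ I := integral_nonneg fun y => sq_nonneg _
  have hsum : ∑ j, ∫ y in Metric.closedBall x₀ r, polyEval (MvPolynomial.pderiv j p) y ^ 2 ≤ I := by
    rw [← integral_finsetSum]
    · simp only [← norm_sq_polyGrad]
      exact setIntegral_mono_set (integrableOn_norm_sq_polyGrad p (isCompact_hull T))
        (ae_of_all _ fun y => sq_nonneg _) hsub.eventuallyLE
    · intro j _
      exact ((continuous_polyEval _).pow 2).continuousOn.integrableOn_compact
        (isCompact_closedBall _ _)
  have hest := fun j =>
    h (MvPolynomial.pderiv j p) ((totalDegree_pderiv_le j p).trans hp) x₀ r hr x hxb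
  have hd0 : (0 : ℝ) ≤ d := Nat.cast_nonneg _
  have hCI : 0 ≤ C * I := by positivity
  constructor
  · calc _ = ∑ j, r ^ d * polyEval (MvPolynomial.pderiv j p) x ^ 2 := by
          rw [norm_sq_polyGrad, Finset.mul_sum]
      _ ≤ ∑ j, C * ∫ y in Metric.closedBall x₀ r, polyEval (MvPolynomial.pderiv j p) y ^ 2 :=
          Finset.sum_le_sum fun j _ => (hest j).1
      _ ≤ C * I := by rw [← Finset.mul_sum]; gcongr
      _ ≤ C * (d + 1) * I := by nlinarith
  · calc _ = ∑ _i : Fin d, ∑ j : Fin d, r ^ (d + 2) *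
            polyEval (MvPolynomial.pderiv _i (MvPolynomial.pderiv j p)) x ^ 2 := by
          simp only [Finset.mul_sum]
      _ ≤ ∑ _i : Fin d, ∑ j, C *
            ∫ y in Metric.closedBall x₀ r, polyEval (MvPolynomial.pderiv j p) y ^ 2 :=
          Finset.sum_le_sum fun i _ => Finset.sum_le_sum fun j _ => (hest j).2 i
      _ ≤ ∑ _i : Fin d, C * I :=
          Finset.sum_le_sum fun i _ => by rw [← Finset.mul_sum]; gcongr
      _ = d * (C * I) := by simp
      _ ≤ C * (d + 1) * I := by nlinarith

/-- The scaled divergence of the flux of a polynomial is bounded by its gradient. -/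
theorem exists_polyDiv_estimate (P : ModelProblem d) (k : ℕ) (γ : ℝ) (A : ℝ≥0) (H : ℝ) :
    ∃ C : ℝ, 0 < C ∧
    ∀ (T : Finset (E d)) (B : E d → Matrix (Fin d) (Fin d) ℝ), IsCoeffExtension P T A B →
    ∀ (x₀ : E d) (r : ℝ), 0 < r → Metric.closedBall x₀ r ⊆ hull T → r ≤ H →
      elemDiam T ≤ 4 * γ * r → ∀ p : MvPolynomial (Fin d) ℝ, p.totalDegree ≤ k →
      elemDiam T ^ 2 * ∫ x in hull T, polyDiv B p x ^ 2 ≤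
        C * ∫ x in hull T, ‖polyGrad p x‖ ^ 2 := by
  obtain ⟨C, hC, h⟩ := exists_deriv_estimate d k γ
  obtain ⟨vd, hv⟩ : ∃ vd : ℝ, vd = (volume (Metric.ball (0 : E d) 1)).toReal := ⟨_, rfl⟩
  have hv0 : 0 ≤ vd := by rw [hv]; positivity
  refine ⟨(4 * γ) ^ 2 * (|4 * γ| ^ d * vd) * (2 * A ^ 2 * d ^ 2 * (d * H ^ 2 * C + C)) + 1,
    by positivity, ?_⟩
  intro T B hB x₀ r hr hsub hrH hdiam p hp
  set I := ∫ y in hull T, ‖polyGrad p y‖ ^ 2 with hI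
  have hI0 : 0 ≤ I := integral_nonneg fun y => sq_nonneg _
  set K := 2 * (A : ℝ) ^ 2 * d ^ 2 * (d * H ^ 2 * C + C) with hK
  have hK0 : 0 ≤ K := by positivity
  have hγ : 0 ≤ 4 * γ := by
    have := (Mesh.elemDiam_nonneg T).trans hdiam
    exact nonneg_of_mul_nonneg_left this hr
  -- a pointwise bound, which is then multiplied by the volume of `T`
  have hpt : ∀ x ∈ hull T, r ^ (d + 2) * polyDiv B p x ^ 2 ≤ K * I := by
    intro x hx
    obtain ⟨h1, h2⟩ := h T x₀ r hr hsub hdiam p hp x hx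
    set D2 := ∑ i, ∑ j, polyEval (MvPolynomial.pderiv i (MvPolynomial.pderiv j p)) x ^ 2 with hD2
    have h3 : polyDiv B p x ^ 2 ≤ d ^ 2 * (2 * A ^ 2 * (d * ‖polyGrad p x‖ ^ 2 + D2)) := by
      rw [← sq_abs]
      refine (pow_le_pow_left₀ (abs_nonneg _) (hB.abs_polyDiv_le p hx) 2).trans ?_
      refine (sq_sum_sum_le _).trans (mul_le_mul_of_nonneg_left ?_ (by positivity))
      have h4 : (d : ℝ) * ‖polyGrad p x‖ ^ 2 =
          ∑ _i : Fin d, ∑ j, polyEval (MvPolynomial.pderiv j p) x ^ 2 := by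
        rw [norm_sq_polyGrad]
        simp
      rw [h4, hD2, ← Finset.sum_add_distrib, Finset.mul_sum]
      refine Finset.sum_le_sum fun i _ => ?_
      rw [← Finset.sum_add_distrib, Finset.mul_sum]
      refine Finset.sum_le_sum fun j _ => ?_
      rw [mul_pow, mul_comm 2, mul_assoc]
      refine mul_le_mul_of_nonneg_left ?_ (sq_nonneg _)
      have := add_sq_le (a := |polyEval (MvPolynomial.pderiv j p) x|)
        (b := |polyEval (MvPolynomial.pderiv i (MvPolynomial.pderiv j p)) x|)
      simpa [sq_abs] using this
    have h5 : r ^ (d + 2) * ‖polyGrad p x‖ ^ 2 ≤ H ^ 2 * (C * I) := by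
      calc r ^ (d + 2) * ‖polyGrad p x‖ ^ 2 = r ^ 2 * (r ^ d * ‖polyGrad p x‖ ^ 2) := by ring
        _ ≤ H ^ 2 * (C * I) := by gcongr
    calc r ^ (d + 2) * polyDiv B p x ^ 2
        ≤ r ^ (d + 2) * (d ^ 2 * (2 * A ^ 2 * (d * ‖polyGrad p x‖ ^ 2 + D2))) := by gcongr
      _ = d ^ 2 * (2 * A ^ 2 * (d * (r ^ (d + 2) * ‖polyGrad p x‖ ^ 2) + r ^ (d + 2) * D2)) := by
          ring
      _ ≤ d ^ 2 * (2 * A ^ 2 * (d * (H ^ 2 * (C * I)) + C * I)) := by gcongr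
      _ = K * I := by rw [hK]; ring
  -- shape regularity: the volume of `T` is of the order of `r ^ d`
  have hvol : (volume (hull T)).toReal ≤ |4 * γ| ^ d * vd * r ^ d := by
    have h1 : volume (hull T) ≤ volume (Metric.closedBall x₀ (4 * γ * r)) :=
      measure_mono (Mesh.hull_subset_closedBall hr.le hsub hdiam)
    rw [Measure.addHaar_closedBall _ _ (by positivity), finrank_euclideanSpace_fin] at h1
    have h2 := ENNReal.toReal_mono (ENNReal.mul_ne_top ENNReal.ofReal_ne_top
      measure_ball_lt_top.ne) h1
    rw [ENNReal.toReal_mul, ENNReal.toReal_ofReal (by positivity), ← hv] at h2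
    rw [abs_of_nonneg hγ]
    calc _ ≤ _ := h2
      _ = _ := by rw [mul_pow]; ring
  have hint : r ^ (d + 2) * ∫ x in hull T, polyDiv B p x ^ 2 ≤
      K * I * (volume (hull T)).toReal := by
    rw [← integral_const_mul]
    have h1 : ∀ᵐ x ∂(volume.restrict (hull T)), r ^ (d + 2) * polyDiv B p x ^ 2 ≤ K * I := by
      filter_upwards [ae_restrict_mem (measurableSet_hull T)] with x hx
      exact hpt x hx
    have : IsFiniteMeasure ((volume : Measure (E d)).restrict (hull T)) :=
      ⟨by rw [Measure.restrict_apply_univ]; exact (isCompact_hull T).measure_lt_top⟩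
    have h2 := integral_mono_of_nonneg (μ := volume.restrict (hull T))
      (ae_of_all _ fun x => by positivity) (integrable_const (K * I)) h1
    refine h2.trans (le_of_eq ?_)
    simp [Measure.real, mul_comm]
  have hrd : 0 < r ^ d := by positivity
  refine le_of_mul_le_mul_left ?_ hrd
  calc r ^ d * (elemDiam T ^ 2 * ∫ x in hull T, polyDiv B p x ^ 2)
      ≤ r ^ d * ((4 * γ * r) ^ 2 * ∫ x in hull T, polyDiv B p x ^ 2) := by
        have : 0 ≤ ∫ x in hull T, polyDiv B p x ^ 2 := integral_nonneg fun x => sq_nonneg _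
        have h0 := Mesh.elemDiam_nonneg T
        gcongr
    _ = (4 * γ) ^ 2 * (r ^ (d + 2) * ∫ x in hull T, polyDiv B p x ^ 2) := by ring
    _ ≤ (4 * γ) ^ 2 * (K * I * (|4 * γ| ^ d * vd * r ^ d)) :=
        mul_le_mul_of_nonneg_left (hint.trans (by gcongr)) (sq_nonneg _)
    _ ≤ _ := by
      have : 0 ≤ r ^ d * I := by positivity
      linarith

/-- The scaled flux of a polynomial on a face is bounded by its gradient. -/
theorem exists_polyFlux_estimate (P : ModelProblem d) (hd : 1 ≤ d) (k : ℕ) (γ : ℝ) (A : ℝ≥0) :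
    ∃ C : ℝ, 0 < C ∧
    ∀ (T S e : Finset (E d)) (B : E d → Matrix (Fin d) (Fin d) ℝ), IsCoeffExtension P T A B →
    IsSimplex T → e ⊆ T → e ⊆ S → e.card = d →
    ∀ (x₀ : E d) (r : ℝ), 0 < r → Metric.closedBall x₀ r ⊆ hull T →
      elemDiam T ≤ 4 * γ * r → ∀ p : MvPolynomial (Fin d) ℝ, p.totalDegree ≤ k → ∀ x ∈ hull T,
      faceSize T S e *
          ((μHE[d - 1] : Measure (E d)) (hull e)).toReal * ‖polyFlux B p x‖ ^ 2 ≤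
        C * ∫ x in hull T, ‖polyGrad p x‖ ^ 2 := by
  obtain ⟨C, hC, h⟩ := exists_deriv_estimate d k γ
  obtain ⟨C', hC', h'⟩ := exists_measure_face_le d hd
  refine ⟨C' * |4 * γ| ^ d * (d * A) ^ 2 * C + 1, by positivity, ?_⟩
  intro T S e B hB hT heT heS he x₀ r hr hsub hdiam p hp x hx
  set I := ∫ y in hull T, ‖polyGrad p y‖ ^ 2 with hI
  have hI0 : 0 ≤ I := integral_nonneg fun y => sq_nonneg _
  have hγ : 0 ≤ 4 * γ := by
    have := (Mesh.elemDiam_nonneg T).trans hdiam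
    exact nonneg_of_mul_nonneg_left this hr
  have h0 := Mesh.elemDiam_nonneg T
  -- the product of the size and the surface measure of the face is of the order of `r ^ d`
  have hface : faceSize T S e *
      ((μHE[d - 1] : Measure (E d)) (hull e)).toReal ≤ C' * elemDiam T ^ d := by
    have hind : AffineIndependent ℝ ((↑) : e → E d) := hT.2.mono (Finset.coe_subset.2 heT)
    have h1 := ENNReal.toReal_le_of_le_ofReal
      (mul_nonneg hC'.le (pow_nonneg Metric.diam_nonneg _)) (h' e he hind)
    have h2 : Metric.diam (hull e) ≤ elemDiam T :=
      Metric.diam_mono (hull_mono heT) (isCompact_hull T).isBounded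
    have h3 : faceSize T S e ≤ elemDiam T :=
      (faceSize_le heT heS).trans (min_le_left _ _)
    have h5 : Metric.diam (hull e) ^ (d - 1) ≤ elemDiam T ^ (d - 1) :=
      pow_le_pow_left₀ Metric.diam_nonneg h2 _
    calc _ ≤ elemDiam T * (C' * elemDiam T ^ (d - 1)) :=
          mul_le_mul h3 (h1.trans (mul_le_mul_of_nonneg_left h5 hC'.le)) ENNReal.toReal_nonneg h0
      _ = C' * elemDiam T ^ (d - 1 + 1) := by ring
      _ = _ := by rw [Nat.sub_add_cancel hd]
  have hpow : elemDiam T ^ d ≤ |4 * γ| ^ d * r ^ d := by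
    rw [abs_of_nonneg hγ, ← mul_pow]
    gcongr
  have hfl : ‖polyFlux B p x‖ ^ 2 ≤ (d * A) ^ 2 * ‖polyGrad p x‖ ^ 2 := by
    rw [← mul_pow]
    exact pow_le_pow_left₀ (norm_nonneg _) (hB.norm_polyFlux_le p hx) 2
  calc _ ≤ C' * elemDiam T ^ d * ((d * A) ^ 2 * ‖polyGrad p x‖ ^ 2) :=
        mul_le_mul hface hfl (sq_nonneg _) (by positivity)
    _ ≤ C' * (|4 * γ| ^ d * r ^ d) * ((d * A) ^ 2 * ‖polyGrad p x‖ ^ 2) := by gcongr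
    _ = C' * |4 * γ| ^ d * (d * A) ^ 2 * (r ^ d * ‖polyGrad p x‖ ^ 2) := by ring
    _ ≤ C' * |4 * γ| ^ d * (d * A) ^ 2 * (C * I) := by
      exact mul_le_mul_of_nonneg_left (h T x₀ r hr hsub hdiam p hp x hx).1 (by positivity)
    _ ≤ _ := by linarith

end

section

variable {d : ℕ} {P : ModelProblem d} {𝒯 : Mesh P.Ω} {k : ℕ}

/-! ### Comparison of the error indicators -/

/-- The function `∑_ij b(w,u_ij) λ_ij u_ij` in the element residual. -/
def eigenSum {q : ℕ} {m : Fin q → ℕ} (lam : Family m ℝ) (u : Family m (L2 P.Ω)) (w : L2 P.Ω) :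
    L2 P.Ω := ∑ i, ∑ j, (inner ℝ w (u i j) * lam i j) • u i j

theorem coeFn_eigenSum {q : ℕ} {m : Fin q → ℕ} (lam : Family m ℝ) (u : Family m (L2 P.Ω))
    (w : L2 P.Ω) : (eigenSum lam u w : E d → ℝ) =ᵐ[volume.restrict P.Ω]
      fun x => ∑ i, ∑ j, inner ℝ w (u i j) * lam i j * u i j x := by
  have h1 : ∀ᵐ x ∂(volume.restrict P.Ω), ∀ i j,
      ((inner ℝ w (u i j) * lam i j) • u i j : L2 P.Ω) x =
        inner ℝ w (u i j) * lam i j * u i j x := by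
    rw [eventually_all]
    intro i
    rw [eventually_all]
    intro j
    exact Lp.coeFn_smul _ _
  have h2 : ∀ᵐ x ∂(volume.restrict P.Ω), ∀ i,
      (∑ j, (inner ℝ w (u i j) * lam i j) • u i j : L2 P.Ω) x =
        ∑ j, ((inner ℝ w (u i j) * lam i j) • u i j : L2 P.Ω) x := by
    rw [eventually_all]
    intro i
    filter_upwards [Lp.coeFn_finsetSum (p := 2) Finset.univ
      fun j => ((inner ℝ w (u i j) * lam i j) • u i j : L2 P.Ω)] with x hx
    rw [hx, Finset.sum_apply]
  filter_upwards [h1, h2, Lp.coeFn_finsetSum (p := 2) Finset.univ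
      fun i => (∑ j, (inner ℝ w (u i j) * lam i j) • u i j : L2 P.Ω)] with x h1 h2 h3
  rw [eigenSum, h3, Finset.sum_apply]
  refine Finset.sum_congr rfl fun i _ => ?_
  rw [h2]
  exact Finset.sum_congr rfl fun j _ => h1 i j

/-- The element residual in terms of the extended coefficient. -/
theorem elemResidual_ae_eq (hR : 𝒯.Resolves P) {T : Finset (E d)} (hT : T ∈ 𝒯.elems) {C : ℝ≥0}
    {B : E d → Matrix (Fin d) (Fin d) ℝ} (hB : IsCoeffExtension P T C B) {q : ℕ} {m : Fin q → ℕ}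
    (lam : Family m ℝ) (u : Family m (L2 P.Ω)) (w : L2 P.Ω) :
    ∀ᵐ x ∂(volume.restrict (hull T)), elemResidual P k lam u w T x =
      eigenSum lam u w x + polyDiv B (locPoly k w T) x - P.c x * w x := by
  filter_upwards [ae_mono (hR.restrict_hull_le hT) (coeFn_eigenSum lam u w),
    hB.divergence_flux_ae_eq k w] with x h1 h2
  rw [elemResidual, h1, h2]

theorem memLp_restrict_hull (hR : 𝒯.Resolves P) {T : Finset (E d)} (hT : T ∈ 𝒯.elems)
    (u : L2 P.Ω) : MemLp u 2 (volume.restrict (hull T)) :=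
  (Lp.memLp u).mono_measure (hR.restrict_hull_le hT)

theorem memLp_polyDiv {T : Finset (E d)} {C : ℝ≥0} {B : E d → Matrix (Fin d) (Fin d) ℝ}
    (hB : IsCoeffExtension P T C B) (p : MvPolynomial (Fin d) ℝ) :
    MemLp (polyDiv B p) 2 (volume.restrict (hull T)) := by
  have : IsFiniteMeasure ((volume : Measure (E d)).restrict (hull T)) :=
    ⟨by rw [Measure.restrict_apply_univ]; exact (isCompact_hull T).measure_lt_top⟩
  have hcont : Continuous fun x : E d => ∑ i : Fin d, ∑ j : Fin d, (C : ℝ) *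
      (|polyEval (MvPolynomial.pderiv j p) x| +
        |polyEval (MvPolynomial.pderiv i (MvPolynomial.pderiv j p)) x|) :=
    continuous_finsetSum _ fun i _ => continuous_finsetSum _ fun j _ => continuous_const.mul
      ((continuous_polyEval _).abs.add (continuous_polyEval _).abs)
  obtain ⟨K, hK⟩ := (isCompact_hull T).exists_bound_of_continuousOn hcont.continuousOn
  refine MemLp.of_bound (hB.measurable_polyDiv p).aestronglyMeasurable K ?_
  filter_upwards [ae_restrict_mem (measurableSet_hull T)] with x hx
  exact (hB.abs_polyDiv_le p hx).trans ((le_abs_self _).trans (hK x hx))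

theorem memLp_potential (hR : 𝒯.Resolves P) {T : Finset (E d)} (hT : T ∈ 𝒯.elems) (u : L2 P.Ω) :
    MemLp (fun x => P.c x * u x) 2 (volume.restrict (hull T)) :=
  ((Lp.memLp u).mul (p := ∞) (r := 2) P.c_bounded).mono_measure (hR.restrict_hull_le hT)

theorem memLp_elemResidual (hR : 𝒯.Resolves P) {T : Finset (E d)} (hT : T ∈ 𝒯.elems) {C : ℝ≥0}
    {B : E d → Matrix (Fin d) (Fin d) ℝ} (hB : IsCoeffExtension P T C B) {q : ℕ} {m : Fin q → ℕ}
    (lam : Family m ℝ) (u : Family m (L2 P.Ω)) (w : L2 P.Ω) :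
    MemLp (elemResidual P k lam u w T) 2 (volume.restrict (hull T)) := by
  refine MemLp.ae_eq (EventuallyEq.symm (elemResidual_ae_eq hR hT hB lam u w)) ?_
  exact ((memLp_restrict_hull hR hT _).add (memLp_polyDiv hB _)).sub (memLp_potential hR hT w)

theorem integral_sq_wgrad_eq (hR : 𝒯.Resolves P) {T : Finset (E d)} (hT : T ∈ 𝒯.elems)
    {w : L2 P.Ω} (hw : w ∈ feSpace 𝒯 k) :
    ∫ x in hull T, ‖polyGrad (locPoly k w T) x‖ ^ 2 = ∫ x in hull T, ‖wgrad w x‖ ^ 2 := by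
  refine integral_congr_ae ?_
  filter_upwards [wgrad_ae_eq_polyGrad hR hT hw] with x hx
  rw [hx]

/-- The arithmetic of the residual estimate: `h` is the squared element size, `D` the square of the
divergence term, which the inverse estimate bounds after multiplication by `h`. -/
theorem residual_bound {h H X Y Z D C₁ a W : ℝ} (hh0 : 0 ≤ h) (hh : h ≤ H) (hX : 0 ≤ X)
    (hY : 0 ≤ Y) (hZ : 0 ≤ Z) (hC : 0 ≤ C₁) (ha : 0 ≤ a) (hD : h * D ≤ C₁ * Z)
    (hW : W ≤ 3 * (X + D + a * Y)) : h * W ≤ 3 * (H * (1 + a) + C₁) * (X + Y + Z) := by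
  have hH := hh0.trans hh
  calc h * W ≤ h * (3 * (X + D + a * Y)) := mul_le_mul_of_nonneg_left hW hh0
    _ = 3 * (h * (X + a * Y) + h * D) := by ring
    _ ≤ 3 * (H * (X + a * Y) + C₁ * Z) := by gcongr
    _ ≤ _ := by
      have e1 : 0 ≤ H * (a * X + Y) := by positivity
      have e2 : 0 ≤ H * (1 + a) * Z := by positivity
      have e3 : 0 ≤ C₁ * (X + Y) := by positivity
      linarith

theorem integral_sq_combination_le {μ : Measure (E d)} {F f g v c : E d → ℝ} {K : ℝ}
    (hf : MemLp f 2 μ) (hg : MemLp g 2 μ) (hv : MemLp v 2 μ) (hc : ∀ᵐ x ∂μ, |c x| ≤ K)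
    (hF : ∀ᵐ x ∂μ, F x = f x + g x - c x * v x) :
    ∫ x, F x ^ 2 ∂μ ≤
      3 * ((∫ x, f x ^ 2 ∂μ) + (∫ x, g x ^ 2 ∂μ) + K ^ 2 * ∫ x, v x ^ 2 ∂μ) := by
  have hi : Integrable (fun x => f x ^ 2 + g x ^ 2) μ := hf.integrable_sq.add hg.integrable_sq
  have hj : Integrable (fun x => K ^ 2 * v x ^ 2) μ := hv.integrable_sq.const_mul _
  have hk : Integrable (fun x => f x ^ 2 + g x ^ 2 + K ^ 2 * v x ^ 2) μ := hi.add hj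
  rw [← integral_const_mul, ← integral_add hf.integrable_sq hg.integrable_sq,
    ← integral_add hi hj, ← integral_const_mul]
  refine integral_mono_of_nonneg (ae_of_all _ fun x => sq_nonneg _) (hk.const_mul _) ?_
  filter_upwards [hF, hc] with x h1 h2
  rw [h1]
  have h3 : (c x * v x) ^ 2 ≤ K ^ 2 * v x ^ 2 := by
    rw [mul_pow]
    refine mul_le_mul_of_nonneg_right ?_ (sq_nonneg _)
    exact sq_le_sq' (by linarith [neg_abs_le (c x)]) ((le_abs_self _).trans h2)
  nlinarith [sq_nonneg (f x - g x), sq_nonneg (f x + c x * v x), sq_nonneg (g x + c x * v x)]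

/-- Comparison of the element residuals. -/
theorem exists_residual_close (P : ModelProblem d) (hd : 1 ≤ d) (k : ℕ) (γ : ℝ) :
    ∃ C : ℝ, 0 < C ∧ ∀ 𝒯 : Mesh P.Ω, 𝒯.ShapeRegular γ → 𝒯.Resolves P → ∀ T ∈ 𝒯.elems,
      ∀ (q : ℕ) (m : Fin q → ℕ) (lam lam' : Family m ℝ) (u u' : Family m (L2 P.Ω)) (w w' : L2 P.Ω),
        w ∈ feSpace 𝒯 k → w' ∈ feSpace 𝒯 k →
        (√(elemDiam T ^ 2 * ∫ x in hull T, elemResidual P k lam u w T x ^ 2) -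
          √(elemDiam T ^ 2 * ∫ x in hull T, elemResidual P k lam' u' w' T x ^ 2)) ^ 2 ≤
        C * ((∫ x in hull T, (eigenSum lam u w - eigenSum lam' u' w') x ^ 2) +
          (∫ x in hull T, (w - w') x ^ 2) + ∫ x in hull T, ‖wgrad (w - w') x‖ ^ 2) := by
  obtain ⟨A, hA⟩ := exists_coeffExtension P
  obtain ⟨H, hH, hΩ⟩ := P.polygonal.exists_subset_closedBall
  obtain ⟨C₁, hC₁, hdiv⟩ := exists_polyDiv_estimate P k γ A (2 * H)
  obtain ⟨Cc, hCc, hc⟩ := P.exists_essBound_c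
  refine ⟨3 * ((2 * H) ^ 2 * (1 + Cc ^ 2) + C₁), by positivity, ?_⟩
  intro 𝒯 hγ hR T hT q m lam lam' u u' w w' hw hw'
  obtain ⟨B, hB⟩ := hA 𝒯 hR T hT
  obtain ⟨x₀, r, hr, hsub, hrT, hdiam⟩ := 𝒯.exists_ball hd hγ hT
  have hTH : elemDiam T ≤ 2 * H := by
    have h1 : hull T ⊆ Metric.closedBall 0 H :=
      (𝒯.hull_subset_closure hT).trans (closure_minimal hΩ Metric.isClosed_closedBall)
    exact (Metric.diam_mono h1 Metric.isBounded_closedBall).trans (Metric.diam_closedBall hH)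
  have h0 := Mesh.elemDiam_nonneg T
  have hv := sub_mem hw hw'
  set p := locPoly k (w - w') T with hp
  have hpk := (locPoly_spec hT hv).1
  have hdiff : ∀ᵐ x ∂(volume.restrict (hull T)),
      elemResidual P k lam u w T x - elemResidual P k lam' u' w' T x =
        (eigenSum lam u w - eigenSum lam' u' w') x + polyDiv B p x - P.c x * (w - w') x := by
    filter_upwards [elemResidual_ae_eq hR hT hB lam u w, elemResidual_ae_eq hR hT hB lam' u' w',
      ae_mono (hR.restrict_hull_le hT) (Lp.coeFn_sub (eigenSum lam u w) (eigenSum lam' u' w')),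
      ae_mono (hR.restrict_hull_le hT) (Lp.coeFn_sub w w')] with x h1 h2 h3 h4
    rw [h1, h2, h3, h4, hp, locPoly_sub hR hT hw hw', polyDiv_sub]
    simp only [Pi.sub_apply]
    ring
  have hg := memLp_restrict_hull hR hT (eigenSum lam u w - eigenSum lam' u' w')
  have hpd := memLp_polyDiv hB p
  have hvL := memLp_restrict_hull hR hT (w - w')
  have hsq := integral_sq_combination_le hg hpd hvL (ae_mono (hR.restrict_hull_le hT) hc) hdiff
  rw [sq_sqrt_mul_sub_sqrt_mul (sq_nonneg _)]
  have h1 := sq_sqrt_integral_sub_le (memLp_elemResidual (k := k) hR hT hB lam u w)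
    (memLp_elemResidual (k := k) hR hT hB lam' u' w')
  have h2 := hdiv T B hB x₀ r hr hsub (hrT.trans hTH) hdiam p hpk
  rw [integral_sq_wgrad_eq hR hT hv] at h2
  exact residual_bound (sq_nonneg _) (by gcongr) (integral_nonneg fun x => sq_nonneg _)
    (integral_nonneg fun x => sq_nonneg _) (integral_nonneg fun x => sq_nonneg _) hC₁.le
    (sq_nonneg _) h2 (h1.trans hsq)

/-- A jump of normal components is bounded by the lengths of the two fluxes. -/
theorem jump_bound {a C I I' t : ℝ} {F F' n n' : E d} (ha : 0 ≤ a) (hn : ‖n‖ = 1) (hn' : ‖n'‖ = 1)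
    (ht : t = -(inner ℝ F n + inner ℝ F' n')) (hI : a * ‖F‖ ^ 2 ≤ C * I)
    (hI' : a * ‖F'‖ ^ 2 ≤ C * I') : a * t ^ 2 ≤ 2 * C * (I + I') := by
  have e4 : |inner ℝ F n| ≤ ‖F‖ := by simpa [hn] using abs_real_inner_le_norm F n
  have e5 : |inner ℝ F' n'| ≤ ‖F'‖ := by simpa [hn'] using abs_real_inner_le_norm F' n'
  have e6 : t ^ 2 ≤ 2 * (‖F‖ ^ 2 + ‖F'‖ ^ 2) := by
    rw [ht, neg_sq]
    have e7 : (inner ℝ F n) ^ 2 ≤ ‖F‖ ^ 2 :=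
      sq_le_sq' (by linarith [neg_abs_le (inner ℝ F n)]) ((le_abs_self _).trans e4)
    have e8 : (inner ℝ F' n') ^ 2 ≤ ‖F'‖ ^ 2 :=
      sq_le_sq' (by linarith [neg_abs_le (inner ℝ F' n')]) ((le_abs_self _).trans e5)
    exact add_sq_le.trans (by linarith)
  have := mul_le_mul_of_nonneg_left e6 ha
  linarith

/-- A pointwise bound that is scaled with the total mass bounds the integral; for measure zero both
sides are trivial. -/
theorem mul_integral_le_of_ae_le {μ : Measure (E d)} [IsFiniteMeasure μ] {f : E d → ℝ}
    {a C I : ℝ} (hI : 0 ≤ I) (hC : 0 ≤ C) (ha : 0 ≤ a) (hf : ∀ x, 0 ≤ f x)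
    (h : ∀ᵐ x ∂μ, a * μ.real univ * f x ≤ 2 * C * I) : a * ∫ x, f x ∂μ ≤ 2 * C * I := by
  rcases eq_or_lt_of_le (measureReal_nonneg : 0 ≤ μ.real univ) with hM0 | hM0
  · have hz : μ = 0 := by
      rw [← Measure.measure_univ_eq_zero]
      exact ((ENNReal.toReal_eq_zero_iff _).1 hM0.symm).resolve_right (measure_ne_top _ _)
    rw [hz, integral_zero_measure, mul_zero]
    positivity
  · have hmono := integral_mono_of_nonneg (μ := μ)
      (f := fun x => a * μ.real univ * f x) (g := fun _ => 2 * C * I)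
      (ae_of_all _ fun x => mul_nonneg (mul_nonneg ha hM0.le) (hf x)) (integrable_const _) h
    rw [integral_const_mul, integral_const, smul_eq_mul] at hmono
    refine le_of_mul_le_mul_left ?_ hM0
    linarith

/-- Comparison of the jumps across one face. -/
theorem exists_jump_close (P : ModelProblem d) (hd : 1 ≤ d) (k : ℕ) (γ : ℝ) :
    ∃ C : ℝ, 0 < C ∧ ∀ 𝒯 : Mesh P.Ω, 𝒯.ShapeRegular γ → 𝒯.Resolves P → ∀ T ∈ 𝒯.elems,
      ∀ S ∈ 𝒯.elems, ∀ e : Finset (E d), e ⊆ T → e ⊆ S → e.card = d →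
      ∀ (w w' : L2 P.Ω), w ∈ feSpace 𝒯 k → w' ∈ feSpace 𝒯 k →
        (√(faceSize T S e * ∫ x in hull e, jump P k w T S e x ^ 2 ∂(μHE[d - 1])) -
          √(faceSize T S e * ∫ x in hull e, jump P k w' T S e x ^ 2 ∂(μHE[d - 1]))) ^ 2 ≤
        C * ((∫ x in hull T, ‖wgrad (w - w') x‖ ^ 2) + ∫ x in hull S, ‖wgrad (w - w') x‖ ^ 2) := by
  obtain ⟨A, hA⟩ := exists_coeffExtension P
  obtain ⟨C, hC, hflux⟩ := exists_polyFlux_estimate P hd k γ A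
  obtain ⟨C', hC', hface⟩ := exists_measure_face_le d hd
  refine ⟨2 * C, by positivity, ?_⟩
  intro 𝒯 hγ hR T hT S hS e heT heS he w w' hw hw'
  obtain ⟨B, hB⟩ := hA 𝒯 hR T hT
  obtain ⟨B', hB'⟩ := hA 𝒯 hR S hS
  obtain ⟨x₀, r, hr, hsub, -, hdiam⟩ := 𝒯.exists_ball hd hγ hT
  obtain ⟨x₀', r', hr', hsub', -, hdiam'⟩ := 𝒯.exists_ball hd hγ hS
  have hsT := 𝒯.simplex T hT
  have hsS := 𝒯.simplex S hS
  have hv := sub_mem hw hw'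
  have hnT := norm_outNormal hd hsT heT he
  have hnS := norm_outNormal hd hsS heS he
  obtain ⟨μ, hμ⟩ : ∃ μ : Measure (E d), μ = (μHE[d - 1] : Measure (E d)).restrict (hull e) :=
    ⟨_, rfl⟩
  have hμtop : (μHE[d - 1] : Measure (E d)) (hull e) < ⊤ :=
    (hface e he (hsT.2.mono (Finset.coe_subset.2 heT))).trans_lt ENNReal.ofReal_lt_top
  have hfin : IsFiniteMeasure μ := ⟨by rw [hμ, Measure.restrict_apply_univ]; exact hμtop⟩
  have hmem : ∀ᵐ x ∂μ, x ∈ hull e := by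
    rw [hμ]
    exact ae_restrict_mem (measurableSet_hull e)
  -- the jump in terms of the polynomial fluxes
  have hjump : ∀ v : L2 P.Ω, ∀ x ∈ hull e, jump P k v T S e x =
      - inner ℝ (polyFlux B (locPoly k v T) x) (outNormal T e) -
        inner ℝ (polyFlux B' (locPoly k v S) x) (outNormal S e) := by
    intro v x hx
    rw [jump, hB.traceFrom_eq hsT k v (hull_mono heT hx),
      hB'.traceFrom_eq hsS k v (hull_mono heS hx)]
  have hL2 : ∀ v : L2 P.Ω, MemLp (jump P k v T S e) 2 μ := by
    intro v
    have hcont : Continuous fun x => - inner ℝ (polyFlux B (locPoly k v T) x) (outNormal T e) -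
        inner ℝ (polyFlux B' (locPoly k v S) x) (outNormal S e) :=
      ((hB.continuous_polyFlux _).inner continuous_const).neg.sub
        ((hB'.continuous_polyFlux _).inner continuous_const)
    obtain ⟨K, hK⟩ := (isCompact_hull e).exists_bound_of_continuousOn hcont.continuousOn
    refine MemLp.ae_eq (f := fun x => - inner ℝ (polyFlux B (locPoly k v T) x) (outNormal T e) -
        inner ℝ (polyFlux B' (locPoly k v S) x) (outNormal S e)) ?_ ?_
    · filter_upwards [hmem] with x hx
      exact (hjump v x hx).symm
    · refine MemLp.of_bound hcont.aestronglyMeasurable K ?_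
      filter_upwards [hmem] with x hx
      exact hK x hx
  have h0 := faceSize_nonneg T S e
  rw [sq_sqrt_mul_sub_sqrt_mul h0]
  have h1 := sq_sqrt_integral_sub_le (hL2 w) (hL2 w')
  rw [hμ] at h1
  refine (mul_le_mul_of_nonneg_left h1 h0).trans ?_
  rw [← hμ]
  have hpt : ∀ x ∈ hull e, faceSize T S e * μ.real univ *
      (jump P k w T S e x - jump P k w' T S e x) ^ 2 ≤
      2 * C * ((∫ x in hull T, ‖wgrad (w - w') x‖ ^ 2) +
        ∫ x in hull S, ‖wgrad (w - w') x‖ ^ 2) := by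
    intro x hx
    have e1 := hflux T S e B hB hsT heT heS he x₀ r hr hsub hdiam (locPoly k (w - w') T)
      (locPoly_spec hT hv).1 x (hull_mono heT hx)
    have e2 := hflux S T e B' hB' hsS heS heT he x₀' r' hr' hsub' hdiam' (locPoly k (w - w') S)
      (locPoly_spec hS hv).1 x (hull_mono heS hx)
    rw [integral_sq_wgrad_eq hR hT hv] at e1
    rw [integral_sq_wgrad_eq hR hS hv, faceSize_comm] at e2
    have hM : μ.real univ = ((μHE[d - 1] : Measure (E d)) (hull e)).toReal := by
      rw [hμ, Measure.real, Measure.restrict_apply_univ]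
    rw [← hM] at e1 e2
    refine jump_bound (mul_nonneg h0 measureReal_nonneg) hnT hnS ?_ e1 e2
    rw [hjump w x hx, hjump w' x hx, locPoly_sub hR hT hw hw', locPoly_sub hR hS hw hw',
      polyFlux_sub, polyFlux_sub, inner_sub_left, inner_sub_left]
    ring
  exact mul_integral_le_of_ae_le (add_nonneg (integral_nonneg fun x => sq_nonneg _)
    (integral_nonneg fun x => sq_nonneg _)) hC.le h0 (fun x => sq_nonneg _)
    (by filter_upwards [hmem] with x hx using hpt x hx)

/-- The elements of a resolved mesh do not overlap and lie in `Ω` up to null sets. -/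
theorem sum_integral_hull_le (hR : 𝒯.Resolves P) {f : E d → ℝ} (hf : ∀ x, 0 ≤ f x)
    (hfi : IntegrableOn f P.Ω volume) :
    ∑ T ∈ 𝒯.elems, ∫ x in hull T, f x ≤ ∫ x in P.Ω, f x := by
  simp only [restrict_hull_eq_interior]
  rw [← integral_biUnion_finset _ (fun T _ => isOpen_interior.measurableSet)
    (fun S hS T hT hne => 𝒯.disjoint_interior hS hT hne)
    (fun T hT => hfi.mono_set (hR.interior_hull_subset hT))]
  have hsub : (⋃ T ∈ 𝒯.elems, interior (hull T)) ⊆ P.Ω :=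
    iUnion₂_subset fun T hT => hR.interior_hull_subset hT
  exact setIntegral_mono_set hfi (ae_of_all _ hf) (LE.le.eventuallyLE hsub)

theorem indicatorSq_nonneg {q : ℕ} {m : Fin q → ℕ} (lam : Family m ℝ) (u : Family m (L2 P.Ω))
    (w : L2 P.Ω) (T : Finset (E d)) : 0 ≤ indicatorSq P 𝒯 k lam u w T := by
  rw [indicatorSq]
  exact add_nonneg (mul_nonneg (sq_nonneg _) (integral_nonneg fun _ => sq_nonneg _))
    (Finset.sum_nonneg fun _ _ => mul_nonneg (faceSize_nonneg _ _ _)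
      (integral_nonneg fun _ => sq_nonneg _))

/-- On every set of elements the two estimators differ by no more than the differences of the
functions in `H^1` and of the eigenvalue terms in `L²`. -/
theorem exists_indicator_close (P : ModelProblem d) (hd : 1 ≤ d) (k : ℕ) (γ : ℝ) :
    ∃ C : ℝ, 0 < C ∧ ∀ 𝒯 : Mesh P.Ω, 𝒯.ShapeRegular γ → 𝒯.Resolves P →
      ∀ (q : ℕ) (m : Fin q → ℕ) (lam lam' : Family m ℝ) (u u' : Family m (L2 P.Ω)) (w w' : L2 P.Ω),
        w ∈ feSpace 𝒯 k → w' ∈ feSpace 𝒯 k → ∀ marked ⊆ 𝒯.elems,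
        (√(∑ T ∈ marked, indicatorSq P 𝒯 k lam u w T) -
          √(∑ T ∈ marked, indicatorSq P 𝒯 k lam' u' w' T)) ^ 2 ≤
        C * (‖eigenSum lam u w - eigenSum lam' u' w'‖ ^ 2 + ‖w - w'‖ ^ 2 +
          ‖wgrad (w - w')‖ ^ 2) := by
  classical
  obtain ⟨C₁, hC₁, hres⟩ := exists_residual_close P hd k γ
  obtain ⟨C₂, hC₂, hjump⟩ := exists_jump_close P hd k γ
  refine ⟨C₁ + C₂ * (2 * (d + 1)), by positivity, ?_⟩
  intro 𝒯 hγ hR q m lam lam' u u' w w' hw hw' marked hmarked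
  obtain ⟨X, hX⟩ : ∃ X : Finset (E d) → ℝ, ∀ T, X T =
    ∫ x in hull T, (eigenSum lam u w - eigenSum lam' u' w') x ^ 2 := ⟨_, fun _ => rfl⟩
  obtain ⟨Y, hY⟩ : ∃ Y : Finset (E d) → ℝ, ∀ T, Y T =
    ∫ x in hull T, (w - w') x ^ 2 := ⟨_, fun _ => rfl⟩
  obtain ⟨Z, hZ⟩ : ∃ Z : Finset (E d) → ℝ, ∀ T, Z T =
    ∫ x in hull T, ‖wgrad (w - w') x‖ ^ 2 := ⟨_, fun _ => rfl⟩
  have hX0 : ∀ T, 0 ≤ X T := fun T => by rw [hX]; exact integral_nonneg fun _ => sq_nonneg _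
  have hY0 : ∀ T, 0 ≤ Y T := fun T => by rw [hY]; exact integral_nonneg fun _ => sq_nonneg _
  have hZ0 : ∀ T, 0 ≤ Z T := fun T => by rw [hZ]; exact integral_nonneg fun _ => sq_nonneg _
  -- the contribution of one element involves its neighbours through the jumps
  have hloc : ∀ T ∈ 𝒯.elems, (√(indicatorSq P 𝒯 k lam u w T) -
      √(indicatorSq P 𝒯 k lam' u' w' T)) ^ 2 ≤
      C₁ * (X T + Y T + Z T) + ∑ S ∈ 𝒯.neighbors T, C₂ * (Z T + Z S) := by
    intro T hT
    rw [indicatorSq, indicatorSq]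
    refine sq_sqrt_sub_sqrt_add_le
      (mul_nonneg (sq_nonneg _) (integral_nonneg fun _ => sq_nonneg _))
      (Finset.sum_nonneg fun _ _ => mul_nonneg (faceSize_nonneg _ _ _)
        (integral_nonneg fun _ => sq_nonneg _))
      (mul_nonneg (sq_nonneg _) (integral_nonneg fun _ => sq_nonneg _))
      (Finset.sum_nonneg fun _ _ => mul_nonneg (faceSize_nonneg _ _ _)
        (integral_nonneg fun _ => sq_nonneg _)) ?_ ?_
    · rw [hX, hY, hZ]
      exact hres 𝒯 hγ hR T hT q m lam lam' u u' w w' hw hw'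
    · refine sq_sqrt_sub_sqrt_sum_le _
        (fun _ _ => mul_nonneg (faceSize_nonneg _ _ _) (integral_nonneg fun _ => sq_nonneg _))
        (fun _ _ => mul_nonneg (faceSize_nonneg _ _ _) (integral_nonneg fun _ => sq_nonneg _))
        fun S hS => ?_
      have hS' := Finset.mem_filter.1 hS
      rw [hZ, hZ]
      exact hjump 𝒯 hγ hR T hT S hS'.1 _ Finset.inter_subset_right Finset.inter_subset_left
        hS'.2.2 w w' hw hw'
  refine (sq_sqrt_sub_sqrt_sum_le marked (fun T _ => indicatorSq_nonneg _ _ _ T)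
    (fun T _ => indicatorSq_nonneg _ _ _ T) fun T hT => hloc T (hmarked hT)).trans ?_
  refine (Finset.sum_le_sum_of_subset_of_nonneg hmarked fun T _ _ => add_nonneg
    (mul_nonneg hC₁.le (add_nonneg (add_nonneg (hX0 T) (hY0 T)) (hZ0 T)))
    (Finset.sum_nonneg fun S _ => mul_nonneg hC₂.le (add_nonneg (hZ0 T) (hZ0 S)))).trans ?_
  have hsX : ∑ T ∈ 𝒯.elems, X T ≤ ‖eigenSum lam u w - eigenSum lam' u' w'‖ ^ 2 := by
    simp only [hX]
    rw [ModelProblem.norm_sq_L2]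
    exact sum_integral_hull_le hR (fun _ => sq_nonneg _) (Lp.memLp _).integrable_sq
  have hsY : ∑ T ∈ 𝒯.elems, Y T ≤ ‖w - w'‖ ^ 2 := by
    simp only [hY]
    rw [ModelProblem.norm_sq_L2]
    exact sum_integral_hull_le hR (fun _ => sq_nonneg _) (Lp.memLp _).integrable_sq
  have hsZ : ∑ T ∈ 𝒯.elems, Z T ≤ ‖wgrad (w - w')‖ ^ 2 := by
    simp only [hZ]
    rw [ModelProblem.norm_sq_L2Vec]
    exact sum_integral_hull_le hR (fun _ => sq_nonneg _) (P.integrable_norm_sq _)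
  have hsn := 𝒯.sum_neighbors_le hd (X := Z) fun T _ => hZ0 T
  have hsum : ∑ T ∈ 𝒯.elems, (C₁ * (X T + Y T + Z T) +
      ∑ S ∈ 𝒯.neighbors T, C₂ * (Z T + Z S)) =
      C₁ * (∑ T ∈ 𝒯.elems, X T + ∑ T ∈ 𝒯.elems, Y T + ∑ T ∈ 𝒯.elems, Z T) +
        C₂ * ∑ T ∈ 𝒯.elems, ∑ S ∈ 𝒯.neighbors T, (Z T + Z S) := by
    simp only [Finset.sum_add_distrib, Finset.mul_sum, mul_add]
  rw [hsum]
  have hd0 : (0 : ℝ) ≤ d := Nat.cast_nonneg _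
  set x := ‖eigenSum lam u w - eigenSum lam' u' w'‖ ^ 2
  set y := ‖w - w'‖ ^ 2
  set z := ‖wgrad (w - w')‖ ^ 2
  have hx : 0 ≤ x := sq_nonneg _
  have hy : 0 ≤ y := sq_nonneg _
  calc _ ≤ C₁ * (x + y + z) + C₂ * (2 * (d + 1) * z) := by
        refine add_le_add (mul_le_mul_of_nonneg_left (by linarith) hC₁.le)
          (mul_le_mul_of_nonneg_left (hsn.trans ?_) hC₂.le)
        exact mul_le_mul_of_nonneg_left hsZ (by positivity)
    _ ≤ _ := by
      have : 0 ≤ C₂ * (2 * (d + 1)) * (x + y) := by positivity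
      linarith

end

section

variable {d : ℕ} {Ω : Set (E d)}

/-! ### Compactly supported Lipschitz functions -/

/-- Dominated convergence in `L²`. -/
theorem tendsto_toLp_of_dominated {F : Type*} [NormedAddCommGroup F] {μ : Measure (E d)}
    {f : ℕ → E d → F} {g : E d → F} (hf : ∀ n, MemLp (f n) 2 μ) (hg : MemLp g 2 μ)
    {b : E d → ℝ} (hb : MemLp b 2 μ) (hfb : ∀ n, ∀ᵐ x ∂μ, ‖f n x‖ ≤ b x)
    (hlim : ∀ᵐ x ∂μ, Tendsto (fun n => f n x) atTop (𝓝 (g x))) :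
    Tendsto (fun n => (hf n).toLp (f n)) atTop (𝓝 (hg.toLp g)) := by
  rw [Lp.tendsto_Lp_iff_tendsto_eLpNorm'']
  have hgb : ∀ᵐ x ∂μ, ‖g x‖ ≤ b x := by
    filter_upwards [hlim, ae_all_iff.2 hfb] with x h1 h2
    exact le_of_tendsto h1.norm (Eventually.of_forall h2)
  have hbound : ∫⁻ x, ‖(2 * b x : ℝ)‖ₑ ^ 2 ∂μ ≠ ⊤ := by
    rw [← eLpNorm_two_sq]
    exact ENNReal.pow_ne_top (hb.const_mul 2).2.ne
  have h : Tendsto (fun n => ∫⁻ x, ‖(f n - g) x‖ₑ ^ 2 ∂μ) atTop (𝓝 (∫⁻ _, 0 ∂μ)) := by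
    refine tendsto_lintegral_of_dominated_convergence' (fun x => ‖(2 * b x : ℝ)‖ₑ ^ 2)
      (fun n => ((hf n).sub hg).1.enorm.pow_const 2) (fun n => ?_) hbound ?_
    · filter_upwards [hgb, hfb n] with x h1 h2
      gcongr
      rw [enorm_le_iff_norm_le, Real.norm_eq_abs]
      refine le_trans ?_ (le_abs_self _)
      exact (norm_sub_le _ _).trans (by linarith)
    · filter_upwards [hlim] with x hx
      have h1 : Tendsto (fun n => ‖(f n - g) x‖ₑ) atTop (𝓝 0) := by
        have := (hx.sub_const (g x)).enorm
        simpa using this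
      simpa using ENNReal.Tendsto.pow (n := 2) h1
  simp only [← eLpNorm_two_sq, lintegral_zero] at h
  have h2 := (ENNReal.continuous_rpow_const (y := (1 / 2 : ℝ))).tendsto 0 |>.comp h
  have e : (0 : ℝ≥0∞) ^ (1 / 2 : ℝ) = 0 := ENNReal.zero_rpow_of_pos (by norm_num)
  rw [e] at h2
  refine h2.congr fun n => ?_
  rw [Function.comp_apply, ← ENNReal.rpow_natCast, ← ENNReal.rpow_mul]
  norm_num

section mollification

open scoped Convolution

variable {w : E d → ℝ} {L : ℝ≥0}

/-- The gradient of a mollified Lipschitz function is the mollified gradient. -/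
theorem hasFDerivAt_convolution_of_lipschitz (hw : LipschitzWith L w)
    {ψ : E d → ℝ} (hψ : Continuous ψ) (hψc : HasCompactSupport ψ) (x : E d) :
    HasFDerivAt (ψ ⋆[ContinuousLinearMap.lsmul ℝ ℝ, volume] w)
      ((ψ ⋆[ContinuousLinearMap.lsmul ℝ ℝ, volume] fderiv ℝ w) x) x := by
  have hsub : ∀ y : E d, Continuous fun t : E d => y - t := fun y =>
    continuous_const.sub continuous_id
  refine (hasFDerivAt_integral_of_dominated_loc_of_lip (μ := (volume : Measure (E d)))
    (F := fun y t => ψ t • w (y - t)) (F' := fun t => ψ t • fderiv ℝ w (x - t))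
    (bound := fun t => |ψ t| * L) univ_mem
    (Eventually.of_forall fun y => (hψ.smul (hw.continuous.comp (hsub y))).aestronglyMeasurable)
    ?_ ?_ ?_ ?_ ?_).2
  · exact (hψ.smul (hw.continuous.comp (hsub x))).integrable_of_hasCompactSupport
      (hψc.smul_right)
  · exact hψ.aestronglyMeasurable.smul
      ((measurable_fderiv ℝ w).comp (hsub x).measurable).aestronglyMeasurable
  · refine ae_of_all _ fun t => LipschitzOnWith.of_dist_le_mul fun y _ z _ => ?_
    rw [dist_eq_norm, ← smul_sub, norm_smul, Real.coe_nnabs, abs_of_nonneg (by positivity),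
      mul_assoc, Real.norm_eq_abs]
    refine mul_le_mul_of_nonneg_left ?_ (abs_nonneg _)
    have := hw.dist_le_mul (y - t) (z - t)
    rwa [dist_sub_right, dist_eq_norm] at this
  · exact ((hψ.integrable_of_hasCompactSupport hψc).abs).mul_const _
  · have h := hw.ae_differentiableAt (μ := (volume : Measure (E d)))
    have h' := (quasiMeasurePreserving_sub_left volume x).ae h
    filter_upwards [h'] with t ht
    have := ht.hasFDerivAt.comp x ((hasFDerivAt_id x).sub_const t)
    have := this.const_smul (ψ t)
    rwa [ContinuousLinearMap.comp_id] at this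

/-- Compactly supported Lipschitz functions in `Ω` belong to `H^1_0`; their weak gradient is the
gradient, which exists almost everywhere by Rademacher's theorem. -/
theorem exists_mem_H10_of_lipschitz (hΩ : IsOpen Ω) (hw : LipschitzWith L w)
    (hc : HasCompactSupport w) (hs : tsupport w ⊆ Ω) :
    ∃ v ∈ H10 Ω, (v : E d → ℝ) =ᵐ[volume.restrict Ω] w ∧
      (wgrad v : E d → E d) =ᵐ[volume.restrict Ω] gradient w := by
  obtain ⟨δ, hδ, hδΩ⟩ := hc.isCompact.exists_cthickening_subset_open hΩ hs
  obtain ⟨K, hK⟩ : ∃ K, K = Metric.cthickening δ (tsupport w) := ⟨_, rfl⟩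
  have hKc : IsCompact K := by rw [hK]; exact hc.isCompact.cthickening
  have hpos : ∀ n : ℕ, 0 < δ / (n + 1) := fun n => by positivity
  -- mollifiers of radius at most `δ`, which keep the supports in `Ω`
  obtain ⟨ψ, hψ⟩ : ∃ ψ : ℕ → ContDiffBump (0 : E d), ∀ n, (ψ n).rOut = δ / (n + 1) ∧
      (ψ n).rIn = δ / (n + 1) / 2 :=
    ⟨fun n => ⟨δ / (n + 1) / 2, δ / (n + 1), half_pos (hpos n), half_lt_self (hpos n)⟩,
      fun n => ⟨rfl, rfl⟩⟩
  have hout : Tendsto (fun n => (ψ n).rOut) atTop (𝓝 0) := by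
    simp only [hψ]
    exact tendsto_const_div_atTop_nhds_zero_nat δ |>.comp (tendsto_add_atTop_nat 1) |>.congr
      fun n => by simp
  have hle : ∀ n, (ψ n).rOut ≤ δ := fun n => by
    rw [(hψ n).1]
    exact div_le_self hδ.le (by linarith [(Nat.cast_nonneg n : (0 : ℝ) ≤ n)])
  obtain ⟨u, hu⟩ : ∃ u : ℕ → E d → ℝ, ∀ n, u n =
      (ψ n).normed volume ⋆[ContinuousLinearMap.lsmul ℝ ℝ, volume] w := ⟨_, fun _ => rfl⟩
  have hloc : LocallyIntegrable w volume := hw.continuous.locallyIntegrable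
  have hsupp : ∀ n, Function.support (u n) ⊆ K := by
    intro n x hx
    rw [hu] at hx
    obtain ⟨t, ht, y, hy, rfl⟩ := Set.mem_add.1 (support_convolution_subset _ hx)
    rw [(ψ n).support_normed_eq] at ht
    rw [hK]
    refine Metric.mem_cthickening_of_dist_le _ y _ _ (subset_tsupport _ hy) ?_
    rw [dist_eq_norm, add_sub_cancel_right, ← dist_zero_right]
    exact (Metric.mem_ball.1 ht).le.trans (hle n)
  have htsupp : ∀ n, tsupport (u n) ⊆ K := fun n => closure_minimal (hsupp n) hKc.isClosed
  have htest : ∀ n, IsTestFun Ω (u n) := by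
    intro n
    refine ⟨?_, HasCompactSupport.of_support_subset_isCompact hKc (hsupp n),
      (htsupp n).trans (hK ▸ hδΩ)⟩
    rw [hu]
    exact (ψ n).hasCompactSupport_normed.contDiff_convolution_left _
      ((ψ n).contDiff_normed (n := ⊤)) hloc
  have hfd : ∀ n x, fderiv ℝ (u n) x = ((ψ n).normed volume
      ⋆[ContinuousLinearMap.lsmul ℝ ℝ, volume] fderiv ℝ w) x := by
    intro n x
    rw [hu]
    exact (hasFDerivAt_convolution_of_lipschitz hw (ψ n).continuous_normed
      (ψ n).hasCompactSupport_normed x).fderiv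
  have hfL : ∀ x, ‖fderiv ℝ w x‖ ≤ L := fun x => norm_fderiv_le_of_lipschitz ℝ hw
  -- the mollified functions and their gradients are dominated by multiples of the indicator of `K`
  have hgL : ∀ n x, ‖gradient (u n) x‖ ≤ K.indicator (fun _ => (L : ℝ)) x := by
    intro n x
    by_cases hx : x ∈ K
    · rw [indicator_of_mem hx, gradient, LinearIsometryEquiv.norm_map, hfd]
      refine (norm_integral_le_of_norm_le (g := fun t => (ψ n).normed volume t * L)
        ((ψ n).integrable_normed.mul_const _) (ae_of_all _ fun t => ?_)).trans_eq ?_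
      · rw [ContinuousLinearMap.lsmul_apply, norm_smul, Real.norm_eq_abs,
          abs_of_nonneg ((ψ n).nonneg_normed t)]
        exact mul_le_mul_of_nonneg_left (hfL _) ((ψ n).nonneg_normed t)
      · rw [integral_mul_const, (ψ n).integral_normed, one_mul]
    · rw [indicator_of_notMem hx, gradient_eq_zero_of_notMem_tsupport fun h => hx (htsupp n h),
        norm_zero]
  obtain ⟨M, hM⟩ := hw.continuous.bounded_above_of_compact_support hc
  have huM : ∀ n x, ‖u n x‖ ≤ K.indicator (fun _ => M) x := by
    intro n x
    by_cases hx : x ∈ K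
    · rw [indicator_of_mem hx, hu]
      refine (norm_integral_le_of_norm_le (g := fun t => (ψ n).normed volume t * M)
        ((ψ n).integrable_normed.mul_const _) (ae_of_all _ fun t => ?_)).trans_eq ?_
      · rw [ContinuousLinearMap.lsmul_apply, norm_smul, Real.norm_eq_abs,
          abs_of_nonneg ((ψ n).nonneg_normed t)]
        exact mul_le_mul_of_nonneg_left (hM _) ((ψ n).nonneg_normed t)
      · rw [integral_mul_const, (ψ n).integral_normed, one_mul]
    · rw [indicator_of_notMem hx, Function.notMem_support.1 fun h => hx (hsupp n h), norm_zero]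
  have hind : ∀ c : ℝ, MemLp (K.indicator fun _ => c) 2 (volume.restrict Ω) := fun c =>
    (memLp_indicator_const 2 hKc.measurableSet c (Or.inr hKc.measure_lt_top.ne)).restrict _
  have hulim : ∀ x, Tendsto (fun n => u n x) atTop (𝓝 (w x)) := by
    intro x
    simp only [hu]
    exact ContDiffBump.convolution_tendsto_right_of_continuous hout hw.continuous x
  have hfm : Measurable (fderiv ℝ w) := measurable_fderiv ℝ w
  have hfloc : LocallyIntegrable (fderiv ℝ w) (volume : Measure (E d)) :=
    (memLp_top_of_bound hfm.aestronglyMeasurable L (ae_of_all _ hfL)).locallyIntegrable le_top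
  -- the gradients converge at the Lebesgue points of `∇w`
  have hglim : ∀ᵐ x ∂(volume : Measure (E d)),
      Tendsto (fun n => gradient (u n) x) atTop (𝓝 (gradient w x)) := by
    filter_upwards [ContDiffBump.ae_convolution_tendsto_right_of_locallyIntegrable (K := 2) hout
      (Eventually.of_forall fun n => by rw [(hψ n).1, (hψ n).2]; linarith) hfloc] with x hx
    simp only [gradient, hfd]
    exact ((InnerProductSpace.toDual ℝ (E d)).symm.continuous.tendsto _).comp hx
  have hwL : MemLp w 2 (volume.restrict Ω) :=
    (hw.continuous.memLp_of_hasCompactSupport hc).restrict _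
  have hgLp : MemLp (gradient w) 2 (volume.restrict Ω) := by
    refine (hind L).of_le (((InnerProductSpace.toDual ℝ (E d)).symm.continuous.measurable.comp
      hfm).aestronglyMeasurable) ?_
    filter_upwards [ae_restrict_of_ae hglim] with x hx
    exact (le_of_tendsto hx.norm (Eventually.of_forall fun n => hgL n x)).trans (le_abs_self _)
  have h1 : Tendsto (fun n => (htest n).toL2) atTop (𝓝 (hwL.toLp w)) :=
    tendsto_toLp_of_dominated (fun n => (htest n).memLp) hwL (hind M)
      (fun n => ae_of_all _ (huM n)) (ae_of_all _ hulim)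
  have h2 : Tendsto (fun n => (htest n).gradL2) atTop (𝓝 (hgLp.toLp (gradient w))) :=
    tendsto_toLp_of_dominated (fun n => (htest n).memLp_gradient) hgLp (hind L)
      (fun n => ae_of_all _ (hgL n)) (ae_restrict_of_ae hglim)
  obtain ⟨h3, h4⟩ := mem_H10_of_tendsto hΩ (fun n => (htest n).mem_H10) h1
    (h2.congr fun n => ((htest n).wgrad_toL2 hΩ).symm)
  refine ⟨_, h3, hwL.coeFn_toLp, ?_⟩
  rw [h4]
  exact hgLp.coeFn_toLp

end mollification

/-- A continuous function which is `L`-Lipschitz on each of finitely many closed sets that cover the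
space is `L`-Lipschitz. -/
theorem lipschitzWith_of_finite_closed_cover {ι : Type*} [Finite ι] {F : ι → Set (E d)}
    (hF : ∀ i, IsClosed (F i)) (hcov : ∀ x, ∃ i, x ∈ F i) {w : E d → ℝ} (hw : Continuous w)
    {L : ℝ≥0} (hL : ∀ i, LipschitzOnWith L w (F i)) : LipschitzWith L w := by
  have key : ∀ x y, w y - w x ≤ L * ‖y - x‖ := by
    intro x y
    have hc : Continuous fun t : ℝ => x + t • (y - x) := by fun_prop
    -- on the segment from `x` to `y` the growth is bounded by a mean value inequality for one-sided
    -- slopes, which need to be small only along a sequence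
    have h := image_le_of_liminf_slope_right_le_deriv_boundary
      (f := fun t : ℝ => w (x + t • (y - x)) - w x) (a := 0) (b := 1)
      ((hw.comp hc).sub continuous_const).continuousOn
      (B := fun t => t * (L * ‖y - x‖)) (B' := fun _ => L * ‖y - x‖) (by simp)
      (by fun_prop) (fun t _ => by simpa using ((hasDerivAt_id t).mul_const _).hasDerivWithinAt)
      (fun t _ r hr => ?_) (right_mem_Icc.2 zero_le_one)
    · simpa using h
    · -- a piece that contains points arbitrarily close to the right of `t` contains `t` itself
      have h1 : ∃ i, ∃ᶠ z in 𝓝[>] t, x + z • (y - x) ∈ F i := by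
        by_contra! hne
        have h2 : ∀ᶠ z in 𝓝[>] t, ∀ i, x + z • (y - x) ∉ F i :=
          eventually_all.2 hne
        obtain ⟨z, hz⟩ := h2.exists
        obtain ⟨i, hi⟩ := hcov (x + z • (y - x))
        exact hz i hi
      obtain ⟨i, hi⟩ := h1
      have hcl : IsClosed {z : ℝ | x + z • (y - x) ∈ F i} := (hF i).preimage hc
      have ht : x + t • (y - x) ∈ F i := by
        have : t ∈ closure {z : ℝ | x + z • (y - x) ∈ F i} :=
          mem_closure_iff_frequently.2 (hi.filter_mono nhdsWithin_le_nhds)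
        rwa [hcl.closure_eq] at this
      refine (hi.and_eventually self_mem_nhdsWithin).mono fun z hz => lt_of_le_of_lt ?_ hr
      have hzt : 0 < z - t := sub_pos.2 hz.2
      rw [slope_def_field, div_le_iff₀ hzt]
      have h3 := (hL i).dist_le_mul _ hz.1 _ ht
      rw [dist_eq_norm, dist_eq_norm, add_sub_add_left_eq_sub, ← sub_smul, norm_smul,
        Real.norm_eq_abs, Real.norm_eq_abs, abs_of_pos hzt] at h3
      linarith [le_abs_self (w (x + z • (y - x)) - w (x + t • (y - x)))]
  refine LipschitzWith.of_dist_le_mul fun x y => ?_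
  rw [dist_eq_norm, dist_eq_norm, Real.norm_eq_abs, abs_le]
  have h1 := key x y
  have h2 := key y x
  rw [norm_sub_rev] at h1
  exact ⟨by linarith, h2⟩

end

section

variable {d : ℕ} {Ω : Set (E d)} {𝒯 : Mesh Ω}

/-! ### Linear interpolation on simplicial meshes -/

theorem IsSimplex.exists_affineMap {T : Finset (E d)} (h : IsSimplex T) (φ : E d → ℝ) :
    ∃ f : E d →ᵃ[ℝ] ℝ, ∀ z ∈ T, f z = φ z := by
  classical
  refine ⟨∑ z : T, φ z • h.basis.coord z, fun z hz => ?_⟩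
  have : ∀ (s : Finset T) (g : T → E d →ᵃ[ℝ] ℝ) (x : E d), (∑ z ∈ s, g z) x = ∑ z ∈ s, g z x := by
    intro s g x
    induction s using Finset.induction_on with
    | empty => simp
    | insert a s ha ih => simp [Finset.sum_insert ha, ih]
  rw [this, Finset.sum_eq_single (⟨z, hz⟩ : T)]
  · have := h.basis.coord_apply_eq (⟨z, hz⟩ : T)
    rw [h.basis_apply] at this
    simp [this]
  · intro y _ hy
    have := h.basis.coord_apply_ne (i := y) (j := (⟨z, hz⟩ : T)) hy
    rw [h.basis_apply] at this
    simp [this]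
  · simp

open Classical in
/-- The affine function with the values of `φ` at the vertices of the simplex `T`. -/
def affineInterp (φ : E d → ℝ) (T : Finset (E d)) : E d →ᵃ[ℝ] ℝ :=
  if h : ∃ f : E d →ᵃ[ℝ] ℝ, ∀ z ∈ T, f z = φ z then h.choose else 0

theorem affineInterp_apply {T : Finset (E d)} (h : IsSimplex T) (φ : E d → ℝ) {z : E d}
    (hz : z ∈ T) : affineInterp φ T z = φ z := by
  have h' := h.exists_affineMap φ
  rw [affineInterp, dif_pos h']
  exact h'.choose_spec z hz

theorem AffineMap.eqOn_convexHull {f g : E d →ᵃ[ℝ] ℝ} {s : Set (E d)} (h : ∀ x ∈ s, f x = g x) :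
    ∀ x ∈ convexHull ℝ s, f x = g x := by
  have hc : Convex ℝ ((f - g) ⁻¹' {0}) := Convex.affine_preimage _ (convex_singleton 0)
  intro x hx
  have := convexHull_min (t := (f - g) ⁻¹' {0})
    (fun y hy => by simp [h y hy]) hc hx
  simpa [sub_eq_zero] using this

open Classical in
/-- The continuous piecewise affine interpolant of `φ`, extended by zero. -/
def meshInterp (𝒯 : Mesh Ω) (φ : E d → ℝ) (x : E d) : ℝ :=
  if h : ∃ T ∈ 𝒯.elems, x ∈ hull T then affineInterp φ h.choose x else 0

/-- By conformity the affine interpolants on two elements agree on the intersection. -/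
theorem meshInterp_eq (φ : E d → ℝ) {T : Finset (E d)} (hT : T ∈ 𝒯.elems) {x : E d}
    (hx : x ∈ hull T) : meshInterp 𝒯 φ x = affineInterp φ T x := by
  have h : ∃ T ∈ 𝒯.elems, x ∈ hull T := ⟨T, hT, hx⟩
  rw [meshInterp, dif_pos h]
  have hS := h.choose_spec
  have hx' : x ∈ hull h.choose ∩ hull T := ⟨hS.2, hx⟩
  rw [𝒯.conforming _ hS.1 _ hT] at hx'
  refine AffineMap.eqOn_convexHull (fun z hz => ?_) x hx'
  rw [affineInterp_apply (𝒯.simplex _ hS.1) φ hz.1, affineInterp_apply (𝒯.simplex _ hT) φ hz.2]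

theorem dist_le_size {T : Finset (E d)} (hT : T ∈ 𝒯.elems) {x y : E d} (hx : x ∈ hull T)
    (hy : y ∈ hull T) : dist x y ≤ 𝒯.size :=
  (Metric.dist_le_diam_of_mem (isCompact_hull T).isBounded hx hy).trans (𝒯.elemDiam_le_size hT)

/-- Every element that contains `x` has only vertices within distance `δ` of `x`. -/
theorem meshInterp_eq_zero {φ : E d → ℝ} {δ : ℝ} (hδ : 𝒯.size ≤ δ) {x : E d}
    (hx : x ∉ Metric.cthickening δ (tsupport φ)) : meshInterp 𝒯 φ x = 0 := by
  by_cases h : ∃ T ∈ 𝒯.elems, x ∈ hull T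
  · obtain ⟨T, hT, hxT⟩ := h
    rw [meshInterp_eq φ hT hxT]
    refine AffineMap.eqOn_convexHull (g := 0) (fun z hz => ?_) x hxT
    rw [affineInterp_apply (𝒯.simplex T hT) φ hz]
    by_contra hne
    exact hx (Metric.mem_cthickening_of_dist_le _ z _ _ (subset_tsupport _ hne)
      ((dist_le_size hT hxT (mem_hull hz)).trans hδ))
  · rw [meshInterp, dif_neg h]

theorem continuous_affineMap (f : E d →ᵃ[ℝ] ℝ) : Continuous f := f.continuous_of_finiteDimensional

theorem continuousOn_meshInterp (𝒯 : Mesh Ω) (φ : E d → ℝ) :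
    ContinuousOn (meshInterp 𝒯 φ) (closure Ω) := by
  rw [← 𝒯.cover, show (⋃ T ∈ 𝒯.elems, hull T) = ⋃ T : 𝒯.elems, hull T.1 by
    ext x; simp]
  refine LocallyFinite.continuousOn_iUnion (locallyFinite_of_finite _)
    (fun T => isClosed_hull _) fun T => ?_
  exact (continuous_affineMap (affineInterp φ T.1)).continuousOn.congr
    fun x hx => meshInterp_eq φ T.2 hx

theorem meshInterp_support {φ : E d → ℝ} {δ : ℝ} (hδ : 𝒯.size ≤ δ)
    (hδΩ : Metric.cthickening δ (tsupport φ) ⊆ Ω) (hφ : HasCompactSupport φ) :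
    HasCompactSupport (meshInterp 𝒯 φ) ∧ tsupport (meshInterp 𝒯 φ) ⊆ Ω := by
  have hs : Function.support (meshInterp 𝒯 φ) ⊆ Metric.cthickening δ (tsupport φ) :=
    fun x hx => by_contra fun h => hx (meshInterp_eq_zero hδ h)
  exact ⟨HasCompactSupport.of_support_subset_isCompact hφ.isCompact.cthickening hs,
    (closure_minimal hs Metric.isClosed_cthickening).trans hδΩ⟩

theorem continuous_meshInterp (hΩ : IsOpen Ω) {φ : E d → ℝ} {δ : ℝ} (hδ : 𝒯.size ≤ δ)
    (hδΩ : Metric.cthickening δ (tsupport φ) ⊆ Ω) : Continuous (meshInterp 𝒯 φ) := by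
  rw [continuous_iff_continuousAt]
  intro x
  by_cases hx : x ∈ Metric.cthickening δ (tsupport φ)
  · exact (continuousOn_meshInterp 𝒯 φ).continuousAt
      (mem_of_superset (hΩ.mem_nhds (hδΩ hx)) subset_closure)
  · refine (continuousAt_const (y := (0 : ℝ))).congr ?_
    filter_upwards [Metric.isClosed_cthickening.isOpen_compl.mem_nhds hx] with y hy
    exact (meshInterp_eq_zero hδ hy).symm

theorem AffineMap.sub_eq (f : E d →ᵃ[ℝ] ℝ) (x y : E d) : f x - f y = f.linear (x - y) := by
  have := f.linearMap_vsub x y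
  simpa using this.symm

theorem exists_lipschitz_affineMap (f : E d →ᵃ[ℝ] ℝ) : ∃ L : ℝ≥0, LipschitzWith L f := by
  refine ⟨‖LinearMap.toContinuousLinearMap f.linear‖₊, LipschitzWith.of_dist_le_mul fun x y => ?_⟩
  rw [dist_eq_norm, AffineMap.sub_eq, dist_eq_norm]
  exact (LinearMap.toContinuousLinearMap f.linear).le_opNorm _

/-- The interpolant is Lipschitz on each element and vanishes outside `Ω`, and these finitely many
closed sets cover the space. -/
theorem exists_lipschitz_meshInterp (hΩ : IsOpen Ω) {φ : E d → ℝ} {δ : ℝ} (hδ : 𝒯.size ≤ δ)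
    (hδΩ : Metric.cthickening δ (tsupport φ) ⊆ Ω) :
    ∃ L : ℝ≥0, LipschitzWith L (meshInterp 𝒯 φ) := by
  choose L hL using fun T : Finset (E d) => exists_lipschitz_affineMap (affineInterp φ T)
  refine ⟨𝒯.elems.sup L, lipschitzWith_of_finite_closed_cover (ι := Option 𝒯.elems)
    (F := fun i => i.elim Ωᶜ fun T => hull T.1) ?_ ?_ (continuous_meshInterp hΩ hδ hδΩ) ?_⟩
  · rintro (_ | T)
    · exact hΩ.isClosed_compl
    · exact isClosed_hull _
  · intro x
    by_cases hx : x ∈ Ω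
    · obtain ⟨T, hT, hxT⟩ := mem_iUnion₂.1 (𝒯.subset_iUnion_hull hx)
      exact ⟨some ⟨T, hT⟩, hxT⟩
    · exact ⟨none, hx⟩
  · rintro (_ | T)
    · refine LipschitzOnWith.of_dist_le_mul fun x hx y hy => ?_
      rw [meshInterp_eq_zero hδ fun h => hx (hδΩ h), meshInterp_eq_zero hδ fun h => hy (hδΩ h),
        dist_self]
      positivity
    · refine LipschitzOnWith.of_dist_le_mul fun x hx y hy => ?_
      rw [meshInterp_eq φ T.2 hx, meshInterp_eq φ T.2 hy]
      refine ((hL T.1).dist_le_mul x y).trans ?_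
      gcongr
      exact Finset.le_sup (f := L) T.2

/-- An affine function as a polynomial of degree at most one. -/
theorem exists_poly_affineMap (f : E d →ᵃ[ℝ] ℝ) : ∃ p : MvPolynomial (Fin d) ℝ,
    p.totalDegree ≤ 1 ∧ ∀ x, f x = polyEval p x := by
  refine ⟨MvPolynomial.C (f 0) + ∑ i, MvPolynomial.C (f.linear (EuclideanSpace.single i 1)) *
    MvPolynomial.X i, ?_, fun x => ?_⟩
  · refine (MvPolynomial.totalDegree_add _ _).trans (max_le (by simp) ?_)
    refine (MvPolynomial.totalDegree_finsetSum _ _).trans (Finset.sup_le fun i _ => ?_)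
    refine (MvPolynomial.totalDegree_mul _ _).trans ?_
    simp [MvPolynomial.totalDegree_X]
  · have hx : x = ∑ i, x i • EuclideanSpace.single i (1 : ℝ) := by
      have := (EuclideanSpace.basisFun (Fin d) ℝ).sum_repr x
      simpa using this.symm
    have h1 : f x = f 0 + f.linear x := by
      have := AffineMap.sub_eq f x 0
      rw [sub_zero] at this
      linarith
    have h2 : f.linear x = ∑ i, x i * f.linear (EuclideanSpace.single i (1 : ℝ)) := by
      conv_lhs => rw [hx]
      simp [map_sum]
    rw [h1, h2]
    simp [polyEval, mul_comm]

theorem isPiecewisePoly_meshInterp (𝒯 : Mesh Ω) (φ : E d → ℝ) {k : ℕ} (hk : 1 ≤ k) :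
    IsPiecewisePoly 𝒯 k (meshInterp 𝒯 φ) := by
  refine ⟨continuousOn_meshInterp 𝒯 φ, fun T hT => ?_⟩
  obtain ⟨p, hp, hf⟩ := exists_poly_affineMap (affineInterp φ T)
  exact ⟨p, hp.trans hk, fun x hx => (meshInterp_eq φ hT hx).trans (hf x)⟩

/-- The gradient of an affine function. -/
theorem exists_gradient_affineMap (f : E d →ᵃ[ℝ] ℝ) : ∃ g : E d,
    (∀ x y, f x - f y = inner ℝ g (x - y)) ∧
      ∀ (w : E d → ℝ) (x : E d), w =ᶠ[𝓝 x] f → gradient w x = g := by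
  refine ⟨(InnerProductSpace.toDual ℝ (E d)).symm (LinearMap.toContinuousLinearMap f.linear),
    fun x y => ?_, fun w x hw => ?_⟩
  · rw [AffineMap.sub_eq, InnerProductSpace.toDual_symm_apply]
    rfl
  · rw [gradient, hw.fderiv_eq]
    congr 1
    refine HasFDerivAt.fderiv ?_
    have : (f : E d → ℝ) = fun y => LinearMap.toContinuousLinearMap f.linear y + f 0 := by
      ext y
      have := AffineMap.sub_eq f y 0
      rw [sub_zero] at this
      simp only [LinearMap.coe_toContinuousLinearMap']
      linarith
    rw [this]
    exact (ContinuousLinearMap.hasFDerivAt _).add_const _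

/-- The gradient error of linear interpolation on one simplex, from the second order Taylor estimate
for `φ` and a ball of radius `r` contained in the simplex. -/
theorem affineInterp_gradient_error {T : Finset (E d)} (hT : IsSimplex T) {φ : E d → ℝ}
    {M D : ℝ} (hM : 0 ≤ M)
    (hTaylor : ∀ x y, |φ y - φ x - inner ℝ (gradient φ x) (y - x)| ≤ M * ‖y - x‖ ^ 2)
    (hD : elemDiam T ≤ D) {x₀ : E d} {r : ℝ} (hr : 0 < r) (hball : Metric.closedBall x₀ r ⊆ hull T)
    {x g : E d} (hx : x ∈ hull T)
    (hg : ∀ x y, affineInterp φ T x - affineInterp φ T y = inner ℝ g (x - y)) :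
    ‖g - gradient φ x‖ ≤ 2 * M * D ^ 2 / r := by
  obtain ⟨f, hf⟩ : ∃ f, f = affineInterp φ T := ⟨_, rfl⟩
  rw [← hf] at hg
  -- the interpolant minus the first Taylor polynomial at `x`; it is affine and small at the
  -- vertices, hence small on the simplex
  obtain ⟨ℓ, hℓ⟩ : ∃ ℓ : E d → ℝ, ∀ y, ℓ y = f y - φ x - inner ℝ (gradient φ x) (y - x) :=
    ⟨_, fun _ => rfl⟩
  have hlin : ∀ y z, ℓ y - ℓ z = inner ℝ (g - gradient φ x) (y - z) := by
    intro y z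
    have e : inner ℝ (gradient φ x) (y - z) =
        inner ℝ (gradient φ x) (y - x) - inner ℝ (gradient φ x) (z - x) := by
      rw [← inner_sub_right, sub_sub_sub_cancel_right]
    rw [inner_sub_left, ← hg, hℓ, hℓ]
    rw [e]
    ring
  obtain ⟨K, hK⟩ : ∃ K : Set (E d), ∀ y, y ∈ K ↔ |ℓ y| ≤ M * D ^ 2 :=
    ⟨{y | |ℓ y| ≤ M * D ^ 2}, fun _ => by rw [Set.mem_ofPred_eq]⟩
  have hconv : Convex ℝ K := by
    intro y hy z hz a b ha hb hab
    have e : ℓ (a • y + b • z) = a * ℓ y + b * ℓ z := by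
      have h1 := hlin (a • y + b • z) z
      have h2 := hlin y z
      have e1 : a • y + b • z - z = a • (y - z) := by
        have : b = 1 - a := by linarith
        rw [this, smul_sub, sub_smul, one_smul]
        abel
      rw [e1, inner_smul_right, ← h2] at h1
      have h5 : b * ℓ z = ℓ z - a * ℓ z := by
        have : b = 1 - a := by linarith
        rw [this]
        ring
      linarith
    rw [hK] at hy hz ⊢
    rw [e, abs_le]
    have h3 := (abs_le.1 hy)
    have h4 := (abs_le.1 hz)
    constructor <;> nlinarith
  have hall : ∀ y ∈ hull T, |ℓ y| ≤ M * D ^ 2 := by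
    refine fun y hy => (hK y).1 (convexHull_min (fun z hz => ?_) hconv hy)
    rw [hK, hℓ, hf, affineInterp_apply hT φ hz]
    refine (hTaylor x z).trans (mul_le_mul_of_nonneg_left ?_ hM)
    have h1 : dist z x ≤ elemDiam T :=
      Metric.dist_le_diam_of_mem (isCompact_hull T).isBounded (mem_hull hz) hx
    rw [dist_eq_norm] at h1
    exact pow_le_pow_left₀ (norm_nonneg _) (h1.trans hD) 2
  obtain ⟨v, hv⟩ : ∃ v, v = g - gradient φ x := ⟨_, rfl⟩
  rw [← hv]
  rcases eq_or_ne v 0 with h0 | h0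
  · rw [h0, norm_zero]
    positivity
  have hnv : 0 < ‖v‖ := norm_pos_iff.2 h0
  -- compare the values at the centre of the ball and at its boundary in the direction of `v`
  have h1 := hall (x₀ + (r / ‖v‖) • v) (hball (by
    rw [Metric.mem_closedBall, dist_eq_norm, add_sub_cancel_left, norm_smul, norm_div, norm_norm,
      div_mul_cancel₀ _ hnv.ne', Real.norm_eq_abs, abs_of_pos hr]))
  have h2 := hall x₀ (hball (Metric.mem_closedBall_self hr.le))
  have h3 := hlin (x₀ + (r / ‖v‖) • v) x₀
  rw [add_sub_cancel_left, inner_smul_right, ← hv, real_inner_self_eq_norm_sq] at h3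
  have h4 : r / ‖v‖ * ‖v‖ ^ 2 = r * ‖v‖ := by field_simp
  rw [h4] at h3
  rw [le_div_iff₀ hr]
  linarith [(abs_le.1 h1).2, (abs_le.1 h2).1]

/-- Second order Taylor estimate for test functions. -/
theorem IsTestFun.exists_taylor {φ : E d → ℝ} (h : IsTestFun Ω φ) : ∃ M : ℝ, 0 ≤ M ∧
    ∀ x y, |φ y - φ x - inner ℝ (gradient φ x) (y - x)| ≤ M * ‖y - x‖ ^ 2 := by
  have hg := (contDiff_gradient h.1).of_le (m := 1) (by norm_cast)
  obtain ⟨M, hM⟩ :=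
    hg.lipschitzWith_of_hasCompactSupport (hasCompactSupport_gradient h.2.1) one_ne_zero
  refine ⟨M, M.2, fun x y => ?_⟩
  have hd : Differentiable ℝ φ := h.1.differentiable (by simp)
  have h1 := (convex_closedBall x ‖y - x‖).norm_image_sub_le_of_norm_hasFDerivWithin_le'
    (f := φ) (f' := fderiv ℝ φ) (φ := fderiv ℝ φ x) (C := M * ‖y - x‖)
    (fun z _ => (hd z).hasFDerivAt.hasFDerivWithinAt) (fun z hz => ?_)
    (Metric.mem_closedBall_self (norm_nonneg _))
    (show y ∈ Metric.closedBall x ‖y - x‖ by simp [dist_eq_norm])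
  · rw [real_inner_comm, inner_gradient_eq, ← Real.norm_eq_abs]
    refine h1.trans_eq (by ring)
  · have h2 := hM.dist_le_mul z x
    rw [gradient, gradient, LinearIsometryEquiv.dist_map, dist_eq_norm] at h2
    exact h2.trans (mul_le_mul_of_nonneg_left (Metric.mem_closedBall.1 hz) M.2)

end

section

variable {d : ℕ}

/-! ### Approximation by finite element functions -/

/-- A test function is approximated by its piecewise affine interpolant, whose gradient error is of
the order of the mesh size. -/
theorem IsTestFun.exists_feApprox (P : ModelProblem d) (hd : 1 ≤ d) {k : ℕ} (hk : 1 ≤ k) (γ : ℝ)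
    {φ : E d → ℝ} (h : IsTestFun P.Ω φ) {ε : ℝ} (hε : 0 < ε) :
    ∃ hbar : ℝ, 0 < hbar ∧ ∀ 𝒯 : Mesh P.Ω, 𝒯.ShapeRegular γ → 𝒯.size ≤ hbar →
      ∃ v ∈ feSpace 𝒯 k, ‖wgrad (v - h.toL2)‖ ≤ ε := by
  have := P.isFiniteMeasure
  obtain ⟨δ, hδ, hδΩ⟩ := h.2.1.isCompact.exists_cthickening_subset_open P.isOpen h.2.2
  obtain ⟨M, hM, hTaylor⟩ := h.exists_taylor
  obtain ⟨K, hK⟩ : ∃ K : ℝ,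
      K = (measureUnivNNReal ((volume : Measure (E d)).restrict P.Ω) : ℝ) ^ (2 : ℝ≥0∞).toReal⁻¹ :=
    ⟨_, rfl⟩
  have hK0 : 0 ≤ K := by rw [hK]; positivity
  -- up to `δ` the interpolant is supported in `Ω`; the second term makes the gradient error small
  refine ⟨min δ (ε / (K * (8 * M * |γ|) + 1)), lt_min hδ (by positivity), ?_⟩
  intro 𝒯 hγ hsize
  have hs1 := hsize.trans (min_le_left _ _)
  have hs2 := hsize.trans (min_le_right _ _)
  obtain ⟨L, hL⟩ := exists_lipschitz_meshInterp P.isOpen hs1 hδΩ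
  obtain ⟨hc, hsupp⟩ := meshInterp_support hs1 hδΩ h.2.1
  obtain ⟨v, hv, hvw, hvg⟩ := exists_mem_H10_of_lipschitz P.isOpen hL hc hsupp
  refine ⟨v, ⟨hv, _, isPiecewisePoly_meshInterp 𝒯 φ hk, hvw⟩, ?_⟩
  rw [wgrad_sub P.isOpen hv h.mem_H10, h.wgrad_toL2 P.isOpen]
  have hsize0 : 0 ≤ 𝒯.size := Real.iSup_nonneg fun T => Mesh.elemDiam_nonneg _
  have hint : ∀ᵐ x ∂(volume.restrict P.Ω), ∀ T ∈ 𝒯.elems, x ∈ hull T → x ∈ interior (hull T) := by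
    refine ae_restrict_of_ae ((Finset.eventually_all _).2 fun T _ => ?_)
    exact ae_mem_interior_hull T
  have hbound : ∀ᵐ x ∂(volume.restrict P.Ω), ‖(wgrad v - h.gradL2 : L2Vec P.Ω) x‖ ≤
      8 * M * |γ| * 𝒯.size := by
    filter_upwards [hint, hvg, h.memLp_gradient.coeFn_toLp, Lp.coeFn_sub (wgrad v) h.gradL2,
      ae_restrict_mem P.isOpen.measurableSet] with x h1 h2 h3 h4 h5
    rw [h4, Pi.sub_apply, h2, IsTestFun.gradL2, h3]
    obtain ⟨T, hT, hxT⟩ := mem_iUnion₂.1 (𝒯.subset_iUnion_hull h5)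
    obtain ⟨g, hg, hgrad⟩ := exists_gradient_affineMap (affineInterp φ T)
    obtain ⟨x₀, r, hr, hball, -, hdiam⟩ := 𝒯.exists_ball hd hγ hT
    have h6 : gradient (meshInterp 𝒯 φ) x = g := by
      refine hgrad _ _ ?_
      filter_upwards [isOpen_interior.mem_nhds (h1 T hT hxT)] with y hy
      exact meshInterp_eq φ hT (interior_subset hy)
    rw [h6]
    refine (affineInterp_gradient_error (𝒯.simplex T hT) hM hTaylor le_rfl hr hball hxT hg).trans ?_
    have h0 := Mesh.elemDiam_nonneg T
    rw [div_le_iff₀ hr]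
    have h7 : elemDiam T ≤ 4 * |γ| * r :=
      hdiam.trans (by nlinarith [le_abs_self γ])
    calc 2 * M * elemDiam T ^ 2 = 2 * M * (elemDiam T * elemDiam T) := by ring
      _ ≤ 2 * M * (𝒯.size * (4 * |γ| * r)) := by
          gcongr
          exact 𝒯.elemDiam_le_size hT
      _ = _ := by ring
  have h1 := Lp.norm_le_of_ae_bound (p := 2) (by positivity) hbound
  rw [← hK] at h1
  refine h1.trans ?_
  rw [le_div_iff₀ (by positivity)] at hs2
  linarith

/-- The finite element spaces become dense in `H^1_0` in the energy norm. -/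
theorem exists_feApprox (P : ModelProblem d) (hd : 1 ≤ d) {k : ℕ} (hk : 1 ≤ k) (γ : ℝ)
    {u : L2 P.Ω} (hu : u ∈ H10 P.Ω) {ε : ℝ} (hε : 0 < ε) :
    ∃ hbar : ℝ, 0 < hbar ∧ ∀ 𝒯 : Mesh P.Ω, 𝒯.ShapeRegular γ → 𝒯.size ≤ hbar →
      ∃ v ∈ feSpace 𝒯 k, ‖v - u‖ ≤ ε ∧ √(aForm P (v - u) (v - u)) ≤ ε := by
  obtain ⟨C₁, hC₁, hp⟩ := P.exists_poincare hd
  obtain ⟨C₂, hC₂, ha⟩ := P.exists_aForm_le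
  obtain ⟨s, hs⟩ : ∃ s, s = √(C₂ * (1 + C₁ ^ 2)) := ⟨_, rfl⟩
  have hs0 : 0 ≤ s := by rw [hs]; positivity
  obtain ⟨η, hη⟩ : ∃ η, η = ε / (C₁ + s) / 2 := ⟨_, rfl⟩
  have hη0 : 0 < η := by rw [hη]; positivity
  have hηε : 2 * η * (C₁ + s) = ε := by rw [hη]; field_simp
  obtain ⟨φ, hφ, -, hlim⟩ := exists_seq_testFun P.isOpen hu
  obtain ⟨n, hn⟩ := (Metric.tendsto_nhds.1 hlim η hη0).exists
  rw [dist_eq_norm] at hn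
  obtain ⟨hbar, hbar0, H⟩ := (hφ n).exists_feApprox P hd hk γ hη0
  -- the error of `φ n` and the interpolation error contribute `η` each
  refine ⟨hbar, hbar0, fun 𝒯 hγ hsize => ?_⟩
  obtain ⟨v, hv, hvg⟩ := H 𝒯 hγ hsize
  have hvH := feSpace_le_H10 𝒯 k hv
  refine ⟨v, hv, ?_⟩
  have h1 : ‖wgrad (v - u)‖ ≤ 2 * η := by
    have e : wgrad (v - u) = wgrad (v - (hφ n).toL2) + ((hφ n).gradL2 - wgrad u) := by
      rw [wgrad_sub P.isOpen hvH hu, wgrad_sub P.isOpen hvH (hφ n).mem_H10,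
        (hφ n).wgrad_toL2 P.isOpen]
      abel
    rw [e]
    exact (norm_add_le _ _).trans (by linarith)
  have h2 : ‖v - u‖ ≤ C₁ * ‖wgrad (v - u)‖ := hp _ (Submodule.sub_mem _ hvH hu)
  have h0 := norm_nonneg (wgrad (v - u))
  have h4 : C₁ * ‖wgrad (v - u)‖ ≤ C₁ * (2 * η) := by gcongr
  have h5 : 0 ≤ 2 * η * s := by positivity
  have h6 : 0 ≤ 2 * η * C₁ := by positivity
  refine ⟨by linarith, ?_⟩
  have h3 : aForm P (v - u) (v - u) ≤ (s * (2 * η)) ^ 2 := by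
    refine (ha _).trans ?_
    rw [mul_pow, hs, Real.sq_sqrt (by positivity), mul_assoc]
    refine mul_le_mul_of_nonneg_left ?_ hC₂
    have h7 : ‖v - u‖ ^ 2 ≤ (C₁ * (2 * η)) ^ 2 :=
      pow_le_pow_left₀ (norm_nonneg _) (h2.trans h4) 2
    have h8 : ‖wgrad (v - u)‖ ^ 2 ≤ (2 * η) ^ 2 := pow_le_pow_left₀ h0 h1 2
    linarith
  refine (Real.sqrt_le_sqrt h3).trans ?_
  rw [Real.sqrt_sq (by positivity)]
  linarith

end

section

variable {d q : ℕ} {P : ModelProblem d} {𝒯 : Mesh P.Ω} {k : ℕ} {m : Fin q → ℕ} {lam : Fin q → ℝ}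

/-! ### Comparison of the estimators -/

theorem indicatorSqVec_nonneg (lam : Family m ℝ) (u W : Family m (L2 P.Ω)) (T : Finset (E d)) :
    0 ≤ indicatorSqVec P 𝒯 k lam u W T :=
  Finset.sum_nonneg fun _ _ => Finset.sum_nonneg fun _ _ => indicatorSq_nonneg _ _ _ _

theorem sum_indicatorSqVec (lam : Family m ℝ) (u W : Family m (L2 P.Ω))
    (marked : Finset (Finset (E d))) :
    ∑ T ∈ marked, indicatorSqVec P 𝒯 k lam u W T =
      ∑ i, ∑ j, ∑ T ∈ marked, indicatorSq P 𝒯 k lam u (W i j) T := by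
  simp only [indicatorSqVec]
  rw [Finset.sum_comm]
  exact Finset.sum_congr rfl fun i _ => Finset.sum_comm

theorem sum_distA_le_discrepancy (lamh lamt : Family m ℝ) (uh ut : Family m (L2 P.Ω)) :
    ∑ i, distA P (cluster uh i) (cluster ut i) ^ 2 ≤ discrepancy P lamh uh lamt ut :=
  Finset.sum_le_sum fun _ _ => le_add_of_nonneg_right (Finset.sum_nonneg fun _ _ => sq_nonneg _)

/-- On fine meshes the finite element eigenpairs satisfy the assumptions of the comparison of the
two families. -/
theorem IsEigenbasis.exists_meshSize (hd : 1 ≤ d) (hk : 1 ≤ k) (γ : ℝ)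
    (hlam : IsLowestEigenvalues P lam m) {U : Family m (L2 P.Ω)} (hU : IsEigenbasis P lam U)
    {r : Fin q → ℝ} (hr : ∀ i, 0 < r i)
    (hΓ : ∀ i μ, IsEigenvalue P μ → μ ≠ lam i → r i < |μ⁻¹ - (lam i)⁻¹|) :
    ∃ hbar : ℝ, 0 < hbar ∧ ∃ Λ : ℝ, 0 < Λ ∧
      ∀ 𝒯 : Mesh P.Ω, 𝒯.ShapeRegular γ → 𝒯.Resolves P → 𝒯.size ≤ hbar →
      ∀ (lamh : Family m ℝ) (uh : Family m (L2 P.Ω)), IsLowestDiscrete P (feSpace 𝒯 k) lamh uh →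
        (∀ i u, specProj P (feSpace 𝒯 k) (lam i) (r i) u = ∑ j, inner ℝ (uh i j) u • uh i j) ∧
        ∀ i j, 0 < lamh i j ∧ lamh i j ≤ Λ := by
  obtain ⟨ε, hε, Λ, hΛ, hspec⟩ := hU.exists_specProj_eq hd hlam hr hΓ
  choose H hH happ using fun i j => exists_feApprox P hd hk γ (hU.mem hd i j).1 hε
  obtain ⟨hbar, hle, hpos⟩ : ∃ hbar : ℝ, (∀ i j, hbar ≤ H i j) ∧ 0 < hbar := by
    have h1 : ∀ᶠ t in 𝓝[>] (0 : ℝ), ∀ i j, t ≤ H i j :=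
      eventually_all.2 fun i => eventually_all.2 fun j =>
        mem_of_superset (Ioc_mem_nhdsGT (hH i j)) fun t ht => ht.2
    exact (h1.and self_mem_nhdsWithin).exists
  refine ⟨hbar, hpos, Λ, hΛ, fun 𝒯 hγ hR hsize => ?_⟩
  exact hspec _ (finiteDimensional_feSpace hR k) (feSpace_le_H10 𝒯 k) fun i j =>
    happ i j 𝒯 hγ (hsize.trans (hle i j))

/-- The two estimators are close on every set of elements. -/
theorem exists_estimator_close (hd : 1 ≤ d) (P : ModelProblem d) (hk : 1 ≤ k) (γ : ℝ)
    {lam : Fin q → ℝ} (hlam : IsLowestEigenvalues P lam m) {r : Fin q → ℝ} (hr : ∀ i, 0 < r i)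
    (hΓ : ∀ i μ, IsEigenvalue P μ → μ ≠ lam i → r i < |μ⁻¹ - (lam i)⁻¹|) :
    ∃ C : ℝ, 0 < C ∧ ∃ hbar : ℝ, 0 < hbar ∧
      ∀ 𝒯 : Mesh P.Ω, 𝒯.ShapeRegular γ → 𝒯.Resolves P → 𝒯.size ≤ hbar →
      ∀ (lamh : Family m ℝ) (uh : Family m (L2 P.Ω)), IsLowestDiscrete P (feSpace 𝒯 k) lamh uh →
      ∀ (lamt : Family m ℝ) (ut : Family m (L2 P.Ω)), IsParOApprox P (feSpace 𝒯 k) lamt ut →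
      ∀ U : Family m (L2 P.Ω), IsEigenbasis P lam U → ∀ marked ⊆ 𝒯.elems,
        (√(∑ T ∈ marked, indicatorSqVec P 𝒯 k lamh uh (feProj P (feSpace 𝒯 k) lam r U) T) -
          √(∑ T ∈ marked,
            indicatorSqVec P 𝒯 k lamt ut (paroProj P (feSpace 𝒯 k) lam r ut U) T)) ^ 2 ≤
        C * discrepancy P lamh uh lamt ut := by
  -- the constants are obtained from one eigenbasis; if there is none, nothing is to be shown
  by_cases hex : ∃ U₀ : Family m (L2 P.Ω), IsEigenbasis P lam U₀
  swap
  · exact ⟨1, one_pos, 1, one_pos, fun _ _ _ _ _ _ _ _ _ _ U hU => (hex ⟨U, hU⟩).elim⟩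
  obtain ⟨U₀, hU₀⟩ := hex
  obtain ⟨hbar, hbar0, Λ, hΛ, hmesh⟩ := hU₀.exists_meshSize hd hk γ hlam hr hΓ
  obtain ⟨C₁, hC₁, hind⟩ := exists_indicator_close P hd k γ
  obtain ⟨C₂, hC₂, hparo⟩ := exists_paro_bound (m := m) hd P hΛ
  refine ⟨C₁ * (3 * C₂ ^ 2) * (∑ i, m i + 1), by positivity, hbar, hbar0, ?_⟩
  intro 𝒯 hγ hR hsize lamh uh hh lamt ut ht U hU marked hmarked
  obtain ⟨hspec, hle⟩ := hmesh 𝒯 hγ hR hsize lamh uh hh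
  obtain ⟨δ, hδ⟩ : ∃ δ : Fin q → ℝ, ∀ i, δ i = distA P (cluster uh i) (cluster ut i) :=
    ⟨_, fun _ => rfl⟩
  have hone : ∀ i (j : Fin (m i)),
      (√(∑ T ∈ marked, indicatorSq P 𝒯 k lamh uh (feProj P (feSpace 𝒯 k) lam r U i j) T) -
        √(∑ T ∈ marked,
          indicatorSq P 𝒯 k lamt ut (paroProj P (feSpace 𝒯 k) lam r ut U i j) T)) ^ 2 ≤
      C₁ * (3 * C₂ ^ 2) * δ i ^ 2 := by
    intro i j
    obtain ⟨h1, h2, h3, h4, h5⟩ := hparo (feSpace 𝒯 k) (feSpace_le_H10 𝒯 k) lamh lamt uh ut hh ht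
      hle i (U i j) (feProj P (feSpace 𝒯 k) lam r U i j) (hU.1.1 ⟨i, j⟩) (hspec i (U i j))
    rw [← hδ] at h3 h4 h5
    refine (hind 𝒯 hγ hR q m lamh lamt uh ut _ _ h1 h2 marked hmarked).trans ?_
    have e3 := pow_le_pow_left₀ (norm_nonneg _) h3 2
    have e4 := pow_le_pow_left₀ (norm_nonneg _) h4 2
    have e5 := pow_le_pow_left₀ (norm_nonneg _) h5 2
    rw [mul_assoc]
    refine mul_le_mul_of_nonneg_left ?_ hC₁.le
    rw [mul_pow] at e3 e4 e5
    refine (add_le_add (add_le_add e5 e3) e4).trans_eq ?_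
    ring
  rw [sum_indicatorSqVec, sum_indicatorSqVec]
  have hn : ∀ (lam : Family m ℝ) (u W : Family m (L2 P.Ω)) (i : Fin q) (j : Fin (m i)),
      0 ≤ ∑ T ∈ marked, indicatorSq P 𝒯 k lam u (W i j) T := fun lam u W i j =>
    Finset.sum_nonneg fun T _ => indicatorSq_nonneg _ _ _ _
  refine (sq_sqrt_sub_sqrt_sum_le Finset.univ
    (fun i _ => Finset.sum_nonneg fun j _ => hn _ _ _ i j)
    (fun i _ => Finset.sum_nonneg fun j _ => hn _ _ _ i j)
    fun i _ => sq_sqrt_sub_sqrt_sum_le Finset.univ (fun j _ => hn _ _ _ i j)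
      (fun j _ => hn _ _ _ i j) fun j _ => hone i j).trans ?_
  have hc : 0 ≤ C₁ * (3 * C₂ ^ 2) := by positivity
  calc ∑ i, ∑ _j : Fin (m i), C₁ * (3 * C₂ ^ 2) * δ i ^ 2
      = ∑ i, C₁ * (3 * C₂ ^ 2) * (m i * δ i ^ 2) := by
        refine Finset.sum_congr rfl fun i _ => ?_
        rw [Finset.sum_const, Finset.card_univ, Fintype.card_fin, nsmul_eq_mul]
        ring
    _ ≤ ∑ i, C₁ * (3 * C₂ ^ 2) * ((∑ i, m i + 1) * δ i ^ 2) := by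
        refine Finset.sum_le_sum fun i _ => mul_le_mul_of_nonneg_left
          (mul_le_mul_of_nonneg_right ?_ (sq_nonneg _)) hc
        have : m i ≤ ∑ i, m i := Finset.single_le_sum (fun _ _ => Nat.zero_le _) (Finset.mem_univ i)
        have : (m i : ℝ) ≤ ((∑ i, m i : ℕ) : ℝ) := Nat.cast_le.2 this
        linarith
    _ = C₁ * (3 * C₂ ^ 2) * (∑ i, m i + 1) * ∑ i, δ i ^ 2 := by
        rw [← Finset.mul_sum, ← Finset.mul_sum]
        ring
    _ ≤ _ := by
        refine mul_le_mul_of_nonneg_left ?_ (by positivity)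
        simp only [hδ]
        exact sum_distA_le_discrepancy lamh lamt uh ut

/-- A Dörfler property with parameter `θ` is inherited with a smaller parameter by quantities that
differ by a small relative amount: `X`, `Y` are the totals, `X'`, `Y'` the marked parts. -/
theorem dorfler_transfer {X Y X' Y' Q θ θt : ℝ} (hX : 0 ≤ X) (hY : 0 ≤ Y) (hX' : 0 ≤ X')
    (hQ : 0 ≤ Q) (hθ : θ < 1) (hτ : √(2 * (Q + 2 * √Q + 2) * Q) < θ)
    (h : (√X - √Y) ^ 2 ≤ Q * Y) (h' : (√X' - √Y') ^ 2 ≤ Q * Y) (hm : θ * Y ≤ Y')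
    (hθt : 0 < θt) (hθt' : θt ≤ (θ - √(2 * (Q + 2 * √Q + 2) * Q)) / (1 + √Q) ^ 2) :
    θt * X ≤ X' := by
  obtain ⟨s, hs⟩ : ∃ s, s = √Q := ⟨_, rfl⟩
  obtain ⟨τ, hτe⟩ : ∃ τ, τ = √(2 * (Q + 2 * √Q + 2) * Q) := ⟨_, rfl⟩
  have hs0 : 0 ≤ s := by rw [hs]; positivity
  have hsQ : s ^ 2 = Q := by rw [hs, Real.sq_sqrt hQ]
  -- the assumption on `θ` is stronger than `2 √Q < θ`, which is all that is needed
  have hτs : 2 * s ≤ τ := by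
    rw [hτe]
    refine Real.le_sqrt_of_sq_le ?_
    rw [← hs, mul_pow, hsQ]
    nlinarith [mul_nonneg hQ hs0, mul_nonneg hQ hQ]
  rw [← hτe] at hτ hθt'
  rw [← hs] at hθt'
  have hθ0 : 0 ≤ θ := by linarith
  obtain ⟨y, hy⟩ : ∃ y, y = √Y := ⟨_, rfl⟩
  have hy0 : 0 ≤ y := by rw [hy]; positivity
  have hyY : y ^ 2 = Y := by rw [hy, Real.sq_sqrt hY]
  obtain ⟨t, ht⟩ : ∃ t, t = √θ := ⟨_, rfl⟩
  have ht0 : 0 ≤ t := by rw [ht]; positivity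
  have htθ : t ^ 2 = θ := by rw [ht, Real.sq_sqrt hθ0]
  have ht1 : t ≤ 1 := by rw [ht]; exact Real.sqrt_le_one.2 hθ.le
  have hst : s ≤ t := by nlinarith
  have hQY : Q * Y = (s * y) ^ 2 := by rw [mul_pow, hsQ, hyY]
  rw [hQY] at h h'
  have h1 := abs_le.1 (abs_le_of_sq_le_sq h (by positivity))
  have h2 := abs_le.1 (abs_le_of_sq_le_sq h' (by positivity))
  have h3 : t * y ≤ √Y' := by
    refine Real.le_sqrt_of_sq_le ?_
    rw [mul_pow, htθ, hyY]
    exact hm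
  have h4 : √X ≤ (1 + s) * y := by
    rw [← hy] at h1
    linarith [h1.2]
  have h5 : (t - s) * y ≤ √X' := by linarith [h2.1]
  have h6 : X ≤ (1 + s) ^ 2 * Y := by
    rw [← Real.sq_sqrt hX, ← hyY, ← mul_pow]
    exact pow_le_pow_left₀ (Real.sqrt_nonneg _) h4 2
  have h7 : (t - s) ^ 2 * Y ≤ X' := by
    rw [← Real.sq_sqrt hX', ← hyY, ← mul_pow]
    exact pow_le_pow_left₀ (mul_nonneg (sub_nonneg.2 hst) hy0) h5 2
  rw [le_div_iff₀ (by positivity)] at hθt'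
  calc θt * X ≤ θt * ((1 + s) ^ 2 * Y) := mul_le_mul_of_nonneg_left h6 hθt.le
    _ = θt * (1 + s) ^ 2 * Y := by ring
    _ ≤ (t - s) ^ 2 * Y := by
        refine mul_le_mul_of_nonneg_right (hθt'.trans ?_) hY
        nlinarith [mul_nonneg hs0 (sub_nonneg.2 ht1), sq_nonneg s]
    _ ≤ X' := h7

end

end ParO

end

open ParO in
theorem mainTheorem5
    -- the model problem, the polynomial degree and the shape regularity constant
    (d : ℕ) (hd : 1 ≤ d) (P : ModelProblem d) (k : ℕ) (hk : 1 ≤ k) (γ : ℝ)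
    -- the smallest eigenvalues with their multiplicities, and the circles defining the projections
    (q : ℕ) (hq : 1 ≤ q) (lam : Fin q → ℝ) (m : Fin q → ℕ) (hlam : IsLowestEigenvalues P lam m)
    (r : Fin q → ℝ) (hr : ∀ i, 0 < r i)
    (hΓ : ∀ i μ, IsEigenvalue P μ → μ ≠ lam i → r i < |μ⁻¹ - (lam i)⁻¹|) :
    ∃ C : ℝ, 0 < C ∧ ∃ hbar : ℝ, 0 < hbar ∧
      ∀ 𝒯 : Mesh P.Ω, 𝒯.ShapeRegular γ → 𝒯.Resolves P → 𝒯.size ≤ hbar →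
      -- finite element eigenpairs and ParO approximations in `V^h`
      ∀ (lamh : Family m ℝ) (uh : Family m (L2 P.Ω)),
        IsLowestDiscrete P (feSpace 𝒯 k) lamh uh →
      ∀ (lamt : Family m ℝ) (ut : Family m (L2 P.Ω)),
        IsParOApprox P (feSpace 𝒯 k) lamt ut →
      ∀ U : Family m (L2 P.Ω), IsEigenbasis P lam U →
        -- `C` is the constant of the comparison of the two theoretical estimators
        |√(estimatorSq P 𝒯 k lamh uh (feProj P (feSpace 𝒯 k) lam r U)) -
            √(estimatorSq P 𝒯 k lamt ut (paroProj P (feSpace 𝒯 k) lam r ut U))| ^ 2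
          ≤ C * discrepancy P lamh uh lamt ut ∧
        -- and the Dörfler property is inherited with this `C`
        ∀ θ ρ : ℝ, 0 < θ → θ < 1 → 0 < ρ →
          √(2 * (C * ρ + 2 * √(C * ρ) + 2) * (C * ρ)) < θ →
          discrepancy P lamh uh lamt ut
            ≤ ρ * estimatorSq P 𝒯 k lamt ut (paroProj P (feSpace 𝒯 k) lam r ut U) →
          ∀ marked ⊆ 𝒯.elems,
            θ * estimatorSq P 𝒯 k lamt ut (paroProj P (feSpace 𝒯 k) lam r ut U)
              ≤ ∑ T ∈ marked,
                  indicatorSqVec P 𝒯 k lamt ut (paroProj P (feSpace 𝒯 k) lam r ut U) T →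
            ∀ θt : ℝ, 0 < θt →
              θt ≤ (θ - √(2 * (C * ρ + 2 * √(C * ρ) + 2) * (C * ρ))) / (1 + √(C * ρ)) ^ 2 →
              θt * estimatorSq P 𝒯 k lamh uh (feProj P (feSpace 𝒯 k) lam r U)
                ≤ ∑ T ∈ marked,
                    indicatorSqVec P 𝒯 k lamh uh (feProj P (feSpace 𝒯 k) lam r U) T := by
  obtain ⟨C, hC, hbar, hbar0, H⟩ := exists_estimator_close hd P hk γ hlam hr hΓ
  refine ⟨C, hC, hbar, hbar0, ?_⟩
  intro 𝒯 hγ hR hsize lamh uh hh lamt ut ht U hU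
  have hclose := H 𝒯 hγ hR hsize lamh uh hh lamt ut ht U hU
  have hall := hclose 𝒯.elems (Finset.Subset.refl _)
  refine ⟨?_, ?_⟩
  · rw [sq_abs]
    exact hall
  · intro θ ρ _ hθ hρ hτ hD marked hmarked hm θt hθt hθt'
    have hCD : C * discrepancy P lamh uh lamt ut ≤
        C * ρ * estimatorSq P 𝒯 k lamt ut (paroProj P (feSpace 𝒯 k) lam r ut U) := by
      rw [mul_assoc]
      exact mul_le_mul_of_nonneg_left hD hC.le
    exact dorfler_transfer (Finset.sum_nonneg fun T _ => indicatorSqVec_nonneg _ _ _ T)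
      (Finset.sum_nonneg fun T _ => indicatorSqVec_nonneg _ _ _ T)
      (Finset.sum_nonneg fun T _ => indicatorSqVec_nonneg _ _ _ T)
      (mul_pos hC hρ).le hθ hτ
      (hall.trans hCD) ((hclose marked hmarked).trans hCD) hm hθt hθt'
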